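/- **Conventions.** A *signature* $\mathcal S$ is a set of sorts together with a set $\mathcal S(A_1,\dots,A_n;B)$ of constants for all $n\ge 0$ and sorts $A_1,\dots,A_n,B$; a map of signatures is a map on sorts with compatible maps on constants; $\mathbf{Sig}$ is the resulting category. All sets lie in one fixed universe. A *representable multicategory* is a multicategory $\mathbb M$ with a chosen universal arrow $u_\Gamma:\Gamma\to T(\Gamma)$ for every finite list of objects $\Gamma$ (every $t:\Gamma\to B$ is $t=t^{\#}\circ u_\Gamma$ for a unique unary $t^{\#}:T(\Gamma)\to B$), such that $u_{T\Gamma,T\Delta}\circ(u_\Gamma,u_\Delta)$ is again universal for all $\Gamma,\Delta$. $\mathbf{RepMulticat}$ has as morphisms the multicategory functors that preserve all $T(\Gamma)$ and $u_\Gamma$ strictly (hence $t\mapsto t^{\#}$). $\mathbf{SRepMulticat}$ is the analogous category of representable multicategories whose multicategory is symmetric, with functors that also preserve the symmetric group actions. In both cases $U$ is the forgetful functor to $\mathbf{Sig}$: objects become sorts, multimaps become constants. $\mathbf{MonCat}$ is the category of small monoidal categories with chosen $n$-ary tensor products: for every finite list $\Gamma=(A_1,\dots,A_n)$ of objects an object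 $\bigotimes\Gamma$ and an isomorphism from $\bigotimes\Gamma$ to the iterated binary tensor product $A_1\otimes(A_2\otimes\cdots(A_n\otimes I))$, where for $n=0$ and $n=2$ these are $I$ and $A_1\otimes A_2$ with the canonical isomorphisms. Morphisms are the strict monoidal functors, which preserve all of this structure on the nose. $\mathbf{SMonCat}$ is the corresponding category of symmetric monoidal categories and strict symmetric monoidal functors. In both cases $V$ is the canonical forgetful functor to $\mathbf{Sig}$: $V\mathbb C$ has the objects of $\mathbb C$ as sorts and $(V\mathbb C)(\Gamma;B)=\mathbb C(\bigotimes\Gamma,B)$. The *nucleus* $\mathcal N\mathbb M$ of a (symmetric) representable multicategory is its category of objects and unary multimaps with the (symmetric) monoidal structure induced by the universal arrows: $\bigotimes\Gamma=T(\Gamma)$, $I=T()$, $A\otimes B=T(A,B)$, with structural isomorphisms determined by universality (and the braiding $A\otimes B\to B\otimes A$ by the action of the transposition on $u_{B,A}$). This defines functors $\mathcal N:\mathbf{RepMulticat}\to\mathbf{MonCat}$ and $\mathcal N_{\mathrm{sym}}:\mathbf{SRepMulticat}\to\mathbf{SMonCat}$. Write $\kappa_{\mathbb M}:U\mathbb M\to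 V\mathcal N\mathbb M$ for the map of signatures that is the identity on sorts and sends $t:\Gamma\to B$ to $t^{\#}$. The *ordered tensor calculus* $\mathcal O^{\otimes}_{\mathcal S}$ has as types the sorts of $\mathcal S$ closed under $n$-ary tensor types $\bigotimes_{i=1}^nA_i$ ($n\ge 0$), and the typing rules $$\frac{}{x:A\vdash x:A}\qquad \frac{c\in\mathcal S(A_1,\dots,A_n;B)\quad \Delta_i\vdash t_i:A_i}{\Delta_1,\dots,\Delta_n\vdash c(t_1,\dots,t_n):B}\qquad \frac{\Delta_i\vdash t_i:A_i}{\Delta_1,\dots,\Delta_n\vdash\bigotimes_i t_i:\bigotimes_iA_i}\qquad \frac{\Delta\vdash s:\bigotimes_iA_i\quad \Lambda,x_1:A_1,\dots,x_n:A_n,\Psi\vdash t:B}{\Lambda,\Delta,\Psi\vdash \mathsf{let}\ (x_1,\dots,x_n)\ \mathsf{be}\ s\ \mathsf{in}\ t:B}$$ Its terms-in-context are derivations (so that a $\mathsf{let}$ records $\Lambda$ and $\Psi$), up to renaming of variables, modulo the congruence, closed under substitution, generated by $\mathsf{let}\ (x_i)_i\ \mathsf{be}\ \bigotimes_i t_i\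 \mathsf{in}\ t=t[t_i/x_i]$ and $\mathsf{let}\ (x_i)_i\ \mathsf{be}\ s\ \mathsf{in}\ t[\bigotimes_i x_i/p]=t[s/p]$. The *linear tensor calculus* $\mathfrak L^{\otimes}_{\mathcal S}$ has the same rules and equations together with the rule exchanging two adjacent variables of a context; there terms are the usual raw terms up to renaming of variables, and exchange leaves no trace in the term. With substitution as composition (and, in the linear case, exchange as symmetric action) these form a representable multicategory $\mathrm{Syn}(\mathcal O^{\otimes}_{\mathcal S})$ and a symmetric representable multicategory $\mathrm{Syn}(\mathfrak L^{\otimes}_{\mathcal S})$, with $T(\Gamma)=\bigotimes\Gamma$ and $u_\Gamma=\bigotimes_ix_i$. Let $\iota_{\mathcal S}$ be the map from $\mathcal S$ to the underlying signature of either one that sends a constant $c$ to $c(x_1,\dots,x_n)$. **Proposition.** 1. The forgetful functor $U:\mathbf{RepMulticat}\to\mathbf{Sig}$ has a left adjoint, with value $\mathrm{Syn}(\mathcal O^{\otimes}_{\mathcal S})$ and unit $\iota_{\mathcal S}$ at $\mathcal S$; and $U:\mathbf{SRepMulticat}\to\mathbf{Sig}$ has a left adjoint, with value $\mathrm{Syn}(\mathfrak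 L^{\otimes}_{\mathcal S})$ and unit $\iota_{\mathcal S}$ at $\mathcal S$. 2. $\mathcal N$ is part of an adjoint equivalence $\mathbf{RepMulticat}\simeq\mathbf{MonCat}$. Its inverse $\mathcal T$ sends $\mathbb C$ to the multicategory with the same objects, multimaps $(\mathcal T\mathbb C)(\Gamma;B)=\mathbb C(\bigotimes\Gamma,B)$, identities and composition induced by the monoidal structure, and universal arrows $T(\Gamma)=\bigotimes\Gamma$, $u_\Gamma=\mathrm{id}$. Likewise $\mathcal N_{\mathrm{sym}}$ is part of an adjoint equivalence $\mathbf{SRepMulticat}\simeq\mathbf{SMonCat}$, whose inverse $\mathcal T_{\mathrm{sym}}$ has the same description, with adjacent transpositions acting by precomposition with the symmetry. 3. $U\circ\mathcal T=V$ and $U\circ\mathcal T_{\mathrm{sym}}=V$. 4. Hence $V:\mathbf{MonCat}\to\mathbf{Sig}$ and $V:\mathbf{SMonCat}\to\mathbf{Sig}$ have left adjoints. For every left adjoint $L$ of $V$, with unit $\eta$, and every signature $\mathcal S$, there is a unique isomorphism $i:L\mathcal S\to\mathcal N(\mathrm{Syn}(\mathcal O^{\otimes}_{\mathcal S}))$ in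 $\mathbf{MonCat}$, respectively $i:L\mathcal S\to\mathcal N_{\mathrm{sym}}(\mathrm{Syn}(\mathfrak L^{\otimes}_{\mathcal S}))$ in $\mathbf{SMonCat}$, with $V(i)\circ\eta_{\mathcal S}=\kappa\circ\iota_{\mathcal S}$. That is, the nucleus of the syntactic multicategory is canonically the free (symmetric) monoidal category on $\mathcal S$. -/

import Mathlib

open CategoryTheory

universe u

/-!
Multicategories, representable and symmetric multicategories, signatures, monoidal categories with
chosen n-ary tensor products, the nucleus functors, and the ordered and linear tensor calculi.
-/

namespace Multi

/-- A list of multimaps with codomains `As`; its domain is the concatenation of their domains. -/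
inductive Args {O : Type u} (H : List O → O → Type u) : List O → List O → Type u
  | nil : Args H [] []
  | cons {Γ Δ Θ : List O} {A : O} {As : List O} (f : H Γ A) (fs : Args H Δ As)
      (h : Θ = Γ ++ Δ) : Args H Θ (A :: As)

namespace Args

variable {O : Type u} {H : List O → O → Type u}

/-- Transport of a multimap along an equality of domains. -/
def castDom {Γ Δ : List O} {A : O} (h : Γ = Δ) (f : H Γ A) : H Δ A := h ▸ f

/-- A one-element list. -/
def single {Γ : List O} {A : O} (f : H Γ A) : Args H Γ [A] :=
  cons f nil (List.append_nil Γ).symm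

/-- A two-element list. -/
def pair {Γ Δ : List O} {A B : O} (f : H Γ A) (g : H Δ B) : Args H (Γ ++ Δ) [A, B] :=
  cons f (single g) rfl

/-- The list of identities. -/
def ones (one : ∀ A, H [A] A) : (As : List O) → Args H As As
  | [] => nil
  | A :: As => cons (one A) (ones one As) rfl

/-- Concatenation of lists of multimaps. -/
def app {Δ Bs : List O} : {Γ As : List O} →
    Args H Γ As → Args H Δ Bs → Args H (Γ ++ Δ) (As ++ Bs)
  | _, _, nil, gs => gs
  | _, _, cons f fs h, gs => cons f (app fs gs) (by rw [h, List.append_assoc])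

/-- A list of multimaps cut into two consecutive parts. -/
structure Split (H : List O → O → Type u) (Θ As Bs : List O) where
  Γ : List O
  Δ : List O
  fst : Args H Γ As
  snd : Args H Δ Bs
  eq : Θ = Γ ++ Δ

/-- Put one more multimap in front of the first part. -/
def Split.cons {Γ Δ Θ As Bs : List O} {A : O} (f : H Γ A) (s : Split H Δ As Bs)
    (h : Θ = Γ ++ Δ) : Split H Θ (A :: As) Bs :=
  ⟨Γ ++ s.Γ, s.Δ, .cons f s.fst rfl, s.snd,
    h.trans ((congrArg (Γ ++ ·) s.eq).trans (List.append_assoc Γ s.Γ s.Δ).symm)⟩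

/-- Cut a list of multimaps with codomains `As ++ Bs` after `As`. -/
def split {Bs : List O} : {Θ : List O} → (As : List O) → Args H Θ (As ++ Bs) → Split H Θ As Bs
  | Θ, [], fs => ⟨[], Θ, nil, fs, rfl⟩
  | _, _ :: As, cons f fs h => Split.cons f (split As fs) h

/-- Given lists `gs` and `hs` such that the codomains of `hs` form the domain of `gs`, compose every
member of `gs` with the corresponding consecutive part of `hs`. -/
def bind (comp : ∀ {Γ As : List O} {B : O}, H As B → Args H Γ As → H Γ B) :
    {Γ Θ As : List O} → Args H Γ As → Args H Θ Γ → Args H Θ As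
  | _, _, _, nil, hs => hs
  | _, _, _, cons (Γ := Γ) g gs h, hs =>
    let s := split Γ (h ▸ hs)
    cons (comp g s.fst) (bind comp gs s.snd) s.eq

/-- Apply a map of multimaps over a map of objects to every member of a list. -/
def map {O' : Type u} {H' : List O' → O' → Type u} (o : O → O')
    (φ : ∀ {Γ A}, H Γ A → H' (Γ.map o) (o A)) :
    {Γ As : List O} → Args H Γ As → Args H' (Γ.map o) (As.map o)
  | _, _, nil => nil
  | _, _, cons f fs h => cons (φ f) (map o φ fs) (by rw [h, List.map_append])

/-! ### Basic facts about lists of multimaps -/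

theorem castDom_heq {Γ Δ : List O} {A : O} (h : Γ = Δ) (f : H Γ A) : HEq (castDom h f) f := by
  subst h; rfl

theorem app_cases {Θ Bs : List O} : ∀ (As : List O) (fs : Args H Θ (As ++ Bs)),
    ∃ (Γ Δ : List O) (a : Args H Γ As) (b : Args H Δ Bs), Θ = Γ ++ Δ ∧ HEq fs (app a b) := by
  intro As
  induction As generalizing Θ with
  | nil => intro fs; exact ⟨[], Θ, nil, fs, rfl, HEq.rfl⟩
  | cons A As ih =>
    intro fs
    cases fs with
    | @cons Γ' Δ' _ _ _ f fs h =>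
      obtain ⟨Γ, Δ, a, b, e, hh⟩ := ih fs
      subst e; subst h
      obtain rfl := eq_of_heq hh
      refine ⟨Γ' ++ Γ, Δ, cons f a rfl, b, (List.append_assoc _ _ _).symm, ?_⟩
      simp only [app]
      congr 1 <;> simp

theorem split_app {Γ Δ As Bs : List O} (a : Args H Γ As) (b : Args H Δ Bs) :
    split As (app a b) = ⟨Γ, Δ, a, b, rfl⟩ := by
  induction a with
  | nil => rfl
  | cons f fs h ih =>
    subst h
    simp only [app, split, ih]
    rfl

theorem app_nil {Γ As : List O} (a : Args H Γ As) : HEq (app a (nil : Args H [] [])) a := by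
  induction a with
  | nil => rfl
  | cons f fs h ih =>
    subst h
    simp only [app]
    congr 1 <;> simp

theorem app_assoc {Γ Δ Θ As Bs Cs : List O} (a : Args H Γ As) (b : Args H Δ Bs)
    (c : Args H Θ Cs) : HEq (app (app a b) c) (app a (app b c)) := by
  induction a with
  | nil => rfl
  | cons f fs h ih =>
    subst h
    simp only [app]
    congr 1 <;> simp

variable (comp : ∀ {Γ As : List O} {B : O}, H As B → Args H Γ As → H Γ B)

theorem bind_cons {Γ Δ Γ' Θ Θ₁ Θ₂ : List O} {A : O} {As : List O} (g : H Γ A) (gs : Args H Δ As)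
    (h : Γ' = Γ ++ Δ) (hs : Args H Θ Γ') (a : Args H Θ₁ Γ) (b : Args H Θ₂ Δ)
    (e : Θ = Θ₁ ++ Θ₂) (hh : HEq hs (app a b)) :
    bind comp (cons g gs h) hs = cons (comp g a) (bind comp gs b) e := by
  subst h; subst e
  obtain rfl := eq_of_heq hh
  have hs := split_app a b
  simp only [bind]
  generalize split Γ (app a b) = s at hs ⊢
  subst hs; rfl

theorem bind_single {Γ Θ : List O} {A : O} (g : H Γ A) (hs : Args H Θ Γ) :
    bind comp (single g) hs = single (comp g hs) := by
  rw [single, bind_cons comp g nil _ hs hs nil (by simp) (app_nil hs).symm]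
  rfl

theorem bind_app {Γ Δ Θ₁ Θ₂ As Bs : List O} (a : Args H Γ As) (b : Args H Δ Bs)
    (c : Args H Θ₁ Γ) (d : Args H Θ₂ Δ) :
    bind comp (app a b) (app c d) = app (bind comp a c) (bind comp b d) := by
  induction a generalizing Θ₁ with
  | nil => cases c; rfl
  | @cons Γ₁ Γ₂ _ A As f fs h ih =>
    subst h
    obtain ⟨Θ₃, Θ₄, c₁, c₂, rfl, hh⟩ := app_cases Γ₁ c
    obtain rfl := eq_of_heq hh
    rw [app, bind_cons comp f (app fs b) _ _ c₁ (app c₂ d) (List.append_assoc _ _ _)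
      (app_assoc _ _ _), bind_cons comp f fs rfl _ c₁ c₂ rfl HEq.rfl, app, ih]

theorem bind_pair {Γ Δ Θ₁ Θ₂ : List O} {A B : O} (f : H Γ A) (g : H Δ B)
    (c : Args H Θ₁ Γ) (d : Args H Θ₂ Δ) :
    bind comp (pair f g) (app c d) = pair (comp f c) (comp g d) := by
  rw [pair, bind_cons comp f (single g) rfl _ c d rfl HEq.rfl, bind_single]
  rfl

end Args

/-- The operations of a multicategory. `comp f gs` is the substitution of the list `gs` into `f`. -/
structure MulticatData where
  Ob : Type u
  Hom : List Ob → Ob → Type u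
  one : ∀ A, Hom [A] A
  comp : ∀ {Γ As : List Ob} {B : Ob}, Hom As B → Args Hom Γ As → Hom Γ B

/-- A multicategory: composition is associative and unital. -/
structure Multicat extends MulticatData.{u} where
  one_comp : ∀ {Γ : List Ob} {B : Ob} (f : Hom Γ B), comp (one B) (Args.single f) = f
  comp_one : ∀ {Γ : List Ob} {B : Ob} (f : Hom Γ B), comp f (Args.ones one Γ) = f
  assoc : ∀ {Θ Γ As : List Ob} {B : Ob} (f : Hom As B) (gs : Args Hom Γ As) (hs : Args Hom Θ Γ),
    comp (comp f gs) hs = comp f (gs.bind comp hs)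

/-- `v : Γ → R` is a universal arrow from `Γ` to the identity functor: every `t : Γ → B` is `e ∘ v`
for a unique unary `e : R → B`. -/
def Multicat.IsUniversal (M : Multicat.{u}) {Γ : List M.Ob} {R : M.Ob} (v : M.Hom Γ R) : Prop :=
  ∀ (B : M.Ob) (t : M.Hom Γ B), ∃! e : M.Hom [R] B, M.comp e (Args.single v) = t

/-- A representable multicategory: a chosen universal arrow `univ Γ : Γ → T Γ` for every list of
objects, closed under composition. -/
structure RepMulticat extends Multicat.{u} where
  T : List Ob → Ob
  univ : ∀ Γ, Hom Γ (T Γ)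
  univ_universal : ∀ Γ, toMulticat.IsUniversal (univ Γ)
  comp_universal : ∀ Γ Δ,
    toMulticat.IsUniversal (comp (univ [T Γ, T Δ]) (Args.pair (univ Γ) (univ Δ)))

namespace Multicat
variable (M : Multicat.{u})

theorem comp_single {Γ Θ : List M.Ob} {A B : M.Ob} (f : M.Hom [A] B) (g : M.Hom Γ A)
    (hs : Args M.Hom Θ Γ) : M.comp (M.comp f (.single g)) hs = M.comp f (.single (M.comp g hs)) := by
  rw [M.assoc, Args.bind_single]

theorem comp_pair {Γ Δ Θ₁ Θ₂ : List M.Ob} {A B C : M.Ob} (f : M.Hom [A, B] C) (g : M.Hom Γ A)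
    (h : M.Hom Δ B) (c : Args M.Hom Θ₁ Γ) (d : Args M.Hom Θ₂ Δ) :
    M.comp (M.comp f (.pair g h)) (.app c d) = M.comp f (.pair (M.comp g c) (M.comp h d)) := by
  rw [M.assoc, Args.bind_pair]

theorem comp_single_one {A B : M.Ob} (f : M.Hom [A] B) : M.comp f (.single (M.one A)) = f :=
  M.comp_one f

/-- The nucleus of a multicategory: its category of objects and unary multimaps. -/
@[nolint unusedArguments]
def Nucleus (M : Multicat.{u}) : Type u := M.Ob

instance : Category.{u} M.Nucleus where
  Hom A B := M.Hom [A] B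
  id A := M.one A
  comp f g := M.comp g (.single f)
  id_comp f := M.comp_one f
  comp_id f := M.one_comp f
  assoc f g h := (M.comp_single h g (.single f)).symm

variable {M}

theorem IsUniversal.hom_ext {Γ : List M.Ob} {R B : M.Ob} {v : M.Hom Γ R}
    (hv : M.IsUniversal v) {e e' : M.Hom [R] B} (h : M.comp e (.single v) = M.comp e' (.single v)) : e = e' :=
  (hv B _).unique h rfl

/-- The unique factorisation through a universal arrow. -/
noncomputable def IsUniversal.desc {Γ : List M.Ob} {R B : M.Ob} {v : M.Hom Γ R}
    (hv : M.IsUniversal v) (t : M.Hom Γ B) : M.Hom [R] B := (hv B t).choose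

theorem IsUniversal.fac {Γ : List M.Ob} {R B : M.Ob} {v : M.Hom Γ R}
    (hv : M.IsUniversal v) (t : M.Hom Γ B) : M.comp (hv.desc t) (.single v) = t :=
  (hv B t).choose_spec.1

theorem isUniversal_one (A : M.Ob) : M.IsUniversal (M.one A) := fun B t =>
  ⟨t, M.comp_one t, fun e he => (M.comp_one e).symm.trans he⟩

/-- Composing a universal multimap with an isomorphism. -/
theorem IsUniversal.comp_iso {Γ : List M.Ob} {R S : M.Ob} {v : M.Hom Γ R} (hv : M.IsUniversal v)
    (i : M.Hom [R] S) (j : M.Hom [S] R) (h₁ : M.comp i (.single j) = M.one S)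
    (h₂ : M.comp j (.single i) = M.one R) : M.IsUniversal (M.comp i (.single v)) := by
  intro B t
  obtain ⟨e, he, hu⟩ := hv B t
  refine ⟨M.comp e (.single j), ?_, fun e' he' => ?_⟩
  · change M.comp (M.comp e (.single j)) (.single (M.comp i (.single v))) = t
    rw [M.comp_single, ← M.comp_single j i, h₂, M.one_comp, he]
  · have := hu (M.comp e' (.single i)) ((M.comp_single e' i _).trans he')
    rw [← this, M.comp_single, h₁]
    exact (M.comp_one e').symm

theorem IsUniversal.exists_iso {Γ : List M.Ob} {R S : M.Ob} {v : M.Hom Γ R} {w : M.Hom Γ S}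
    (hv : M.IsUniversal v) (hw : M.IsUniversal w) :
    ∃ (i : M.Hom [R] S) (j : M.Hom [S] R), M.comp i (.single j) = M.one S ∧
      M.comp j (.single i) = M.one R ∧ M.comp i (.single v) = w := by
  refine ⟨hv.desc w, hw.desc v, hw.hom_ext ?_, hv.hom_ext ?_, hv.fac w⟩
  · rw [M.comp_single, hw.fac, hv.fac, M.one_comp]
  · rw [M.comp_single, hv.fac, hw.fac, M.one_comp]

end Multicat

namespace RepMulticat
open Multicat
variable (M : RepMulticat.{u})

/-- `x ⊗ y`, the composite of the universal arrow of two objects with `x` and `y`. -/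
def ten {Γ Δ : List M.Ob} {A B : M.Ob} (x : M.Hom Γ A) (y : M.Hom Δ B) :
    M.Hom (Γ ++ Δ) (M.T [A, B]) := M.comp (M.univ [A, B]) (.pair x y)

/-- The unique extension of `t : Γ → B` to `T Γ → B`. -/
noncomputable def ext {Γ : List M.Ob} {B : M.Ob} (t : M.Hom Γ B) : M.Hom [M.T Γ] B :=
  (M.univ_universal Γ).desc t

theorem ext_univ {Γ : List M.Ob} {B : M.Ob} (t : M.Hom Γ B) :
    M.comp (M.ext t) (.single (M.univ Γ)) = t := (M.univ_universal Γ).fac t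

theorem ten_comp {Γ Δ Θ₁ Θ₂ : List M.Ob} {A B : M.Ob} (x : M.Hom Γ A) (y : M.Hom Δ B)
    (c : Args M.Hom Θ₁ Γ) (d : Args M.Hom Θ₂ Δ) :
    M.comp (M.ten x y) (.app c d) = M.ten (M.comp x c) (M.comp y d) := by
  rw [ten, M.comp_pair]; rfl

theorem ten_one (A B : M.Ob) : M.ten (M.one A) (M.one B) = M.univ [A, B] :=
  M.comp_one (M.univ [A, B])

/-- The tensor product of unary multimaps. -/
noncomputable def tensorHom {A A' B B' : M.Ob} (f : M.Hom [A] A') (g : M.Hom [B] B') :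
    M.Hom [M.T [A, B]] (M.T [A', B']) := M.ext (M.ten f g)

theorem tensorHom_ten {A A' B B' : M.Ob} (f : M.Hom [A] A') (g : M.Hom [B] B')
    {Γ Δ : List M.Ob} (x : M.Hom Γ A) (y : M.Hom Δ B) :
    M.comp (M.tensorHom f g) (.single (M.ten x y)) =
      M.ten (M.comp f (.single x)) (M.comp g (.single y)) := by
  have : M.ten x y = M.comp (M.univ [A, B]) (.app (.single x) (.single y)) := rfl
  rw [this, ← M.comp_single, tensorHom, ext_univ]
  exact M.ten_comp f g _ _

theorem isUniversal_ten {Γ Δ : List M.Ob} {A B : M.Ob} {x : M.Hom Γ A} {y : M.Hom Δ B}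
    (hx : M.IsUniversal x) (hy : M.IsUniversal y) : M.IsUniversal (M.ten x y) := by
  obtain ⟨i, i', h₁, h₂, rfl⟩ := (M.univ_universal Γ).exists_iso hx
  obtain ⟨j, j', h₃, h₄, rfl⟩ := (M.univ_universal Δ).exists_iso hy
  rw [← tensorHom_ten]
  refine IsUniversal.comp_iso (M.comp_universal Γ Δ) _ (M.tensorHom i' j') ?_ ?_
  · refine (M.univ_universal _).hom_ext ?_
    rw [← ten_one, M.comp_single, tensorHom_ten, tensorHom_ten, M.comp_single_one, M.comp_single_one, h₁, h₃,
      M.one_comp]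
  · refine (M.univ_universal _).hom_ext ?_
    rw [← ten_one, M.comp_single, tensorHom_ten, tensorHom_ten, M.comp_single_one, M.comp_single_one, h₂, h₄,
      M.one_comp]

theorem tensorHom_univ {A A' B B' : M.Ob} (f : M.Hom [A] A') (g : M.Hom [B] B') :
    M.comp (M.tensorHom f g) (.single (M.univ [A, B])) = M.ten f g := M.ext_univ _

/-- The multimap `(a ⊗ b) ⊗ c`. -/
def ten₃ (A B C : M.Ob) : M.Hom [A, B, C] (M.T [M.T [A, B], C]) := M.ten (M.univ [A, B]) (M.one C)

/-- The multimap `a ⊗ (b ⊗ c)`. -/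
def ten₃' (A B C : M.Ob) : M.Hom [A, B, C] (M.T [A, M.T [B, C]]) := M.ten (M.one A) (M.univ [B, C])

theorem isUniversal_ten₃ (A B C : M.Ob) : M.IsUniversal (M.ten₃ A B C) :=
  M.isUniversal_ten (M.univ_universal _) (isUniversal_one C)

theorem isUniversal_ten₃' (A B C : M.Ob) : M.IsUniversal (M.ten₃' A B C) :=
  M.isUniversal_ten (isUniversal_one A) (M.univ_universal _)

/-- The associator, `(a ⊗ b) ⊗ c ↦ a ⊗ (b ⊗ c)`. -/
noncomputable def assocHom (A B C : M.Ob) : M.Hom [M.T [M.T [A, B], C]] (M.T [A, M.T [B, C]]) :=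
  (M.isUniversal_ten₃ A B C).desc (M.ten₃' A B C)

noncomputable def assocInv (A B C : M.Ob) : M.Hom [M.T [A, M.T [B, C]]] (M.T [M.T [A, B], C]) :=
  (M.isUniversal_ten₃' A B C).desc (M.ten₃ A B C)

/-- The inverse left unitor, `a ↦ () ⊗ a`. -/
noncomputable def leftInv (A : M.Ob) : M.Hom [A] (M.T [M.T [], A]) :=
  M.ten (Γ := []) (M.univ []) (M.one A)

/-- The inverse right unitor, `a ↦ a ⊗ ()`. -/
noncomputable def rightInv (A : M.Ob) : M.Hom [A] (M.T [A, M.T []]) :=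
  M.ten (Δ := []) (M.one A) (M.univ [])

theorem isUniversal_leftInv (A : M.Ob) : M.IsUniversal (M.leftInv A) :=
  M.isUniversal_ten (M.univ_universal _) (isUniversal_one A)

theorem isUniversal_rightInv (A : M.Ob) : M.IsUniversal (M.rightInv A) :=
  M.isUniversal_ten (isUniversal_one A) (M.univ_universal _)

noncomputable def leftHom (A : M.Ob) : M.Hom [M.T [M.T [], A]] A :=
  (M.isUniversal_leftInv A).desc (M.one A)

noncomputable def rightHom (A : M.Ob) : M.Hom [M.T [A, M.T []]] A :=
  (M.isUniversal_rightInv A).desc (M.one A)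

theorem ten_castDom {Γ Γ' Δ Δ' : List M.Ob} {A B : M.Ob} (x : M.Hom Γ A) (y : M.Hom Δ B) (h : Γ = Γ')
    (h' : Δ = Δ') : HEq (M.ten (Args.castDom h x) (Args.castDom h' y)) (M.ten x y) := by
  subst h; subst h'; rfl

theorem comp_heq {Γ Γ' As : List M.Ob} {A : M.Ob} (f : M.Hom As A) {a : Args M.Hom Γ As}
    {b : Args M.Hom Γ' As} (hΓ : Γ = Γ') (h : HEq a b) : HEq (M.comp f a) (M.comp f b) := by
  subst hΓ; obtain rfl := eq_of_heq h; rfl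

theorem assocHom_ten {Γ Δ Θ : List M.Ob} {A B C : M.Ob} (x : M.Hom Γ A) (y : M.Hom Δ B)
    (z : M.Hom Θ C) : M.comp (M.assocHom A B C) (.single (M.ten (M.ten x y) z)) =
      Args.castDom (List.append_assoc _ _ _).symm (M.ten x (M.ten y z)) := by
  have h₁ : M.ten (M.ten x y) z = M.comp (M.ten₃ A B C)
      (.app (.app (.single x) (.single y)) (.single z)) := by
    refine Eq.symm ((M.ten_comp (M.univ [A, B]) (M.one C) _ _).trans ?_)
    rw [M.one_comp]; rfl
  have h₂ : M.ten x (M.ten y z) = M.comp (M.ten₃' A B C)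
      (.app (.single x) (.app (.single y) (.single z))) := by
    refine Eq.symm ((M.ten_comp (M.one A) (M.univ [B, C]) _ _).trans ?_)
    rw [M.one_comp]; rfl
  rw [h₁, h₂, ← M.comp_single, assocHom, IsUniversal.fac]
  refine eq_of_heq ((M.comp_heq _ ?_ (Args.app_assoc _ _ _)).trans (Args.castDom_heq _ _).symm)
  simp

theorem leftHom_ten {Γ : List M.Ob} {A : M.Ob} (x : M.Hom Γ A) :
    M.comp (M.leftHom A) (.single (M.ten (M.univ []) x)) = x := by
  have h : M.ten (M.univ []) x = M.comp (M.leftInv A) (.single x) := by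
    refine Eq.symm ((M.ten_comp (M.univ []) (M.one A) .nil (.single x)).trans ?_)
    rw [M.one_comp]; exact congrArg (fun w => M.ten w x) (M.comp_one (M.univ []))
  refine (congrArg (fun w => M.comp _ (.single w)) h).trans ?_
  refine (M.comp_single _ _ _).symm.trans ?_
  rw [leftHom, IsUniversal.fac, M.one_comp]

theorem rightHom_ten {Γ : List M.Ob} {A : M.Ob} (x : M.Hom Γ A) :
    M.comp (M.rightHom A) (.single (M.ten x (M.univ []))) =
      Args.castDom (List.append_nil Γ).symm x := by
  have h : M.ten x (M.univ []) = M.comp (M.rightInv A) (.app (.single x) .nil) := by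
    refine Eq.symm ((M.ten_comp (M.one A) (M.univ []) (.single x) .nil).trans ?_)
    rw [M.one_comp]; exact congrArg (fun w => M.ten x w) (M.comp_one (M.univ []))
  rw [h, ← M.comp_single, rightHom, IsUniversal.fac]
  refine eq_of_heq ((M.comp_heq _ (List.append_nil _) (Args.app_nil _)).trans
    ((heq_of_eq (M.one_comp x)).trans (Args.castDom_heq _ _).symm))

theorem assoc_inv_hom (A B C : M.Ob) :
    M.comp (M.assocInv A B C) (.single (M.assocHom A B C)) = M.one _ := by
  refine (M.isUniversal_ten₃ A B C).hom_ext ?_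
  rw [M.comp_single, assocHom, IsUniversal.fac, assocInv, IsUniversal.fac, M.one_comp]

theorem assoc_hom_inv (A B C : M.Ob) :
    M.comp (M.assocHom A B C) (.single (M.assocInv A B C)) = M.one _ := by
  refine (M.isUniversal_ten₃' A B C).hom_ext ?_
  rw [M.comp_single, assocInv, IsUniversal.fac, assocHom, IsUniversal.fac, M.one_comp]

theorem left_inv_hom (A : M.Ob) :
    M.comp (M.leftInv A) (.single (M.leftHom A)) = M.one _ := by
  refine (M.isUniversal_leftInv A).hom_ext ?_
  rw [M.comp_single, leftHom, IsUniversal.fac, M.comp_single_one, M.one_comp]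

theorem right_inv_hom (A : M.Ob) :
    M.comp (M.rightInv A) (.single (M.rightHom A)) = M.one _ := by
  refine (M.isUniversal_rightInv A).hom_ext ?_
  rw [M.comp_single, rightHom, IsUniversal.fac, M.comp_single_one, M.one_comp]

theorem tensorHom_one (A B : M.Ob) : M.tensorHom (M.one A) (M.one B) = M.one _ := by
  refine (M.univ_universal _).hom_ext ?_
  rw [tensorHom_univ, ten_one, M.one_comp]

theorem tensorHom_tensorHom {A B C A' B' C' : M.Ob} (f : M.Hom [A] B) (g : M.Hom [B] C)
    (f' : M.Hom [A'] B') (g' : M.Hom [B'] C') :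
    M.comp (M.tensorHom g g') (.single (M.tensorHom f f')) =
      M.tensorHom (M.comp g (.single f)) (M.comp g' (.single f')) := by
  refine (M.univ_universal _).hom_ext ?_
  rw [M.comp_single, tensorHom_univ, tensorHom_ten, tensorHom_univ]

theorem assoc_naturality {A B C A' B' C' : M.Ob} (f : M.Hom [A] A') (g : M.Hom [B] B')
    (h : M.Hom [C] C') :
    M.comp (M.assocHom A' B' C') (.single (M.tensorHom (M.tensorHom f g) h)) =
      M.comp (M.tensorHom f (M.tensorHom g h)) (.single (M.assocHom A B C)) := by
  refine (M.isUniversal_ten₃ A B C).hom_ext ?_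
  rw [M.comp_single, M.comp_single]
  conv_rhs => rw [assocHom, IsUniversal.fac]
  rw [ten₃, ten₃', tensorHom_ten, tensorHom_ten, tensorHom_univ, tensorHom_univ,
    M.comp_single_one, M.comp_single_one, assocHom_ten]
  rfl

theorem left_naturality {A B : M.Ob} (f : M.Hom [A] B) :
    M.comp (M.leftHom B) (.single (M.tensorHom (M.one (M.T [])) f)) =
      M.comp f (.single (M.leftHom A)) := by
  refine (M.isUniversal_leftInv A).hom_ext ?_
  rw [M.comp_single, M.comp_single]
  conv_rhs => rw [leftHom, IsUniversal.fac, M.comp_single_one]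
  refine (congrArg (fun w => M.comp _ (.single w)) (M.tensorHom_ten _ _ _ _)).trans ?_
  rw [M.one_comp, leftHom_ten, M.comp_single_one]

theorem right_naturality {A B : M.Ob} (f : M.Hom [A] B) :
    M.comp (M.rightHom B) (.single (M.tensorHom f (M.one (M.T [])))) =
      M.comp f (.single (M.rightHom A)) := by
  refine (M.isUniversal_rightInv A).hom_ext ?_
  rw [M.comp_single, M.comp_single]
  conv_rhs => rw [rightHom, IsUniversal.fac, M.comp_single_one]
  refine (congrArg (fun w => M.comp _ (.single w)) (M.tensorHom_ten _ _ _ _)).trans ?_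
  rw [M.one_comp, rightHom_ten, M.comp_single_one]
  rfl

theorem pentagon_aux (A B C D : M.Ob) :
    M.comp (M.comp (M.tensorHom (M.one A) (M.assocHom B C D))
        (.single (M.assocHom A (M.T [B, C]) D)))
      (.single (M.tensorHom (M.assocHom A B C) (M.one D))) =
    M.comp (M.assocHom A B (M.T [C, D])) (.single (M.assocHom (M.T [A, B]) C D)) := by
  refine ((M.isUniversal_ten (M.isUniversal_ten₃ A B C) (isUniversal_one D))).hom_ext ?_
  rw [M.comp_single, M.comp_single, M.comp_single, tensorHom_ten, M.one_comp]
  have h₁ : M.comp (M.assocHom A B C) (.single (M.ten₃ A B C)) =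
    M.ten (M.one A) (M.univ [B, C]) := IsUniversal.fac _ _
  have h₂ := M.assocHom_ten (M.one A) (M.one B) (M.univ [C, D])
  have h₃ := M.assocHom_ten (M.one A) (M.univ [B, C]) (M.one D)
  have h₄ := M.assocHom_ten (M.one B) (M.one C) (M.one D)
  have h₅ := M.assocHom_ten (M.univ [A, B]) (M.one C) (M.one D)
  rw [ten_one] at h₂ h₄ h₅
  rw [h₁]
  refine ((congrArg (fun w => M.comp _ (.single w)) h₃).trans ?_).trans
    ((congrArg (fun w => M.comp _ (.single w)) h₅).trans h₂).symm
  refine (M.tensorHom_ten _ _ _ _).trans ?_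
  rw [M.one_comp]
  exact congrArg (M.ten (M.one A)) (h₄.trans (congrArg (M.ten (M.one B)) (M.ten_one C D)))

theorem triangle_aux (A B : M.Ob) :
    M.comp (M.tensorHom (M.one A) (M.leftHom B)) (.single (M.assocHom A (M.T []) B)) =
      M.tensorHom (M.rightHom A) (M.one B) := by
  refine ((M.isUniversal_ten (M.isUniversal_rightInv A) (isUniversal_one B))).hom_ext ?_
  rw [M.comp_single, tensorHom_ten]
  refine (congrArg (fun w => M.comp _ (.single w)) (M.assocHom_ten _ _ _)).trans ?_
  refine (M.tensorHom_ten _ _ _ _).trans ?_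
  rw [leftHom_ten, rightInv, rightHom_ten, M.comp_single_one, M.comp_single_one]
  rfl

/-- The tensor product on the nucleus is the object representing two-element lists, the unit the one
representing the empty list. -/
noncomputable instance : MonoidalCategoryStruct M.Nucleus where
  tensorObj A B := M.T [A, B]
  tensorUnit := M.T []
  tensorHom f g := M.tensorHom f g
  whiskerLeft A _ _ g := M.tensorHom (M.one A) g
  whiskerRight f B := M.tensorHom f (M.one B)
  associator A B C := ⟨M.assocHom A B C, M.assocInv A B C, M.assoc_inv_hom A B C,
    M.assoc_hom_inv A B C⟩
  leftUnitor A := ⟨M.leftHom A, M.leftInv A, M.left_inv_hom A, (M.isUniversal_leftInv A).fac _⟩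
  rightUnitor A := ⟨M.rightHom A, M.rightInv A, M.right_inv_hom A, (M.isUniversal_rightInv A).fac _⟩

noncomputable instance : MonoidalCategory M.Nucleus :=
  MonoidalCategory.ofTensorHom
    (id_tensorHom_id := M.tensorHom_one)
    (id_tensorHom := fun _ {_ _} _ => rfl)
    (tensorHom_id := fun _ _ => rfl)
    (tensorHom_comp_tensorHom := fun _ _ _ _ => M.tensorHom_tensorHom _ _ _ _)
    (associator_naturality := fun _ _ _ => M.assoc_naturality _ _ _)
    (leftUnitor_naturality := fun _ => M.left_naturality _)
    (rightUnitor_naturality := fun _ => M.right_naturality _)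
    (pentagon := fun A B C D => M.pentagon_aux A B C D)
    (triangle := fun A B => M.triangle_aux A B)

end RepMulticat

/-- A permutation of a list: position `i` of `Γ'` holds the entry of `Γ` at position `σ i`. -/
structure CtxPerm {O : Type u} (Γ Γ' : List O) where
  σ : Fin Γ'.length ≃ Fin Γ.length
  get_eq : ∀ i, Γ'.get i = Γ.get (σ i)

namespace CtxPerm
variable {O : Type u} {Γ Γ' Γ'' : List O}

@[ext] theorem ext' {p q : CtxPerm Γ Γ'} (h : ∀ i, p.σ i = q.σ i) : p = q := by
  cases p; cases q; congr; exact Equiv.ext h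

def refl (Γ : List O) : CtxPerm Γ Γ := ⟨Equiv.refl _, fun _ => rfl⟩

def trans (p : CtxPerm Γ Γ') (q : CtxPerm Γ' Γ'') : CtxPerm Γ Γ'' :=
  ⟨q.σ.trans p.σ, fun i => (q.get_eq i).trans (p.get_eq _)⟩

def map {O' : Type u} (o : O → O') (p : CtxPerm Γ Γ') : CtxPerm (Γ.map o) (Γ'.map o) where
  σ := (finCongr (List.length_map o)).trans (p.σ.trans (finCongr (List.length_map o).symm))
  get_eq i := by simpa using congrArg o (p.get_eq (i.cast (List.length_map o)))

end CtxPerm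

namespace Args
variable {O : Type u} {H : List O → O → Type u}

/-- The domain of the `i`-th multimap of a list. -/
def dom : {Γ As : List O} → Args H Γ As → Fin As.length → List O
  | _, _, cons (Γ := Γ) _ _ _, ⟨0, _⟩ => Γ
  | _, _, cons _ fs _, ⟨i + 1, h⟩ => fs.dom ⟨i, Nat.lt_of_succ_lt_succ h⟩

/-- The `i`-th multimap of a list. -/
def get : {Γ As : List O} → (fs : Args H Γ As) → (i : Fin As.length) → H (fs.dom i) (As.get i)
  | _, _, cons f _ _, ⟨0, _⟩ => f
  | _, _, cons _ fs _, ⟨i + 1, h⟩ => fs.get ⟨i, Nat.lt_of_succ_lt_succ h⟩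

/-- The position in the concatenated domain at which the domain of the `i`-th multimap starts. -/
def offset : {Γ As : List O} → Args H Γ As → Fin As.length → ℕ
  | _, _, cons _ _ _, ⟨0, _⟩ => 0
  | _, _, cons (Γ := Γ) _ fs _, ⟨i + 1, h⟩ =>
    Γ.length + fs.offset ⟨i, Nat.lt_of_succ_lt_succ h⟩

end Args

/-- A symmetric structure on a multicategory: permutations act on domains, functorially, and
compatibly with composition. In `comp_act` the `i`-th member of `gs'` is the `σ i`-th member of `gs`
acted on by `τ i`, and `q` is the resulting permutation of the concatenated domain: it permutes the
blocks as `p` does and acts on the `i`-th block as `τ i`. -/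
structure Multicat.Symmetry (M : Multicat.{u}) where
  act : ∀ {Γ Γ' : List M.Ob} {B : M.Ob}, CtxPerm Γ Γ' → M.Hom Γ B → M.Hom Γ' B
  act_refl : ∀ {Γ : List M.Ob} {B : M.Ob} (f : M.Hom Γ B), act (.refl Γ) f = f
  act_trans : ∀ {Γ Γ' Γ'' : List M.Ob} {B : M.Ob} (p : CtxPerm Γ Γ') (q : CtxPerm Γ' Γ'')
    (f : M.Hom Γ B), act (p.trans q) f = act q (act p f)
  comp_act : ∀ {As As' Γ Γ' : List M.Ob} {B : M.Ob} (f : M.Hom As B) (gs : Args M.Hom Γ As)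
    (gs' : Args M.Hom Γ' As') (p : CtxPerm As As')
    (τ : ∀ i, CtxPerm (gs.dom (p.σ i)) (gs'.dom i)) (q : CtxPerm Γ Γ'),
    (∀ i, HEq (gs'.get i) (act (τ i) (gs.get (p.σ i)))) →
    (∀ i (j : Fin (gs'.dom i).length) (k : Fin Γ'.length), (k : ℕ) = gs'.offset i + j →
      (q.σ k : ℕ) = gs.offset (p.σ i) + (τ i).σ j) →
    M.comp (act p f) gs' = act q (M.comp f gs)

/-- A representable multicategory whose underlying multicategory is symmetric. -/
structure SRepMulticat extends RepMulticat.{u} where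
  symmetry : toMulticat.Symmetry

namespace SRepMulticat
variable (M : SRepMulticat.{u})
open Multicat RepMulticat

/-- The action of permutations. -/
def act {Γ Γ' : List M.Ob} {B : M.Ob} (p : CtxPerm Γ Γ') (f : M.Hom Γ B) : M.Hom Γ' B :=
  M.symmetry.act p f

theorem act_single {Γ Γ' : List M.Ob} {A B : M.Ob} (p : CtxPerm Γ Γ') (f : M.Hom [A] B)
    (g : M.Hom Γ A) :
    M.comp f (.single (M.act p g)) = M.act p (M.comp f (.single g)) := by
  have := M.symmetry.comp_act f (.single g) (.single (M.act p g)) (.refl [A])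
    (fun i => match i with | ⟨0, _⟩ => p) p
    (fun i => match i with | ⟨0, _⟩ => HEq.rfl)
    (fun i => match i with
      | ⟨0, _⟩ => fun j k h => by
        obtain rfl : k = j := Fin.ext (h.trans (Nat.zero_add _))
        exact (Nat.zero_add _).symm)
  rwa [M.symmetry.act_refl] at this

theorem act_pair {Γ Γ' Δ Δ' : List M.Ob} {A B C : M.Ob} (p : CtxPerm Γ Γ') (p' : CtxPerm Δ Δ')
    (q : CtxPerm (Γ ++ Δ) (Γ' ++ Δ'))
    (h₁ : ∀ (k : Fin (Γ' ++ Δ').length) (j : Fin Γ'.length), (k : ℕ) = j →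
      (q.σ k : ℕ) = p.σ j)
    (h₂ : ∀ (k : Fin (Γ' ++ Δ').length) (j : Fin Δ'.length), (k : ℕ) = Γ'.length + j →
      (q.σ k : ℕ) = Γ.length + p'.σ j)
    (f : M.Hom [A, B] C) (x : M.Hom Γ A) (y : M.Hom Δ B) :
    M.comp f (.pair (M.act p x) (M.act p' y)) = M.act q (M.comp f (.pair x y)) := by
  have := M.symmetry.comp_act f (.pair x y) (.pair (M.act p x) (M.act p' y)) (.refl [A, B])
    (fun i => match i with | ⟨0, _⟩ => p | ⟨1, _⟩ => p') q
    (fun i => match i with | ⟨0, _⟩ => HEq.rfl | ⟨1, _⟩ => HEq.rfl)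
    (fun i => match i with
      | ⟨0, _⟩ => fun j k h =>
        (h₁ k j (h.trans (Nat.zero_add _))).trans (Nat.zero_add _).symm
      | ⟨1, _⟩ => fun j k h => h₂ k j h)
  rwa [M.symmetry.act_refl] at this

/-- The transposition of a two-element list. -/
def swapPerm (A B : M.Ob) : CtxPerm [B, A] [A, B] where
  σ := (Equiv.swap 0 1 : Fin 2 ≃ Fin 2)
  get_eq i := match i with | ⟨0, _⟩ => rfl | ⟨1, _⟩ => rfl

/-- The symmetry of the nucleus, `a ⊗ b ↦ b ⊗ a`. -/
noncomputable def braid (A B : M.Ob) : M.Hom [M.T [A, B]] (M.T [B, A]) :=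
  M.ext (M.act (M.swapPerm A B) (M.univ [B, A]))

theorem braid_ten {Γ Δ : List M.Ob} {A B : M.Ob} (x : M.Hom Γ A) (y : M.Hom Δ B)
    (q : CtxPerm (Δ ++ Γ) (Γ ++ Δ))
    (h₁ : ∀ (k : Fin (Γ ++ Δ).length) (j : Fin Γ.length), (k : ℕ) = j →
      (q.σ k : ℕ) = Δ.length + j)
    (h₂ : ∀ (k : Fin (Γ ++ Δ).length) (j : Fin Δ.length), (k : ℕ) = Γ.length + j →
      (q.σ k : ℕ) = j) :
    M.comp (M.braid A B) (.single (M.ten x y)) = M.act q (M.ten y x) := by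
  rw [ten, ← M.comp_single, braid, ext_univ]
  exact M.symmetry.comp_act (M.univ [B, A]) (.pair y x) (.pair x y) (M.swapPerm A B)
    (fun i => match i with | ⟨0, _⟩ => .refl _ | ⟨1, _⟩ => .refl _) q
    (fun i => match i with
      | ⟨0, _⟩ => heq_of_eq (M.symmetry.act_refl x).symm
      | ⟨1, _⟩ => heq_of_eq (M.symmetry.act_refl y).symm)
    (fun i => match i with
      | ⟨0, _⟩ => fun j k h => h₁ k j (h.trans (Nat.zero_add _))
      | ⟨1, _⟩ => fun j k h => (h₂ k j h).trans (Nat.zero_add _).symm)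

theorem braid_univ (A B : M.Ob) :
    M.comp (M.braid A B) (.single (M.univ [A, B])) = M.act (M.swapPerm A B) (M.univ [B, A]) :=
  M.ext_univ _

theorem braid_braid (A B : M.Ob) :
    M.comp (M.braid B A) (.single (M.braid A B)) = M.one _ := by
  refine (M.univ_universal _).hom_ext ?_
  rw [M.comp_single, braid_univ, act_single, braid_univ, M.one_comp]
  refine (M.symmetry.act_trans _ _ _).symm.trans (Eq.trans ?_ (M.symmetry.act_refl _))
  congr 1
  ext i
  match i with | ⟨0, _⟩ => rfl | ⟨1, _⟩ => rfl

theorem braid_naturality {A A' B B' : M.Ob} (f : M.Hom [A] A') (g : M.Hom [B] B') :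
    M.comp (M.braid A' B') (.single (M.tensorHom f g)) =
      M.comp (M.tensorHom g f) (.single (M.braid A B)) := by
  refine (M.univ_universal _).hom_ext ?_
  rw [M.comp_single, M.comp_single, braid_univ, tensorHom_univ, act_single, tensorHom_univ]
  exact M.braid_ten f g (M.swapPerm A B)
    (fun k j h => by match k, j, h with | ⟨_, _⟩, ⟨0, _⟩, rfl => rfl)
    (fun k j h => by match k, j, h with | ⟨_, _⟩, ⟨0, _⟩, rfl => rfl)

def rot₃ : Fin 3 ≃ Fin 3 := ⟨![2, 0, 1], ![1, 2, 0], by decide, by decide⟩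

def rot (A B C : M.Ob) : CtxPerm [B, C, A] [A, B, C] where
  σ := rot₃
  get_eq i := match i with | ⟨0, _⟩ => rfl | ⟨1, _⟩ => rfl | ⟨2, _⟩ => rfl

def rot' (A B C : M.Ob) : CtxPerm [C, A, B] [A, B, C] where
  σ := rot₃.symm
  get_eq i := match i with | ⟨0, _⟩ => rfl | ⟨1, _⟩ => rfl | ⟨2, _⟩ => rfl

def swap₁ (A B C : M.Ob) : CtxPerm [B, A, C] [A, B, C] where
  σ := (Equiv.swap 0 1 : Fin 3 ≃ Fin 3)
  get_eq i := match i with | ⟨0, _⟩ => rfl | ⟨1, _⟩ => rfl | ⟨2, _⟩ => rfl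

def swap₂ (A B C : M.Ob) : CtxPerm [A, C, B] [A, B, C] where
  σ := (Equiv.swap 1 2 : Fin 3 ≃ Fin 3)
  get_eq i := match i with | ⟨0, _⟩ => rfl | ⟨1, _⟩ => rfl | ⟨2, _⟩ => rfl

theorem ten_swap_one (A B C : M.Ob) :
    M.ten (M.act (M.swapPerm A B) (M.univ [B, A])) (M.one C) =
      M.act (M.swap₁ A B C) (M.ten₃ B A C) := by
  have := M.act_pair (M.swapPerm A B) (.refl [C]) (M.swap₁ A B C)
    (fun k j h => by match k, j, h with | ⟨_, _⟩, ⟨0, _⟩, rfl => rfl | ⟨_, _⟩, ⟨1, _⟩, rfl => rfl)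
    (fun k j h => by match k, j, h with | ⟨_, _⟩, ⟨0, _⟩, rfl => rfl)
    (M.univ [M.T [B, A], C]) (M.univ [B, A]) (M.one C)
  rwa [show M.act (.refl [C]) (M.one C) = M.one C from M.symmetry.act_refl _] at this

theorem ten_one_swap (A B C : M.Ob) :
    M.ten (M.one A) (M.act (M.swapPerm B C) (M.univ [C, B])) =
      M.act (M.swap₂ A B C) (M.ten₃' A C B) := by
  have := M.act_pair (.refl [A]) (M.swapPerm B C) (M.swap₂ A B C)
    (fun k j h => by match k, j, h with | ⟨_, _⟩, ⟨0, _⟩, rfl => rfl)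
    (fun k j h => by match k, j, h with | ⟨_, _⟩, ⟨0, _⟩, rfl => rfl | ⟨_, _⟩, ⟨1, _⟩, rfl => rfl)
    (M.univ [A, M.T [C, B]]) (M.one A) (M.univ [C, B])
  rwa [show M.act (.refl [A]) (M.one A) = M.one A from M.symmetry.act_refl _] at this

theorem assoc_ten₃ (A B C : M.Ob) :
    M.comp (M.assocHom A B C) (.single (M.ten₃ A B C)) = M.ten₃' A B C := IsUniversal.fac _ _

theorem assocInv_ten₃' (A B C : M.Ob) :
    M.comp (M.assocInv A B C) (.single (M.ten₃' A B C)) = M.ten₃ A B C := IsUniversal.fac _ _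

theorem hexagon_aux (A B C : M.Ob) :
    M.comp (M.comp (M.assocHom B C A) (.single (M.braid A (M.T [B, C]))))
      (.single (M.assocHom A B C)) =
    M.comp (M.comp (M.tensorHom (M.one B) (M.braid A C)) (.single (M.assocHom B A C)))
      (.single (M.tensorHom (M.braid A B) (M.one C))) := by
  refine (M.isUniversal_ten₃ A B C).hom_ext ?_
  rw [M.comp_single, M.comp_single, M.comp_single, M.comp_single, assoc_ten₃]
  have h₁ : M.comp (M.braid A (M.T [B, C])) (.single (M.ten₃' A B C)) =
      M.act (M.rot A B C) (M.ten₃ B C A) :=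
    M.braid_ten (M.one A) (M.univ [B, C]) (M.rot A B C)
      (fun k j h => by match k, j, h with | ⟨_, _⟩, ⟨0, _⟩, rfl => rfl)
      (fun k j h => by match k, j, h with | ⟨_, _⟩, ⟨0, _⟩, rfl => rfl | ⟨_, _⟩, ⟨1, _⟩, rfl => rfl)
  have h₂ : M.comp (M.tensorHom (M.braid A B) (M.one C)) (.single (M.ten₃ A B C)) =
      M.act (M.swap₁ A B C) (M.ten₃ B A C) := by
    rw [ten₃, tensorHom_ten, braid_univ, M.one_comp, ten_swap_one]
  have h₃ : M.comp (M.tensorHom (M.one B) (M.braid A C)) (.single (M.ten₃' B A C)) =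
      M.act (M.swap₂ B A C) (M.ten₃' B C A) := by
    rw [ten₃', tensorHom_ten, braid_univ, M.one_comp, ten_one_swap]
  rw [h₁, h₂, act_single, act_single, act_single, assoc_ten₃, assoc_ten₃, h₃]
  refine Eq.trans ?_ (M.symmetry.act_trans _ _ _)
  refine congrArg (fun p => M.act p (M.ten₃' B C A)) ?_
  ext i
  match i with | ⟨0, _⟩ => rfl | ⟨1, _⟩ => rfl | ⟨2, _⟩ => rfl

theorem hexagon_aux' (A B C : M.Ob) :
    M.comp (M.comp (M.assocInv C A B) (.single (M.braid (M.T [A, B]) C)))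
      (.single (M.assocInv A B C)) =
    M.comp (M.comp (M.tensorHom (M.braid A C) (M.one B)) (.single (M.assocInv A C B)))
      (.single (M.tensorHom (M.one A) (M.braid B C))) := by
  refine (M.isUniversal_ten₃' A B C).hom_ext ?_
  rw [M.comp_single, M.comp_single, M.comp_single, M.comp_single, assocInv_ten₃']
  have h₁ : M.comp (M.braid (M.T [A, B]) C) (.single (M.ten₃ A B C)) =
      M.act (M.rot' A B C) (M.ten₃' C A B) :=
    M.braid_ten (M.univ [A, B]) (M.one C) (M.rot' A B C)
      (fun k j h => by match k, j, h with | ⟨_, _⟩, ⟨0, _⟩, rfl => rfl | ⟨_, _⟩, ⟨1, _⟩, rfl => rfl)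
      (fun k j h => by match k, j, h with | ⟨_, _⟩, ⟨0, _⟩, rfl => rfl)
  have h₂ : M.comp (M.tensorHom (M.one A) (M.braid B C)) (.single (M.ten₃' A B C)) =
      M.act (M.swap₂ A B C) (M.ten₃' A C B) := by
    rw [ten₃', tensorHom_ten, braid_univ, M.one_comp, ten_one_swap]
  have h₃ : M.comp (M.tensorHom (M.braid A C) (M.one B)) (.single (M.ten₃ A C B)) =
      M.act (M.swap₁ A C B) (M.ten₃ C A B) := by
    rw [ten₃, tensorHom_ten, braid_univ, M.one_comp, ten_swap_one]
  rw [h₁, h₂, act_single, act_single, act_single, assocInv_ten₃', assocInv_ten₃', h₃]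
  refine Eq.trans ?_ (M.symmetry.act_trans _ _ _)
  refine congrArg (fun p => M.act p (M.ten₃ C A B)) ?_
  ext i
  match i with | ⟨0, _⟩ => rfl | ⟨1, _⟩ => rfl | ⟨2, _⟩ => rfl

noncomputable instance : BraidedCategory M.Nucleus where
  braiding A B := ⟨M.braid A B, M.braid B A, M.braid_braid A B, M.braid_braid B A⟩
  braiding_naturality_right _ _ _ _ := M.braid_naturality _ _
  braiding_naturality_left _ _ := M.braid_naturality _ _
  hexagon_forward A B C := M.hexagon_aux A B C
  hexagon_reverse A B C := M.hexagon_aux' A B C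

noncomputable instance : SymmetricCategory M.Nucleus where
  symmetry A B := M.braid_braid A B

end SRepMulticat
end Multi

namespace Multi
open CategoryTheory MonoidalCategory

/-! ## Signatures -/

/-- A signature: sorts, and constants with a list of input sorts and an output sort. -/
structure Sig where
  Ob : Type u
  con : List Ob → Ob → Type u

/-- A map of signatures. -/
structure Sig.Fun (S S' : Sig.{u}) where
  ob : S.Ob → S'.Ob
  map : ∀ {Γ : List S.Ob} {B : S.Ob}, S.con Γ B → S'.con (Γ.map ob) (ob B)

theorem Sig.Fun.ext' {S S' : Sig.{u}} {F G : Sig.Fun S S'} (h : F.ob = G.ob)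
    (h' : ∀ {Γ : List S.Ob} {B : S.Ob} (c : S.con Γ B), HEq (F.map c) (G.map c)) : F = G := by
  obtain ⟨o, m⟩ := F
  obtain ⟨o', m'⟩ := G
  obtain rfl : o = o' := h
  congr
  funext Γ B c
  exact eq_of_heq (h' c)

theorem Sig.Fun.map_heq {S S' : Sig.{u}} (F : Sig.Fun S S') {Γ Γ' : List S.Ob} {B : S.Ob}
    (h : Γ = Γ') {c : S.con Γ B} {c' : S.con Γ' B} (hc : HEq c c') :
    HEq (F.map c) (F.map c') := by
  subst h; obtain rfl := eq_of_heq hc; rfl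

namespace Sig.Fun
variable {S S' S'' S''' : Sig.{u}}

/-- The identity map of signatures. -/
def id (S : Sig.{u}) : Sig.Fun S S := ⟨_root_.id, fun c => Args.castDom (List.map_id _).symm c⟩

/-- Composition of maps of signatures. -/
def comp (F : Sig.Fun S S') (G : Sig.Fun S' S'') : Sig.Fun S S'' :=
  ⟨G.ob ∘ F.ob, fun c => Args.castDom List.map_map (G.map (F.map c))⟩

theorem id_comp (F : Sig.Fun S S') : (Sig.Fun.id S).comp F = F :=
  Sig.Fun.ext' rfl fun _ =>
    (Args.castDom_heq _ _).trans (F.map_heq (List.map_id _) (Args.castDom_heq _ _))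

theorem comp_id (F : Sig.Fun S S') : F.comp (Sig.Fun.id S') = F :=
  Sig.Fun.ext' rfl fun _ => (Args.castDom_heq _ _).trans (Args.castDom_heq _ _)

theorem assoc (F : Sig.Fun S S') (G : Sig.Fun S' S'') (K : Sig.Fun S'' S''') :
    (F.comp G).comp K = F.comp (G.comp K) :=
  Sig.Fun.ext' rfl fun _ => (Args.castDom_heq _ _).trans
    ((K.map_heq List.map_map.symm (Args.castDom_heq _ _)).trans
      ((Args.castDom_heq _ _).trans (Args.castDom_heq _ _)).symm)

end Sig.Fun

instance : Category.{u} Sig.{u} where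
  Hom := Sig.Fun
  id := Sig.Fun.id
  comp := Sig.Fun.comp
  id_comp := Sig.Fun.id_comp
  comp_id := Sig.Fun.comp_id
  assoc := Sig.Fun.assoc

/-! ## Functors of multicategories -/

/-- A multicategory functor. -/
structure MultiFunctor (M M' : Multicat.{u}) where
  ob : M.Ob → M'.Ob
  map : ∀ {Γ : List M.Ob} {B : M.Ob}, M.Hom Γ B → M'.Hom (Γ.map ob) (ob B)
  map_one : ∀ A, map (M.one A) = M'.one (ob A)
  map_comp : ∀ {Γ As : List M.Ob} {B : M.Ob} (f : M.Hom As B) (gs : Args M.Hom Γ As),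
    map (M.comp f gs) = M'.comp (map f) (gs.map ob map)

/-- A functor of representable multicategories preserves the chosen universal arrows on the nose
(and hence also the extensions along them). -/
structure RepFunctor (M M' : RepMulticat.{u}) extends
    MultiFunctor M.toMulticat M'.toMulticat where
  ob_T : ∀ Γ, ob (M.T Γ) = M'.T (Γ.map ob)
  map_univ : ∀ Γ, HEq (map (M.univ Γ)) (M'.univ (Γ.map ob))

/-- A functor of symmetric representable multicategories also preserves the action of permutations. -/
structure SRepFunctor (M M' : SRepMulticat.{u}) extends
    RepFunctor M.toRepMulticat M'.toRepMulticat where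
  map_act : ∀ {Γ Γ' : List M.Ob} {B : M.Ob} (p : CtxPerm Γ Γ') (f : M.Hom Γ B),
    map (M.symmetry.act p f) = M'.symmetry.act (p.map ob) (map f)

namespace Multicat

/-- The underlying map of signatures. -/
def _root_.Multi.MultiFunctor.toSig {M M' : Multicat.{u}} (F : MultiFunctor M M') :
    Sig.Fun ⟨M.Ob, M.Hom⟩ ⟨M'.Ob, M'.Hom⟩ :=
  ⟨F.ob, F.map⟩

theorem _root_.Multi.MultiFunctor.toSig_injective {M M' : Multicat.{u}} {F G : MultiFunctor M M'} (h : F.toSig = G.toSig) :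
    F = G := by
  obtain ⟨o, m, _, _⟩ := F
  obtain ⟨o', m', _, _⟩ := G
  simp only [MultiFunctor.toSig, Sig.Fun.mk.injEq] at h
  obtain ⟨rfl, h⟩ := h
  have : @m = @m' := eq_of_heq h
  subst this
  rfl

theorem comp_congr (M : Multicat.{u}) {Γ Γ' As As' : List M.Ob} {B B' : M.Ob} {f : M.Hom As B}
    {f' : M.Hom As' B'} {a : Args M.Hom Γ As} {a' : Args M.Hom Γ' As'} (hΓ : Γ = Γ')
    (hA : As = As') (hB : B = B') (hf : HEq f f') (h : HEq a a') :
    HEq (M.comp f a) (M.comp f' a') := by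
  subst hΓ hA hB; obtain rfl := eq_of_heq h; obtain rfl := eq_of_heq hf; rfl

end Multicat

theorem Args.cons_congr {O : Type u} {H : List O → O → Type u} {Γ Γ' Δ Δ' Θ Θ' As As' : List O}
    {A A' : O} {f : H Γ A} {f' : H Γ' A'} {fs : Args H Δ As} {fs' : Args H Δ' As'}
    {h : Θ = Γ ++ Δ} {h' : Θ' = Γ' ++ Δ'} (hΓ : Γ = Γ') (hΔ : Δ = Δ') (hA : A = A')
    (hAs : As = As') (hf : HEq f f') (hfs : HEq fs fs') :
    HEq (Args.cons f fs h) (Args.cons f' fs' h') := by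
  subst hΓ hΔ hA hAs h h'; obtain rfl := eq_of_heq hf; obtain rfl := eq_of_heq hfs; rfl

theorem Args.map_comp {O O' O'' : Type u} {H : List O → O → Type u} {H' : List O' → O' → Type u}
    {H'' : List O'' → O'' → Type u} (o : O → O') (o' : O' → O'')
    (φ : ∀ {Γ A}, H Γ A → H' (Γ.map o) (o A)) (ψ : ∀ {Γ A}, H' Γ A → H'' (Γ.map o') (o' A))
    {Γ As : List O} (fs : Args H Γ As) :
    HEq ((fs.map o φ).map o' ψ)
      (fs.map (H' := H'') (o' ∘ o) (fun f => Args.castDom List.map_map (ψ (φ f)))) := by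
  induction fs with
  | nil => rfl
  | cons f fs h ih =>
    exact Args.cons_congr (by simp) (by simp) rfl (by simp) (Args.castDom_heq _ _).symm ih

theorem Args.map_id {O : Type u} {H : List O → O → Type u} {Γ As : List O} (fs : Args H Γ As) :
    HEq fs (fs.map (H' := H) id (fun f => Args.castDom (List.map_id _).symm f)) := by
  induction fs with
  | nil => rfl
  | cons f fs h ih =>
    exact Args.cons_congr (by simp) (by simp) rfl (by simp) (Args.castDom_heq _ _).symm ih

/-- The identity functor. -/
def MultiFunctor.id (M : Multicat.{u}) : MultiFunctor M M where
  ob := _root_.id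
  map f := Args.castDom (List.map_id _).symm f
  map_one _ := rfl
  map_comp f gs := eq_of_heq <| (Args.castDom_heq _ _).trans
    (M.comp_congr (List.map_id _).symm (List.map_id _).symm rfl (Args.castDom_heq _ _).symm
      (Args.map_id gs))

theorem MultiFunctor.map_heq {M M' : Multicat.{u}} (F : MultiFunctor M M') {Γ Γ' : List M.Ob} {B B' : M.Ob}
    (h : Γ = Γ') (hB : B = B') {c : M.Hom Γ B} {c' : M.Hom Γ' B'} (hc : HEq c c') :
    HEq (F.map c) (F.map c') := by
  subst h hB; obtain rfl := eq_of_heq hc; rfl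

/-- Composition of functors. -/
def MultiFunctor.comp {M M' M'' : Multicat.{u}} (F : MultiFunctor M M') (G : MultiFunctor M' M'') : MultiFunctor M M'' where
  ob := G.ob ∘ F.ob
  map f := Args.castDom List.map_map (G.map (F.map f))
  map_one A := by rw [F.map_one, G.map_one]; rfl
  map_comp f gs := eq_of_heq <| (Args.castDom_heq _ _).trans <| by
    rw [F.map_comp, G.map_comp]
    exact M''.comp_congr List.map_map List.map_map rfl (Args.castDom_heq _ _).symm
      (Args.map_comp _ _ _ _ gs)

namespace RepMulticat

theorem univ_heq (M : RepMulticat.{u}) {Γ Γ' : List M.Ob} (h : Γ = Γ') :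
    HEq (M.univ Γ) (M.univ Γ') := by
  subst h; rfl

theorem _root_.Multi.RepFunctor.toSig_injective {M M' : RepMulticat.{u}} {F G : RepFunctor M M'}
    (h : F.toSig = G.toSig) : F = G := by
  have h := MultiFunctor.toSig_injective h
  cases F; cases G; congr

/-- The identity functor. -/
def _root_.Multi.RepFunctor.id (M : RepMulticat.{u}) : RepFunctor M M :=
  { MultiFunctor.id M.toMulticat with
    ob_T := fun Γ => (congrArg M.T (List.map_id Γ)).symm
    map_univ := fun Γ => (Args.castDom_heq _ _).trans (M.univ_heq (List.map_id Γ).symm) }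

/-- Composition of functors. -/
def _root_.Multi.RepFunctor.comp {M M' M'' : RepMulticat.{u}} (F : RepFunctor M M')
    (G : RepFunctor M' M'') : RepFunctor M M'' :=
  { F.toMultiFunctor.comp G.toMultiFunctor with
    ob_T := fun Γ => (congrArg G.ob (F.ob_T Γ)).trans
      ((G.ob_T _).trans (congrArg M''.T List.map_map))
    map_univ := fun Γ => (Args.castDom_heq _ _).trans
      ((G.map_heq rfl (F.ob_T Γ) (F.map_univ Γ)).trans
        ((G.map_univ _).trans (M''.univ_heq List.map_map))) }

instance : Category.{u} RepMulticat.{u} where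
  Hom := RepFunctor
  id := RepFunctor.id
  comp := RepFunctor.comp
  id_comp F := RepFunctor.toSig_injective F.toSig.id_comp
  comp_id F := RepFunctor.toSig_injective F.toSig.comp_id
  assoc F G K := RepFunctor.toSig_injective (F.toSig.assoc G.toSig K.toSig)

/-- The forgetful functor: objects become sorts and multimaps become constants. -/
def U : RepMulticat.{u} ⥤ Sig.{u} where
  obj M := ⟨M.Ob, M.Hom⟩
  map F := MultiFunctor.toSig (RepFunctor.toMultiFunctor F)

end RepMulticat

namespace SRepMulticat

theorem _root_.Multi.SRepFunctor.toSig_injective {M M' : SRepMulticat.{u}} {F G : SRepFunctor M M'}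
    (h : F.toSig = G.toSig) : F = G := by
  have h := RepFunctor.toSig_injective h
  cases F; cases G; congr

theorem act_congr (M : SRepMulticat.{u}) {Γ₁ Γ₂ Δ₁ Δ₂ : List M.Ob} {B B' : M.Ob}
    (p : CtxPerm Γ₁ Δ₁) (q : CtxPerm Γ₂ Δ₂) (hΓ : Γ₁ = Γ₂) (hΔ : Δ₁ = Δ₂) (hB : B = B')
    (hσ : ∀ i, (p.σ i : ℕ) = q.σ (i.cast (congrArg _ hΔ)))
    {f : M.Hom Γ₁ B} {g : M.Hom Γ₂ B'} (h : HEq f g) :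
    HEq (M.symmetry.act p f) (M.symmetry.act q g) := by
  subst hΓ hΔ hB; obtain rfl := eq_of_heq h
  obtain rfl : p = q := CtxPerm.ext' fun i => Fin.ext (hσ i)
  rfl

/-- The identity functor. -/
def _root_.Multi.SRepFunctor.id (M : SRepMulticat.{u}) : SRepFunctor M M :=
  { RepFunctor.id M.toRepMulticat with
    map_act := fun p _ => eq_of_heq ((Args.castDom_heq _ _).trans
      (M.act_congr p _ (List.map_id _).symm (List.map_id _).symm rfl (fun _ => rfl)
        (Args.castDom_heq _ _).symm)) }

/-- Composition of functors. -/
def _root_.Multi.SRepFunctor.comp {M M' M'' : SRepMulticat.{u}} (F : SRepFunctor M M')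
    (G : SRepFunctor M' M'') : SRepFunctor M M'' :=
  { F.toRepFunctor.comp G.toRepFunctor with
    map_act := fun p f => eq_of_heq ((Args.castDom_heq _ _).trans
      ((heq_of_eq ((congrArg G.map (F.map_act p f)).trans (G.map_act _ _))).trans
        (M''.act_congr _ _ List.map_map List.map_map rfl (fun _ => rfl)
          (Args.castDom_heq _ _).symm))) }

instance : Category.{u} SRepMulticat.{u} where
  Hom := SRepFunctor
  id := SRepFunctor.id
  comp := SRepFunctor.comp
  id_comp F := SRepFunctor.toSig_injective F.toSig.id_comp
  comp_id F := SRepFunctor.toSig_injective F.toSig.comp_id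
  assoc F G K := SRepFunctor.toSig_injective (F.toSig.assoc G.toSig K.toSig)

/-- The forgetful functor: objects become sorts and multimaps become constants. -/
def U : SRepMulticat.{u} ⥤ Sig.{u} where
  obj M := ⟨M.Ob, M.Hom⟩
  map F := MultiFunctor.toSig (RepFunctor.toMultiFunctor (SRepFunctor.toRepFunctor F))

end SRepMulticat
end Multi

namespace Multi
open CategoryTheory MonoidalCategory

/-! ## Monoidal categories with n-ary tensor products -/

/-- The right-bracketed tensor product of a list. -/
def fold {C : Type u} [Category.{u} C] [MonoidalCategory C] : List C → C
  | [] => 𝟙_ C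
  | A :: Γ => A ⊗ fold Γ

/-- Chosen n-ary tensor products on a monoidal category, one for every list of objects, each with an
isomorphism to the iterated binary tensor product. The nullary and binary ones are the unit and the
binary tensor product of the monoidal structure. -/
class NaryTensor (C : Type u) [Category.{u} C] [MonoidalCategory C] where
  tens : List C → C
  bracket : ∀ Γ : List C, tens Γ ≅ fold Γ
  tens_nil : tens [] = 𝟙_ C
  bracket_nil : (bracket []).hom = eqToHom tens_nil
  tens_pair : ∀ A B : C, tens [A, B] = A ⊗ B
  bracket_pair : ∀ A B : C, (bracket [A, B]).hom = eqToHom (tens_pair A B) ≫ A ◁ (ρ_ B).inv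

open NaryTensor

/-- A small monoidal category with chosen n-ary tensor products. -/
structure TensorCat where
  carrier : Type u
  [cat : Category.{u} carrier]
  [mon : MonoidalCategory carrier]
  [nary : NaryTensor carrier]

attribute [instance] TensorCat.cat TensorCat.mon TensorCat.nary

/-- A small symmetric monoidal category with chosen n-ary tensor products. -/
structure STensorCat extends TensorCat.{u} where
  [sym : SymmetricCategory carrier]

attribute [instance] STensorCat.sym

/-- A strict monoidal functor: all the monoidal structure is preserved on the nose. -/
structure StrictFunctor (C D : TensorCat.{u}) extends C.carrier ⥤ D.carrier where
  obj_unit : obj (𝟙_ C.carrier) = 𝟙_ D.carrier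
  obj_tensor : ∀ A B : C.carrier, obj (A ⊗ B) = obj A ⊗ obj B
  obj_tens : ∀ Γ : List C.carrier, obj (tens Γ) = tens (Γ.map obj)
  map_tensor : ∀ {A A' B B' : C.carrier} (f : A ⟶ A') (g : B ⟶ B'),
    HEq (map (f ⊗ₘ g)) (map f ⊗ₘ map g)
  map_associator : ∀ A B X : C.carrier,
    HEq (map (α_ A B X).hom) (α_ (obj A) (obj B) (obj X)).hom
  map_leftUnitor : ∀ A : C.carrier, HEq (map (λ_ A).hom) (λ_ (obj A)).hom
  map_rightUnitor : ∀ A : C.carrier, HEq (map (ρ_ A).hom) (ρ_ (obj A)).hom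
  map_bracket : ∀ Γ : List C.carrier, HEq (map (bracket Γ).hom) (bracket (Γ.map obj)).hom

/-- A strict symmetric monoidal functor. -/
structure SStrictFunctor (C D : STensorCat.{u}) extends
    StrictFunctor C.toTensorCat D.toTensorCat where
  map_braiding : ∀ A B : C.carrier, HEq (map (β_ A B).hom) (β_ (obj A) (obj B)).hom

theorem functor_map_heq {C D : Type u} [Category.{u} C] [Category.{u} D] (F : C ⥤ D)
    {A A' B B' : C} (hA : A = A') (hB : B = B') {f : A ⟶ B} {f' : A' ⟶ B'} (h : HEq f f') :
    HEq (F.map f) (F.map f') := by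
  subst hA hB; obtain rfl := eq_of_heq h; rfl

theorem fold_map {C D : TensorCat.{u}} (F : StrictFunctor C D) (Γ : List C.carrier) :
    F.obj (fold Γ) = fold (Γ.map F.obj) := by
  induction Γ with
  | nil => exact F.obj_unit
  | cons A Γ ih => exact (F.obj_tensor _ _).trans (congrArg _ ih)

namespace StrictFunctor

theorem ext' {C D : TensorCat.{u}} {F G : StrictFunctor C D} (h : F.toFunctor = G.toFunctor) :
    F = G := by
  cases F; cases G; congr

/-- The identity functor. -/
def id (C : TensorCat.{u}) : StrictFunctor C C where
  toFunctor := 𝟭 C.carrier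
  obj_unit := rfl
  obj_tensor _ _ := rfl
  obj_tens Γ := (congrArg tens (List.map_id Γ)).symm
  map_tensor _ _ := HEq.rfl
  map_associator _ _ _ := HEq.rfl
  map_leftUnitor _ := HEq.rfl
  map_rightUnitor _ := HEq.rfl
  map_bracket Γ := by
    change HEq (bracket Γ).hom (bracket (Γ.map _root_.id)).hom
    rw [List.map_id]

/-- Composition of strict monoidal functors. -/
def comp {C D E : TensorCat.{u}} (F : StrictFunctor C D) (G : StrictFunctor D E) :
    StrictFunctor C E where
  toFunctor := F.toFunctor ⋙ G.toFunctor
  obj_unit := (congrArg G.obj F.obj_unit).trans G.obj_unit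
  obj_tensor A B := (congrArg G.obj (F.obj_tensor A B)).trans (G.obj_tensor _ _)
  obj_tens Γ := (congrArg G.obj (F.obj_tens Γ)).trans
    ((G.obj_tens _).trans (congrArg tens List.map_map))
  map_tensor f g := (functor_map_heq G.toFunctor (F.obj_tensor _ _) (F.obj_tensor _ _)
    (F.map_tensor f g)).trans (G.map_tensor _ _)
  map_associator A B X := (functor_map_heq G.toFunctor
    (by rw [F.obj_tensor, F.obj_tensor]) (by rw [F.obj_tensor, F.obj_tensor])
    (F.map_associator A B X)).trans (G.map_associator _ _ _)
  map_leftUnitor A := (functor_map_heq G.toFunctor (by rw [F.obj_tensor, F.obj_unit]) rfl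
    (F.map_leftUnitor A)).trans (G.map_leftUnitor _)
  map_rightUnitor A := (functor_map_heq G.toFunctor (by rw [F.obj_tensor, F.obj_unit]) rfl
    (F.map_rightUnitor A)).trans (G.map_rightUnitor _)
  map_bracket Γ := (functor_map_heq G.toFunctor (F.obj_tens Γ) (fold_map F Γ)
    (F.map_bracket Γ)).trans ((G.map_bracket _).trans (by
      rw [List.map_map]; rfl))

end StrictFunctor

instance : Category.{u} TensorCat.{u} where
  Hom := StrictFunctor
  id := StrictFunctor.id
  comp := StrictFunctor.comp

namespace SStrictFunctor

theorem ext' {C D : STensorCat.{u}} {F G : SStrictFunctor C D} (h : F.toFunctor = G.toFunctor) :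
    F = G := by
  have h := StrictFunctor.ext' h
  cases F; cases G; congr

/-- The identity functor. -/
def id (C : STensorCat.{u}) : SStrictFunctor C C where
  toStrictFunctor := StrictFunctor.id C.toTensorCat
  map_braiding _ _ := HEq.rfl

/-- Composition of strict symmetric monoidal functors. -/
def comp {C D E : STensorCat.{u}} (F : SStrictFunctor C D) (G : SStrictFunctor D E) :
    SStrictFunctor C E where
  toStrictFunctor := F.toStrictFunctor.comp G.toStrictFunctor
  map_braiding A B := (functor_map_heq G.toFunctor (F.obj_tensor _ _) (F.obj_tensor _ _)
    (F.map_braiding A B)).trans (G.map_braiding _ _)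

end SStrictFunctor

instance : Category.{u} STensorCat.{u} where
  Hom := SStrictFunctor
  id := SStrictFunctor.id
  comp := SStrictFunctor.comp

theorem tens_congr {C : Type u} [Category.{u} C] [MonoidalCategory C] [NaryTensor C]
    {Γ Δ : List C} (h : Γ = Δ) : (tens Γ : C) = tens Δ := congrArg _ h

theorem eqToHom_comp_heq' {C : Type u} [Category.{u} C] {A A' B : C} (h : A' = A) (f : A ⟶ B) :
    HEq (eqToHom h ≫ f) f := by subst h; simp

/-- The underlying signature of a strict functor. -/
def StrictFunctor.toSig {C D : TensorCat.{u}} (F : StrictFunctor C D) :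
    Sig.Fun ⟨C.carrier, fun Γ B => tens Γ ⟶ B⟩ ⟨D.carrier, fun Γ B => tens Γ ⟶ B⟩ :=
  ⟨F.obj, fun f => eqToHom (F.obj_tens _).symm ≫ F.map f⟩

theorem StrictFunctor.toSig_id (C : TensorCat.{u}) : (StrictFunctor.id C).toSig = Sig.Fun.id _ :=
  Sig.Fun.ext' rfl fun _ => (eqToHom_comp_heq' _ _).trans (Args.castDom_heq _ _).symm

theorem StrictFunctor.toSig_comp {C D E : TensorCat.{u}} (F : StrictFunctor C D)
    (G : StrictFunctor D E) : (F.comp G).toSig = F.toSig.comp G.toSig :=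
  Sig.Fun.ext' rfl fun {Γ B} f => by
    refine (eqToHom_comp_heq' _ _).trans (HEq.trans ?_ (Args.castDom_heq _ _).symm)
    refine HEq.trans ?_ (eqToHom_comp_heq' _ _).symm
    exact functor_map_heq G.toFunctor (F.obj_tens Γ) rfl (eqToHom_comp_heq' _ _).symm

/-- The canonical forgetful functor: the sorts are the objects, and the constants from `Γ` to `B` are
the morphisms from the tensor product of `Γ` to `B`. -/
def TensorCat.V : TensorCat.{u} ⥤ Sig.{u} where
  obj C := ⟨C.carrier, fun Γ B => tens Γ ⟶ B⟩
  map F := StrictFunctor.toSig F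
  map_id := StrictFunctor.toSig_id
  map_comp := StrictFunctor.toSig_comp

/-- The canonical forgetful functor: the sorts are the objects, and the constants from `Γ` to `B` are
the morphisms from the tensor product of `Γ` to `B`. -/
def STensorCat.V : STensorCat.{u} ⥤ Sig.{u} where
  obj C := ⟨C.carrier, fun Γ B => tens Γ ⟶ B⟩
  map F := StrictFunctor.toSig (SStrictFunctor.toStrictFunctor F)
  map_id C := StrictFunctor.toSig_id C.toTensorCat
  map_comp F G := StrictFunctor.toSig_comp (SStrictFunctor.toStrictFunctor F)
    (SStrictFunctor.toStrictFunctor G)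

/-! ## The nucleus functors -/

namespace RepMulticat
open Multicat
variable (M : RepMulticat.{u})

/-- The iterated binary tensor product in the nucleus. -/
noncomputable def foldOb (Γ : List M.Ob) : M.Ob := fold (C := M.Nucleus) Γ

/-- The iterated universal arrow `a₁ ⊗ (a₂ ⊗ (⋯ ⊗ ()))`. -/
noncomputable def foldUniv : (Γ : List M.Ob) → M.Hom Γ (M.foldOb Γ)
  | [] => M.univ []
  | A :: Γ => M.ten (M.one A) (foldUniv Γ)

theorem isUniversal_foldUniv (Γ : List M.Ob) : M.IsUniversal (M.foldUniv Γ) := by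
  induction Γ with
  | nil => exact M.univ_universal []
  | cons A Γ ih => exact M.isUniversal_ten (isUniversal_one A) ih

/-- The comparison from the n-ary to the iterated binary tensor product. -/
noncomputable def bracketHom (Γ : List M.Ob) : M.Hom [M.T Γ] (M.foldOb Γ) := M.ext (M.foldUniv Γ)

noncomputable def bracketInv (Γ : List M.Ob) : M.Hom [M.foldOb Γ] (M.T Γ) :=
  (M.isUniversal_foldUniv Γ).desc (M.univ Γ)

theorem bracketInv_hom (Γ : List M.Ob) :
    M.comp (M.bracketInv Γ) (.single (M.bracketHom Γ)) = M.one _ := by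
  refine (M.univ_universal Γ).hom_ext ?_
  rw [M.comp_single, bracketHom, ext_univ, bracketInv, IsUniversal.fac, M.one_comp]

theorem bracketHom_inv (Γ : List M.Ob) :
    M.comp (M.bracketHom Γ) (.single (M.bracketInv Γ)) = M.one _ := by
  refine (M.isUniversal_foldUniv Γ).hom_ext ?_
  rw [M.comp_single, bracketInv, IsUniversal.fac, bracketHom, ext_univ, M.one_comp]

theorem bracketHom_nil : M.bracketHom [] = M.one (M.T []) :=
  (M.univ_universal []).hom_ext ((M.ext_univ _).trans (M.one_comp _).symm)

theorem bracketHom_pair (A B : M.Ob) :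
    M.bracketHom [A, B] = M.tensorHom (M.one A) (M.rightInv B) := rfl

/-- The n-ary tensor product in the nucleus is the representing object of a list. -/
noncomputable instance : NaryTensor M.Nucleus where
  tens Γ := M.T Γ
  bracket Γ := ⟨M.bracketHom Γ, M.bracketInv Γ, M.bracketInv_hom Γ, M.bracketHom_inv Γ⟩
  tens_nil := rfl
  bracket_nil := M.bracketHom_nil
  tens_pair _ _ := rfl
  bracket_pair A B := by
    refine (M.bracketHom_pair A B).trans ?_
    exact (M.comp_single_one _).symm

/-- The nucleus of a representable multicategory, as a monoidal category. -/
noncomputable def nucleus : TensorCat.{u} := ⟨M.Nucleus⟩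

end RepMulticat

/-- The nucleus of a symmetric representable multicategory, as a symmetric monoidal category. -/
noncomputable def SRepMulticat.nucleus (M : SRepMulticat.{u}) : STensorCat.{u} :=
  { M.toRepMulticat.nucleus with
    sym := inferInstanceAs (SymmetricCategory M.Nucleus) }

theorem MultiFunctor.map_pair {M M' : Multicat.{u}} (F : MultiFunctor M M') {Γ Δ : List M.Ob}
    {A B : M.Ob} (x : M.Hom Γ A) (y : M.Hom Δ B) :
    HEq ((Args.pair x y).map F.ob F.map) (Args.pair (F.map x) (F.map y)) :=
  Args.cons_congr rfl rfl rfl rfl HEq.rfl HEq.rfl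

theorem MultiFunctor.map_single {M M' : Multicat.{u}} (F : MultiFunctor M M') {Γ : List M.Ob}
    {A : M.Ob} (x : M.Hom Γ A) :
    (Args.single x).map F.ob F.map = Args.single (F.map x) := rfl

namespace RepFunctor
open Multicat RepMulticat
variable {M M' : RepMulticat.{u}} (F : RepFunctor M M')

theorem map_ten {Γ Δ : List M.Ob} {A B : M.Ob} (x : M.Hom Γ A) (y : M.Hom Δ B) :
    HEq (F.map (M.ten x y)) (M'.ten (F.map x) (F.map y)) := by
  rw [ten, F.map_comp]
  exact M'.comp_congr List.map_append rfl (F.ob_T _) (F.map_univ _) (F.map_pair x y)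

theorem ten_congr (M : RepMulticat.{u}) {Γ Γ' Δ Δ' : List M.Ob} {A A' B B' : M.Ob} {x : M.Hom Γ A}
    {x' : M.Hom Γ' A'} {y : M.Hom Δ B} {y' : M.Hom Δ' B'} (hΓ : Γ = Γ') (hΔ : Δ = Δ') (hA : A = A')
    (hB : B = B') (hx : HEq x x') (hy : HEq y y') : HEq (M.ten x y) (M.ten x' y') := by
  subst hΓ hΔ hA hB; obtain rfl := eq_of_heq hx; obtain rfl := eq_of_heq hy; rfl

/-- Maps out of a universal multimap agree as soon as they agree on it. -/
theorem universal_heq {M : Multicat.{u}} {Γ Γ' : List M.Ob} {R R' B B' : M.Ob} {v : M.Hom Γ R}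
    {v' : M.Hom Γ' R'} {e : M.Hom [R] B} {e' : M.Hom [R'] B'} (hΓ : Γ = Γ') (hR : R = R')
    (hB : B = B') (hv : HEq v v') (hv' : M.IsUniversal v')
    (h : HEq (M.comp e (.single v)) (M.comp e' (.single v'))) : HEq e e' := by
  subst hΓ hR hB; obtain rfl := eq_of_heq hv
  exact heq_of_eq (hv'.hom_ext (eq_of_heq h))

theorem map_heq_of_universal {Γ : List M.Ob} {Γ' : List M'.Ob} {R B : M.Ob} {R' B' : M'.Ob}
    {v : M.Hom Γ R} {v' : M'.Hom Γ' R'} {e : M.Hom [R] B} {e' : M'.Hom [R'] B'} {w : M.Hom Γ B}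
    {w' : M'.Hom Γ' B'} (hΓ : Γ.map F.ob = Γ') (hR : F.ob R = R') (hB : F.ob B = B')
    (hv : HEq (F.map v) v') (hv' : M'.IsUniversal v') (he : M.comp e (.single v) = w)
    (he' : M'.comp e' (.single v') = w') (h : HEq (F.map w) w') : HEq (F.map e) e' := by
  refine universal_heq hΓ hR hB hv hv' ?_
  rw [he', ← F.map_single, ← F.map_comp, he]
  exact h

theorem map_one_heq (A : M.Ob) : HEq (F.map (M.one A)) (M'.one (F.ob A)) :=
  heq_of_eq (F.map_one A)

theorem map_ten₃ (A B C : M.Ob) :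
    HEq (F.map (M.ten₃ A B C)) (M'.ten₃ (F.ob A) (F.ob B) (F.ob C)) :=
  (F.map_ten (M.univ [A, B]) (M.one C)).trans
    (ten_congr M' rfl rfl (F.ob_T _) rfl (F.map_univ _) (F.map_one_heq C))

theorem map_ten₃' (A B C : M.Ob) :
    HEq (F.map (M.ten₃' A B C)) (M'.ten₃' (F.ob A) (F.ob B) (F.ob C)) :=
  (F.map_ten (M.one A) (M.univ [B, C])).trans
    (ten_congr M' rfl rfl rfl (F.ob_T _) (F.map_one_heq A) (F.map_univ _))

theorem ob_T_T (A B C : M.Ob) :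
    F.ob (M.T [M.T [A, B], C]) = M'.T [M'.T [F.ob A, F.ob B], F.ob C] :=
  (F.ob_T _).trans (congrArg (fun x => M'.T [x, F.ob C]) (F.ob_T _))

theorem ob_T_T' (A B C : M.Ob) :
    F.ob (M.T [A, M.T [B, C]]) = M'.T [F.ob A, M'.T [F.ob B, F.ob C]] :=
  (F.ob_T _).trans (congrArg (fun x => M'.T [F.ob A, x]) (F.ob_T _))

theorem map_tensorHom {A A' B B' : M.Ob} (f : M.Hom [A] A') (g : M.Hom [B] B') :
    HEq (F.map (M.tensorHom f g)) (M'.tensorHom (F.map f) (F.map g)) :=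
  F.map_heq_of_universal rfl (F.ob_T _) (F.ob_T _) (F.map_univ _) (M'.univ_universal _)
    (M.tensorHom_univ f g) (M'.tensorHom_univ (F.map f) (F.map g)) (F.map_ten f g)

theorem map_assocHom (A B C : M.Ob) :
    HEq (F.map (M.assocHom A B C)) (M'.assocHom (F.ob A) (F.ob B) (F.ob C)) :=
  F.map_heq_of_universal rfl (F.ob_T_T A B C) (F.ob_T_T' A B C) (F.map_ten₃ A B C)
    (M'.isUniversal_ten₃ _ _ _) (IsUniversal.fac _ _) (IsUniversal.fac _ _) (F.map_ten₃' A B C)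

theorem map_leftHom (A : M.Ob) : HEq (F.map (M.leftHom A)) (M'.leftHom (F.ob A)) :=
  F.map_heq_of_universal rfl
    ((F.ob_T _).trans (congrArg (fun x => M'.T [x, F.ob A]) (F.ob_T _))) rfl
    ((F.map_ten (M.univ []) (M.one A)).trans
      (ten_congr M' rfl rfl (F.ob_T _) rfl (F.map_univ _) (F.map_one_heq A)))
    (M'.isUniversal_leftInv _) (IsUniversal.fac _ _) (IsUniversal.fac _ _) (F.map_one_heq A)

theorem map_rightHom (A : M.Ob) : HEq (F.map (M.rightHom A)) (M'.rightHom (F.ob A)) :=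
  F.map_heq_of_universal rfl
    ((F.ob_T _).trans (congrArg (fun x => M'.T [F.ob A, x]) (F.ob_T _))) rfl
    ((F.map_ten (M.one A) (M.univ [])).trans
      (ten_congr M' rfl rfl rfl (F.ob_T _) (F.map_one_heq A) (F.map_univ _)))
    (M'.isUniversal_rightInv _) (IsUniversal.fac _ _) (IsUniversal.fac _ _) (F.map_one_heq A)

theorem ob_foldOb : ∀ Γ : List M.Ob, F.ob (M.foldOb Γ) = M'.foldOb (Γ.map F.ob)
  | [] => F.ob_T []
  | A :: Γ => (F.ob_T _).trans (congrArg (fun x => M'.T [F.ob A, x]) (ob_foldOb Γ))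

theorem map_foldUniv : ∀ Γ : List M.Ob,
    HEq (F.map (M.foldUniv Γ)) (M'.foldUniv (Γ.map F.ob))
  | [] => F.map_univ []
  | A :: Γ => (F.map_ten (M.one A) (M.foldUniv Γ)).trans
      (ten_congr M' rfl rfl rfl (F.ob_foldOb Γ) (F.map_one_heq A) (map_foldUniv Γ))

theorem map_bracketHom (Γ : List M.Ob) :
    HEq (F.map (M.bracketHom Γ)) (M'.bracketHom (Γ.map F.ob)) :=
  F.map_heq_of_universal rfl (F.ob_T Γ) (F.ob_foldOb Γ) (F.map_univ Γ)
    (M'.univ_universal _) (M.ext_univ _) (M'.ext_univ _) (F.map_foldUniv Γ)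

/-- The restriction of a representable multicategory functor to unary multimaps. -/
def nucleus : StrictFunctor M.nucleus M'.nucleus where
  obj := F.ob
  map f := F.map f
  map_id A := F.map_one A
  map_comp f g := F.map_comp _ _
  obj_unit := F.ob_T []
  obj_tensor A B := F.ob_T [A, B]
  obj_tens Γ := F.ob_T Γ
  map_tensor f g := F.map_tensorHom f g
  map_associator := F.map_assocHom
  map_leftUnitor := F.map_leftHom
  map_rightUnitor := F.map_rightHom
  map_bracket := F.map_bracketHom

end RepFunctor

namespace SRepFunctor
open RepMulticat SRepMulticat
variable {M M' : SRepMulticat.{u}} (F : SRepFunctor M M')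

theorem map_braid (A B : M.Ob) : HEq (F.map (M.braid A B)) (M'.braid (F.ob A) (F.ob B)) :=
  F.map_heq_of_universal rfl (F.ob_T _) (F.ob_T _) (F.map_univ _) (M'.univ_universal _)
    (M.braid_univ A B) (M'.braid_univ _ _)
    ((heq_of_eq (F.map_act (M.swapPerm A B) (M.univ [B, A]))).trans
      (M'.act_congr _ _ rfl rfl (F.ob_T _) (fun _ => rfl) (F.map_univ _)))

/-- The restriction of a functor to unary multimaps, as a strict symmetric monoidal functor. -/
def nucleus : SStrictFunctor M.nucleus M'.nucleus where
  toStrictFunctor := F.toRepFunctor.nucleus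
  map_braiding := F.map_braid

end SRepFunctor

/-- The nucleus functor from representable multicategories to monoidal categories. -/
noncomputable def RepMulticat.N : RepMulticat.{u} ⥤ TensorCat.{u} where
  obj M := M.nucleus
  map F := RepFunctor.nucleus F
  map_id M := StrictFunctor.ext' rfl
  map_comp F G := StrictFunctor.ext' rfl

/-- The nucleus functor from symmetric representable multicategories to symmetric monoidal
categories. -/
noncomputable def SRepMulticat.N : SRepMulticat.{u} ⥤ STensorCat.{u} where
  obj M := M.nucleus
  map F := SRepFunctor.nucleus F
  map_id M := SStrictFunctor.ext' rfl
  map_comp F G := SStrictFunctor.ext' rfl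

/-- The comparison of the underlying signatures of `M` and of its nucleus: it is the identity on
objects and sends a multimap `t : Γ → B` to its extension `T Γ → B`. -/
noncomputable def RepMulticat.kappa (M : RepMulticat.{u}) :
    RepMulticat.U.obj M ⟶ TensorCat.V.obj (RepMulticat.N.obj M) :=
  Sig.Fun.mk _root_.id fun {Γ _} t =>
    Args.castDom (H := fun Γ B => M.Hom [M.T Γ] B) (List.map_id Γ).symm (M.ext t)


/-! ## Universality in context -/

namespace Multicat
variable {M : Multicat.{u}}

/-- Bijectivity of precomposition with `v` inside an arbitrary context. -/
def IsStrong (M : Multicat.{u}) {Γ : List M.Ob} {R : M.Ob} (v : M.Hom Γ R) : Prop :=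
  ∀ (Λ Ψ : List M.Ob) (B : M.Ob) (t : M.Hom (Λ ++ (Γ ++ Ψ)) B),
    ∃! e : M.Hom (Λ ++ ([R] ++ Ψ)) B,
      M.comp e (.app (.ones M.one Λ) (.app (.single v) (.ones M.one Ψ))) = t

theorem IsStrong.isUniversal {Γ : List M.Ob} {R : M.Ob} {v : M.Hom Γ R} (hv : M.IsStrong v) :
    M.IsUniversal v := by
  intro B t
  obtain ⟨e, he, hu⟩ := hv [] [] B (Args.castDom (List.append_nil Γ).symm t)
  have key : ∀ e : M.Hom [R] B, M.comp e (.app (.ones M.one []) (.app (.single v)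
      (.ones M.one []))) = Args.castDom (List.append_nil Γ).symm t ↔
      M.comp e (.single v) = t := by
    intro e
    have : HEq (M.comp e (.app (.ones M.one []) (.app (.single v) (.ones M.one []))))
        (M.comp e (.single v)) :=
      M.comp_congr (List.append_nil _) rfl rfl HEq.rfl (Args.app_nil _)
    constructor
    · intro h
      exact eq_of_heq (this.symm.trans ((heq_of_eq h).trans (Args.castDom_heq _ _)))
    · intro h
      exact eq_of_heq (this.trans ((heq_of_eq h).trans (Args.castDom_heq _ _).symm))
  exact ⟨e, (key e).1 he, fun e' he' => hu e' ((key e').2 he')⟩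

theorem IsStrong.right {Γ : List M.Ob} {R : M.Ob} {v : M.Hom Γ R} (hv : M.IsStrong v)
    (Λ : List M.Ob) (B : M.Ob) (t : M.Hom (Λ ++ Γ) B) :
    ∃! e : M.Hom (Λ ++ [R]) B, M.comp e (.app (.ones M.one Λ) (.single v)) = t := by
  have h0 : Λ ++ Γ = Λ ++ (Γ ++ []) := by rw [List.append_nil]
  obtain ⟨e, he, hu⟩ := hv Λ [] B (Args.castDom h0 t)
  have key : ∀ e : M.Hom (Λ ++ [R]) B, M.comp e (.app (.ones M.one Λ) (.app (.single v)
      (.ones M.one []))) = Args.castDom h0 t ↔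
      M.comp e (.app (.ones M.one Λ) (.single v)) = t := by
    intro e
    have h1 : ∀ {Δ : List M.Ob} (a : Args M.Hom Δ [R]) (a' : Args M.Hom Γ [R]), Γ = Δ → HEq a a' →
        HEq (Args.app (.ones M.one Λ) a) (Args.app (.ones M.one Λ) a') := by
      intro Δ a a' h hh; subst h; obtain rfl := eq_of_heq hh; rfl
    have : HEq (M.comp e (.app (.ones M.one Λ) (.app (.single v) (.ones M.one []))))
        (M.comp e (.app (.ones M.one Λ) (.single v))) :=
      M.comp_congr h0.symm rfl rfl HEq.rfl
        (h1 _ _ (List.append_nil _).symm (Args.app_nil (Args.single v)))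
    constructor
    · intro h
      exact eq_of_heq (this.symm.trans ((heq_of_eq h).trans (Args.castDom_heq _ _)))
    · intro h
      exact eq_of_heq (this.trans ((heq_of_eq h).trans (Args.castDom_heq _ _).symm))
  exact ⟨e, (key e).1 he, fun e' he' => hu e' ((key e').2 he')⟩

theorem IsStrong.comp_pair {Γ Δ : List M.Ob} {R S Q : M.Ob} {w : M.Hom [R, S] Q}
    {v₁ : M.Hom Γ R} {v₂ : M.Hom Δ S} (hw : M.IsStrong w) (h₁ : M.IsStrong v₁)
    (h₂ : M.IsStrong v₂) : M.IsUniversal (M.comp w (.pair v₁ v₂)) := by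
  have key : ∀ {B : M.Ob} (f : M.Hom [R, S] B), M.comp f (.pair v₁ v₂) =
      M.comp (M.comp f (.pair v₁ (M.one S))) (.app (.ones M.one Γ) (.single v₂)) := by
    intro B f
    rw [Multicat.comp_pair, M.comp_one, M.one_comp]
  intro B t
  obtain ⟨e₂, he₂, hu₂⟩ := h₂.right Γ B t
  obtain ⟨e₁, he₁, hu₁⟩ := h₁ [] [S] B e₂
  obtain ⟨e₀, he₀, hu₀⟩ := hw.isUniversal B e₁
  refine ⟨e₀, ?_, fun e he => hu₀ _ (hu₁ _ (hu₂ _ ?_))⟩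
  · change M.comp e₀ _ = t
    rw [← M.comp_single, he₀, key]
    exact (congrArg (fun x => M.comp x _) he₁).trans he₂
  · refine Eq.trans ?_ he
    change _ = M.comp e _
    rw [← M.comp_single, key]
    rfl

end Multicat

namespace Args
variable {O : Type u} {H : List O → O → Type u}

theorem ones_app (one : ∀ A, H [A] A) (As Bs : List O) :
    ones one (As ++ Bs) = app (ones one As) (ones one Bs) := by
  induction As with
  | nil => rfl
  | cons A As ih =>
    change cons _ (ones one (As ++ Bs)) _ = _
    rw [ih]; rfl

theorem exists_single {Γ : List O} {A : O} (fs : Args H Γ [A]) : ∃ f, fs = single f := by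
  cases fs with
  | cons f fs h =>
    cases fs
    obtain rfl := h.trans (List.append_nil _)
    exact ⟨f, rfl⟩

variable {comp : ∀ {Γ As : List O} {B : O}, H As B → Args H Γ As → H Γ B} {one : ∀ A, H [A] A}

theorem ones_bind (h : ∀ {Γ : List O} {B : O} (f : H Γ B), comp (one B) (single f) = f)
    {Γ As : List O} (fs : Args H Γ As) : bind comp (ones one As) fs = fs := by
  induction fs with
  | nil => rfl
  | cons f fs e ih =>
    subst e
    rw [ones, bind_cons comp _ _ _ (cons f fs rfl) (single f) fs rfl HEq.rfl, h, ih]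

theorem bind_ones (h : ∀ {Γ : List O} {B : O} (f : H Γ B), comp f (ones one Γ) = f)
    {Γ As : List O} (fs : Args H Γ As) : bind comp fs (ones one Γ) = fs := by
  induction fs with
  | nil => rfl
  | cons f fs e ih =>
    subst e
    rw [bind_cons comp _ _ _ _ (ones one _) (ones one _) rfl (heq_of_eq (ones_app _ _ _)), h, ih]

variable {H' : List O → O → Type u}

/-- Apply a function to every multimap of a list. -/
def mapHom (φ : ∀ {Γ A}, H Γ A → H' Γ A) : {Γ As : List O} → Args H Γ As → Args H' Γ As
  | _, _, nil => nil
  | _, _, cons f fs h => cons (φ f) (mapHom φ fs) h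

theorem mapHom_app (φ : ∀ {Γ A}, H Γ A → H' Γ A) {Γ Δ As Bs : List O} (a : Args H Γ As)
    (b : Args H Δ Bs) : mapHom φ (app a b) = app (mapHom φ a) (mapHom φ b) := by
  induction a with
  | nil => rfl
  | cons f fs h ih => simp only [app, mapHom, ih]

theorem mapHom_bind (φ : ∀ {Γ A}, H Γ A → H' Γ A)
    {comp' : ∀ {Γ As : List O} {B : O}, H' As B → Args H' Γ As → H' Γ B}
    (h : ∀ {Γ As : List O} {B : O} (f : H As B) (gs : Args H Γ As),
      comp' (φ f) (mapHom φ gs) = φ (comp f gs))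
    {Θ Γ As : List O} (fs : Args H Γ As) (gs : Args H Θ Γ) :
    bind comp' (mapHom φ fs) (mapHom φ gs) = mapHom φ (bind comp fs gs) := by
  induction fs generalizing Θ with
  | nil => rfl
  | cons f fs e ih =>
    subst e
    obtain ⟨Θ₁, Θ₂, a, b, rfl, hh⟩ := app_cases _ gs
    obtain rfl := eq_of_heq hh
    rw [bind_cons comp f fs rfl _ a b rfl HEq.rfl, mapHom, mapHom,
      bind_cons comp' _ _ _ _ (mapHom φ a) (mapHom φ b) rfl (heq_of_eq (mapHom_app φ a b)), h, ih]

theorem mapHom_ones (φ : ∀ {Γ A}, H Γ A → H' Γ A) (one : ∀ A, H [A] A) : ∀ As : List O,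
    mapHom φ (ones one As) = ones (fun A => φ (one A)) As
  | [] => rfl
  | A :: As => by simp only [ones, mapHom, mapHom_ones φ one As]

/-- A list of multimaps cut into three consecutive parts. -/
structure Split₃ (H : List O → O → Type u) (Θ As Bs Cs : List O) where
  Γ₁ : List O
  Γ₂ : List O
  Γ₃ : List O
  fst : Args H Γ₁ As
  snd : Args H Γ₂ Bs
  trd : Args H Γ₃ Cs
  eq : Θ = Γ₁ ++ (Γ₂ ++ Γ₃)

def Split.join {Θ Δ As Bs Cs : List O} (Γ : List O) (a : Args H Γ As) (h : Θ = Γ ++ Δ)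
    (q : Split H Δ Bs Cs) : Split₃ H Θ As Bs Cs :=
  ⟨Γ, q.Γ, q.Δ, a, q.fst, q.snd, h.trans (congrArg (Γ ++ ·) q.eq)⟩

def Split.cut {Θ As Cs : List O} (Bs : List O) (p : Split H Θ As (Bs ++ Cs)) :
    Split₃ H Θ As Bs Cs :=
  Split.join p.Γ p.fst p.eq (split Bs p.snd)

def split₃ {Θ Cs : List O} (As Bs : List O) (fs : Args H Θ (As ++ (Bs ++ Cs))) :
    Split₃ H Θ As Bs Cs :=
  (split As fs).cut Bs

theorem split₃_app {Γ₁ Γ₂ Γ₃ As Bs Cs : List O} (a : Args H Γ₁ As) (b : Args H Γ₂ Bs)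
    (c : Args H Γ₃ Cs) : split₃ As Bs (app a (app b c)) = ⟨Γ₁, Γ₂, Γ₃, a, b, c, rfl⟩ := by
  rw [split₃, split_app, Split.cut, split_app]
  rfl

end Args


/-! ## Types -/

/-- The types over a set of sorts: the sorts, and an n-ary tensor type for every list of types. -/
inductive Ty (O : Type u) : Type u
  | base (a : O) : Ty O
  | tens (As : List (Ty O)) : Ty O

/-! ## Calculi with a tensor type former -/

/-- Terms-in-context of a calculus with tensor types, before any equations between them are imposed.
The terms form a multicategory under substitution; `tens As` is the term `x₁ ⊗ ⋯ ⊗ xₙ`, and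
`letT Λ Ψ As s t` is `let (x₁, …, xₙ) be s in t`, in the context `Λ, Δ, Ψ`, where `s` lives in the
context `Δ` and `t` in `Λ, x₁ : A₁, …, xₙ : Aₙ, Ψ`. Substitution goes through `letT`. For a calculus
with the exchange rule, `exch` is its action on terms. -/
structure Calculus extends Multicat.{u} where
  T : List Ob → Ob
  tens : ∀ As, Hom As (T As)
  letT : ∀ {Δ : List Ob} {B : Ob} (Λ Ψ As : List Ob),
    Hom Δ (T As) → Hom (Λ ++ (As ++ Ψ)) B → Hom (Λ ++ (Δ ++ Ψ)) B
  letT_comp : ∀ {Θ₁ Θ₂ Θ₃ Δ : List Ob} {B : Ob} (Λ Ψ As : List Ob) (s : Hom Δ (T As))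
    (t : Hom (Λ ++ (As ++ Ψ)) B) (σ₁ : Args Hom Θ₁ Λ) (σ₂ : Args Hom Θ₂ Δ) (σ₃ : Args Hom Θ₃ Ψ),
    comp (letT Λ Ψ As s t) (.app σ₁ (.app σ₂ σ₃)) =
      letT Θ₁ Θ₃ As (comp s σ₂) (comp t (.app σ₁ (.app (.ones one As) σ₃)))
  exch : Option toMulticat.Symmetry

namespace Calculus

/-! The equational theory: the congruence on terms generated by
`let (x₁, …, xₙ) be t₁ ⊗ ⋯ ⊗ tₙ in t = t[t₁/x₁, …, tₙ/xₙ]` and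
`let (x₁, …, xₙ) be s in t[x₁ ⊗ ⋯ ⊗ xₙ/p] = t[s/p]`. -/

mutual
inductive Eqv (K : Calculus.{u}) : {Γ : List K.Ob} → {B : K.Ob} → K.Hom Γ B → K.Hom Γ B → Prop
  | refl {Γ : List K.Ob} {B : K.Ob} (t : K.Hom Γ B) : Eqv K t t
  | symm {Γ : List K.Ob} {B : K.Ob} {t t' : K.Hom Γ B} : Eqv K t t' → Eqv K t' t
  | trans {Γ : List K.Ob} {B : K.Ob} {t t' t'' : K.Hom Γ B} :
      Eqv K t t' → Eqv K t' t'' → Eqv K t t''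
  | exch {Γ Γ' : List K.Ob} {B : K.Ob} {t t' : K.Hom Γ B} (Y : K.Symmetry) (h : Y ∈ K.exch)
      (p : CtxPerm Γ Γ') : Eqv K t t' → Eqv K (Y.act p t) (Y.act p t')
  | subst {Γ Δ : List K.Ob} {B : K.Ob} {t t' : K.Hom Γ B} {σ σ' : Args K.Hom Δ Γ} :
      Eqv K t t' → Eqvs K σ σ' → Eqv K (K.comp t σ) (K.comp t' σ')
  | letT {Δ : List K.Ob} {B : K.Ob} {Λ Ψ As : List K.Ob} {s s' : K.Hom Δ (K.T As)}
      {t t' : K.Hom (Λ ++ (As ++ Ψ)) B} :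
      Eqv K s s' → Eqv K t t' → Eqv K (K.letT Λ Ψ As s t) (K.letT Λ Ψ As s' t')
  | beta {Δ : List K.Ob} {B : K.Ob} (Λ Ψ As : List K.Ob) (ts : Args K.Hom Δ As)
      (t : K.Hom (Λ ++ (As ++ Ψ)) B) :
      Eqv K (K.letT Λ Ψ As (K.comp (K.tens As) ts) t)
        (K.comp t (.app (.ones K.one Λ) (.app ts (.ones K.one Ψ))))
  | eta {Δ : List K.Ob} {B : K.Ob} (Λ Ψ As : List K.Ob) (s : K.Hom Δ (K.T As))
      (t : K.Hom (Λ ++ ([K.T As] ++ Ψ)) B) :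
      Eqv K (K.letT Λ Ψ As s
          (K.comp t (.app (.ones K.one Λ) (.app (.single (K.tens As)) (.ones K.one Ψ)))))
        (K.comp t (.app (.ones K.one Λ) (.app (.single s) (.ones K.one Ψ))))
inductive Eqvs (K : Calculus.{u}) :
    {Γ As : List K.Ob} → Args K.Hom Γ As → Args K.Hom Γ As → Prop
  | nil : Eqvs K .nil .nil
  | cons {Γ Δ Θ As : List K.Ob} {A : K.Ob} {t t' : K.Hom Γ A}
      {ts ts' : Args K.Hom Δ As} (h : Θ = Γ ++ Δ) :
      Eqv K t t' → Eqvs K ts ts' → Eqvs K (.cons t ts h) (.cons t' ts' h)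
end

variable (K : Calculus.{u})

instance setoid (Γ : List K.Ob) (B : K.Ob) : Setoid (K.Hom Γ B) where
  r := K.Eqv
  iseqv := ⟨.refl, .symm, .trans⟩

/-- Terms-in-context modulo the equational theory. -/
def SynHom (Γ : List K.Ob) (B : K.Ob) : Type u := Quotient (K.setoid Γ B)

variable {K}

namespace SynHom

/-- The class of a term. -/
def mk {Γ : List K.Ob} {B : K.Ob} (t : K.Hom Γ B) : K.SynHom Γ B := Quotient.mk _ t

/-- A representing term. -/
noncomputable def rep {Γ : List K.Ob} {B : K.Ob} (q : K.SynHom Γ B) : K.Hom Γ B := Quotient.out q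

/-- Composition is substitution. -/
noncomputable def comp {Γ As : List K.Ob} {B : K.Ob} (q : K.SynHom As B)
    (qs : Args K.SynHom Γ As) : K.SynHom Γ B :=
  mk (K.comp q.rep (qs.mapHom rep))

theorem mk_rep {Γ : List K.Ob} {B : K.Ob} (q : K.SynHom Γ B) : mk q.rep = q :=
  Quotient.out_eq q

theorem mapHom_mk_rep {Γ As : List K.Ob} (qs : Args K.SynHom Γ As) :
    (qs.mapHom rep).mapHom mk = qs := by
  induction qs with
  | nil => rfl
  | cons q qs h ih => simp only [Args.mapHom, mk_rep, ih]

theorem eqvs_rep {Γ As : List K.Ob} (ts : Args K.Hom Γ As) :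
    K.Eqvs ((ts.mapHom mk).mapHom rep) ts := by
  induction ts with
  | nil => exact .nil
  | cons t ts h ih => exact .cons h (Quotient.mk_out t) ih

theorem comp_mk {Γ As : List K.Ob} {B : K.Ob} (t : K.Hom As B) (ts : Args K.Hom Γ As) :
    comp (mk t) (ts.mapHom mk) = mk (K.comp t ts) :=
  Quotient.sound (Eqv.subst (Quotient.mk_out t) (eqvs_rep ts))

theorem one_comp {Γ : List K.Ob} {B : K.Ob} (f : K.SynHom Γ B) :
    comp (mk (K.one B)) (.single f) = f := by
  induction f using Quotient.inductionOn with
  | h t => exact (comp_mk (K.one B) (.single t)).trans (congrArg _ (K.one_comp t))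

theorem comp_one {Γ : List K.Ob} {B : K.Ob} (f : K.SynHom Γ B) :
    comp f (.ones (fun A => mk (K.one A)) Γ) = f := by
  induction f using Quotient.inductionOn with
  | h t =>
    have := comp_mk t (.ones K.one _)
    rw [K.comp_one, Args.mapHom_ones] at this
    exact this

theorem assoc {Θ Γ As : List K.Ob} {B : K.Ob} (f : K.SynHom As B) (gs : Args K.SynHom Γ As)
    (hs : Args K.SynHom Θ Γ) : comp (comp f gs) hs = comp f (gs.bind comp hs) := by
  induction f using Quotient.inductionOn with
  | h t =>
    rw [← mapHom_mk_rep gs, ← mapHom_mk_rep hs, Args.mapHom_bind (comp := K.comp) mk comp_mk]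
    refine Eq.trans ?_ (comp_mk _ _).symm
    rw [← K.assoc]
    refine Eq.trans ?_ (comp_mk _ _)
    exact congrArg (fun x => comp x _) (comp_mk _ _)

/-- Representatives can be prescribed componentwise. -/
theorem exists_rep {Γ As : List K.Ob} (qs : Args K.SynHom Γ As)
    (x : ∀ i, K.Hom (qs.dom i) (As.get i)) (hx : ∀ i, mk (x i) = qs.get i) :
    ∃ ts : Args K.Hom Γ As, ts.mapHom mk = qs ∧ (∀ i, ts.dom i = qs.dom i) ∧
      (∀ i, HEq (ts.get i) (x i)) ∧ ∀ i, ts.offset i = qs.offset i := by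
  induction qs with
  | nil => exact ⟨.nil, rfl, fun i => i.elim0, fun i => i.elim0, fun i => i.elim0⟩
  | cons q qs h ih =>
    obtain ⟨ts, h₁, h₂, h₃, h₄⟩ := ih (fun i => x i.succ) (fun i => hx i.succ)
    refine ⟨.cons (x ⟨0, Nat.succ_pos _⟩) ts h, ?_, ?_, ?_, ?_⟩
    · refine (congrArg (fun y => Args.cons (mk (x ⟨0, Nat.succ_pos _⟩)) y h) h₁).trans ?_
      exact congrArg (fun y => Args.cons y qs h) (hx ⟨0, Nat.succ_pos _⟩)
    · rintro ⟨_ | i, hi⟩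
      · rfl
      · exact h₂ ⟨i, _⟩
    · rintro ⟨_ | i, hi⟩
      · exact HEq.rfl
      · exact h₃ ⟨i, _⟩
    · rintro ⟨_ | i, hi⟩
      · rfl
      · exact congrArg (_ + ·) (h₄ ⟨i, _⟩)

end SynHom

variable (K)

/-- The syntactic multicategory of a calculus. -/
noncomputable def synMulticat : Multicat.{u} where
  Ob := K.Ob
  Hom := K.SynHom
  one A := .mk (K.one A)
  comp := SynHom.comp
  one_comp := SynHom.one_comp
  comp_one := SynHom.comp_one
  assoc := SynHom.assoc

variable {K}

theorem strong_aux {Γ As : List K.Ob} (Λ Ψ : List K.Ob) (t : Args K.Hom Γ As) :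
    (Args.app (Args.ones K.synMulticat.one Λ) (.app (t.mapHom SynHom.mk)
      (Args.ones K.synMulticat.one Ψ)) : Args K.SynHom _ _) =
    (Args.app (.ones K.one Λ) (.app t (.ones K.one Ψ))).mapHom SynHom.mk := by
  rw [Args.mapHom_app, Args.mapHom_app, Args.mapHom_ones, Args.mapHom_ones]
  rfl

theorem strong_exists (Λ Ψ As : List K.Ob) {B : K.Ob} (t : K.Hom (Λ ++ (As ++ Ψ)) B) :
    K.Eqv (K.comp (K.letT Λ Ψ As (K.one _) t) (.app (.ones K.one Λ)
      (.app (.single (K.tens As)) (.ones K.one Ψ)))) t := by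
  rw [K.letT_comp, ← Args.ones_app, ← Args.ones_app, K.comp_one, K.one_comp]
  have h := Eqv.beta Λ Ψ As (.ones K.one As) t
  rwa [← Args.ones_app, ← Args.ones_app, K.comp_one, K.comp_one] at h

theorem strong_unique (Λ Ψ As : List K.Ob) {B : K.Ob} (t : K.Hom (Λ ++ (As ++ Ψ)) B)
    (e : K.Hom (Λ ++ ([K.T As] ++ Ψ)) B) (he : K.Eqv (K.comp e (.app (.ones K.one Λ)
      (.app (.single (K.tens As)) (.ones K.one Ψ)))) t) :
    K.Eqv e (K.letT Λ Ψ As (K.one _) t) := by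
  have h₁ := Eqv.eta Λ Ψ As (K.one _) e
  have h₂ : K.comp e (.app (.ones K.one Λ) (.app (.single (K.one (K.T As))) (.ones K.one Ψ))) =
      e := by
    have : (Args.single (K.one (K.T As)) : Args K.Hom _ _) = .ones K.one [K.T As] := rfl
    rw [this, ← Args.ones_app, ← Args.ones_app, K.comp_one]
  rw [h₂] at h₁
  exact h₁.symm.trans (.letT (.refl _) he)

theorem syn_strong (As : List K.Ob) :
    K.synMulticat.IsStrong (Γ := As) (R := K.T As) (SynHom.mk (K.tens As)) := by
  intro Λ Ψ B q
  induction q using Quotient.inductionOn with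
  | h t =>
    have hv := strong_aux Λ Ψ (.single (K.tens As))
    refine ⟨SynHom.mk (K.letT Λ Ψ As (K.one _) t), ?_, fun e => ?_⟩
    · refine (congrArg (SynHom.comp _) hv).trans ((SynHom.comp_mk _ _).trans ?_)
      exact Quotient.sound (strong_exists Λ Ψ As t)
    · induction e using Quotient.inductionOn with
      | h e =>
        intro he
        have he := ((SynHom.comp_mk _ _).symm.trans (congrArg (SynHom.comp (SynHom.mk e)) hv).symm).trans he
        exact Quotient.sound (strong_unique Λ Ψ As t e (Quotient.exact he))

variable (K)

/-- The syntactic multicategory with its representable structure, given by tensor types. -/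
noncomputable def syn : RepMulticat.{u} where
  toMulticat := K.synMulticat
  T := K.T
  univ As := .mk (K.tens As)
  univ_universal As := (syn_strong As).isUniversal
  comp_universal Γ Δ := Multicat.IsStrong.comp_pair (syn_strong _) (syn_strong _) (syn_strong _)

variable {K}

theorem comp_act_aux {M : Multicat.{u}} (Y : M.Symmetry) {As As' Γ Γ' : List M.Ob} {B : M.Ob}
    (f : M.Hom As B) (gs : Args M.Hom Γ As) (gs' : Args M.Hom Γ' As') (p : CtxPerm As As')
    (q : CtxPerm Γ Γ') (d : Fin As.length → List M.Ob) (hd : ∀ i, gs.dom i = d i)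
    (d' : Fin As'.length → List M.Ob) (hd' : ∀ i, gs'.dom i = d' i)
    (x : ∀ i, M.Hom (d i) (As.get i)) (hx : ∀ i, HEq (gs.get i) (x i))
    (x' : ∀ i, M.Hom (d' i) (As'.get i)) (hx' : ∀ i, HEq (gs'.get i) (x' i))
    (τ : ∀ i, CtxPerm (d (p.σ i)) (d' i)) (h : ∀ i, HEq (x' i) (Y.act (τ i) (x (p.σ i))))
    (hq : ∀ i (j : Fin (d' i).length) (k : Fin Γ'.length), (k : ℕ) = gs'.offset i + j →
      (q.σ k : ℕ) = gs.offset (p.σ i) + (τ i).σ j) :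
    M.comp (Y.act p f) gs' = Y.act q (M.comp f gs) := by
  obtain rfl : gs.dom = d := funext hd
  obtain rfl : gs'.dom = d' := funext hd'
  obtain rfl : gs.get = x := funext fun i => eq_of_heq (hx i)
  exact Y.comp_act f gs gs' p τ q (fun i => (hx' i).trans (h i)) hq

/-- Exchange respects the equational theory. -/
def SynHom.act (Y : K.Symmetry) (hY : Y ∈ K.exch) {Γ Γ' : List K.Ob} {B : K.Ob}
    (p : CtxPerm Γ Γ') : K.SynHom Γ B → K.SynHom Γ' B :=
  Quotient.map (Y.act p) fun _ _ h => Eqv.exch Y hY p h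

theorem mk_cast {Γ : List K.Ob} {A A' : K.Ob} (h : A = A') (t : K.Hom Γ A) :
    HEq (SynHom.mk (h ▸ t : K.Hom Γ A')) (SynHom.mk t) := by
  subst h; rfl

/-- Exchange acts on terms modulo the equational theory. -/
def synSymmetry (Y : K.Symmetry) (hY : Y ∈ K.exch) : K.synMulticat.Symmetry where
  act := SynHom.act Y hY
  act_refl f := by
    induction f using Quotient.inductionOn with
    | h t => exact congrArg SynHom.mk (Y.act_refl t)
  act_trans p q f := by
    induction f using Quotient.inductionOn with
    | h t => exact congrArg SynHom.mk (Y.act_trans p q t)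
  comp_act {As As' Γ Γ' B} f gs gs' p τ q h hq := by
    induction f using Quotient.inductionOn with
    | h t =>
      let x : ∀ i, K.Hom (gs.dom i) (As.get i) := fun i => SynHom.rep (gs.get i)
      let x' : ∀ i, K.Hom (gs'.dom i) (As'.get i) := fun i =>
        (p.get_eq i).symm ▸ Y.act (τ i) (x (p.σ i))
      have hx : ∀ i, SynHom.mk (x i) = gs.get i := fun i => SynHom.mk_rep _
      have hx' : ∀ i, SynHom.mk (x' i) = gs'.get i := fun i => by
        refine eq_of_heq ((mk_cast _ _).trans (HEq.trans ?_ (h i).symm))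
        rw [← hx]
        rfl
      obtain ⟨ts, h₁, h₂, h₃, h₄⟩ := SynHom.exists_rep gs x hx
      obtain ⟨ts', h₁', h₂', h₃', h₄'⟩ := SynHom.exists_rep gs' x' hx'
      have key := comp_act_aux Y t ts ts' p q _ h₂ _ h₂' x h₃ x' h₃' τ
        (fun i => eqRec_heq _ _) (fun i j k hk => by
          exact (hq i j k (hk.trans (congrArg (· + (j : ℕ)) (h₄' i)))).trans
            (congrArg (· + ((τ i).σ j : ℕ)) (h₄ _).symm))
      rw [← h₁, ← h₁']
      refine (SynHom.comp_mk (Y.act p t) ts').trans ((congrArg SynHom.mk key).trans ?_)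
      exact congrArg (SynHom.act Y hY q) (SynHom.comp_mk t ts).symm

end Calculus

/-! ## The ordered calculus -/

/-- Well-typed terms-in-context of the ordered tensor calculus over a signature, that is, derivations:
a variable; a constant applied to terms; a tuple `t₁ ⊗ ⋯ ⊗ tₙ`; and `let (x₁, …, xₙ) be s in t` with
the two parts `Λ` and `Ψ` of the context of `t` to the left and to the right of the bound variables.
Variables are referred to by their position in the context, so that terms are taken up to renaming. -/
inductive OTm (S : Sig.{u}) : List (Ty S.Ob) → Ty S.Ob → Type u
  | var (A : Ty S.Ob) : OTm S [A] A
  | con {Δ : List (Ty S.Ob)} {As : List S.Ob} {B : S.Ob} (c : S.con As B)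
      (ts : Args (OTm S) Δ (As.map Ty.base)) : OTm S Δ (Ty.base B)
  | tens {Δ As : List (Ty S.Ob)} (ts : Args (OTm S) Δ As) : OTm S Δ (Ty.tens As)
  | letT {Γ Δ : List (Ty S.Ob)} {B : Ty S.Ob} (Λ Ψ As : List (Ty S.Ob))
      (s : OTm S Δ (Ty.tens As)) (t : OTm S (Λ ++ (As ++ Ψ)) B) (h : Γ = Λ ++ (Δ ++ Ψ)) :
      OTm S Γ B

namespace OTm
variable {S : Sig.{u}}

/-- The variables of a context. -/
abbrev vars (As : List (Ty S.Ob)) : Args (OTm S) As As := .ones .var As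

/-- The only member of a one-element list. -/
def toTm {Γ : List (Ty S.Ob)} {A : Ty S.Ob} : Args (OTm S) Γ [A] → OTm S Γ A
  | .cons t .nil h => Args.castDom (h.trans (List.append_nil _)).symm t

/-! Simultaneous substitution. -/

mutual
def subst : {Γ Δ : List (Ty S.Ob)} → {B : Ty S.Ob} →
    OTm S Γ B → Args (OTm S) Δ Γ → OTm S Δ B
  | _, _, _, .var _, σ => toTm σ
  | _, _, _, .con c ts, σ => .con c (substs ts σ)
  | _, _, _, .tens ts, σ => .tens (substs ts σ)
  | _, _, _, .letT (Δ := Δ) Λ Ψ As s t h, σ =>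
    let p := Args.split₃ (Cs := Ψ) Λ Δ (h ▸ σ)
    .letT p.Γ₁ p.Γ₃ As (subst s p.snd) (subst t (.app p.fst (.app (vars As) p.trd))) p.eq
def substs : {Γ Δ As : List (Ty S.Ob)} →
    Args (OTm S) Γ As → Args (OTm S) Δ Γ → Args (OTm S) Δ As
  | _, _, _, .nil, σ => σ
  | _, _, _, .cons (Γ := Γ) t ts h, σ =>
    let p := Args.split Γ (h ▸ σ)
    .cons (subst t p.fst) (substs ts p.snd) p.eq
end

theorem substs_eq {Γ Δ As : List (Ty S.Ob)} (ts : Args (OTm S) Γ As) (σ : Args (OTm S) Δ Γ) :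
    substs ts σ = ts.bind subst σ := by
  induction ts generalizing Δ with
  | nil => simp only [substs, Args.bind]
  | cons t ts h ih => simp only [substs, Args.bind, ih]

theorem var_subst {Γ : List (Ty S.Ob)} {A : Ty S.Ob} (t : OTm S Γ A) :
    subst (.var A) (.single t) = t := by
  simp only [subst]; rfl

theorem letT_subst {Γ Δ Θ Θ₁ Θ₂ Θ₃ : List (Ty S.Ob)} {B : Ty S.Ob} (Λ Ψ As : List (Ty S.Ob))
    (s : OTm S Δ (Ty.tens As)) (t : OTm S (Λ ++ (As ++ Ψ)) B) (h : Γ = Λ ++ (Δ ++ Ψ))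
    (σ : Args (OTm S) Θ Γ) (σ₁ : Args (OTm S) Θ₁ Λ) (σ₂ : Args (OTm S) Θ₂ Δ)
    (σ₃ : Args (OTm S) Θ₃ Ψ) (e : Θ = Θ₁ ++ (Θ₂ ++ Θ₃)) (hh : HEq σ (Args.app σ₁ (Args.app σ₂ σ₃))) :
    subst (.letT Λ Ψ As s t h) σ =
      .letT Θ₁ Θ₃ As (subst s σ₂) (subst t (.app σ₁ (.app (vars As) σ₃))) e := by
  subst h; subst e
  obtain rfl := eq_of_heq hh
  have key : ∀ p : Args.Split₃ (OTm S) (Θ₁ ++ (Θ₂ ++ Θ₃)) Λ Δ Ψ,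
      p = ⟨Θ₁, Θ₂, Θ₃, σ₁, σ₂, σ₃, rfl⟩ → ∀ e,
      letT p.Γ₁ p.Γ₃ As (subst s p.snd) (subst t (p.fst.app ((vars As).app p.trd))) e =
        letT Θ₁ Θ₃ As (subst s σ₂) (subst t (σ₁.app ((vars As).app σ₃))) rfl := by
    rintro _ rfl _; rfl
  simp only [subst]
  exact key _ (Args.split₃_app σ₁ σ₂ σ₃) _

mutual
theorem subst_vars : ∀ {Γ : List (Ty S.Ob)} {B : Ty S.Ob} (t : OTm S Γ B), subst t (vars Γ) = t
  | _, _, .var A => var_subst (.var A)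
  | _, _, .con c ts => by rw [subst, substs_vars ts]
  | _, _, .tens ts => by rw [subst, substs_vars ts]
  | _, _, .letT (Δ := Δ) Λ Ψ As s t h => by
    subst h
    rw [letT_subst Λ Ψ As s t rfl _ (vars Λ) (vars Δ) (vars Ψ) rfl
      (heq_of_eq (by rw [vars, Args.ones_app, Args.ones_app])), subst_vars s]
    rw [vars, vars, vars, ← Args.ones_app, ← Args.ones_app, subst_vars t]
theorem substs_vars : ∀ {Γ As : List (Ty S.Ob)} (ts : Args (OTm S) Γ As), substs ts (vars Γ) = ts
  | _, _, .nil => by rw [substs]; rfl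
  | _, _, .cons t ts h => by
    rw [substs_eq, Args.bind_cons subst t ts h _ (vars _) (vars _) h (by
      subst h; exact heq_of_eq (Args.ones_app _ _ _)), subst_vars t, ← substs_eq, substs_vars ts]
end

mutual
theorem subst_subst : ∀ {Γ Δ Θ : List (Ty S.Ob)} {B : Ty S.Ob} (t : OTm S Γ B)
    (σ : Args (OTm S) Δ Γ) (τ : Args (OTm S) Θ Δ), subst (subst t σ) τ = subst t (substs σ τ)
  | _, _, _, _, .var A, σ, τ => by
    obtain ⟨g, rfl⟩ := Args.exists_single σ
    rw [var_subst, substs_eq, Args.bind_single, var_subst]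
  | _, _, _, _, .con c ts, σ, τ => by rw [subst, subst, subst, substs_substs ts]
  | _, _, _, _, .tens ts, σ, τ => by rw [subst, subst, subst, substs_substs ts]
  | _, _, _, _, .letT (Δ := Δ) Λ Ψ As s t h, σ, τ => by
    subst h
    obtain ⟨_, _, σ₁, σ', rfl, hh⟩ := Args.app_cases Λ σ
    obtain rfl := eq_of_heq hh
    obtain ⟨_, _, σ₂, σ₃, rfl, hh⟩ := Args.app_cases Δ σ'
    obtain rfl := eq_of_heq hh
    obtain ⟨_, _, τ₁, τ', rfl, hh⟩ := Args.app_cases _ τ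
    obtain rfl := eq_of_heq hh
    obtain ⟨_, _, τ₂, τ₃, rfl, hh⟩ := Args.app_cases _ τ'
    obtain rfl := eq_of_heq hh
    rw [letT_subst Λ Ψ As s t rfl _ σ₁ σ₂ σ₃ rfl HEq.rfl,
      letT_subst _ _ As _ _ rfl _ τ₁ τ₂ τ₃ rfl HEq.rfl,
      letT_subst Λ Ψ As s t rfl _ (substs σ₁ τ₁) (substs σ₂ τ₂) (substs σ₃ τ₃) rfl (by
        simp only [substs_eq, Args.bind_app]; rfl), subst_subst s, subst_subst t]
    congr 1
    rw [substs_eq, Args.bind_app, Args.bind_app, ← substs_eq, ← substs_eq, ← substs_eq,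
      substs_vars]
theorem substs_substs : ∀ {Γ Δ Θ As : List (Ty S.Ob)} (ts : Args (OTm S) Γ As)
    (σ : Args (OTm S) Δ Γ) (τ : Args (OTm S) Θ Δ),
    substs (substs ts σ) τ = substs ts (substs σ τ)
  | _, _, _, _, .nil, σ, τ => by rw [substs, substs]
  | _, _, _, _, .cons t ts h, σ, τ => by
    subst h
    obtain ⟨_, _, σ₁, σ', rfl, hh⟩ := Args.app_cases _ σ
    obtain rfl := eq_of_heq hh
    obtain ⟨_, _, τ₁, τ', rfl, hh⟩ := Args.app_cases _ τ
    obtain rfl := eq_of_heq hh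
    rw [substs_eq (.cons t ts rfl), Args.bind_cons subst t ts rfl _ σ₁ σ' rfl HEq.rfl, substs_eq,
      Args.bind_cons subst _ _ rfl _ τ₁ τ' rfl HEq.rfl, substs_eq (.cons t ts rfl),
      Args.bind_cons subst t ts rfl _ (substs σ₁ τ₁) (substs σ' τ') rfl (by
        simp only [substs_eq, Args.bind_app]; rfl), subst_subst t, ← substs_eq, ← substs_eq,
      ← substs_eq, substs_substs ts]
end

end OTm

/-- The ordered tensor calculus over a signature. -/
def OCalc (S : Sig.{u}) : Calculus.{u} where
  Ob := Ty S.Ob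
  Hom := OTm S
  one := .var
  comp := OTm.subst
  one_comp := OTm.var_subst
  comp_one := OTm.subst_vars
  assoc f gs hs := by rw [OTm.subst_subst, OTm.substs_eq]
  T := .tens
  tens As := .tens (OTm.vars As)
  letT Λ Ψ As s t := .letT Λ Ψ As s t rfl
  letT_comp Λ Ψ As s t σ₁ σ₂ σ₃ := OTm.letT_subst Λ Ψ As s t rfl _ σ₁ σ₂ σ₃ rfl HEq.rfl
  exch := none

/-- The syntactic representable multicategory of the ordered tensor calculus. -/
noncomputable def OSyn (S : Sig.{u}) : RepMulticat.{u} := (OCalc S).syn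

/-- A constant `c` is interpreted as the term `c(x₁, …, xₙ)`. -/
noncomputable def OSyn.incl (S : Sig.{u}) : S ⟶ RepMulticat.U.obj (OSyn S) :=
  Sig.Fun.mk (S' := RepMulticat.U.obj (OSyn S)) Ty.base fun {Γ _} c =>
    Calculus.SynHom.mk (K := OCalc S) (.con c (OTm.vars (Γ.map Ty.base)))


/-! ## The linear calculus -/

/-- Raw terms of the linear tensor calculus, with de Bruijn indices: `letT As s t` binds the indices
`0, …, n - 1` in `t`, where `n` is the length of `As`, and index `n + i` in `t` is index `i` outside. -/
inductive LTm (S : Sig.{u}) : Type u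
  | var (n : ℕ) : LTm S
  | con {As : List S.Ob} {B : S.Ob} (c : S.con As B) (ts : Fin As.length → LTm S) : LTm S
  | tens (As : List (Ty S.Ob)) (ts : Fin As.length → LTm S) : LTm S
  | letT (As : List (Ty S.Ob)) (s t : LTm S) : LTm S

namespace LTm
variable {S : Sig.{u}}

/-- A renaming under `n` binders. -/
def lift (n : ℕ) (ρ : ℕ → ℕ) (i : ℕ) : ℕ := if i < n then i else ρ (i - n) + n

/-- Renaming of the free variables. -/
def rename (ρ : ℕ → ℕ) : LTm S → LTm S
  | .var i => .var (ρ i)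
  | .con c ts => .con c fun i => rename ρ (ts i)
  | .tens As ts => .tens As fun i => rename ρ (ts i)
  | .letT As s t => .letT As (rename ρ s) (rename (lift As.length ρ) t)

/-- Renaming of the free variable `i` to `i + n`. -/
abbrev shift (n : ℕ) : LTm S → LTm S := rename (· + n)

/-- A substitution under `n` binders. -/
def lifts (n : ℕ) (σ : ℕ → LTm S) (i : ℕ) : LTm S := if i < n then .var i else shift n (σ (i - n))

/-- Simultaneous capture-avoiding substitution. -/
def subst (σ : ℕ → LTm S) : LTm S → LTm S
  | .var i => σ i
  | .con c ts => .con c fun i => subst σ (ts i)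
  | .tens As ts => .tens As fun i => subst σ (ts i)
  | .letT As s t => .letT As (subst σ s) (subst (lifts As.length σ) t)

/-- Contexts of named variables. -/
abbrev Ctx (S : Sig.{u}) := List (ℕ × Ty S.Ob)

/-- The context `k : A₀, k + 1 : A₁, …`. -/
def names (k : ℕ) : List (Ty S.Ob) → Ctx S
  | [] => []
  | A :: As => (k, A) :: names (k + 1) As

/-- Renaming of the variables of a context. -/
def Ctx.rename (ρ : ℕ → ℕ) (Γ : Ctx S) : Ctx S := Γ.map fun p => (ρ p.1, p.2)

/-- The typing rules: variables, constants, tensors, `let`, and exchange of adjacent variables. -/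
inductive Typed : Ctx S → LTm S → Ty S.Ob → Prop
  | var (n : ℕ) (A : Ty S.Ob) : Typed [(n, A)] (.var n) A
  | con {As : List S.Ob} {B : S.Ob} (c : S.con As B) (ts : Fin As.length → LTm S)
      (Δ : Fin As.length → Ctx S) (h : ∀ i, Typed (Δ i) (ts i) (.base (As.get i))) :
      Typed (List.ofFn Δ).flatten (.con c ts) (.base B)
  | tens (As : List (Ty S.Ob)) (ts : Fin As.length → LTm S)
      (Δ : Fin As.length → Ctx S) (h : ∀ i, Typed (Δ i) (ts i) (As.get i)) :
      Typed (List.ofFn Δ).flatten (.tens As ts) (.tens As)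
  | letT {As : List (Ty S.Ob)} {B : Ty S.Ob} {s t : LTm S} (Λ Δ Ψ : Ctx S)
      (hs : Typed Δ s (.tens As))
      (ht : Typed (Λ.rename (· + As.length) ++ (names 0 As ++ Ψ.rename (· + As.length))) t B) :
      Typed (Λ ++ (Δ ++ Ψ)) (.letT As s t) B
  | exch {B : Ty S.Ob} {t : LTm S} (Λ Ψ : Ctx S) (x y : ℕ × Ty S.Ob)
      (h : Typed (Λ ++ x :: y :: Ψ) t B) : Typed (Λ ++ y :: x :: Ψ) t B

/-! ### Laws of renaming and substitution -/

theorem lift_lift (n : ℕ) (ρ ρ' : ℕ → ℕ) (i : ℕ) :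
    lift n ρ' (lift n ρ i) = lift n (fun i => ρ' (ρ i)) i := by
  unfold lift; split_ifs <;> simp_all

theorem rename_rename (t : LTm S) : ∀ ρ ρ' : ℕ → ℕ,
    rename ρ' (rename ρ t) = rename (fun i => ρ' (ρ i)) t := by
  induction t with
  | var i => intros; rfl
  | con c ts ih => intros; simp only [rename, ih]
  | tens As ts ih => intros; simp only [rename, ih]
  | letT As s t ihs iht => intros; simp only [rename, ihs, iht, lift_lift]

theorem subst_rename (t : LTm S) : ∀ (ρ : ℕ → ℕ) (σ : ℕ → LTm S),
    subst σ (rename ρ t) = subst (fun i => σ (ρ i)) t := by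
  induction t with
  | var i => intros; rfl
  | con c ts ih => intros; simp only [rename, subst, ih]
  | tens As ts ih => intros; simp only [rename, subst, ih]
  | letT As s t ihs iht =>
    intro ρ σ
    simp only [rename, subst, ihs, iht]
    congr 2
    funext i
    unfold lifts lift; split_ifs <;> simp_all

theorem rename_subst (t : LTm S) : ∀ (σ : ℕ → LTm S) (ρ : ℕ → ℕ),
    rename ρ (subst σ t) = subst (fun i => rename ρ (σ i)) t := by
  induction t with
  | var i => intros; rfl
  | con c ts ih => intros; simp only [rename, subst, ih]
  | tens As ts ih => intros; simp only [rename, subst, ih]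
  | letT As s t ihs iht =>
    intro σ ρ
    simp only [rename, subst, ihs, iht]
    congr 2
    funext i
    unfold lifts
    split_ifs with h
    · simp [rename, lift, h]
    · rw [shift, rename_rename, rename_rename]
      congr 1
      funext j
      simp [lift]

theorem subst_subst (t : LTm S) : ∀ (σ τ : ℕ → LTm S),
    subst τ (subst σ t) = subst (fun i => subst τ (σ i)) t := by
  induction t with
  | var i => intros; rfl
  | con c ts ih => intros; simp only [subst, ih]
  | tens As ts ih => intros; simp only [subst, ih]
  | letT As s t ihs iht =>
    intro σ τ
    simp only [subst, ihs, iht]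
    congr 2
    funext i
    unfold lifts
    split_ifs with h
    · simp [subst, h]
    · rw [shift, subst_rename, rename_subst]
      congr 1
      funext j
      simp

theorem lifts_var (n : ℕ) : lifts n (var : ℕ → LTm S) = var := by
  funext i
  unfold lifts
  split_ifs with h
  · rfl
  · simp only [shift, rename]
    congr 1; omega

theorem subst_var (t : LTm S) : subst var t = t := by
  induction t with
  | var i => rfl
  | con c ts ih => simp only [subst, ih]
  | tens As ts ih => simp only [subst, ih]
  | letT As s t ihs iht => simp only [subst, ihs, lifts_var, iht]

theorem rename_eq_subst (t : LTm S) (ρ : ℕ → ℕ) : rename ρ t = subst (fun i => var (ρ i)) t := by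
  have := rename_subst t var ρ
  rwa [subst_var] at this

theorem rename_id (t : LTm S) : rename (fun i => i) t = t := by
  rw [rename_eq_subst]; exact subst_var t

/-! ### Contexts and typing -/

theorem names_shift (k n : ℕ) (As : List (Ty S.Ob)) :
    (names k As).rename (· + n) = names (k + n) As := by
  induction As generalizing k with
  | nil => rfl
  | cons A As ih =>
    have := ih (k + 1)
    simp only [names, Ctx.rename, List.map_cons] at this ⊢
    rw [this, Nat.add_right_comm]

theorem names_append (k : ℕ) (As Bs : List (Ty S.Ob)) :
    names k (As ++ Bs) = names k As ++ names (k + As.length) Bs := by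
  induction As generalizing k with
  | nil => rfl
  | cons A As ih =>
    simp only [List.cons_append, names, ih, List.length_cons]
    rw [Nat.add_assoc, Nat.add_comm 1]

theorem mem_names {k : ℕ} {As : List (Ty S.Ob)} {p : ℕ × Ty S.Ob} :
    p ∈ names k As ↔ k ≤ p.1 ∧ As[p.1 - k]? = some p.2 := by
  induction As generalizing k with
  | nil => simp [names]
  | cons A As ih =>
    rw [names, List.mem_cons, ih]
    obtain ⟨i, B⟩ := p
    simp only [Prod.mk.injEq]
    constructor
    · rintro (⟨rfl, rfl⟩ | ⟨h, h'⟩)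
      · simp
      · refine ⟨by omega, ?_⟩
        rw [show i - k = (i - (k + 1)) + 1 by omega, List.getElem?_cons_succ, h']
    · rintro ⟨h, h'⟩
      rcases Nat.eq_or_lt_of_le h with rfl | h
      · left; simpa [eq_comm] using h'
      · right
        refine ⟨h, ?_⟩
        rwa [show i - k = (i - (k + 1)) + 1 by omega, List.getElem?_cons_succ] at h'

theorem lt_of_mem_names {As : List (Ty S.Ob)} {p : ℕ × Ty S.Ob} (h : p ∈ names 0 As) :
    p.1 < As.length := by
  have := (mem_names.1 h).2
  rw [Nat.sub_zero] at this
  exact (List.getElem?_eq_some_iff.1 this).1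

theorem nodup_names (k : ℕ) (As : List (Ty S.Ob)) : (names k As).Nodup := by
  induction As generalizing k with
  | nil => exact List.nodup_nil
  | cons A As ih =>
    refine List.nodup_cons.2 ⟨fun h => ?_, ih _⟩
    have := (mem_names.1 h).1
    simp at this

theorem Typed.perm_aux {Γ Γ' : Ctx S} (h : Γ.Perm Γ') : ∀ (Λ : Ctx S) {t : LTm S} {B : Ty S.Ob},
    Typed (Λ ++ Γ) t B → Typed (Λ ++ Γ') t B := by
  induction h with
  | nil => intro Λ t B h; exact h
  | cons x _ ih =>
    intro Λ t B h
    rw [List.append_cons] at h ⊢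
    exact ih _ h
  | swap x y l => intro Λ t B h; exact .exch Λ l _ _ h
  | trans _ _ ih₁ ih₂ => intro Λ t B h; exact ih₂ _ (ih₁ _ h)

theorem Typed.perm {Γ Γ' : Ctx S} (h : Γ.Perm Γ') {t : LTm S} {B : Ty S.Ob} (ht : Typed Γ t B) :
    Typed Γ' t B := Typed.perm_aux h [] ht

theorem flatMap_flatten {α β : Type*} (L : List (List α)) (f : α → List β) :
    L.flatten.flatMap f = (L.map fun l => l.flatMap f).flatten := by
  induction L with
  | nil => rfl
  | cons l L ih => simp [ih]

theorem subst_congr {Γ : Ctx S} {t : LTm S} {B : Ty S.Ob} (ht : Typed Γ t B) :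
    ∀ {σ τ : ℕ → LTm S}, (∀ p ∈ Γ, σ p.1 = τ p.1) → subst σ t = subst τ t := by
  induction ht with
  | var n A => intro σ τ h; exact h _ (List.mem_singleton_self _)
  | con c ts Δ _ ih =>
    intro σ τ h
    simp only [subst]
    congr 1
    funext i
    exact ih i fun p hp => h p (List.mem_flatten.2 ⟨_, (List.mem_ofFn' Δ _).2 ⟨i, rfl⟩, hp⟩)
  | tens As ts Δ _ ih =>
    intro σ τ h
    simp only [subst]
    congr 1
    funext i
    exact ih i fun p hp => h p (List.mem_flatten.2 ⟨_, (List.mem_ofFn' Δ _).2 ⟨i, rfl⟩, hp⟩)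
  | @letT As B s t Λ Δ Ψ _ _ ihs iht =>
    intro σ τ h
    simp only [subst]
    rw [ihs fun p hp => h p (by simp [hp])]
    congr 1
    refine iht fun p hp => ?_
    simp only [List.mem_append, Ctx.rename, List.mem_map] at hp
    obtain ⟨q, hq, rfl⟩ | hp | ⟨q, hq, rfl⟩ := hp
    · simp [lifts, h q (by simp [hq])]
    · simp [lifts, lt_of_mem_names hp]
    · simp [lifts, h q (by simp [hq])]
  | exch Λ Ψ x y _ ih =>
    intro σ τ h
    exact ih fun p hp => h p (by simp only [List.mem_append, List.mem_cons] at hp ⊢; tauto)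

theorem rename_congr {Γ : Ctx S} {t : LTm S} {B : Ty S.Ob} (ht : Typed Γ t B) {ρ ρ' : ℕ → ℕ}
    (h : ∀ p ∈ Γ, ρ p.1 = ρ' p.1) : rename ρ t = rename ρ' t := by
  rw [rename_eq_subst, rename_eq_subst]
  exact subst_congr ht fun p hp => congrArg var (h p hp)

theorem Typed.rename {Γ : Ctx S} {t : LTm S} {B : Ty S.Ob} (ht : Typed Γ t B) :
    ∀ ρ : ℕ → ℕ, Typed (Γ.rename ρ) (t.rename ρ) B := by
  induction ht with
  | var n A => intro ρ; exact .var _ _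
  | con c ts Δ _ ih =>
    intro ρ
    rw [Ctx.rename, List.map_flatten, List.map_ofFn]
    exact .con c _ _ fun i => ih i ρ
  | tens As ts Δ _ ih =>
    intro ρ
    rw [Ctx.rename, List.map_flatten, List.map_ofFn]
    exact .tens As _ _ fun i => ih i ρ
  | @letT As B s t Λ Δ Ψ _ _ ihs iht =>
    intro ρ
    have h := iht (lift As.length ρ)
    have e₁ : ∀ Λ : Ctx S, Ctx.rename (lift As.length ρ) (Ctx.rename (· + As.length) Λ) =
        Ctx.rename (· + As.length) (Ctx.rename ρ Λ) := fun Λ => by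
      simp [Ctx.rename, lift]
    have e₂ : Ctx.rename (lift As.length ρ) (names 0 As) = names 0 As := by
      refine (List.map_congr_left fun p hp => ?_).trans (List.map_id _)
      simp [lift, lt_of_mem_names hp]
    have e₃ : ∀ Λ Λ' : Ctx S, Ctx.rename (lift As.length ρ) (Λ ++ Λ') =
      Ctx.rename (lift As.length ρ) Λ ++ Ctx.rename (lift As.length ρ) Λ' := fun _ _ =>
      List.map_append
    rw [e₃, e₃, e₁, e₁, e₂] at h
    have := Typed.letT _ _ _ (ihs ρ) h
    rw [Ctx.rename, List.map_append, List.map_append]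
    exact this
  | exch Λ Ψ x y _ ih =>
    intro ρ
    have := ih ρ
    simp only [Ctx.rename, List.map_append, List.map_cons] at this ⊢
    exact .exch _ _ _ _ this

theorem Typed.subst {Γ : Ctx S} {t : LTm S} {B : Ty S.Ob} (ht : Typed Γ t B) :
    ∀ (σ : ℕ → LTm S) (Δ : ℕ → Ctx S), (∀ p ∈ Γ, Typed (Δ p.1) (σ p.1) p.2) →
      Typed (Γ.flatMap fun p => Δ p.1) (t.subst σ) B := by
  induction ht with
  | var n A => 
    intro σ Δ h
    have := h _ (List.mem_singleton_self _)
    rwa [← List.append_nil (Δ _)] at this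
  | con c ts D _ ih =>
    intro σ Δ h
    rw [flatMap_flatten, List.map_ofFn]
    exact .con c _ _ fun i => ih i σ Δ fun p hp =>
      h p (List.mem_flatten.2 ⟨_, (List.mem_ofFn' D _).2 ⟨i, rfl⟩, hp⟩)
  | tens As ts D _ ih =>
    intro σ Δ h
    rw [flatMap_flatten, List.map_ofFn]
    exact .tens As _ _ fun i => ih i σ Δ fun p hp =>
      h p (List.mem_flatten.2 ⟨_, (List.mem_ofFn' D _).2 ⟨i, rfl⟩, hp⟩)
  | @letT As B s t Λ D Ψ _ _ ihs iht =>
    intro σ Δ h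
    let Δ' : ℕ → Ctx S := fun i => match As[i]? with
      | some A => [(i, A)]
      | none => (Δ (i - As.length)).rename (· + As.length)
    have hΔ : ∀ i, Δ' (i + As.length) = (Δ i).rename (· + As.length) := fun i => by
      simp [Δ']
    have hn : ∀ p ∈ names 0 As, Δ' p.1 = [p] := fun p hp => by
      have := (mem_names.1 hp).2
      rw [Nat.sub_zero] at this
      simp [Δ', this]
    have hs := ihs σ Δ fun p hp => h p (by simp [hp])
    have ht := iht (lifts As.length σ) Δ' fun p hp => by
      simp only [List.mem_append, Ctx.rename, List.mem_map] at hp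
      obtain ⟨q, hq, rfl⟩ | hp | ⟨q, hq, rfl⟩ := hp
      · simp only [hΔ, lifts, Nat.not_lt.2 (Nat.le_add_left _ _), if_false, Nat.add_sub_cancel]
        exact (h q (by simp [hq])).rename _
      · rw [hn p hp]
        simp only [lifts, lt_of_mem_names hp, if_true]
        exact .var _ _
      · simp only [hΔ, lifts, Nat.not_lt.2 (Nat.le_add_left _ _), if_false, Nat.add_sub_cancel]
        exact (h q (by simp [hq])).rename _
    have e₁ : ∀ Λ : Ctx S, (Ctx.rename (· + As.length) Λ).flatMap (fun p => Δ' p.1) =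
        Ctx.rename (· + As.length) (Λ.flatMap fun p => Δ p.1) := fun Λ => by
      induction Λ with
      | nil => rfl
      | cons x Λ ih =>
        simp only [Ctx.rename, List.map_cons, List.flatMap_cons, List.map_append] at ih ⊢
        rw [ih, hΔ]; rfl
    have e₂ : (names 0 As).flatMap (fun p => Δ' p.1) = names 0 As := by
      refine (List.flatMap_congr fun p hp => hn p hp).trans ?_
      exact List.flatMap_singleton' _
    rw [List.flatMap_append, List.flatMap_append, e₁, e₁, e₂] at ht
    rw [List.flatMap_append, List.flatMap_append]
    exact .letT _ _ _ hs ht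
  | exch Λ Ψ x y _ ih =>
    intro σ Δ h
    refine Typed.perm ?_ (ih σ Δ fun p hp => h p (by
      simp only [List.mem_append, List.mem_cons] at hp ⊢; tauto))
    exact List.Perm.flatMap_right _ (List.Perm.append_left _ (List.Perm.swap _ _ _))

end LTm

/-- Terms of the linear tensor calculus in the context `0 : A₀, 1 : A₁, …`. -/
@[ext] structure LTerm (S : Sig.{u}) (Γ : List (Ty S.Ob)) (B : Ty S.Ob) : Type u where
  tm : LTm S
  typed : LTm.Typed (LTm.names 0 Γ) tm B

namespace LTerm
variable {S : Sig.{u}}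
open LTm

theorem rename_congr {Γ : List (Ty S.Ob)} {B : Ty S.Ob} (t : LTerm S Γ B) {ρ ρ' : ℕ → ℕ}
    (h : ∀ i < Γ.length, ρ i = ρ' i) : t.1.rename ρ = t.1.rename ρ' :=
  LTm.rename_congr t.2 fun _ hp => h _ (lt_of_mem_names hp)

theorem subst_congr {Γ : List (Ty S.Ob)} {B : Ty S.Ob} (t : LTerm S Γ B) {σ τ : ℕ → LTm S}
    (h : ∀ i < Γ.length, σ i = τ i) : t.1.subst σ = t.1.subst τ :=
  LTm.subst_congr t.2 fun _ hp => h _ (lt_of_mem_names hp)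

/-- The substitution given by a list of terms; the variables of each term are shifted past those of
the preceding ones. -/
def sub : {Γ As : List (Ty S.Ob)} → Args (LTerm S) Γ As → ℕ → LTm S
  | _, _, .nil, i => .var i
  | _, _, .cons t _ _, 0 => t.1
  | _, _, .cons (Γ := Γ) _ ts _, i + 1 => (sub ts i).shift Γ.length

/-- The part of the concatenated context used by the `i`-th term. -/
def subCtx : {Γ As : List (Ty S.Ob)} → Args (LTerm S) Γ As → ℕ → Ctx S
  | _, _, .nil, _ => []
  | _, _, .cons (Γ := Γ) _ _ _, 0 => names 0 Γ
  | _, _, .cons (Γ := Γ) _ ts _, i + 1 => (subCtx ts i).rename (· + Γ.length)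

theorem sub_typed {Γ As : List (Ty S.Ob)} (ts : Args (LTerm S) Γ As) :
    ∀ p ∈ names 0 As, Typed (subCtx ts p.1) (sub ts p.1) p.2 := by
  induction ts with
  | nil => intro p hp; simp [names] at hp
  | cons t ts h ih =>
    intro p hp
    rw [names, List.mem_cons, ← names_shift] at hp
    obtain rfl | hp := hp
    · exact t.2
    · obtain ⟨q, hq, rfl⟩ := List.mem_map.1 hp
      exact (ih q hq).rename _

theorem flatMap_subCtx {Γ As : List (Ty S.Ob)} (ts : Args (LTerm S) Γ As) :
    (names 0 As).flatMap (fun p => subCtx ts p.1) = names 0 Γ := by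
  induction ts with
  | nil => rfl
  | @cons Γ₁ Γ₂ Γ A As t ts h ih =>
    subst h
    rw [names, List.flatMap_cons, ← names_shift, Ctx.rename, List.flatMap_map, names_append,
      ← names_shift, ← ih, Ctx.rename, List.map_flatMap]
    rfl

/-- Substitution. -/
def comp {Γ As : List (Ty S.Ob)} {B : Ty S.Ob} (t : LTerm S As B) (ts : Args (LTerm S) Γ As) :
    LTerm S Γ B :=
  ⟨t.1.subst (sub ts), by
    have := t.2.subst (sub ts) (subCtx ts) (sub_typed ts)
    rwa [flatMap_subCtx] at this⟩

/-- The variable. -/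
def var (A : Ty S.Ob) : LTerm S [A] A := ⟨.var 0, .var 0 A⟩

theorem sub_ones (As : List (Ty S.Ob)) : sub (.ones var As) = (LTm.var : ℕ → LTm S) := by
  induction As with
  | nil => rfl
  | cons A As ih =>
    funext i
    match i with
    | 0 => rfl
    | i + 1 => rw [Args.ones, sub, ih]; rfl

theorem sub_lt {Γ Δ As Bs : List (Ty S.Ob)} (a : Args (LTerm S) Γ As) (b : Args (LTerm S) Δ Bs) :
    ∀ i < As.length, sub (.app a b) i = sub a i := by
  induction a with
  | nil => intro i hi; simp at hi
  | cons t ts h ih =>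
    intro i hi
    match i with
    | 0 => rfl
    | i + 1 => exact congrArg (LTm.shift _) (ih i (by simpa using hi))

theorem sub_ge {Γ Δ As Bs : List (Ty S.Ob)} (a : Args (LTerm S) Γ As) (b : Args (LTerm S) Δ Bs)
    (i : ℕ) : sub (.app a b) (As.length + i) = (sub b i).shift Γ.length := by
  induction a with
  | nil => simp [Args.app, shift, rename_id]
  | @cons Γ₁ Γ₂ Γ A As t ts h ih =>
    subst h
    rw [List.length_cons, Nat.add_right_comm]
    refine (congrArg (LTm.shift Γ₁.length) ih).trans ?_
    rw [shift, rename_rename]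
    congr 1
    funext j
    simp; omega

theorem one_comp {Γ : List (Ty S.Ob)} {B : Ty S.Ob} (t : LTerm S Γ B) :
    comp (var B) (.single t) = t := LTerm.ext rfl

theorem comp_one {Γ : List (Ty S.Ob)} {B : Ty S.Ob} (t : LTerm S Γ B) :
    comp t (.ones var Γ) = t := LTerm.ext (by
  exact (congrArg (fun σ => t.1.subst σ) (sub_ones Γ)).trans (subst_var _))

theorem sub_bind {Θ Γ As : List (Ty S.Ob)} (gs : Args (LTerm S) Γ As) (hs : Args (LTerm S) Θ Γ) :
    ∀ i < As.length, sub (gs.bind comp hs) i = (sub gs i).subst (sub hs) := by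
  induction gs generalizing Θ with
  | nil => intro i hi; simp at hi
  | @cons Γ₁ Γ₂ Γ A As t ts e ih =>
    subst e
    intro i hi
    obtain ⟨Θ₁, Θ₂, a, b, rfl, hh⟩ := Args.app_cases _ hs
    obtain rfl := eq_of_heq hh
    rw [Args.bind_cons comp t ts rfl _ a b rfl HEq.rfl]
    match i with
    | 0 => exact t.subst_congr fun j hj => (sub_lt a b j hj).symm
    | i + 1 =>
      rw [sub, sub, ih b i (by simpa using hi), shift, shift, rename_subst, subst_rename]
      congr 1
      funext j
      rw [Nat.add_comm j, sub_ge]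

theorem assoc {Θ Γ As : List (Ty S.Ob)} {B : Ty S.Ob} (f : LTerm S As B)
    (gs : Args (LTerm S) Γ As) (hs : Args (LTerm S) Θ Γ) :
    comp (comp f gs) hs = comp f (gs.bind comp hs) := LTerm.ext (by
  simp only [comp]
  rw [LTm.subst_subst]
  exact f.subst_congr fun i hi => (sub_bind gs hs i hi).symm)

/-- The term `x₁ ⊗ ⋯ ⊗ xₙ`. -/
def tens (As : List (Ty S.Ob)) : LTerm S As (.tens As) :=
  ⟨.tens As fun i => .var i, by
    have h := Typed.tens As (fun i => .var i) (fun i => [((i : ℕ), As.get i)]) fun i => .var _ _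
    have e : ∀ k (As : List (Ty S.Ob)),
        (List.ofFn fun i : Fin As.length => [(k + (i : ℕ), As.get i)]).flatten = names k As := by
      intro k As
      induction As generalizing k with
      | nil => rfl
      | cons A As ih =>
        rw [names, ← ih (k + 1)]
        simp [List.ofFn_succ, Nat.add_assoc, Nat.add_comm 1]
    have e0 := e 0 As
    simp only [Nat.zero_add] at e0
    rwa [e0] at h⟩

/-- The term `c(x₁, …, xₙ)`. -/
def con {As : List S.Ob} {B : S.Ob} (c : S.con As B) : LTerm S (As.map .base) (.base B) :=
  ⟨.con c fun i => .var i, by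
    have h := Typed.con c (fun i => .var i) (fun i => [((i : ℕ), Ty.base (As.get i))]) fun i =>
      .var _ _
    have e : ∀ k (As : List S.Ob), (List.ofFn fun i : Fin As.length =>
        [(k + (i : ℕ), Ty.base (As.get i))]).flatten = names (S := S) k (As.map .base) := by
      intro k As
      induction As generalizing k with
      | nil => rfl
      | cons A As ih =>
        rw [List.map_cons, names, ← ih (k + 1)]
        simp [List.ofFn_succ, Nat.add_assoc, Nat.add_comm 1]
    have e0 := e 0 As
    simp only [Nat.zero_add] at e0
    rwa [e0] at h⟩

/-- Renaming of the body of a `let` in the context `Λ, x₁, …, xₙ, Ψ` that makes the variables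
`x₁, …, xₙ` the bound indices; `l`, `n`, `d` are the lengths of `Λ`, of the bound variables and of the
context of the term that is decomposed. -/
def place (l n d i : ℕ) : ℕ := if i < l then i + n else if i < l + n then i - l else i + d

/-- The term `let (x₁, …, xₙ) be s in t`. -/
def letT {Δ : List (Ty S.Ob)} {B : Ty S.Ob} (Λ Ψ As : List (Ty S.Ob)) (s : LTerm S Δ (.tens As))
    (t : LTerm S (Λ ++ (As ++ Ψ)) B) : LTerm S (Λ ++ (Δ ++ Ψ)) B :=
  ⟨.letT As (s.1.shift Λ.length) (t.1.rename (place Λ.length As.length Δ.length)), by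
    have hs := s.2.rename (· + Λ.length)
    have ht := t.2.rename (place Λ.length As.length Δ.length)
    rw [names_shift, Nat.zero_add] at hs
    have e₁ : (names (S := S) 0 Λ).rename (place Λ.length As.length Δ.length) =
        (names 0 Λ).rename (· + As.length) :=
      List.map_congr_left fun p hp => by simp [place, lt_of_mem_names hp]
    have e₂ : (names (S := S) Λ.length As).rename (place Λ.length As.length Δ.length) =
        names 0 As := by
      rw [show Λ.length = 0 + Λ.length by omega, ← names_shift, Ctx.rename, Ctx.rename,
        List.map_map]
      refine (List.map_congr_left fun p hp => ?_).trans (List.map_id _)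
      have := lt_of_mem_names hp
      have h₁ : ¬ p.1 + Λ.length < Λ.length := by omega
      have h₂ : p.1 + Λ.length < Λ.length + As.length := by omega
      simp [place, h₁, h₂]
    have e₃ : (names (S := S) (Λ.length + As.length) Ψ).rename
        (place Λ.length As.length Δ.length) =
        (names (Λ.length + Δ.length) Ψ).rename (· + As.length) := by
      rw [show Λ.length + As.length = 0 + (Λ.length + As.length) by omega, ← names_shift,
        show Λ.length + Δ.length = 0 + (Λ.length + Δ.length) by omega, ← names_shift]
      simp only [Ctx.rename, List.map_map]
      refine List.map_congr_left fun p _ => ?_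
      have h₁ : ¬ p.1 + (Λ.length + As.length) < Λ.length := by omega
      have h₂ : ¬ p.1 + (Λ.length + As.length) < Λ.length + As.length := by omega
      simp [place, h₁, h₂]; omega
    rw [names_append, names_append] at ht ⊢
    simp only [Nat.zero_add] at ht ⊢
    refine .letT _ _ _ hs ?_
    rw [← e₁, ← e₂, ← e₃]
    simpa [Ctx.rename] using ht⟩

theorem letT_comp {Θ₁ Θ₂ Θ₃ Δ : List (Ty S.Ob)} {B : Ty S.Ob} (Λ Ψ As : List (Ty S.Ob))
    (s : LTerm S Δ (.tens As)) (t : LTerm S (Λ ++ (As ++ Ψ)) B) (σ₁ : Args (LTerm S) Θ₁ Λ)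
    (σ₂ : Args (LTerm S) Θ₂ Δ) (σ₃ : Args (LTerm S) Θ₃ Ψ) :
    comp (letT Λ Ψ As s t) (.app σ₁ (.app σ₂ σ₃)) =
      letT Θ₁ Θ₃ As (comp s σ₂) (comp t (.app σ₁ (.app (.ones var As) σ₃))) := LTerm.ext (by
  have hl : ∀ n (σ : ℕ → LTm S) i, lifts n σ (i + n) = (σ i).shift n := fun n σ i => by
    simp [lifts]
  have h₁ : ∀ i < Λ.length, sub (.app σ₁ (.app σ₂ σ₃)) i = sub σ₁ i := sub_lt _ _
  have h₂ : ∀ i < Δ.length, sub (.app σ₁ (.app σ₂ σ₃)) (i + Λ.length) =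
      (sub σ₂ i).shift Θ₁.length := fun i hi => by
    rw [Nat.add_comm, sub_ge, sub_lt _ _ i hi]
  have h₃ : ∀ i, sub (.app σ₁ (.app σ₂ σ₃)) (Λ.length + (Δ.length + i)) =
      ((sub σ₃ i).shift Θ₂.length).shift Θ₁.length := fun i => by
    rw [sub_ge, sub_ge]
  have k₁ : ∀ i < Λ.length, sub (.app σ₁ (.app (.ones var As) σ₃)) i = sub σ₁ i := sub_lt _ _
  have k₂ : ∀ i < As.length, sub (.app σ₁ (.app (.ones var As) σ₃)) (Λ.length + i) =
      .var (i + Θ₁.length) := fun i hi => by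
    rw [sub_ge, sub_lt _ _ i hi, sub_ones]; rfl
  have k₃ : ∀ i, sub (.app σ₁ (.app (.ones var As) σ₃)) (Λ.length + (As.length + i)) =
      ((sub σ₃ i).shift As.length).shift Θ₁.length := fun i => by
    rw [sub_ge, sub_ge]
  have hs : (s.1.shift Λ.length).subst (sub (.app σ₁ (.app σ₂ σ₃))) =
      (s.1.subst (sub σ₂)).shift Θ₁.length := by
    rw [shift, shift, subst_rename, rename_subst]
    exact s.subst_congr h₂
  have ht : (t.1.rename (place Λ.length As.length Δ.length)).subst
        (lifts As.length (sub (.app σ₁ (.app σ₂ σ₃)))) =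
      (t.1.subst (sub (.app σ₁ (.app (.ones var As) σ₃)))).rename
        (place Θ₁.length As.length Θ₂.length) := by
    rw [subst_rename, rename_subst]
    refine t.subst_congr fun i hi => ?_
    rw [List.length_append, List.length_append] at hi
    rcases Nat.lt_or_ge i Λ.length with hΛ | hΛ
    · rw [k₁ i hΛ, place, if_pos hΛ, hl, h₁ i hΛ]
      obtain ⟨A, hA⟩ : ∃ A, Λ[i]? = some A := ⟨_, List.getElem?_eq_getElem hΛ⟩
      have hm : (i, A) ∈ names 0 Λ := mem_names.2 ⟨Nat.zero_le _, hA⟩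
      rw [shift]
      refine LTm.rename_congr (sub_typed σ₁ _ hm) fun p hp => ?_
      have : p ∈ names 0 Θ₁ := by
        rw [← flatMap_subCtx σ₁]; exact List.mem_flatMap.2 ⟨_, hm, hp⟩
      rw [place, if_pos (lt_of_mem_names this)]
    · obtain ⟨i, rfl⟩ := Nat.exists_eq_add_of_le hΛ
      rcases Nat.lt_or_ge i As.length with hA | hA
      · rw [k₂ i hA, place, if_neg (by omega), if_pos (by omega), LTm.rename, place,
          if_neg (by omega), if_pos (by omega), lifts, if_pos (by omega)]
        congr 1; omega
      · obtain ⟨i, rfl⟩ := Nat.exists_eq_add_of_le hA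
        rw [k₃ i, place, if_neg (by omega), if_neg (by omega),
          show Λ.length + (As.length + i) + Δ.length = Λ.length + (Δ.length + i) + As.length by
            omega, hl, h₃]
        simp only [shift, rename_rename]
        congr 1
        funext j
        rw [place, if_neg (by omega), if_neg (by omega)]
        omega
  exact congrArg₂ (LTm.letT As) hs ht)

/-- The renaming of variables given by a permutation of contexts. -/
def permIdx {Γ Γ' : List (Ty S.Ob)} (p : CtxPerm Γ Γ') (i : ℕ) : ℕ :=
  if h : i < Γ.length then p.σ.symm ⟨i, h⟩ else i

theorem permIdx_of_lt {Γ Γ' : List (Ty S.Ob)} (p : CtxPerm Γ Γ') {i : ℕ} (h : i < Γ.length) :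
    permIdx p i = p.σ.symm ⟨i, h⟩ := dif_pos h

theorem permIdx_symm {Γ Γ' : List (Ty S.Ob)} (p : CtxPerm Γ Γ') (j : Fin Γ'.length) :
    permIdx p (p.σ j) = j := by
  rw [permIdx_of_lt p (p.σ j).2]; simp

theorem perm_names {Γ Γ' : List (Ty S.Ob)} (p : CtxPerm Γ Γ') :
    ((names (S := S) 0 Γ).rename (permIdx p)).Perm (names 0 Γ') := by
  have hinj : ((names (S := S) 0 Γ).rename (permIdx p)).Nodup := by
    refine List.Nodup.map_on ?_ (nodup_names 0 Γ)
    rintro ⟨i, A⟩ hi ⟨j, B⟩ hj h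
    simp only [Prod.mk.injEq] at h
    rw [permIdx_of_lt p (lt_of_mem_names hi), permIdx_of_lt p (lt_of_mem_names hj)] at h
    have := p.σ.symm.injective (Fin.ext h.1)
    simp only [Fin.mk.injEq] at this
    rw [this, h.2]
  refine (List.perm_ext_iff_of_nodup hinj (nodup_names 0 Γ')).2 ?_
  rintro ⟨j, B⟩
  simp only [Ctx.rename, List.mem_map, mem_names, Nat.zero_le, true_and, Nat.sub_zero,
    List.getElem?_eq_some_iff, Prod.mk.injEq, Prod.exists]
  constructor
  · rintro ⟨i, A, ⟨hi, hA⟩, rfl, rfl⟩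
    rw [← hA]
    have := p.get_eq (p.σ.symm ⟨i, hi⟩)
    simp only [Equiv.apply_symm_apply, List.get_eq_getElem] at this
    simp only [permIdx_of_lt p hi]
    exact ⟨(p.σ.symm ⟨i, hi⟩).2, this⟩
  · rintro ⟨hj, rfl⟩
    exact ⟨p.σ ⟨j, hj⟩, _, ⟨(p.σ ⟨j, hj⟩).2, rfl⟩, permIdx_symm p ⟨j, hj⟩, (p.get_eq ⟨j, hj⟩).symm⟩

/-- A permutation of contexts renames the variables. -/
def act {Γ Γ' : List (Ty S.Ob)} {B : Ty S.Ob} (p : CtxPerm Γ Γ') (t : LTerm S Γ B) :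
    LTerm S Γ' B :=
  ⟨t.1.rename (permIdx p), (t.2.rename _).perm (perm_names p)⟩

theorem act_refl {Γ : List (Ty S.Ob)} {B : Ty S.Ob} (t : LTerm S Γ B) : act (.refl Γ) t = t :=
  LTerm.ext ((t.rename_congr fun i hi => permIdx_of_lt (.refl Γ) hi).trans (rename_id t.1))

theorem act_trans {Γ Γ' Γ'' : List (Ty S.Ob)} {B : Ty S.Ob} (p : CtxPerm Γ Γ')
    (q : CtxPerm Γ' Γ'') (t : LTerm S Γ B) : act (p.trans q) t = act q (act p t) :=
  LTerm.ext (by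
    refine (t.rename_congr (ρ' := fun i => permIdx q (permIdx p i)) fun i hi => ?_).trans (rename_rename t.1 _ _).symm
    rw [permIdx_of_lt p hi, permIdx_of_lt q (Fin.is_lt _), permIdx_of_lt _ hi]
    rfl)

theorem sub_get {Γ As : List (Ty S.Ob)} (ts : Args (LTerm S) Γ As) (i : Fin As.length) :
    sub ts i = (ts.get i).1.shift (ts.offset i) := by
  induction ts with
  | nil => exact i.elim0
  | cons t ts h ih =>
    match i with
    | ⟨0, _⟩ => exact (rename_id _).symm
    | ⟨i + 1, hi⟩ =>
      refine (congrArg (LTm.shift _) (ih ⟨i, Nat.lt_of_succ_lt_succ hi⟩)).trans ?_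
      rw [shift, shift, rename_rename]
      refine congrArg (fun ρ => LTm.rename ρ _) ?_
      funext j
      change j + _ + _ = j + (_ + _)
      omega

theorem tm_congr {Γ : List (Ty S.Ob)} {A A' : Ty S.Ob} (h : A = A') {t : LTerm S Γ A}
    {t' : LTerm S Γ A'} (ht : HEq t t') : t.tm = t'.tm := by
  subst h; rw [eq_of_heq ht]

theorem offset_add_lt {Γ As : List (Ty S.Ob)} (ts : Args (LTerm S) Γ As) (i : Fin As.length)
    (j : Fin (ts.dom i).length) : ts.offset i + j < Γ.length := by
  induction ts with
  | nil => exact i.elim0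
  | cons t ts h ih =>
    subst h
    rw [List.length_append]
    match i with
    | ⟨0, _⟩ => have := j.2; simp only [Args.offset, Args.dom] at this ⊢; omega
    | ⟨i + 1, hi⟩ =>
      have := ih ⟨i, Nat.lt_of_succ_lt_succ hi⟩ j
      simp only [Args.offset] at this ⊢; omega

theorem comp_act {As As' Γ Γ' : List (Ty S.Ob)} {B : Ty S.Ob} (f : LTerm S As B)
    (gs : Args (LTerm S) Γ As) (gs' : Args (LTerm S) Γ' As') (p : CtxPerm As As')
    (τ : ∀ i, CtxPerm (gs.dom (p.σ i)) (gs'.dom i)) (q : CtxPerm Γ Γ')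
    (h : ∀ i, HEq (gs'.get i) (act (τ i) (gs.get (p.σ i))))
    (hq : ∀ i (j : Fin (gs'.dom i).length) (k : Fin Γ'.length), (k : ℕ) = gs'.offset i + j →
      (q.σ k : ℕ) = gs.offset (p.σ i) + (τ i).σ j) :
    comp (act p f) gs' = act q (comp f gs) := LTerm.ext (by
  change (f.1.rename (permIdx p)).subst (sub gs') = (f.1.subst (sub gs)).rename (permIdx q)
  rw [subst_rename, rename_subst]
  refine f.subst_congr fun k hk => ?_
  obtain ⟨i, hi⟩ := p.σ.surjective ⟨k, hk⟩
  obtain rfl : (p.σ i : ℕ) = k := congrArg Fin.val hi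
  rw [permIdx_symm, sub_get, sub_get, tm_congr (p.get_eq i) (h i)]
  change ((gs.get (p.σ i)).1.rename (permIdx (τ i))).rename _ = _
  rw [shift, rename_rename, rename_rename]
  refine (gs.get (p.σ i)).rename_congr fun j hj => ?_
  obtain ⟨j', hj'⟩ := (τ i).σ.surjective ⟨j, hj⟩
  obtain rfl : ((τ i).σ j' : ℕ) = j := congrArg Fin.val hj'
  have := hq i j' ⟨_, offset_add_lt gs' i j'⟩ rfl
  rw [permIdx_symm, Nat.add_comm _ (gs.offset _), ← this, permIdx_symm, Nat.add_comm])

end LTerm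

/-- The multicategory of linear terms under substitution. -/
def LMulticat (S : Sig.{u}) : Multicat.{u} where
  Ob := Ty S.Ob
  Hom := LTerm S
  one := .var
  comp := LTerm.comp
  one_comp := LTerm.one_comp
  comp_one := LTerm.comp_one
  assoc := LTerm.assoc

/-- Exchange makes it a symmetric multicategory. -/
def LExch (S : Sig.{u}) : (LMulticat S).Symmetry where
  act := LTerm.act
  act_refl := LTerm.act_refl
  act_trans := LTerm.act_trans
  comp_act := LTerm.comp_act

/-- The linear tensor calculus over a signature. -/
def LCalc (S : Sig.{u}) : Calculus.{u} where
  toMulticat := LMulticat S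
  T := .tens
  tens := LTerm.tens
  letT := LTerm.letT
  letT_comp := LTerm.letT_comp
  exch := some (LExch S)

/-- The syntactic symmetric representable multicategory of the linear tensor calculus. -/
noncomputable def LSyn (S : Sig.{u}) : SRepMulticat.{u} where
  toRepMulticat := (LCalc S).syn
  symmetry := (LCalc S).synSymmetry (LExch S) rfl

/-- A constant `c` is interpreted as the term `c(x₁, …, xₙ)`. -/
noncomputable def LSyn.incl (S : Sig.{u}) : S ⟶ SRepMulticat.U.obj (LSyn S) :=
  Sig.Fun.mk (S' := SRepMulticat.U.obj (LSyn S)) Ty.base fun c =>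
    Calculus.SynHom.mk (K := LCalc S) (LTerm.con c)

end Multi

namespace Multi
open CategoryTheory MonoidalCategory NaryTensor

/-! ## The multicategory of a monoidal category -/

/-- The operations of a representable multicategory. -/
structure RepData extends MulticatData.{u} where
  T : List Ob → Ob
  univ : ∀ Γ, Hom Γ (T Γ)

/-- The operations of a representable multicategory. -/
def RepMulticat.data (M : RepMulticat.{u}) : RepData.{u} where
  toMulticatData := M.toMulticatData
  T := M.T
  univ := M.univ

/-- A permutation of a list extended by a fixed first entry. -/
def CtxPerm.cons {O : Type u} {Γ Γ' : List O} (A : O) (p : CtxPerm Γ Γ') :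
    CtxPerm (A :: Γ) (A :: Γ') where
  σ := (finSuccEquiv Γ'.length).trans (p.σ.optionCongr.trans (finSuccEquiv Γ.length).symm)
  get_eq i := by
    cases i using Fin.cases with
    | zero => simp
    | succ i => simpa using p.get_eq i

/-- The transposition of two adjacent entries. -/
def CtxPerm.swap {O : Type u} (Ψ : List O) (A B : O) :
    (Λ : List O) → CtxPerm (Λ ++ A :: B :: Ψ) (Λ ++ B :: A :: Ψ)
  | [] =>
    { σ := Equiv.swap ⟨0, Nat.succ_pos _⟩ ⟨1, Nat.succ_lt_succ (Nat.succ_pos _)⟩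
      get_eq := fun i => match i with
        | ⟨0, _⟩ => by simp
        | ⟨1, _⟩ => by simp
        | ⟨i + 2, _⟩ => by
          rw [Equiv.swap_apply_of_ne_of_ne (by simp) (by simp)]; rfl }
  | X :: Λ => (CtxPerm.swap Ψ A B Λ).cons X

/-- The operations of a symmetric representable multicategory, where the action is recorded on the
adjacent transpositions, which determine it. -/
structure SRepData extends RepData.{u} where
  swap : ∀ (Λ Ψ : List Ob) (A B : Ob) {C : Ob}, Hom (Λ ++ A :: B :: Ψ) C → Hom (Λ ++ B :: A :: Ψ) C

/-- The operations of a symmetric representable multicategory. -/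
def SRepMulticat.data (M : SRepMulticat.{u}) : SRepData.{u} where
  toRepData := M.toRepMulticat.data
  swap Λ Ψ A B := M.symmetry.act (.swap Ψ A B Λ)

section
variable {C : Type u} [Category.{u} C] [MonoidalCategory C]

/-- The canonical isomorphism from the iterated tensor product of a concatenation. -/
def foldAppend : (Γ Δ : List C) → (fold (Γ ++ Δ) ≅ fold Γ ⊗ fold Δ)
  | [], Δ => (λ_ (fold Δ)).symm
  | A :: Γ, Δ => whiskerLeftIso A (foldAppend Γ Δ) ≪≫ (α_ A (fold Γ) (fold Δ)).symm

/-- The symmetry applied to two adjacent factors of an iterated tensor product. -/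
def foldSwap [BraidedCategory C] (Ψ : List C) (A B : C) :
    (Λ : List C) → (fold (Λ ++ B :: A :: Ψ) ⟶ fold (Λ ++ A :: B :: Ψ))
  | [] => (α_ B A (fold Ψ)).inv ≫ ((β_ B A).hom ▷ fold Ψ) ≫ (α_ A B (fold Ψ)).hom
  | X :: Λ => X ◁ foldSwap Ψ A B Λ

variable [NaryTensor C]

/-- The tensor product of a list of multimaps `⨂ Γᵢ ⟶ Aᵢ`. -/
def foldArgs : {Γ As : List C} → Args (fun Γ (B : C) => (tens Γ : C) ⟶ B) Γ As → (fold Γ ⟶ fold As)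
  | _, _, .nil => 𝟙 _
  | _, _, .cons (Γ := Γ) (Δ := Δ) f fs h =>
    eqToHom (congrArg fold h) ≫ (foldAppend Γ Δ).hom ≫ (((bracket Γ).inv ≫ f) ⊗ₘ foldArgs fs)
end

/-- The multicategory of a monoidal category: multimaps from `Γ` to `B` are morphisms from the tensor
product of `Γ` to `B`, and the universal arrows are the identities. -/
def TensorCat.tensorData (C : TensorCat.{u}) : RepData.{u} where
  Ob := C.carrier
  Hom Γ B := tens Γ ⟶ B
  one A := (bracket [A]).hom ≫ (ρ_ A).hom
  comp {Γ As _} f gs := (bracket Γ).hom ≫ foldArgs gs ≫ (bracket As).inv ≫ f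
  T := tens
  univ Γ := 𝟙 (tens Γ)

/-- The action of an adjacent transposition on the multimaps of a symmetric monoidal category. -/
def STensorCat.swapData (C : STensorCat.{u}) (Λ Ψ : List C.carrier) (A B : C.carrier)
    {D : C.carrier} (f : (tens (Λ ++ A :: B :: Ψ) : C.carrier) ⟶ D) :
    (tens (Λ ++ B :: A :: Ψ) : C.carrier) ⟶ D :=
  (bracket (Λ ++ B :: A :: Ψ)).hom ≫ foldSwap Ψ A B Λ ≫ (bracket (Λ ++ A :: B :: Ψ)).inv ≫ f

/-- The symmetric multicategory of a symmetric monoidal category. -/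
def STensorCat.tensorData (C : STensorCat.{u}) : SRepData.{u} where
  toRepData := C.toTensorCat.tensorData
  swap := C.swapData

/-- The comparison of the underlying signatures of `M` and of its nucleus, as in the non-symmetric
case. -/
noncomputable def SRepMulticat.kappa (M : SRepMulticat.{u}) :
    SRepMulticat.U.obj M ⟶ STensorCat.V.obj (SRepMulticat.N.obj M) :=
  M.toRepMulticat.kappa

end Multi

-- Everything rests on two facts: the syntactic multicategories are free, and a representable
-- multicategory is the same thing as its nucleus. The rest is formal. The equivalence carries a
-- universal arrow from `S` to `U` to a universal arrow from `S` to `V = U ∘ T`, and universal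
-- arrows with the same source are uniquely isomorphic.
--
-- Freeness, ordered case. A universal arrow `v : Γ → R` of a representable multicategory is
-- universal in every context (`RepMulticat.isStrong`): universal arrows are closed under ⊗, so the
-- iterated tensor of a context stays universal after one slot has been filled with `v`, and
-- multimaps out of both contexts are unary maps out of one object. Hence every `t : Λ, Γ, Ψ → B` is
-- `e ∘ (1, v, 1)` for a unique `e`, and `let` is interpreted as `e ∘ (1, s, 1)`. With this reading
-- the β and η equations hold (`Calculus.Model.sound`). Ordered terms are derivations, so the
-- interpretation is a plain recursion. Conversely, uniqueness of `e` forces the value of a functor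
-- on `let` (`Calculus.agree_letT`), and composition forces it on the other term formers.
--
-- Freeness, linear case. Exchange leaves no trace in a raw term, so a recursion over typing
-- derivations would not obviously be well defined. Instead a relation `LTm.Den` is defined by
-- recursion on raw terms: a multimap whose inputs are labelled by variable names is denoted by a
-- term. The relation is stable under permuting inputs together with their labels, total on typed
-- terms (`LTm.Typed.exists_den`), and single-valued up to a label-preserving permutation
-- (`LTm.Den.unique`). For distinct labels that permutation is the identity, so a function results,
-- and each of its laws is proved by exhibiting one denotation.
--
-- The equivalence. Composition in `T C` uses the tensor product `foldArgs` of a list of multimaps;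
-- its functoriality comes down to associativity of the isomorphisms `foldAppend`. The comparison `t
-- ↦ t^#` from `M` to `T (N M)` is a functor because, after precomposition with universal arrows,
-- the structural isomorphisms of the nucleus merely rebracket tensor products
-- (`RepMulticat.ext_comp`). The comparison from `C` to `N (T C)` sends `f` to its composite with
-- the isomorphism from the unary tensor product of its domain; it is strict because structural maps
-- of a nucleus are determined by their composites with universal arrows, which can be computed in
-- `C` (`TensorCat.emb_heq`). Both comparisons are bijective on objects and on maps, and their
-- inverses preserve the structure automatically.
--
-- The symmetric equivalence. All permutations must act on iterated tensor products, independently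
-- of how they are decomposed into transpositions. The factors are given distinct labels, and a
-- permutation is realised by inserting the factors one after the other (`Reorder`). The labels make
-- the resulting morphism unique (`Reorder.unique`), and the Yang–Baxter equation makes such
-- morphisms compose (`Reorder.trans`). Permutations of whole blocks are again reorderings, which
-- gives equivariance of composition (`mcomp_mact`).

namespace Multi

/-! ## Restriction of a multicategory along a map of objects -/

namespace Args
variable {O O' : Type u} {H : List O → O → Type u} {H' : List O' → O' → Type u}

theorem app_congr {Γ Γ' Δ Δ' As As' Bs Bs' : List O} {a : Args H Γ As} {a' : Args H Γ' As'}
    {b : Args H Δ Bs} {b' : Args H Δ' Bs'} (hΓ : Γ = Γ') (hΔ : Δ = Δ') (hA : As = As')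
    (hB : Bs = Bs') (ha : HEq a a') (hb : HEq b b') : HEq (app a b) (app a' b') := by
  subst hΓ hΔ hA hB; obtain rfl := eq_of_heq ha; obtain rfl := eq_of_heq hb; rfl

theorem map_app (o : O → O') (φ : ∀ {Γ A}, H Γ A → H' (Γ.map o) (o A)) {Γ Δ As Bs : List O}
    (a : Args H Γ As) (b : Args H Δ Bs) :
    HEq ((app a b).map o φ) (app (a.map o φ) (b.map o φ)) := by
  induction a with
  | nil => rfl
  | cons f fs h ih => exact cons_congr rfl (by simp) rfl (by simp) HEq.rfl ih

theorem map_ones (o : O → O') (φ : ∀ {Γ A}, H Γ A → H' (Γ.map o) (o A)) {one : ∀ A, H [A] A}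
    {one' : ∀ A, H' [A] A} (h : ∀ A, φ (one A) = one' (o A)) :
    ∀ As : List O, (ones one As).map o φ = ones one' (As.map o)
  | [] => rfl
  | A :: As => by
    simp only [ones, map, map_ones o φ h As, h]
    rfl

theorem map_bind (o : O → O') (φ : ∀ {Γ A}, H Γ A → H' (Γ.map o) (o A))
    {comp : ∀ {Γ As : List O} {B : O}, H As B → Args H Γ As → H Γ B}
    {comp' : ∀ {Γ As : List O'} {B : O'}, H' As B → Args H' Γ As → H' Γ B}
    (h : ∀ {Γ As : List O} {B : O} (f : H As B) (gs : Args H Γ As),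
      φ (comp f gs) = comp' (φ f) (gs.map o φ))
    {Θ Γ As : List O} (fs : Args H Γ As) (gs : Args H Θ Γ) :
    (bind comp fs gs).map o φ = bind comp' (fs.map o φ) (gs.map o φ) := by
  induction fs generalizing Θ with
  | nil => cases gs; rfl
  | cons f fs e ih =>
    subst e
    obtain ⟨Θ₁, Θ₂, a, b, rfl, hh⟩ := app_cases _ gs
    obtain rfl := eq_of_heq hh
    rw [bind_cons comp f fs rfl _ a b rfl HEq.rfl]
    refine Eq.trans ?_ (bind_cons comp' (φ f) (fs.map o φ) List.map_append _ (a.map o φ)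
      (b.map o φ) List.map_append (map_app o φ a b)).symm
    simp only [map, h, ih]

theorem map_mapHom {H₁ : List O → O → Type u} (o : O → O') (ψ : ∀ {Γ A}, H₁ Γ A → H Γ A)
    (φ : ∀ {Γ A}, H Γ A → H' (Γ.map o) (o A)) {Γ As : List O} (fs : Args H₁ Γ As) :
    (fs.mapHom ψ).map o φ = fs.map o (fun f => φ (ψ f)) := by
  induction fs with
  | nil => rfl
  | cons f fs h ih => simp only [mapHom, map, ih]

/-- A predicate holds for all members of a list of multimaps. -/
def All (P : ∀ {Γ A}, H Γ A → Prop) : {Γ As : List O} → Args H Γ As → Prop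
  | _, _, nil => True
  | _, _, cons f fs _ => P f ∧ All P fs

theorem All.app {P : ∀ {Γ A}, H Γ A → Prop} {Γ Δ As Bs : List O} {a : Args H Γ As}
    {b : Args H Δ Bs} (ha : a.All P) (hb : b.All P) : (Args.app a b).All P := by
  induction a with
  | nil => exact hb
  | cons f fs h ih => exact ⟨ha.1, ih ha.2⟩

theorem All.ones {P : ∀ {Γ A}, H Γ A → Prop} {one : ∀ A, H [A] A} (h : ∀ A, P (one A)) :
    ∀ As : List O, (Args.ones one As).All P
  | [] => trivial
  | A :: As => ⟨h A, All.ones h As⟩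

end Args

/-- The multicategory with objects `O` obtained by restriction along `o`. -/
@[reducible] def Multicat.pullback (M : Multicat.{u}) {O : Type u} (o : O → M.Ob) :
    Multicat.{u} where
  Ob := O
  Hom Γ B := M.Hom (Γ.map o) (o B)
  one A := M.one (o A)
  comp f gs := M.comp f (gs.map o fun f => f)
  one_comp f := M.one_comp f
  comp_one {Γ _} f := by
    rw [Args.map_ones o (fun f => f) (fun _ => rfl)]
    exact M.comp_one f
  assoc f gs hs := by
    rw [M.assoc, Args.map_bind (H' := M.Hom) o (fun f => f) (comp' := M.comp) (fun _ _ => rfl)]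

-- Universality in context and the `let` it defines.

namespace Multicat

section Strong
variable {M : Multicat.{u}} {Γ : List M.Ob} {R : M.Ob} {v : M.Hom Γ R}

/-- Mapping a context along `o` distributes over `++` only propositionally, so bijectivity of
precomposition has to be transported along equalities of both contexts. -/
theorem exists_unique_congr {X X' Y Y' : List M.Ob} {B : M.Ob} {gs : Args M.Hom Y X}
    {gs' : Args M.Hom Y' X'} (hX : X = X') (hY : Y = Y') (h : HEq gs gs')
    (H : ∀ t : M.Hom Y' B, ∃! e : M.Hom X' B, M.comp e gs' = t) (t : M.Hom Y B) :
    ∃! e : M.Hom X B, M.comp e gs = t := by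
  subst hX hY; obtain rfl := eq_of_heq h; exact H t

/-- A context of the restricted multicategory is an image under `o`, so its universal property is an
instance of the one in `M`. -/
theorem IsStrong.pullback {O : Type u} {o : O → M.Ob} {Γ : List O} {R : O}
    {v : M.Hom (Γ.map o) (o R)} (hv : M.IsStrong v) :
    (M.pullback o).IsStrong (Γ := Γ) (R := R) v := by
  intro Λ Ψ B t
  refine exists_unique_congr (gs' := .app (.ones M.one (Λ.map o)) (.app (.single v)
    (.ones M.one (Ψ.map o)))) (by simp) (by simp) ?_ (fun t => hv _ _ _ t) t
  refine (Args.map_app o _ _ _).trans (Args.app_congr rfl (by simp) rfl (by simp) ?_ ?_)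
  · exact heq_of_eq (Args.map_ones o _ (fun _ => rfl) _)
  · refine (Args.map_app o _ _ _).trans (Args.app_congr rfl rfl rfl rfl HEq.rfl ?_)
    exact heq_of_eq (Args.map_ones o _ (fun _ => rfl) _)

/-- The composite `let (x₁, …, xₙ) be s in t` defined by a strongly universal arrow. -/
noncomputable def IsStrong.lett (hv : M.IsStrong v) {Δ : List M.Ob} {B : M.Ob} (Λ Ψ : List M.Ob)
    (s : M.Hom Δ R) (t : M.Hom (Λ ++ (Γ ++ Ψ)) B) : M.Hom (Λ ++ (Δ ++ Ψ)) B :=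
  M.comp (hv Λ Ψ B t).choose (.app (.ones M.one Λ) (.app (.single s) (.ones M.one Ψ)))

/-- Frees the composite from the choice in its definition: by uniqueness any factorisation of the
body may be used. -/
theorem IsStrong.lett_eq (hv : M.IsStrong v) {Δ : List M.Ob} {B : M.Ob} {Λ Ψ : List M.Ob}
    {s : M.Hom Δ R} {t : M.Hom (Λ ++ (Γ ++ Ψ)) B} (e : M.Hom (Λ ++ ([R] ++ Ψ)) B)
    (he : M.comp e (.app (.ones M.one Λ) (.app (.single v) (.ones M.one Ψ))) = t) :
    hv.lett Λ Ψ s t =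
      M.comp e (.app (.ones M.one Λ) (.app (.single s) (.ones M.one Ψ))) := by
  rw [IsStrong.lett, (hv Λ Ψ B t).unique (hv Λ Ψ B t).choose_spec.1 he]

theorem comp_app₃ {Θ₁ Θ₂ Θ₃ Λ Δ Ψ Λ' Ψ' : List M.Ob} {A B : M.Ob} (e : M.Hom (Λ' ++ ([A] ++ Ψ')) B)
    (a : Args M.Hom Λ Λ') (s : M.Hom Δ A) (b : Args M.Hom Ψ Ψ')
    (σ₁ : Args M.Hom Θ₁ Λ) (σ₂ : Args M.Hom Θ₂ Δ) (σ₃ : Args M.Hom Θ₃ Ψ) :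
    M.comp (M.comp e (.app a (.app (.single s) b))) (.app σ₁ (.app σ₂ σ₃)) =
      M.comp e (.app (a.bind M.comp σ₁) (.app (.single (M.comp s σ₂)) (b.bind M.comp σ₃))) := by
  rw [M.assoc, Args.bind_app, Args.bind_app, Args.bind_single]

theorem ones_bind {Γ As : List M.Ob} (fs : Args M.Hom Γ As) :
    (Args.ones M.one As).bind M.comp fs = fs := Args.ones_bind M.one_comp fs

theorem bind_ones {Γ As : List M.Ob} (fs : Args M.Hom Γ As) :
    fs.bind M.comp (Args.ones M.one Γ) = fs := Args.bind_ones M.comp_one fs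

/-- If `e` factors the body, then `e ∘ (σ₁, 1, σ₃)` factors the substituted body. This is the
semantic counterpart of the axiom `letT_comp`. -/
theorem IsStrong.lett_comp (hv : M.IsStrong v) {Θ₁ Θ₂ Θ₃ Δ : List M.Ob} {B : M.Ob}
    (Λ Ψ : List M.Ob) (s : M.Hom Δ R) (t : M.Hom (Λ ++ (Γ ++ Ψ)) B) (σ₁ : Args M.Hom Θ₁ Λ)
    (σ₂ : Args M.Hom Θ₂ Δ) (σ₃ : Args M.Hom Θ₃ Ψ) :
    M.comp (hv.lett Λ Ψ s t) (.app σ₁ (.app σ₂ σ₃)) =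
      hv.lett Θ₁ Θ₃ (M.comp s σ₂) (M.comp t (.app σ₁ (.app (.ones M.one Γ) σ₃))) := by
  obtain ⟨e, he, -⟩ := hv Λ Ψ B t
  have he : M.comp e _ = t := he
  rw [hv.lett_eq e he, comp_app₃, ones_bind, ones_bind,
    hv.lett_eq (M.comp e (.app σ₁ (.app (.single (M.one R)) σ₃))), comp_app₃, M.one_comp,
    bind_ones, bind_ones]
  rw [← he, comp_app₃, comp_app₃, M.one_comp, M.comp_one, ones_bind, ones_bind, bind_ones,
    bind_ones]

end Strong
end Multicat

-- Tensor products of universal arrows.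

namespace RepMulticat
open Multicat
variable (M : RepMulticat.{u})

/-- By `ten_comp` the composite is the iterated ⊗ of the members of `gs`, and ⊗ preserves
universality. -/
theorem isUniversal_comp_foldUniv {Γ As : List M.Ob} (gs : Args M.Hom Γ As)
    (h : gs.All fun {_ _} g => M.IsUniversal g) : M.IsUniversal (M.comp (M.foldUniv As) gs) := by
  induction gs with
  | nil =>
    have : M.comp (M.univ []) .nil = M.univ [] := M.comp_one (M.univ [])
    change M.IsUniversal (M.comp (M.univ []) .nil)
    rw [this]; exact M.univ_universal []
  | @cons Γ Δ Θ A As g gs e ih =>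
    subst e
    have : M.comp (M.foldUniv (A :: As)) (.cons g gs rfl) = M.ten g (M.comp (M.foldUniv As) gs) :=
      (M.ten_comp (M.one A) (M.foldUniv As) (.single g) gs).trans (by rw [M.one_comp])
    rw [this]
    exact M.isUniversal_ten h.1 (ih h.2)

/-- In a representable multicategory, universal arrows are universal in context. -/
theorem isStrong {Γ : List M.Ob} {R : M.Ob} {v : M.Hom Γ R} (hv : M.IsUniversal v) :
    M.IsStrong v := by
  intro Λ Ψ B t
  -- Two universal arrows into the same object: the iterated tensor `W` of `Λ, R, Ψ`, and `W` with
  -- `v` substituted for the entry `R`. The required `e` is the factorisation of `t` through the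
  -- second, composed with `W`.
  have hW := M.isUniversal_foldUniv (Λ ++ ([R] ++ Ψ))
  have hg := M.isUniversal_comp_foldUniv
    (.app (.ones M.one Λ) (.app (.single v) (.ones M.one Ψ)))
    ((Args.All.ones isUniversal_one Λ).app
      (Args.All.app (a := .single v) ⟨hv, trivial⟩ (Args.All.ones isUniversal_one Ψ)))
  obtain ⟨e, he, hu⟩ := hg B t
  refine ⟨M.comp e (.single (M.foldUniv _)), (M.comp_single _ _ _).trans he, fun e' he' => ?_⟩
  -- Every competitor factors through `W`, so uniqueness reduces to uniqueness through the second
  -- universal arrow.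
  rw [← hW.fac e'] at he' ⊢
  rw [hu _ ((M.comp_single _ _ _).symm.trans he')]

end RepMulticat

/-! ## Models of a calculus -/

/-- An interpretation of the terms of a calculus in a representable multicategory. -/
structure Calculus.Model (K : Calculus.{u}) (M : RepMulticat.{u}) where
  ob : K.Ob → M.Ob
  ob_T : ∀ As, ob (K.T As) = M.T (As.map ob)
  map : ∀ {Γ : List K.Ob} {B : K.Ob}, K.Hom Γ B → (M.pullback ob).Hom Γ B
  map_one : ∀ A, map (K.one A) = (M.pullback ob).one A
  map_comp : ∀ {Γ As : List K.Ob} {B : K.Ob} (f : K.Hom As B) (gs : Args K.Hom Γ As),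
    map (K.comp f gs) = (M.pullback ob).comp (map f) (gs.mapHom map)
  map_tens : ∀ As, HEq (map (K.tens As)) (M.univ (As.map ob))
  -- Asked for every factorisation `e` of the body instead of a chosen one, so that no choice enters
  -- the notion of a model.
  map_letT : ∀ {Δ : List K.Ob} {B : K.Ob} (Λ Ψ As : List K.Ob) (s : K.Hom Δ (K.T As))
    (t : K.Hom (Λ ++ (As ++ Ψ)) B) (e : (M.pullback ob).Hom (Λ ++ ([K.T As] ++ Ψ)) B),
    (M.pullback ob).comp e (.app (.ones (M.pullback ob).one Λ)
      (.app (.single (map (K.tens As))) (.ones (M.pullback ob).one Ψ))) = map t →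
    map (K.letT Λ Ψ As s t) = (M.pullback ob).comp e (.app (.ones (M.pullback ob).one Λ)
      (.app (.single (map s)) (.ones (M.pullback ob).one Ψ)))
  -- Soundness needs only that exchange respects equality of interpretations. The target therefore
  -- need not be symmetric, and one notion of model serves both calculi.
  map_exch : ∀ (Y : K.Symmetry), Y ∈ K.exch → ∀ {Γ Γ' : List K.Ob} {B : K.Ob} (p : CtxPerm Γ Γ')
    (t t' : K.Hom Γ B), map t = map t' → map (Y.act p t) = map (Y.act p t')

/-- The interpretation of a tensor type equals the representing object only propositionally, so
interpreted tuples are universal arrows up to `HEq`. -/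
theorem RepMulticat.univ_strong_cast (M : RepMulticat.{u}) {Γ : List M.Ob} {R : M.Ob}
    {v : M.Hom Γ R} (hR : R = M.T Γ) (hv : HEq v (M.univ Γ)) : M.IsStrong v := by
  subst hR; obtain rfl := eq_of_heq hv; exact M.isStrong (M.univ_universal Γ)

namespace Calculus.Model
variable {K : Calculus.{u}} {M : RepMulticat.{u}} (I : K.Model M)

theorem strong (As : List K.Ob) : (M.pullback I.ob).IsStrong (I.map (K.tens As)) :=
  Multicat.IsStrong.pullback (M.univ_strong_cast (I.ob_T As) (I.map_tens As))

theorem map_ctx {Γ As : List K.Ob} (Λ Ψ : List K.Ob) (ts : Args K.Hom Γ As) :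
    (Args.app (.ones K.one Λ) (.app ts (.ones K.one Ψ))).mapHom I.map =
      .app (.ones (M.pullback I.ob).one Λ) (.app (ts.mapHom I.map)
        (.ones (M.pullback I.ob).one Ψ)) := by
  have h : ∀ A, I.map (K.one A) = (M.pullback I.ob).one A := I.map_one
  simp only [Args.mapHom_app, Args.mapHom_ones, h]

/-- Let `e` be the factorisation of the interpreted body along the universal arrow `v`. Both sides
of β are `e ∘ (1, v ∘ ts, 1)`. For η the body is already presented as such a composite, so `I.map t`
itself is the factorisation. -/
theorem sound {Γ : List K.Ob} {B : K.Ob} {t t' : K.Hom Γ B} (h : K.Eqv t t') :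
    I.map t = I.map t' := by
  -- The congruence is defined mutually with its extension to lists, so the induction carries a
  -- second motive.
  refine Eqv.rec (motive_1 := fun {Γ B} t t' _ => I.map t = I.map t')
    (motive_2 := fun {Γ As} ts ts' _ => ts.mapHom I.map = ts'.mapHom I.map)
    (fun _ => rfl) (fun _ h => h.symm) (fun _ _ h h' => h.trans h') ?_ ?_ ?_ ?_ ?_ rfl ?_ h
  · exact fun Y hY p _ ih => I.map_exch Y hY p _ _ ih
  · intro _ _ _ _ _ _ _ _ _ h h'
    rw [I.map_comp, I.map_comp, h, h']
  · intro Δ B Λ Ψ As s s' t t' _ _ h h'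
    obtain ⟨e, he, -⟩ := I.strong As Λ Ψ B (I.map t)
    rw [I.map_letT Λ Ψ As s t e he, I.map_letT Λ Ψ As s' t' e (he.trans h'), h]
  · intro Δ B Λ Ψ As ts t
    obtain ⟨e, he, -⟩ := I.strong As Λ Ψ B (I.map t)
    rw [I.map_letT Λ Ψ As _ t e he, I.map_comp, I.map_comp, map_ctx, ← he]
    refine Eq.trans ?_ (Multicat.comp_app₃ (M := M.pullback I.ob) _ _ _ _ _ _ _).symm
    rw [Multicat.ones_bind, Multicat.ones_bind]
  · intro Δ B Λ Ψ As s t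
    rw [I.map_letT Λ Ψ As s _ (I.map t), I.map_comp, map_ctx]
    · rfl
    · rw [I.map_comp, map_ctx]; rfl
  · intro _ _ _ _ _ _ _ _ _ _ _ _ h h'
    simp only [Args.mapHom, h, h']

theorem _root_.Multi.Calculus.SynHom.exists_mapHom_mk {Γ As : List K.Ob}
    (qs : Args K.SynHom Γ As) : ∃ ts : Args K.Hom Γ As, qs = ts.mapHom SynHom.mk :=
  ⟨_, (SynHom.mapHom_mk_rep qs).symm⟩

/-- The map on equivalence classes induced by an interpretation. -/
def desc {Γ : List K.Ob} {B : K.Ob} : K.SynHom Γ B → M.Hom (Γ.map I.ob) (I.ob B) :=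
  Quotient.lift (s := K.setoid Γ B) I.map (fun _ _ h => I.sound h)

theorem map_desc {Γ As : List K.Ob} (ts : Args K.Hom Γ As) :
    (ts.mapHom SynHom.mk).map I.ob I.desc = (ts.mapHom I.map).map I.ob (fun f => f) :=
  (Args.map_mapHom (H := K.SynHom) (H' := M.Hom) I.ob SynHom.mk I.desc ts).trans
    (Args.map_mapHom (H := (M.pullback I.ob).Hom) (H' := M.Hom) I.ob I.map (fun f => f) ts).symm

/-- The functor induced by an interpretation. -/
def toRepFunctor : RepFunctor K.syn M where
  ob := I.ob
  map q := I.desc q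
  map_one A := I.map_one A
  map_comp {Γ As B} f gs := by
    induction f using Quotient.inductionOn with
    | h t =>
      obtain ⟨ts, rfl⟩ := SynHom.exists_mapHom_mk gs
      refine (congrArg _ (SynHom.comp_mk t ts)).trans ((I.map_comp _ _).trans ?_)
      exact congrArg (M.comp (I.map t)) (I.map_desc ts).symm
  ob_T := I.ob_T
  map_univ := I.map_tens

end Calculus.Model

/-! ## Interpretation of types -/

mutual
/-- The interpretation of types in a multicategory with objects `T Γ`. -/
def Ty.interp {O X : Type u} (b : O → X) (T : List X → X) : Ty O → X
  | .base a => b a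
  | .tens As => T (Ty.interps b T As)
def Ty.interps {O X : Type u} (b : O → X) (T : List X → X) : List (Ty O) → List X
  | [] => []
  | A :: As => Ty.interp b T A :: Ty.interps b T As
end

theorem Ty.interps_eq {O X : Type u} (b : O → X) (T : List X → X) (As : List (Ty O)) :
    Ty.interps b T As = As.map (Ty.interp b T) := by
  induction As with
  | nil => rfl
  | cons A As ih => rw [Ty.interps, ih]; rfl

theorem Ty.interp_tens {O X : Type u} (b : O → X) (T : List X → X) (As : List (Ty O)) :
    Ty.interp b T (.tens As) = T (As.map (Ty.interp b T)) := by
  rw [Ty.interp, Ty.interps_eq]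

theorem Ty.eq_interp {O X : Type u} (b : O → X) (T : List X → X) (f : Ty O → X)
    (hb : ∀ a, f (.base a) = b a) (hT : ∀ As, f (.tens As) = T (As.map f)) (A : Ty O) :
    f A = Ty.interp b T A := by
  -- Types are nested through lists, so the induction runs simultaneously over lists of types.
  refine Ty.rec (motive_1 := fun A => f A = Ty.interp b T A)
    (motive_2 := fun As => As.map f = Ty.interps b T As) hb ?_ rfl ?_ A
  · intro As h; rw [hT, h, Ty.interp]
  · intro A As h h'; rw [List.map_cons, h, h', Ty.interps]

/-- Two maps out of the types that agree on sorts and commute with tensors are equal. -/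
theorem Ty.hom_ext {O X : Type u} (T : List X → X) (f g : Ty O → X)
    (hb : ∀ a, f (.base a) = g (.base a)) (hT : ∀ As, f (.tens As) = T (As.map f))
    (hT' : ∀ As, g (.tens As) = T (As.map g)) : f = g := by
  funext A
  rw [Ty.eq_interp (fun a => g (.base a)) T f hb hT, Ty.eq_interp (fun a => g (.base a)) T g (fun _ => rfl) hT']

end Multi

namespace Multi

/-! ## Functors agreeing on generators -/

namespace RepFunctor
variable {N M : RepMulticat.{u}} {F G : RepFunctor N M}

/-- Two functors agree on a multimap. -/
def Agree (F G : RepFunctor N M) {Γ : List N.Ob} {B : N.Ob} (f : N.Hom Γ B) : Prop :=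
  HEq (F.map f) (G.map f)

theorem map_agree (h : F.ob = G.ob) {Γ As : List N.Ob} (gs : Args N.Hom Γ As)
    (hg : gs.All fun {_ _} f => Agree F G f) :
    HEq (gs.map F.ob F.map) (gs.map G.ob G.map) := by
  induction gs with
  | nil => rfl
  | cons f fs e ih =>
    exact Args.cons_congr (by rw [h]) (by rw [h]) (by rw [h]) (by rw [h]) hg.1 (ih hg.2)

theorem agree_one (h : F.ob = G.ob) (A : N.Ob) : Agree F G (N.one A) := by
  rw [Agree, F.map_one, G.map_one, h]

theorem agree_univ (h : F.ob = G.ob) (As : List N.Ob) : Agree F G (N.univ As) :=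
  (F.map_univ As).trans ((M.univ_heq (by rw [h])).trans (G.map_univ As).symm)

theorem agree_comp (h : F.ob = G.ob) {Γ As : List N.Ob} {B : N.Ob} {f : N.Hom As B}
    {gs : Args N.Hom Γ As} (hf : Agree F G f) (hg : gs.All fun {_ _} f => Agree F G f) :
    Agree F G (N.comp f gs) := by
  rw [Agree, F.map_comp, G.map_comp]
  exact M.comp_congr (by rw [h]) (by rw [h]) (by rw [h]) hf (map_agree h gs hg)

/-- The image under `F` of the list `(1, v, 1)` is `(1, F v, 1)` up to reassociation of contexts,
and strength of `F v` makes precomposition with it injective. -/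
theorem map_injective_strong (F : MultiFunctor N.toMulticat M.toMulticat) {Γ : List N.Ob}
    {R B : N.Ob} (v : N.Hom Γ R) (hv : M.IsStrong (F.map v)) (Λ Ψ : List N.Ob)
    (x y : M.Hom ((Λ ++ ([R] ++ Ψ)).map F.ob) (F.ob B))
    (h : M.comp x ((Args.app (.ones N.one Λ) (.app (.single v) (.ones N.one Ψ))).map F.ob F.map) =
      M.comp y ((Args.app (.ones N.one Λ) (.app (.single v) (.ones N.one Ψ))).map F.ob F.map)) :
    x = y := by
  refine (Multicat.exists_unique_congr (gs' := .app (.ones M.one (Λ.map F.ob))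
    (.app (.single (F.map v)) (.ones M.one (Ψ.map F.ob)))) (by simp) (by simp) ?_
    (fun t => hv _ _ _ t) _).unique rfl h.symm |>.symm ▸ rfl
  refine (Args.map_app _ _ _ _).trans (Args.app_congr rfl (by simp) rfl (by simp) ?_ ?_)
  · exact heq_of_eq (Args.map_ones _ _ F.map_one _)
  · refine (Args.map_app _ _ _ _).trans (Args.app_congr rfl rfl rfl rfl HEq.rfl ?_)
    exact heq_of_eq (Args.map_ones _ _ F.map_one _)

/-- Functors which agree on a multimap agree on its extension along a universal arrow. -/
theorem agree_of_comp_univ (h : F.ob = G.ob) {Λ Ψ As : List N.Ob} {B : N.Ob}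
    (e : N.Hom (Λ ++ ([N.T As] ++ Ψ)) B)
    (he : Agree F G (N.comp e (.app (.ones N.one Λ) (.app (.single (N.univ As))
      (.ones N.one Ψ))))) : Agree F G e := by
  have hg := map_agree h (.app (.ones N.one Λ) (.app (.single (N.univ As)) (.ones N.one Ψ)))
    ((Args.All.ones (agree_one h) Λ).app (Args.All.app (a := .single (N.univ As))
      ⟨agree_univ h As, trivial⟩ (Args.All.ones (agree_one h) Ψ)))
  have hs : M.IsStrong (F.map (N.univ As)) := M.univ_strong_cast (F.ob_T As) (F.map_univ As)
  rw [Agree, F.map_comp, G.map_comp] at he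
  -- Both functors are taken apart so that their object maps can be identified. Heterogeneous
  -- agreement then becomes an equation in a single hom-set, where injectivity applies.
  obtain ⟨⟨o, m, h₁, h₂⟩, h₃, h₄⟩ := F
  obtain ⟨⟨o', m', h₁', h₂'⟩, h₃', h₄'⟩ := G
  obtain rfl : o = o' := h
  refine heq_of_eq (map_injective_strong ⟨o, m, h₁, h₂⟩ (N.univ As) hs Λ Ψ (m e) (m' e) ?_)
  rw [← eq_of_heq hg] at he
  exact eq_of_heq he

theorem ext_agree (h : F.ob = G.ob)
    (h' : ∀ {Γ : List N.Ob} {B : N.Ob} (f : N.Hom Γ B), Agree F G f) : F = G :=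
  RepFunctor.toSig_injective (Sig.Fun.ext' h h')

end RepFunctor

namespace Calculus
variable {K : Calculus.{u}} {M : RepMulticat.{u}} {F G : RepFunctor K.syn M}
open RepFunctor

/-- By `letT_comp`, `let x be s in t` is the substitution of `s` into `let x be p in t` with `p` a
variable. By β the latter becomes `t` when restricted along the universal arrow, so agreement on `t`
suffices. -/
theorem agree_letT (h : F.ob = G.ob) {Δ Λ Ψ As : List K.Ob} {B : K.Ob} (s : K.Hom Δ (K.T As))
    (t : K.Hom (Λ ++ (As ++ Ψ)) B) (hs : Agree F G (SynHom.mk s)) (ht : Agree F G (SynHom.mk t)) :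
    Agree F G (SynHom.mk (K.letT Λ Ψ As s t)) := by
  have h₁ : SynHom.mk (K.letT Λ Ψ As s t) = K.syn.comp (SynHom.mk (K.letT Λ Ψ As (K.one _) t))
      (.app (.ones K.syn.one Λ) (.app (.single (SynHom.mk s)) (.ones K.syn.one Ψ))) := by
    refine Eq.trans ?_ ((SynHom.comp_mk _ _).symm.trans
      (congrArg (SynHom.comp _) (strong_aux Λ Ψ (.single s)).symm))
    rw [K.letT_comp, ← Args.ones_app, ← Args.ones_app, K.comp_one]
    exact congrArg (fun x => SynHom.mk (K.letT Λ Ψ As x t)) (K.one_comp s).symm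
  rw [h₁]
  refine agree_comp h (agree_of_comp_univ h (As := As) _ ?_) ((Args.All.ones (agree_one h) Λ).app
    (Args.All.app (a := .single (SynHom.mk s)) ⟨hs, trivial⟩ (Args.All.ones (agree_one h) Ψ)))
  have h₂ : K.syn.comp (SynHom.mk (K.letT Λ Ψ As (K.one _) t))
      (.app (.ones K.syn.one Λ) (.app (.single (K.syn.univ As)) (.ones K.syn.one Ψ))) =
      SynHom.mk t :=
    (congrArg (SynHom.comp _) (strong_aux Λ Ψ (.single (K.tens As)))).trans
      ((SynHom.comp_mk _ _).trans (Quotient.sound (strong_exists Λ Ψ As t)))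
  exact h₂.symm ▸ ht

theorem agree_comp_mk (h : F.ob = G.ob) {Γ As : List K.Ob} {B : K.Ob} (f : K.Hom As B)
    (gs : Args K.Hom Γ As) (hf : Agree F G (SynHom.mk f))
    (hg : (gs.mapHom SynHom.mk).All fun {_ _} f => Agree F G f) :
    Agree F G (SynHom.mk (K.comp f gs)) :=
  SynHom.comp_mk f gs ▸ agree_comp h hf hg

end Calculus

/-! ## Interpretation of the ordered calculus -/

section Interp
variable {S : Sig.{u}} {M : RepMulticat.{u}} (φ : S ⟶ RepMulticat.U.obj M)

/-- The interpretation of types. -/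
abbrev Sig.Fun.ty : Ty S.Ob → M.Ob := Ty.interp (Sig.Fun.ob φ) M.T

/-- The interpretation of a constant. -/
def Sig.Fun.con {As : List S.Ob} {B : S.Ob} (c : S.con As B) :
    (M.pullback φ.ty).Hom (As.map Ty.base) (.base B) :=
  Args.castDom (H := M.Hom) List.map_map.symm (Sig.Fun.map φ c)

/-- The interpretation of `x₁ ⊗ ⋯ ⊗ xₙ`. -/
def Sig.Fun.tens (As : List (Ty S.Ob)) : (M.pullback φ.ty).Hom As (.tens As) :=
  cast (congrArg (M.Hom (As.map φ.ty)) (Ty.interp_tens (Sig.Fun.ob φ) M.T As).symm)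
    (M.univ (As.map φ.ty))

theorem Sig.Fun.tens_heq (As : List (Ty S.Ob)) :
    HEq (Sig.Fun.tens φ As) (M.univ (As.map φ.ty)) :=
  cast_heq _ _

theorem Sig.Fun.tens_strong (As : List (Ty S.Ob)) :
    (M.pullback φ.ty).IsStrong (Sig.Fun.tens φ As) :=
  Multicat.IsStrong.pullback
    (M.univ_strong_cast (Ty.interp_tens (Sig.Fun.ob φ) M.T As) (Sig.Fun.tens_heq φ As))

namespace OTm

mutual
/-- The interpretation of terms of the ordered calculus. -/
noncomputable def interp : {Γ : List (Ty S.Ob)} → {B : Ty S.Ob} → OTm S Γ B →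
    (M.pullback φ.ty).Hom Γ B
  | _, _, .var A => (M.pullback φ.ty).one A
  | _, _, .con c ts => (M.pullback φ.ty).comp (Sig.Fun.con φ c) (interps ts)
  | _, _, .tens (As := As) ts => (M.pullback φ.ty).comp (Sig.Fun.tens φ As) (interps ts)
  | _, _, .letT Λ Ψ As s t h => Args.castDom (H := (M.pullback φ.ty).Hom) h.symm
    ((Sig.Fun.tens_strong φ As).lett Λ Ψ (interp s) (interp t))
noncomputable def interps : {Γ As : List (Ty S.Ob)} → Args (OTm S) Γ As →
    Args (M.pullback φ.ty).Hom Γ As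
  | _, _, .nil => .nil
  | _, _, .cons t ts h => .cons (interp t) (interps ts) h
end

theorem interps_eq {Γ As : List (Ty S.Ob)} (ts : Args (OTm S) Γ As) :
    interps φ ts = ts.mapHom (interp φ) := by
  induction ts with
  | nil => rw [interps, Args.mapHom]
  | cons t ts h ih => rw [interps, Args.mapHom, ih]

theorem interps_app {Γ Δ As Bs : List (Ty S.Ob)} (a : Args (OTm S) Γ As)
    (b : Args (OTm S) Δ Bs) : interps φ (.app a b) = .app (interps φ a) (interps φ b) := by
  simp only [interps_eq, Args.mapHom_app]

theorem interps_vars (Γ : List (Ty S.Ob)) :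
    interps φ (vars Γ) = .ones (M.pullback φ.ty).one Γ := by
  rw [interps_eq, vars, Args.mapHom_ones]
  have h : (fun A => interp φ (.var A)) = (M.pullback φ.ty).one := by
    funext A; rw [interp]
  rw [h]

mutual
-- Variables and applied operations use the unit and associativity laws; the `let` case is
-- `lett_comp`.
theorem interp_subst : ∀ {Γ Δ : List (Ty S.Ob)} {B : Ty S.Ob} (t : OTm S Γ B)
    (σ : Args (OTm S) Δ Γ),
    interp φ (subst t σ) = (M.pullback φ.ty).comp (interp φ t) (interps φ σ)
  | _, _, _, .var A, σ => by
    obtain ⟨g, rfl⟩ := Args.exists_single σ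
    rw [var_subst, interp]
    exact ((M.pullback φ.ty).one_comp (interp φ g)).symm
  | _, _, _, .con c ts, σ => by
    rw [subst, interp, interp, interps_substs ts]
    exact ((M.pullback φ.ty).assoc _ _ _).symm
  | _, _, _, .tens ts, σ => by
    rw [subst, interp, interp, interps_substs ts]
    exact ((M.pullback φ.ty).assoc _ _ _).symm
  | _, _, _, .letT (Δ := Δ) Λ Ψ As s t h, σ => by
    subst h
    obtain ⟨_, _, σ₁, σ', rfl, hh⟩ := Args.app_cases Λ σ
    obtain rfl := eq_of_heq hh
    obtain ⟨_, _, σ₂, σ₃, rfl, hh⟩ := Args.app_cases Δ σ'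
    obtain rfl := eq_of_heq hh
    rw [letT_subst Λ Ψ As s t rfl _ σ₁ σ₂ σ₃ rfl HEq.rfl, interp, interp, interp_subst s,
      interp_subst t]
    simp only [interps_app, interps_vars]
    exact ((Sig.Fun.tens_strong φ As).lett_comp Λ Ψ (interp φ s) (interp φ t) (interps φ σ₁)
      (interps φ σ₂) (interps φ σ₃)).symm
theorem interps_substs : ∀ {Γ Δ As : List (Ty S.Ob)} (ts : Args (OTm S) Γ As)
    (σ : Args (OTm S) Δ Γ),
    interps φ (substs ts σ) = (interps φ ts).bind (M.pullback φ.ty).comp (interps φ σ)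
  | _, _, _, .nil, σ => by rw [substs, interps]; cases σ; rfl
  | _, _, _, .cons t ts h, σ => by
    subst h
    obtain ⟨_, _, σ₁, σ', rfl, hh⟩ := Args.app_cases _ σ
    obtain rfl := eq_of_heq hh
    rw [substs_eq (.cons t ts rfl), Args.bind_cons subst t ts rfl _ σ₁ σ' rfl HEq.rfl,
      ← substs_eq, interps, interps, interp_subst t, interps_substs ts]
    exact (Args.bind_cons (M.pullback φ.ty).comp _ _ rfl _ (interps φ σ₁) (interps φ σ') rfl
      (heq_of_eq (interps_app φ _ _))).symm
end

theorem interp_tens (As : List (Ty S.Ob)) :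
    interp φ (.tens (vars As)) = Sig.Fun.tens φ As := by
  rw [interp, interps_vars]
  exact (M.pullback φ.ty).comp_one _

end OTm

/-- The interpretation of the ordered calculus. -/
noncomputable def OCalc.model : (OCalc S).Model M where
  ob := φ.ty
  ob_T := Ty.interp_tens _ _
  map t := OTm.interp φ t
  map_one A := OTm.interp.eq_1 φ A
  map_comp f gs := (OTm.interp_subst φ f gs).trans (congrArg _ (OTm.interps_eq φ gs))
  map_tens As := (heq_of_eq (OTm.interp_tens φ As)).trans (Sig.Fun.tens_heq φ As)
  map_letT Λ Ψ As s t e he := by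
    refine (OTm.interp.eq_4 ..).trans ?_
    refine (Sig.Fun.tens_strong φ As).lett_eq e (Eq.trans ?_ he)
    exact congrArg (fun x => (M.pullback φ.ty).comp e (.app (.ones (M.pullback φ.ty).one Λ)
      (.app (.single x) (.ones (M.pullback φ.ty).one Ψ)))) (OTm.interp_tens φ As).symm
  map_exch Y hY := nomatch hY

end Interp

-- Freeness of the ordered syntactic multicategory.

namespace OSyn
open RepFunctor Calculus

theorem incl_desc {S : Sig.{u}} {M : RepMulticat.{u}} (φ : S ⟶ RepMulticat.U.obj M) :
    OSyn.incl S ≫ RepMulticat.U.map (OCalc.model φ).toRepFunctor = φ := by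
  refine Sig.Fun.ext' rfl fun {Γ B} c => ?_
  refine (Args.castDom_heq _ _).trans ?_
  change HEq (OTm.interp φ (.con c (OTm.vars (Γ.map Ty.base)))) _
  rw [OTm.interp, OTm.interps_vars]
  refine (heq_of_eq ((M.pullback φ.ty).comp_one _)).trans ?_
  exact Args.castDom_heq _ _

/-- Object maps agree because types are generated from sorts by tensors, which both functors
preserve. Agreement on multimaps then follows by induction on a representing term. -/
theorem incl_hom_ext {S : Sig.{u}} {M : RepMulticat.{u}} {F G : RepFunctor (OSyn S) M}
    (h : OSyn.incl S ≫ RepMulticat.U.map F = OSyn.incl S ≫ RepMulticat.U.map G) : F = G := by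
  have hb : ∀ a, F.ob (.base a) = G.ob (.base a) := fun a => congrFun (congrArg Sig.Fun.ob h) a
  have hob : F.ob = G.ob := Ty.hom_ext M.T F.ob G.ob hb F.ob_T G.ob_T
  have hcon : ∀ {As : List S.Ob} {B : S.Ob} (c : S.con As B), Agree F G
      (SynHom.mk (K := OCalc S) (.con c (OTm.vars (As.map Ty.base)))) := fun {As B} c => by
    have h₁ : HEq (Sig.Fun.map (OSyn.incl S ≫ RepMulticat.U.map F) c)
      (Sig.Fun.map (OSyn.incl S ≫ RepMulticat.U.map G) c) := by rw [h]
    exact (Args.castDom_heq _ _).symm.trans (h₁.trans (Args.castDom_heq _ _))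
  refine ext_agree hob fun {Γ B} q => ?_
  induction q using Quotient.inductionOn with
  | h t =>
    refine OTm.rec (motive_1 := fun Γ B t => Agree F G (SynHom.mk (K := OCalc S) t))
      (motive_2 := fun Γ As ts => (ts.mapHom (SynHom.mk (K := OCalc S))).All
        fun {_ _} f => Agree F G f) ?_ ?_ ?_ ?_ trivial (fun _ _ _ h h' => ⟨h, h'⟩) t
    · exact fun A => agree_one hob (N := (OCalc S).syn) A
    · intro Δ As B c ts ih
      have := agree_comp_mk (K := OCalc S) hob _ ts (hcon c) ih
      -- `c(t₁, …, tₙ)` is `c(x₁, …, xₙ)` with the `tᵢ` substituted, hence a composite in the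
      -- syntactic multicategory. Tuples are treated in the same way below.
      have e : OTm.subst (.con c (OTm.vars _)) ts = .con c ts := by
        rw [OTm.subst, OTm.substs_eq, Args.ones_bind OTm.var_subst]
      exact e ▸ this
    · intro Δ As ts ih
      have := agree_comp_mk (K := OCalc S) hob _ ts (agree_univ hob (N := (OCalc S).syn) As) ih
      have e : OTm.subst (.tens (OTm.vars _)) ts = .tens ts := by
        rw [OTm.subst, OTm.substs_eq, Args.ones_bind OTm.var_subst]
      exact e ▸ this
    · intro Γ Δ B Λ Ψ As s t h hs ht
      subst h
      exact agree_letT (K := OCalc S) hob s t hs ht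

/-- The syntactic multicategory is free on its signature. -/
theorem bijective (S : Sig.{u}) (M : RepMulticat.{u}) : Function.Bijective
    fun F : OSyn S ⟶ M => OSyn.incl S ≫ RepMulticat.U.map F :=
  ⟨fun _ _ h => incl_hom_ext h, fun φ => ⟨_, incl_desc φ⟩⟩

end OSyn

/-! ## Universal arrows and adjunctions -/

section Universal
universe v₁ v₂ u₁ u₂
variable {C : Type u₁} {D : Type u₂} [Category.{v₁} C] [Category.{v₂} D] (G : D ⥤ C)

/-- A universal arrow from every object makes `P` functorial and left adjoint. The `eqToHom` in the
unit law only records that the values of the functor are those of `P`. -/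
theorem exists_adjunction (P : C → D) (η : ∀ X, X ⟶ G.obj (P X))
    (h : ∀ X Y, Function.Bijective fun f : P X ⟶ Y => η X ≫ G.map f) :
    ∃ (F : C ⥤ D) (adj : F ⊣ G) (h : ∀ X, F.obj X = P X),
      ∀ X, adj.unit.app X ≫ G.map (eqToHom (h X)) = η X := by
  let e : ∀ X Y, (P X ⟶ Y) ≃ (X ⟶ G.obj Y) := fun X Y => Equiv.ofBijective _ (h X Y)
  have he : ∀ X Y Y' (g : Y ⟶ Y') (f : P X ⟶ Y), e X Y' (f ≫ g) = e X Y f ≫ G.map g :=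
    fun X Y Y' g f => by simp [e]
  refine ⟨_, Adjunction.adjunctionOfEquivLeft e he, fun _ => rfl, fun X => ?_⟩
  simp [Adjunction.adjunctionOfEquivLeft, e]

/-- The unit of the adjunction and `η` are universal arrows from the same object, so each factors
uniquely through the other and the factorisations are mutually inverse. -/
theorem existsUnique_iso {L : C ⥤ D} (adj : L ⊣ G) {X : C} {Y : D} (η : X ⟶ G.obj Y)
    (h : ∀ Z, Function.Bijective fun f : Y ⟶ Z => η ≫ G.map f) :
    ∃! i : L.obj X ≅ Y, adj.unit.app X ≫ G.map i.hom = η := by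
  obtain ⟨g, hg⟩ := (h (L.obj X)).2 (adj.unit.app X)
  have hf : adj.unit.app X ≫ G.map ((adj.homEquiv X Y).symm η) = η :=
    (adj.homEquiv_unit X Y _).symm.trans ((adj.homEquiv X Y).apply_symm_apply η)
  refine ⟨⟨(adj.homEquiv X Y).symm η, g, ?_, ?_⟩, hf, fun j hj => ?_⟩
  · apply (adj.homEquiv X _).injective
    rw [adj.homEquiv_unit, adj.homEquiv_unit, G.map_comp, ← Category.assoc, hf]
    exact hg.trans (by simp)
  · apply (h Y).1
    change η ≫ G.map (g ≫ _) = η ≫ G.map (𝟙 Y)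
    have hg : η ≫ G.map g = _ := hg
    rw [G.map_comp, ← Category.assoc, hg, hf]; simp
  · ext
    apply (adj.homEquiv X Y).injective
    rw [adj.homEquiv_unit, adj.homEquiv_unit, hj]
    exact hf.symm

end Universal

end Multi

-- From monoidal categories to representable multicategories and back.

namespace Multi
open MonoidalCategory NaryTensor

/-! ## Iterated tensor products -/

section Fold
variable {C : Type u} [Category.{u} C] [MonoidalCategory C]

theorem whiskerLeft_eqToHom' (X : C) {Y Z : C} (h : Y = Z) :
    X ◁ eqToHom h = eqToHom (congrArg (X ⊗ ·) h) := by
  subst h; simp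

/-- Inductive steps about iterated tensors are isolated with arbitrary objects in place of folds, so
that rewriting never meets concatenated lists and their propositional equalities. The other lemmas
named `step` serve the same purpose. -/
theorem rightUnitor_step (A : C) {X G : C} (a : X ⟶ G ⊗ 𝟙_ C) {e : X ⟶ G} (h : a ≫ (ρ_ G).hom = e) :
    (A ◁ a ≫ (α_ A G (𝟙_ C)).inv) ≫ (ρ_ (A ⊗ G)).hom = A ◁ e := by
  subst h
  simp

/-- Right unit coherence of the concatenation isomorphisms. The base case is the coincidence of the
two unitors at the unit object. -/
theorem foldAppend_nil_rightUnitor (Γ : List C) :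
    (foldAppend Γ []).hom ≫ (ρ_ (fold Γ)).hom = eqToHom (by rw [List.append_nil]) := by
  induction Γ with
  | nil =>
    change (λ_ (𝟙_ C)).inv ≫ (ρ_ (𝟙_ C)).hom = 𝟙 (𝟙_ C)
    rw [← unitors_equal, Iso.inv_hom_id]
  | cons A Γ ih =>
    exact (rightUnitor_step A (foldAppend Γ []).hom ih).trans (whiskerLeft_eqToHom' _ _)

/-- The hypothesis whiskered by `A`, rearranged by the pentagon. -/
theorem assoc_step (A : C) {X X' G D T GD DT : C} (a : X ⟶ GD ⊗ T) (b : GD ⟶ G ⊗ D)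
    (c : X' ⟶ G ⊗ DT) (d : DT ⟶ D ⊗ T) (e : X ⟶ X')
    (h : a ≫ b ▷ T ≫ (α_ G D T).hom = e ≫ c ≫ G ◁ d) :
    (A ◁ a ≫ (α_ A GD T).inv) ≫ (A ◁ b ≫ (α_ A G D).inv) ▷ T ≫ (α_ (A ⊗ G) D T).hom =
      A ◁ e ≫ (A ◁ c ≫ (α_ A G DT).inv) ≫ (A ⊗ G) ◁ d := by
  have h' := congrArg (A ◁ ·) h
  simp only [MonoidalCategory.whiskerLeft_comp] at h'
  simp only [Category.assoc, tensor_whiskerLeft, Iso.inv_hom_id_assoc]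
  rw [← reassoc_of% h']
  simp

theorem nil_step {X D T : C} (a : X ⟶ D ⊗ T) :
    (λ_ X).inv ≫ ((𝟙_ C) ◁ a) = a ≫ (λ_ D).inv ▷ T ≫ (α_ (𝟙_ C) D T).hom := by
  simp

/-- Associativity coherence of the concatenation isomorphisms, by induction on the first list. It
makes the tensor product of lists of multimaps compatible with concatenation. -/
theorem foldAppend_assoc (Γ Δ Θ : List C) :
    (foldAppend (Γ ++ Δ) Θ).hom ≫ (foldAppend Γ Δ).hom ▷ fold Θ ≫ (α_ _ _ _).hom =
      eqToHom (by rw [List.append_assoc]) ≫ (foldAppend Γ (Δ ++ Θ)).hom ≫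
        fold Γ ◁ (foldAppend Δ Θ).hom := by
  induction Γ with
  | nil =>
    refine Eq.trans ?_ (Category.id_comp _).symm
    exact (nil_step (foldAppend Δ Θ).hom).symm
  | cons A Γ ih =>
    exact (assoc_step A _ _ _ _ _ ih).trans (congrArg (· ≫ _) (whiskerLeft_eqToHom' _ _))

variable [NaryTensor C]

/-- The multimaps of the multicategory of a monoidal category. -/
abbrev MHom (Γ : List C) (B : C) : Type u := (tens Γ : C) ⟶ B

theorem foldArgs_cons {Γ Δ As : List C} {A : C} (f : MHom Γ A) (fs : Args MHom Δ As) :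
    foldArgs (.cons f fs rfl) =
      (foldAppend Γ Δ).hom ≫ (((bracket Γ).inv ≫ f) ⊗ₘ foldArgs fs) :=
  Category.id_comp _

theorem foldArgs_cast {Γ Γ' As : List C} (h : Γ = Γ') {a : Args MHom Γ As} {b : Args MHom Γ' As}
    (hh : HEq a b) : foldArgs a = eqToHom (by rw [h]) ≫ foldArgs b := by
  subst h; obtain rfl := eq_of_heq hh; simp

theorem nil_app_step {D T : C} (b : D ⟶ T) : b ≫ (λ_ T).inv = (λ_ D).inv ≫ (𝟙 (𝟙_ C) ⊗ₘ b) := by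
  simp

theorem app_step {A X X' X'' G G₁ G₂ D S T AB : C} (f : G₁ ⟶ A) (e : X ⟶ X') (p : X' ⟶ G₁ ⊗ G)
    (q : G ⟶ G₂ ⊗ D) (r : X ⟶ X'' ⊗ D) (t : X'' ⟶ G₁ ⊗ G₂)
    (a : G₂ ⟶ S) (b : D ⟶ T) (c : G ⟶ AB) (s : AB ⟶ S ⊗ T)
    (ih : c ≫ s = q ≫ (a ⊗ₘ b)) (h : r ≫ t ▷ D ≫ (α_ G₁ G₂ D).hom = e ≫ p ≫ G₁ ◁ q) :
    (e ≫ p ≫ (f ⊗ₘ c)) ≫ A ◁ s ≫ (α_ A S T).inv = r ≫ ((t ≫ (f ⊗ₘ a)) ⊗ₘ b) := by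
  have h₂ : (f ⊗ₘ c) ≫ A ◁ s = G₁ ◁ q ≫ (f ⊗ₘ (a ⊗ₘ b)) := by
    rw [← id_tensorHom, ← id_tensorHom, tensorHom_comp_tensorHom, tensorHom_comp_tensorHom, ih]
    simp
  simp only [Category.assoc]
  rw [reassoc_of% h₂, associator_inv_naturality, ← reassoc_of% h, Iso.hom_inv_id_assoc,
    ← tensorHom_id, tensorHom_comp_tensorHom, Category.id_comp]

/-- Naturality of `foldAppend` in lists of multimaps. In the inductive step the domain is
rebracketed by `foldAppend_assoc`. -/
theorem foldArgs_app {Γ Δ As Bs : List C} (a : Args MHom Γ As) (b : Args MHom Δ Bs) :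
    foldArgs (.app a b) ≫ (foldAppend As Bs).hom =
      (foldAppend Γ Δ).hom ≫ (foldArgs a ⊗ₘ foldArgs b) := by
  induction a with
  | nil => exact nil_app_step (foldArgs b)
  | @cons Γ₁ Γ₂ Γ A As f fs h ih =>
    subst h
    have h₁ : foldArgs (Args.app (.cons f fs rfl) b) = eqToHom (by rw [List.append_assoc]) ≫
        foldArgs (.cons f (.app fs b) rfl) := foldArgs_cast (List.append_assoc _ _ _)
          (Args.cons_congr rfl rfl rfl rfl HEq.rfl HEq.rfl)
    rw [h₁, foldArgs_cons, foldArgs_cons]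
    exact app_step _ _ _ _ _ _ _ _ _ _ ih (foldAppend_assoc Γ₁ Γ₂ Δ)

theorem ones_step (A X : C) {T : C} (e : X ⟶ X) (h : e = 𝟙 X) (b : T ≅ A ⊗ 𝟙_ C) :
    (A ◁ (λ_ X).inv ≫ (α_ A (𝟙_ C) X).inv) ≫ ((b.inv ≫ b.hom ≫ (ρ_ A).hom) ⊗ₘ e) = 𝟙 (A ⊗ X) := by
  subst h
  simp

theorem foldArgs_ones (As : List C) :
    foldArgs (.ones (H := MHom) (fun A => (bracket [A]).hom ≫ (ρ_ A).hom) As) = 𝟙 (fold As) := by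
  induction As with
  | nil => rfl
  | cons A As ih => exact (foldArgs_cons _ _).trans (ones_step A (fold As) _ ih (bracket [A]))

theorem single_step {X G T A : C} (b : T ≅ G) (f : T ⟶ A) (d : G ⟶ X) (a : X ⟶ G ⊗ 𝟙_ C)
    (e : X ⟶ G) (h : a ≫ (ρ_ G).hom = e) (hd : d ≫ e = 𝟙 G) :
    b.hom ≫ d ≫ a ≫ ((b.inv ≫ f) ⊗ₘ 𝟙 (𝟙_ C)) = f ≫ (ρ_ A).inv := by
  obtain rfl : a = e ≫ (ρ_ G).inv := by rw [← h]; simp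
  have : (ρ_ G).inv ≫ ((b.inv ≫ f) ⊗ₘ 𝟙 (𝟙_ C)) = (b.inv ≫ f) ≫ (ρ_ A).inv := by
    rw [rightUnitor_inv_naturality]; simp
  rw [Category.assoc, this, reassoc_of% hd]
  simp

theorem foldArgs_single {Γ : List C} {A : C} (f : MHom Γ A) :
    (bracket Γ).hom ≫ foldArgs (.single f) = f ≫ (ρ_ A).inv := by
  have h : foldArgs (.single f) = eqToHom (by rw [List.append_nil]) ≫ (foldAppend Γ []).hom ≫
      (((bracket Γ).inv ≫ f) ⊗ₘ 𝟙 (fold [])) := rfl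
  rw [h]
  exact single_step (bracket Γ) f _ (foldAppend Γ []).hom _ (foldAppend_nil_rightUnitor Γ) (by simp)

/-- Composition in the multicategory of a monoidal category. -/
def mcomp {Γ As : List C} {B : C} (f : MHom As B) (gs : Args MHom Γ As) : MHom Γ B :=
  (bracket Γ).hom ≫ foldArgs gs ≫ (bracket As).inv ≫ f

theorem bind_step {X Θ₁ Θ₂ G G₁ G₂ T₁ S₁ A As : C} (c : S₁ ≅ Θ₁) (b : T₁ ≅ G₁) (x : G ⟶ G₁ ⊗ G₂)
    (g : T₁ ⟶ A) (y : X ⟶ Θ₁ ⊗ Θ₂) (a : Θ₁ ⟶ G₁) (d : Θ₂ ⟶ G₂) (z : G₂ ⟶ As) (ab : X ⟶ G)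
    {w : Θ₂ ⟶ As} (hw : w = d ≫ z) (h : ab ≫ x = y ≫ (a ⊗ₘ d)) :
    y ≫ ((c.inv ≫ c.hom ≫ a ≫ b.inv ≫ g) ⊗ₘ w) = ab ≫ x ≫ ((b.inv ≫ g) ⊗ₘ z) := by
  subst hw
  rw [reassoc_of% h]
  simp

/-- Functoriality of the tensor product of multimaps: the domain of the tail is split off by
`foldArgs_app`, and the two brackets around each intermediate composite cancel. Associativity of
composition in `T C` is an immediate consequence. -/
theorem foldArgs_bind {Θ Γ As : List C} (gs : Args MHom Γ As) (hs : Args MHom Θ Γ) :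
    foldArgs (gs.bind mcomp hs) = foldArgs hs ≫ foldArgs gs := by
  induction gs generalizing Θ with
  | nil =>
    cases hs
    exact (Category.id_comp _).symm
  | @cons Γ₁ Γ₂ Γ A As g gs e ih =>
    subst e
    obtain ⟨Θ₁, Θ₂, a, b, rfl, hh⟩ := Args.app_cases _ hs
    obtain rfl := eq_of_heq hh
    rw [Args.bind_cons mcomp g gs rfl _ a b rfl HEq.rfl, foldArgs_cons, foldArgs_cons]
    exact bind_step (bracket Θ₁) (bracket Γ₁) _ g _ _ _ _ _ (ih b) (foldArgs_app a b)

theorem isIso_foldArgs {Γ As : List C} (gs : Args MHom Γ As)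
    (h : gs.All fun {_ _} g => IsIso g) : IsIso (foldArgs gs) := by
  induction gs with
  | nil => exact IsIso.id _
  | @cons Γ Δ Θ A As g gs e ih =>
    have := h.1
    have := ih h.2
    have h₁ : IsIso (((bracket Γ).inv ≫ g) ⊗ₘ foldArgs gs) := inferInstance
    have h₂ : IsIso ((foldAppend Γ Δ).hom ≫ (((bracket Γ).inv ≫ g) ⊗ₘ foldArgs gs)) :=
      inferInstance
    exact @IsIso.comp_isIso _ _ _ _ _ (eqToHom (congrArg fold e)) _ inferInstance h₂

/-- The identity multimaps of the multicategory of a monoidal category. -/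
def mone (A : C) : MHom [A] A := (bracket [A]).hom ≫ (ρ_ A).hom

theorem mcomp_eq {Γ As : List C} {B : C} (f : MHom As B) (gs : Args MHom Γ As) :
    mcomp f gs = (bracket Γ).hom ≫ foldArgs gs ≫ (bracket As).inv ≫ f := rfl

/-- Objects are isomorphic to their unary tensor products. -/
def unary (A : C) : (tens [A] : C) ≅ A := bracket [A] ≪≫ ρ_ A

theorem mcomp_single {Γ : List C} {A B : C} (e : MHom [A] B) (v : MHom Γ A) :
    mcomp e (.single v) = v ≫ (unary A).inv ≫ e := by
  rw [mcomp_eq, reassoc_of% foldArgs_single v]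
  exact (Category.assoc _ _ _).trans (congrArg (v ≫ ·) (Category.assoc _ _ _).symm)

theorem mone_mcomp {Γ : List C} {B : C} (f : MHom Γ B) : mcomp (mone B) (.single f) = f := by
  rw [mcomp_single]
  exact (congrArg (f ≫ ·) (unary B).inv_hom_id).trans (Category.comp_id f)

theorem mcomp_mones {Γ : List C} {B : C} (f : MHom Γ B) : mcomp f (.ones mone Γ) = f := by
  have h : foldArgs (.ones (H := MHom) mone Γ) = 𝟙 (fold Γ) := foldArgs_ones Γ
  rw [mcomp_eq, h]
  simp

theorem mcomp_assoc {Θ Γ As : List C} {B : C} (f : MHom As B) (gs : Args MHom Γ As)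
    (hs : Args MHom Θ Γ) : mcomp (mcomp f gs) hs = mcomp f (gs.bind mcomp hs) := by
  rw [mcomp_eq f, mcomp_eq f, mcomp_eq, foldArgs_bind]
  simp

/-- By `mcomp_single`, composing a unary multimap with `v` is, up to the isomorphism `unary A`,
precomposition with `v`. Thus invertible multimaps are universal. -/
theorem existsUnique_mcomp {Γ : List C} {A : C} (v : MHom Γ A) [IsIso v] {B : C} (t : MHom Γ B) :
    ∃! e : MHom [A] B, mcomp e (.single v) = t := by
  refine ⟨(unary A).hom ≫ inv v ≫ t, ?_, fun e he => ?_⟩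
  · refine (mcomp_single _ _).trans ?_
    rw [Iso.inv_hom_id_assoc, IsIso.hom_inv_id_assoc]
  · rw [← he, mcomp_single, IsIso.inv_hom_id_assoc, Iso.hom_inv_id_assoc]

theorem isIso_mcomp {Γ As : List C} {B : C} (f : MHom As B) [IsIso f] (gs : Args MHom Γ As)
    (h : gs.All fun {_ _} g => IsIso g) : IsIso (mcomp f gs) := by
  have := isIso_foldArgs gs h
  rw [mcomp_eq]
  infer_instance

/-- Closure of the chosen universal arrows under composition: they are identities, and composites of
invertible multimaps are invertible. -/
theorem isIso_mcomp_pair (Γ Δ : List C) : IsIso (mcomp (𝟙 (tens [tens Γ, tens Δ]))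
    (.pair (𝟙 (tens Γ : C)) (𝟙 (tens Δ : C)) : Args MHom (Γ ++ Δ) [tens Γ, tens Δ])) :=
  isIso_mcomp _ _ ⟨IsIso.id _, IsIso.id _, trivial⟩

end Fold

-- The representable multicategory of a monoidal category.

namespace TensorCat
variable (C : TensorCat.{u})

/-- The underlying multicategory of a monoidal category. -/
@[reducible] def multicat : Multicat.{u} where
  toMulticatData := C.tensorData.toMulticatData
  one_comp f := mone_mcomp (C := C.carrier) f
  comp_one f := mcomp_mones (C := C.carrier) f
  assoc f gs hs := mcomp_assoc (C := C.carrier) f gs hs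

theorem isUniversal_of_isIso {Γ : List C.carrier} {A : C.carrier} (v : MHom Γ A) [IsIso v] :
    C.multicat.IsUniversal v := fun _ t => existsUnique_mcomp v t

/-- The representable multicategory of a monoidal category. -/
@[reducible] def multi : RepMulticat.{u} where
  toMulticat := C.multicat
  T := C.tensorData.T
  univ := C.tensorData.univ
  univ_universal Γ := C.isUniversal_of_isIso (𝟙 _)
  comp_universal Γ Δ := by
    have := isIso_mcomp_pair (C := C.carrier) Γ Δ
    exact @isUniversal_of_isIso C _ _ _ this

end TensorCat

/-! ## Strict functors preserve iterated tensor products -/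

section HEq
variable {C : Type u} [Category.{u} C]

/-- Preservation on the nose relates morphisms whose endpoints agree only propositionally. These
congruences let such heterogeneous equations propagate through composites, inverses and tensor
products. -/
theorem comp_heq_comp {X X' Y Y' Z Z' : C} {f : X ⟶ Y} {f' : X' ⟶ Y'} {g : Y ⟶ Z} {g' : Y' ⟶ Z'}
    (hX : X = X') (hY : Y = Y') (hZ : Z = Z') (hf : HEq f f') (hg : HEq g g') :
    HEq (f ≫ g) (f' ≫ g') := by
  subst hX hY hZ; obtain rfl := eq_of_heq hf; obtain rfl := eq_of_heq hg; rfl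

theorem inv_heq_inv {X X' Y Y' : C} {i : X ≅ Y} {j : X' ≅ Y'} (hX : X = X') (hY : Y = Y')
    (h : HEq i.hom j.hom) : HEq i.inv j.inv := by
  subst hX hY
  rw [Iso.ext (eq_of_heq h)]

theorem tensorHom_heq [MonoidalCategory C] {X X' Y Y' Z Z' W W' : C} {f : X ⟶ Y} {f' : X' ⟶ Y'}
    {g : Z ⟶ W} {g' : Z' ⟶ W'} (hX : X = X') (hY : Y = Y') (hZ : Z = Z') (hW : W = W')
    (hf : HEq f f') (hg : HEq g g') : HEq (f ⊗ₘ g) (f' ⊗ₘ g') := by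
  subst hX hY hZ hW; obtain rfl := eq_of_heq hf; obtain rfl := eq_of_heq hg; rfl

end HEq

namespace StrictFunctor
variable {C D : TensorCat.{u}} (F : StrictFunctor C D)

theorem map_inv_heq {X Y : C.carrier} {X' Y' : D.carrier} {i : X ≅ Y} {j : X' ≅ Y'}
    (hX : F.obj X = X') (hY : F.obj Y = Y') (h : HEq (F.map i.hom) j.hom) :
    HEq (F.map i.inv) j.inv :=
  inv_heq_inv (i := F.mapIso i) hX hY h

theorem map_comp_heq {X Y Z : C.carrier} {X' Y' Z' : D.carrier} {f : X ⟶ Y} {g : Y ⟶ Z}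
    {f' : X' ⟶ Y'} {g' : Y' ⟶ Z'} (hX : F.obj X = X') (hY : F.obj Y = Y') (hZ : F.obj Z = Z')
    (hf : HEq (F.map f) f') (hg : HEq (F.map g) g') : HEq (F.map (f ≫ g)) (f' ≫ g') :=
  (heq_of_eq (F.map_comp f g)).trans (comp_heq_comp hX hY hZ hf hg)

theorem map_tensorHom_heq {X Y Z W : C.carrier} {X' Y' Z' W' : D.carrier} {f : X ⟶ Y} {g : Z ⟶ W}
    {f' : X' ⟶ Y'} {g' : Z' ⟶ W'} (hX : F.obj X = X') (hY : F.obj Y = Y') (hZ : F.obj Z = Z')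
    (hW : F.obj W = W') (hf : HEq (F.map f) f') (hg : HEq (F.map g) g') :
    HEq (F.map (f ⊗ₘ g)) (f' ⊗ₘ g') :=
  (F.map_tensor f g).trans (tensorHom_heq hX hY hZ hW hf hg)

theorem map_id_heq {X : C.carrier} {X' : D.carrier} (hX : F.obj X = X') :
    HEq (F.map (𝟙 X)) (𝟙 X') := by
  subst hX; exact heq_of_eq (F.map_id X)

theorem map_whiskerLeft_heq {X Z W : C.carrier} {X' Z' W' : D.carrier} {g : Z ⟶ W}
    {g' : Z' ⟶ W'} (hX : F.obj X = X') (hZ : F.obj Z = Z') (hW : F.obj W = W')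
    (hg : HEq (F.map g) g') : HEq (F.map (X ◁ g)) (X' ◁ g') := by
  rw [← id_tensorHom, ← id_tensorHom]
  exact F.map_tensorHom_heq hX hX hZ hW (F.map_id_heq hX) hg

theorem map_whiskerRight_heq {X Z W : C.carrier} {X' Z' W' : D.carrier} {g : Z ⟶ W}
    {g' : Z' ⟶ W'} (hX : F.obj X = X') (hZ : F.obj Z = Z') (hW : F.obj W = W')
    (hg : HEq (F.map g) g') : HEq (F.map (g ▷ X)) (g' ▷ X') := by
  rw [← tensorHom_id, ← tensorHom_id]
  exact F.map_tensorHom_heq hZ hW hX hX hg (F.map_id_heq hX)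

theorem obj_tensor' {X Y : C.carrier} {X' Y' : D.carrier} (hX : F.obj X = X') (hY : F.obj Y = Y') :
    F.obj (X ⊗ Y) = X' ⊗ Y' := by
  subst hX hY; exact F.obj_tensor X Y

theorem map_associator_heq {X Y Z : C.carrier} {X' Y' Z' : D.carrier} (hX : F.obj X = X')
    (hY : F.obj Y = Y') (hZ : F.obj Z = Z') : HEq (F.map (α_ X Y Z).hom) (α_ X' Y' Z').hom := by
  subst hX hY hZ; exact F.map_associator X Y Z

theorem map_associator_inv_heq {X Y Z : C.carrier} {X' Y' Z' : D.carrier} (hX : F.obj X = X')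
    (hY : F.obj Y = Y') (hZ : F.obj Z = Z') : HEq (F.map (α_ X Y Z).inv) (α_ X' Y' Z').inv :=
  F.map_inv_heq (F.obj_tensor' (F.obj_tensor' hX hY) hZ) (F.obj_tensor' hX (F.obj_tensor' hY hZ))
    (F.map_associator_heq hX hY hZ)

theorem map_leftUnitor_heq {X : C.carrier} {X' : D.carrier} (hX : F.obj X = X') :
    HEq (F.map (λ_ X).hom) (λ_ X').hom := by
  subst hX; exact F.map_leftUnitor X

theorem map_leftUnitor_inv_heq {X : C.carrier} {X' : D.carrier} (hX : F.obj X = X') :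
    HEq (F.map (λ_ X).inv) (λ_ X').inv :=
  F.map_inv_heq (F.obj_tensor' F.obj_unit hX) hX (F.map_leftUnitor_heq hX)

theorem map_rightUnitor_heq {X : C.carrier} {X' : D.carrier} (hX : F.obj X = X') :
    HEq (F.map (ρ_ X).hom) (ρ_ X').hom := by
  subst hX; exact F.map_rightUnitor X

theorem obj_fold_append (Γ Δ : List C.carrier) :
    F.obj (fold (Γ ++ Δ)) = fold (Γ.map F.obj ++ Δ.map F.obj) :=
  (fold_map F _).trans (congrArg fold List.map_append)

theorem map_foldAppend : ∀ Γ Δ : List C.carrier, HEq (F.map (foldAppend Γ Δ).hom)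
    (foldAppend (Γ.map F.obj) (Δ.map F.obj)).hom
  | [], Δ => F.map_leftUnitor_inv_heq (fold_map F Δ)
  | A :: Γ, Δ =>
    F.map_comp_heq (F.obj_fold_append (A :: Γ) Δ)
      (F.obj_tensor' rfl (F.obj_tensor' (fold_map F Γ) (fold_map F Δ)))
      (F.obj_tensor' (fold_map F (A :: Γ)) (fold_map F Δ))
      (F.map_whiskerLeft_heq rfl (F.obj_fold_append Γ Δ)
        (F.obj_tensor' (fold_map F Γ) (fold_map F Δ)) (map_foldAppend Γ Δ))
      (F.map_associator_inv_heq rfl (fold_map F Γ) (fold_map F Δ))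

/-- The action of a strict functor on multimaps. -/
def mmap {Γ : List C.carrier} {B : C.carrier} (f : MHom Γ B) : MHom (Γ.map F.obj) (F.obj B) :=
  eqToHom (F.obj_tens Γ).symm ≫ F.map f

theorem mmap_heq {Γ : List C.carrier} {B : C.carrier} (f : MHom Γ B) :
    HEq (F.mmap f) (F.map f) := eqToHom_comp_heq' _ _

theorem map_bracket_inv (Γ : List C.carrier) :
    HEq (F.map (bracket Γ).inv) (bracket (Γ.map F.obj)).inv :=
  F.map_inv_heq (F.obj_tens Γ) (fold_map F Γ) (F.map_bracket Γ)

theorem map_foldArgs {Γ As : List C.carrier} (gs : Args MHom Γ As) :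
    HEq (F.map (foldArgs gs)) (foldArgs (gs.map F.obj F.mmap)) := by
  induction gs with
  | nil => exact (heq_of_eq (F.map_id _)).trans (by rw [fold_map F]; rfl)
  | @cons Γ Δ Θ A As f fs h ih =>
    subst h
    have e : foldArgs ((Args.cons f fs rfl).map F.obj F.mmap) =
      eqToHom (by rw [List.map_append]) ≫ foldArgs (.cons (F.mmap f) (fs.map F.obj F.mmap) rfl) :=
      foldArgs_cast List.map_append (Args.cons_congr rfl rfl rfl rfl HEq.rfl HEq.rfl)
    rw [e, foldArgs_cons, foldArgs_cons]
    refine HEq.trans ?_ (eqToHom_comp_heq' _ _).symm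
    exact F.map_comp_heq (F.obj_fold_append Γ Δ)
      (F.obj_tensor' (fold_map F Γ) (fold_map F Δ)) (fold_map F (A :: As)) (F.map_foldAppend Γ Δ)
      (F.map_tensorHom_heq (fold_map F Γ) rfl (fold_map F Δ) (fold_map F As)
        (F.map_comp_heq (fold_map F Γ) (F.obj_tens Γ) rfl (F.map_bracket_inv Γ)
          (F.mmap_heq f).symm) ih)

theorem mmap_comp {Γ As : List C.carrier} {B : C.carrier} (f : MHom As B) (gs : Args MHom Γ As) :
    F.mmap (mcomp f gs) = mcomp (F.mmap f) (gs.map F.obj F.mmap) := by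
  refine eq_of_heq ((F.mmap_heq _).trans ?_)
  exact F.map_comp_heq (F.obj_tens Γ) (fold_map F Γ) rfl (F.map_bracket Γ)
    (F.map_comp_heq (fold_map F Γ) (fold_map F As) rfl (F.map_foldArgs gs)
      (F.map_comp_heq (fold_map F As) (F.obj_tens As) rfl (F.map_bracket_inv As)
        (F.mmap_heq f).symm))

theorem mmap_mone (A : C.carrier) : F.mmap (mone A) = mone (F.obj A) :=
  eq_of_heq ((F.mmap_heq _).trans (F.map_comp_heq (F.obj_tens [A]) (fold_map F [A]) rfl
    (F.map_bracket _) (F.map_rightUnitor A)))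

theorem mmap_id (Γ : List C.carrier) : HEq (F.mmap (𝟙 (tens Γ))) (𝟙 (tens (Γ.map F.obj))) :=
  (F.mmap_heq _).trans (F.map_id_heq (F.obj_tens Γ))

/-- The functor of representable multicategories induced by a strict functor. -/
def multi : RepFunctor C.multi D.multi where
  ob := F.obj
  map f := F.mmap (C := C) (D := D) f
  map_one := F.mmap_mone
  map_comp f gs := F.mmap_comp f gs
  ob_T := F.obj_tens
  map_univ := F.mmap_id

end StrictFunctor

/-- The functor from monoidal categories to representable multicategories. -/
def TensorCat.M : TensorCat.{u} ⥤ RepMulticat.{u} where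
  obj C := C.multi
  map F := StrictFunctor.multi F
  map_id C := RepFunctor.toSig_injective (StrictFunctor.toSig_id C)
  map_comp F G := RepFunctor.toSig_injective (StrictFunctor.toSig_comp F G)

theorem TensorCat.M_U : TensorCat.M.{u} ⋙ RepMulticat.U = TensorCat.V := rfl

end Multi

namespace Multi
open MonoidalCategory NaryTensor

/-! ## Invertible functors of representable multicategories -/

theorem Args.map_heq_self {O : Type u} {H : List O → O → Type u} {o : O → O}
    {φ : ∀ {Γ A}, H Γ A → H (Γ.map o) (o A)} (ho : ∀ A, o A = A)
    (hφ : ∀ {Γ A} (f : H Γ A), HEq (φ f) f) {Γ As : List O} (fs : Args H Γ As) :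
    HEq (fs.map o φ) fs := by
  have h : ∀ Γ : List O, Γ.map o = Γ := fun Γ => by rw [funext ho (g := id)]; simp
  induction fs with
  | nil => rfl
  | cons f fs e ih => exact Args.cons_congr (h _) (h _) (ho _) (h _) (hφ f) ih

theorem Args.map_id_heq {O : Type u} {H H' : List O → O → Type u}
    (φ : ∀ {Γ A}, H Γ A → H' Γ A) {Γ As : List O} (fs : Args H Γ As) :
    HEq (fs.map (H' := H') id fun f => Args.castDom (List.map_id _).symm (φ f))
      (fs.mapHom φ) := by
  induction fs with
  | nil => rfl
  | cons f fs h ih =>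
    exact Args.cons_congr (by simp) (by simp) rfl (by simp) (Args.castDom_heq _ _) ih

theorem RepMulticat.one_congr (M : RepMulticat.{u}) {A B : M.Ob} (h : A = B) :
    HEq (M.one A) (M.one B) := by
  subst h; rfl

namespace RepFunctor
variable {M M' : RepMulticat.{u}} (F : RepFunctor M M')

/-- A map of signatures inverse to a functor of representable multicategories. -/
structure Inverse where
  ob : M'.Ob → M.Ob
  map : ∀ {Γ : List M'.Ob} {B : M'.Ob}, M'.Hom Γ B → M.Hom (Γ.map ob) (ob B)
  ob_map_ob : ∀ A, ob (F.ob A) = A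
  ob_ob : ∀ A, F.ob (ob A) = A
  map_map : ∀ {Γ : List M.Ob} {B : M.Ob} (f : M.Hom Γ B), HEq (map (F.map f)) f
  map_map' : ∀ {Γ : List M'.Ob} {B : M'.Ob} (f : M'.Hom Γ B), HEq (F.map (map f)) f

namespace Inverse
variable {F} (G : F.Inverse)

theorem map_ob' (Γ : List M'.Ob) : (Γ.map G.ob).map F.ob = Γ := by
  rw [List.map_map, show F.ob ∘ G.ob = _root_.id from funext G.ob_ob, List.map_id]

theorem map_congr {Γ Δ : List M'.Ob} {A B : M'.Ob} (hΓ : Γ = Δ) (hA : A = B) {f : M'.Hom Γ A}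
    {g : M'.Hom Δ B} (h : HEq f g) : HEq (G.map f) (G.map g) := by
  subst hΓ hA; obtain rfl := eq_of_heq h; rfl

/-- A functor with an inverse reflects heterogeneous equality. Each preservation property of the
inverse can therefore be checked after applying `F`, where it is the corresponding property of `F`.
-/
theorem heq_of_map_heq (G : F.Inverse) {Γ Δ : List M.Ob} {A B : M.Ob} (hΓ : Γ.map F.ob = Δ.map F.ob)
    (hA : F.ob A = F.ob B) {f : M.Hom Γ A} {g : M.Hom Δ B} (h : HEq (F.map f) (F.map g)) :
    HEq f g :=
  (G.map_map f).symm.trans ((G.map_congr hΓ hA h).trans (G.map_map g))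

theorem map_args {Γ As : List M'.Ob} (gs : Args M'.Hom Γ As) :
    HEq ((gs.map G.ob G.map).map F.ob F.map) gs :=
  (Args.map_comp _ _ _ _ gs).trans (Args.map_heq_self G.ob_ob
    (fun f => (Args.castDom_heq _ _).trans (G.map_map' f)) gs)

/-- The inverse map of signatures is a functor. -/
def functor : RepFunctor M' M where
  ob := G.ob
  map := G.map
  map_one A := eq_of_heq (G.heq_of_map_heq rfl rfl ((G.map_map' _).trans
    ((M'.one_congr (G.ob_ob A).symm).trans (heq_of_eq (F.map_one _).symm))))
  map_comp {Γ As B} f gs := eq_of_heq (G.heq_of_map_heq rfl rfl ((G.map_map' _).trans (by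
    rw [F.map_comp]
    exact M'.comp_congr (G.map_ob' _).symm (G.map_ob' _).symm (G.ob_ob _).symm (G.map_map' f).symm
      (G.map_args gs).symm)))
  ob_T Γ := by
    rw [← G.ob_map_ob (M.T _), F.ob_T, G.map_ob']
  map_univ Γ := by
    have h : G.ob (M'.T Γ) = M.T (Γ.map G.ob) := by rw [← G.ob_map_ob (M.T _), F.ob_T, G.map_ob']
    refine G.heq_of_map_heq rfl (by rw [h]) ((G.map_map' _).trans ((F.map_univ _).trans ?_).symm)
    rw [G.map_ob']

/-- An invertible functor is an isomorphism. -/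
def iso : M ≅ M' where
  hom := F
  inv := G.functor
  hom_inv_id := toSig_injective (Sig.Fun.ext' (funext G.ob_map_ob)
    fun f => (Args.castDom_heq _ _).trans ((G.map_map f).trans (Args.castDom_heq _ _).symm))
  inv_hom_id := toSig_injective (Sig.Fun.ext' (funext G.ob_ob)
    fun f => (Args.castDom_heq _ _).trans ((G.map_map' f).trans (Args.castDom_heq _ _).symm))

end Inverse
end RepFunctor

/-! ## A representable multicategory is determined by its nucleus -/

namespace RepMulticat
open Multicat
variable (M : RepMulticat.{u})

theorem tensorHom_comp_ten {A A' B B' : M.Ob} (f : M.Hom [A] A') (g : M.Hom [B] B')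
    {Γ Δ : List M.Ob} (x : M.Hom Γ A) (y : M.Hom Δ B) {x' : M.Hom Γ A'} {y' : M.Hom Δ B'}
    (hx : M.comp f (.single x) = x') (hy : M.comp g (.single y) = y') :
    M.comp (M.tensorHom f g) (.single (M.ten x y)) = M.ten x' y' := by
  rw [tensorHom_ten, hx, hy]

theorem assocInv_ten {A : M.Ob} {Δ Θ : List M.Ob} {B C : M.Ob} (y : M.Hom Δ B) (z : M.Hom Θ C) :
    M.comp (M.assocInv A B C) (.single (M.ten (M.one A) (M.ten y z))) =
      M.ten (Γ := A :: Δ) (M.ten (M.one A) y) z := by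
  have h := M.assocHom_ten (M.one A) y z
  change _ = M.ten (M.one A) (M.ten y z) at h
  rw [← h]
  refine (M.comp_single _ _ _).symm.trans ?_
  rw [assoc_inv_hom, M.one_comp]

/-- Describes the concatenation isomorphism of the nucleus by its effect on the universal arrow of a
concatenated list. In the inductive step the inverse associator rebrackets `a ⊗ (y ⊗ z)`. -/
theorem foldAppend_foldUniv (Γ Δ : List M.Ob) :
    M.comp (foldAppend (C := M.Nucleus) Γ Δ).hom (.single (M.foldUniv (Γ ++ Δ))) =
      M.ten (M.foldUniv Γ) (M.foldUniv Δ) := by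
  induction Γ with
  | nil =>
    refine (M.ten_comp (M.univ []) (M.one _) .nil (.single (M.foldUniv Δ))).trans ?_
    rw [M.one_comp]
    exact congrArg (fun w => M.ten w _) (M.comp_one (M.univ []))
  | cons A Γ ih =>
    refine (M.comp_single _ _ _).trans ?_
    refine (congrArg (fun w => M.comp _ (.single w))
      (M.tensorHom_comp_ten (M.one A) _ (M.one A) _ (M.one_comp _) ih)).trans ?_
    exact M.assocInv_ten _ _

/-- The tensor product of the extensions, restricted along the iterated universal arrow, is the
iterated tensor of the original multimaps. The head uses the fact that the inverse bracket takes
`foldUniv` back to `univ`. -/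
theorem foldArgs_foldUniv {Γ As : List M.Ob} (gs : Args M.Hom Γ As) :
    M.comp (foldArgs (C := M.Nucleus) (gs.mapHom M.ext)) (.single (M.foldUniv Γ)) =
      M.comp (M.foldUniv As) gs := by
  induction gs with
  | nil => exact (M.one_comp _).trans (M.comp_one (M.univ [])).symm
  | @cons Γ Δ Θ A As f fs h ih =>
    subst h
    refine (congrArg (fun w => M.comp w (.single _))
      (foldArgs_cons (C := M.Nucleus) (M.ext f) (fs.mapHom M.ext))).trans ?_
    refine (M.comp_single _ _ _).trans ?_
    refine (congrArg (fun w => M.comp _ (.single w)) (M.foldAppend_foldUniv Γ Δ)).trans ?_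
    refine (M.tensorHom_comp_ten _ _ _ _ (x' := f) ?_ ih).trans ?_
    · refine (M.comp_single _ _ _).trans ?_
      refine (congrArg (fun w => M.comp _ (.single w)) ((M.isUniversal_foldUniv Γ).fac _)).trans ?_
      exact M.ext_univ f
    · refine Eq.symm ((M.ten_comp (M.one A) (M.foldUniv As) (.single f) fs).trans ?_)
      exact congrArg (fun w => M.ten w _) (M.one_comp f)

/-- The first bracket turns `univ` into `foldUniv`, the tensor product of the extensions is
evaluated there, and the inverse bracket returns to `univ`. -/
theorem mcomp_comp_univ {Γ As : List M.Ob} {B : M.Ob} (f : M.Hom [M.T As] B)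
    (gs : Args M.Hom Γ As) :
    M.comp (mcomp (C := M.Nucleus) f (gs.mapHom M.ext)) (.single (M.univ Γ)) =
      M.comp (M.comp f (.single (M.univ As))) gs := by
  refine (M.comp_single _ _ _).trans ?_
  refine (congrArg (fun w => M.comp _ (.single w)) (M.ext_univ (M.foldUniv Γ))).trans ?_
  refine (M.comp_single _ _ _).trans ?_
  refine (congrArg (fun w => M.comp _ (.single w)) (M.foldArgs_foldUniv gs)).trans ?_
  refine (M.comp_single _ _ _).symm.trans ?_
  refine congrArg (fun w => M.comp w gs) ?_
  refine (M.comp_single _ _ _).trans ?_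
  exact congrArg (fun w => M.comp _ (.single w)) ((M.isUniversal_foldUniv As).fac _)

/-- The reason the nucleus remembers all multimaps: under `t ↦ t^#`, substitution becomes the
composition built from the monoidal structure. Both sides agree after restriction along `univ Γ`. -/
theorem ext_comp {Γ As : List M.Ob} {B : M.Ob} (f : M.Hom As B) (gs : Args M.Hom Γ As) :
    M.ext (M.comp f gs) = mcomp (C := M.Nucleus) (M.ext f) (gs.mapHom M.ext) :=
  (M.univ_universal Γ).hom_ext (by rw [mcomp_comp_univ, ext_univ, ext_univ])

theorem ext_one (A : M.Ob) : M.ext (M.one A) = mone (C := M.Nucleus) A :=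
  (M.univ_universal [A]).hom_ext (by
    rw [ext_univ]
    refine Eq.symm ((M.comp_single _ _ _).trans ?_)
    refine (congrArg (fun w => M.comp _ (.single w)) (M.ext_univ (M.foldUniv [A]))).trans ?_
    exact (M.isUniversal_rightInv A).fac _)

theorem ext_univ_self (Γ : List M.Ob) : M.ext (M.univ Γ) = M.one (M.T Γ) :=
  (M.univ_universal Γ).hom_ext ((M.ext_univ _).trans (M.one_comp _).symm)

theorem mcomp_congr {C : TensorCat.{u}} {Γ Γ' As As' : List C.carrier} {B : C.carrier}
    {f : MHom As B} {f' : MHom As' B} {a : Args MHom Γ As} {a' : Args MHom Γ' As'} (hΓ : Γ = Γ')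
    (hA : As = As') (hf : HEq f f') (h : HEq a a') : HEq (mcomp f a) (mcomp f' a') := by
  subst hΓ hA; obtain rfl := eq_of_heq h; obtain rfl := eq_of_heq hf; rfl

theorem kappa_heq {Γ : List M.Ob} {B : M.Ob} (f : M.Hom Γ B) : HEq (M.kappa.map f) (M.ext f) :=
  Args.castDom_heq (H := fun Γ B => M.Hom [M.T Γ] B) (List.map_id Γ).symm (M.ext f)

/-- The comparison of a representable multicategory with the one of its nucleus. -/
noncomputable def kappaFunctor : RepFunctor M M.nucleus.multi where
  ob := id
  map f := M.kappa.map f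
  map_one A := M.ext_one A
  map_comp {Γ As B} f gs := eq_of_heq (by
    refine (M.kappa_heq _).trans ((heq_of_eq (M.ext_comp f gs)).trans ?_)
    exact mcomp_congr (C := M.nucleus) (List.map_id _).symm (List.map_id _).symm
      (M.kappa_heq f).symm
      (Args.map_id_heq (H' := fun Γ B => M.Hom [M.T Γ] B) M.ext gs).symm)
  ob_T Γ := congrArg M.T (List.map_id Γ).symm
  map_univ Γ := (M.kappa_heq _).trans ((heq_of_eq (M.ext_univ_self Γ)).trans
    (M.one_congr (congrArg M.T (List.map_id Γ).symm)))

theorem kappaFunctor_heq {Γ : List M.Ob} {B : M.Ob} (f : M.Hom Γ B) :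
    HEq (M.kappaFunctor.map f) (M.ext f) := M.kappa_heq f

/-- The inverse of the comparison restricts along the universal arrows. -/
noncomputable def kappaInverse : M.kappaFunctor.Inverse where
  ob := id
  map {Γ B} f := Args.castDom (H := M.Hom) (List.map_id Γ).symm (M.comp f (.single (M.univ Γ)))
  ob_map_ob _ := rfl
  ob_ob _ := rfl
  map_map {Γ B} f := by
    refine (Args.castDom_heq _ _).trans (HEq.trans ?_ (heq_of_eq (M.ext_univ f)))
    -- `Γ.map id` equals `Γ` only propositionally. It is generalised to a variable `Δ` so that the
    -- equality can be substituted.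
    have h : ∀ (Δ : List M.Ob) (h : Γ = Δ) (e : M.Hom [M.T Δ] B), HEq e (M.ext f) →
        HEq (M.comp e (.single (M.univ Δ))) (M.comp (M.ext f) (.single (M.univ Γ))) := by
      rintro _ rfl e he
      rw [eq_of_heq he]
    exact h _ (List.map_id Γ).symm _ (M.kappaFunctor_heq f)
  map_map' {Γ B} f := by
    refine (M.kappaFunctor_heq _).trans ?_
    have h : ∀ (Δ : List M.Ob) (h : Γ = Δ) (e : M.Hom Δ B),
        HEq e (M.comp f (.single (M.univ Γ))) → HEq (M.ext e) f := by
      rintro _ rfl e he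
      rw [eq_of_heq he]
      exact heq_of_eq ((M.univ_universal _).hom_ext (M.ext_univ _))
    exact h _ (List.map_id Γ).symm _ (Args.castDom_heq _ _)

end RepMulticat

theorem RepFunctor.map_ext {M M' : RepMulticat.{u}} (F : RepFunctor M M') {Γ : List M.Ob} {B : M.Ob}
    (t : M.Hom Γ B) : HEq (F.map (M.ext t)) (M'.ext (F.map t)) :=
  F.map_heq_of_universal rfl (F.ob_T Γ) rfl (F.map_univ Γ) (M'.univ_universal _) (M.ext_univ t)
    (M'.ext_univ _) HEq.rfl

/-- A functor commutes with `t ↦ t^#` because it preserves the universal arrows that characterise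
extensions. -/
theorem RepFunctor.kappa_naturality {M M' : RepMulticat.{u}} (F : RepFunctor M M') :
    F.comp M'.kappaFunctor = M.kappaFunctor.comp (StrictFunctor.multi F.nucleus) :=
  toSig_injective (Sig.Fun.ext' rfl fun {Γ B} t => by
    refine (Args.castDom_heq _ _).trans (HEq.trans ?_ (Args.castDom_heq _ _).symm)
    refine (M'.kappaFunctor_heq _).trans ((F.map_ext t).symm.trans ?_)
    refine HEq.trans ?_ (F.nucleus.mmap_heq _).symm
    exact F.map_heq (congrArg (fun Γ => [M.T Γ]) (List.map_id Γ).symm) rfl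
      (M.kappaFunctor_heq t).symm)

/-- The comparison is natural. -/
noncomputable def RepMulticat.kappaIso : 𝟭 RepMulticat.{u} ≅ RepMulticat.N ⋙ TensorCat.M :=
  NatIso.ofComponents (fun M => M.kappaInverse.iso) fun F => RepFunctor.kappa_naturality F

end Multi

namespace Multi
open MonoidalCategory NaryTensor

/-! ## A monoidal category is isomorphic to the nucleus of its multicategory -/

section Box
variable {C : Type u} [Category.{u} C] [MonoidalCategory C] [NaryTensor C]

/-- The tensor product of two multimaps in a monoidal category. -/
def box {Γ Δ : List C} {A B : C} (x : MHom Γ A) (y : MHom Δ B) : MHom (Γ ++ Δ) (A ⊗ B) :=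
  (bracket _).hom ≫ (foldAppend Γ Δ).hom ≫ (((bracket Γ).inv ≫ x) ⊗ₘ ((bracket Δ).inv ≫ y))

theorem box_congr {Γ Γ' Δ Δ' : List C} {A A' B B' : C} {x : MHom Γ A} {x' : MHom Γ' A'}
    {y : MHom Δ B} {y' : MHom Δ' B'} (hΓ : Γ = Γ') (hΔ : Δ = Δ') (hA : A = A') (hB : B = B')
    (hx : HEq x x') (hy : HEq y y') : HEq (box x y) (box x' y') := by
  subst hΓ hΔ hA hB; obtain rfl := eq_of_heq hx; obtain rfl := eq_of_heq hy; rfl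

theorem box_comp {Γ Δ : List C} {A A' B B' : C} (x : MHom Γ A) (y : MHom Δ B) (f : A ⟶ A')
    (g : B ⟶ B') : box x y ≫ (f ⊗ₘ g) = box (x ≫ f) (y ≫ g) := by
  simp [box]

theorem bracket_hom_heq {Γ Δ : List C} (h : Γ = Δ) : HEq (bracket Γ).hom (bracket Δ).hom := by
  subst h; rfl

theorem bracket_eqToHom {Γ Δ : List C} (h : Γ = Δ) :
    (bracket Γ).hom ≫ eqToHom (congrArg fold h) = eqToHom (congrArg tens h) ≫ (bracket Δ).hom := by
  subst h; simp

theorem pair_inv_step {T A B : C} (b : T ≅ A ⊗ (B ⊗ 𝟙_ C)) (h : T = A ⊗ B)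
    (hb : b.hom = eqToHom h ≫ A ◁ (ρ_ B).inv) :
    b.inv = A ◁ (ρ_ B).hom ≫ eqToHom h.symm := by
  subst h
  rw [← cancel_epi b.hom, Iso.hom_inv_id, hb]
  simp only [eqToHom_refl, Category.id_comp, Category.comp_id]
  rw [← MonoidalCategory.whiskerLeft_comp, Iso.inv_hom_id, MonoidalCategory.whiskerLeft_id]

theorem bracket_pair_inv (A B : C) :
    (bracket [A, B]).inv = A ◁ (ρ_ B).hom ≫ eqToHom (tens_pair A B).symm :=
  pair_inv_step (bracket [A, B]) (tens_pair A B) (bracket_pair A B)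

theorem mcomp_pair_step {X G D T A B S : C} (b : S ≅ X) (a : X ⟶ G ⊗ D) (x : G ⟶ A) (y : D ⟶ B)
    {w : D ⟶ B ⊗ 𝟙_ C} (hw : w = y ≫ (ρ_ B).inv) (h : A ⊗ B = T) {c : A ⊗ (B ⊗ 𝟙_ C) ⟶ T}
    (hc : c = A ◁ (ρ_ B).hom ≫ eqToHom h) :
    HEq (b.hom ≫ (𝟙 X ≫ a ≫ (x ⊗ₘ w)) ≫ c ≫ 𝟙 T) (b.hom ≫ a ≫ (x ⊗ₘ y)) := by
  subst h hw hc
  refine heq_of_eq ?_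
  have h : (x ⊗ₘ (y ≫ (ρ_ B).inv)) ≫ A ◁ (ρ_ B).hom = x ⊗ₘ y := by
    rw [← id_tensorHom, tensorHom_comp_tensorHom]; simp
  simp only [eqToHom_refl, Category.comp_id, Category.id_comp, Category.assoc, h]

/-- Composition with the binary universal arrow lands first in `A ⊗ (B ⊗ I)`. The normalisation of
the bracket on two-element lists says that removing the unit by `ρ` is its inverse, up to the
identification of `tens [A, B]` with `A ⊗ B`. -/
theorem mcomp_pair_heq {Γ Δ : List C} {A B : C} (x : MHom Γ A) (y : MHom Δ B) :
    HEq (mcomp (𝟙 (tens [A, B])) (.pair x y)) (box x y) := by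
  have h : foldArgs (.single y) = ((bracket Δ).inv ≫ y) ≫ (ρ_ B).inv := by
    exact (Iso.inv_hom_id_assoc (bracket Δ) _).symm.trans
      ((congrArg ((bracket Δ).inv ≫ ·) (foldArgs_single y)).trans (Category.assoc _ _ _).symm)
  exact mcomp_pair_step (bracket (Γ ++ Δ)) _ _ _ h (tens_pair A B).symm (bracket_pair_inv A B)

theorem mcomp_unary {Γ : List C} {A B : C} (f : A ⟶ B) (v : MHom Γ A) :
    mcomp ((unary A).hom ≫ f : MHom [A] B) (.single v) = v ≫ f := by
  rw [mcomp_single]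
  exact congrArg (v ≫ ·) (Iso.inv_hom_id_assoc _ _)

theorem box_mone (A B : C) : HEq (box (mone A) (mone B)) (𝟙 (tens [A, B] : C)) :=
  (mcomp_pair_heq (mone A) (mone B)).symm.trans (heq_of_eq (mcomp_mones (𝟙 (tens [A, B]))))

/-- After cancelling brackets, naturality of the associator leaves exactly `foldAppend_assoc`. The
discrepancy is the `eqToHom` for associativity of `++`. -/
theorem box_assoc {Γ Δ Θ : List C} {X Y Z : C} (x : MHom Γ X) (y : MHom Δ Y) (z : MHom Θ Z) :
    HEq (box (box x y) z ≫ (α_ X Y Z).hom) (box x (box y z)) := by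
  have h : box (box x y) z ≫ (α_ X Y Z).hom =
      eqToHom (congrArg tens (List.append_assoc Γ Δ Θ)) ≫ box x (box y z) := by
    have h₁ : ((bracket (Γ ++ Δ)).inv ≫ box x y) ⊗ₘ ((bracket Θ).inv ≫ z) =
        (foldAppend Γ Δ).hom ▷ fold Θ ≫
          ((((bracket Γ).inv ≫ x) ⊗ₘ ((bracket Δ).inv ≫ y)) ⊗ₘ ((bracket Θ).inv ≫ z)) := by
      rw [← tensorHom_id, tensorHom_comp_tensorHom, Category.id_comp, box, Iso.inv_hom_id_assoc]
    have h₂ : ((bracket Γ).inv ≫ x) ⊗ₘ ((bracket (Δ ++ Θ)).inv ≫ box y z) =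
        fold Γ ◁ (foldAppend Δ Θ).hom ≫
          (((bracket Γ).inv ≫ x) ⊗ₘ (((bracket Δ).inv ≫ y) ⊗ₘ ((bracket Θ).inv ≫ z))) := by
      rw [← id_tensorHom, tensorHom_comp_tensorHom, Category.id_comp, box, Iso.inv_hom_id_assoc]
    rw [box, h₁, box, h₂]
    simp only [Category.assoc]
    rw [associator_naturality, reassoc_of% foldAppend_assoc Γ Δ Θ,
      reassoc_of% bracket_eqToHom (List.append_assoc Γ Δ Θ)]
  rw [h]
  exact eqToHom_comp_heq' _ _

theorem box_nil_step {S X T B U : C} (b : S ≅ X) (c : T ≅ 𝟙_ C) (y : S ⟶ B) :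
    (b.hom ≫ (λ_ X).inv ≫ ((c.inv ≫ c.hom) ⊗ₘ (b.inv ≫ y))) ≫ (λ_ B).hom = y := by
  simp

theorem box_nil_left {Δ : List C} {B : C} (y : MHom Δ B) :
    box ((bracket []).hom : MHom [] (𝟙_ C)) y ≫ (λ_ B).hom = y :=
  box_nil_step (U := B) (bracket Δ) (bracket []) y

theorem nil_right_step {S S' X G T A : C} (b : S ≅ X) (b' : S' ≅ G) (c : T ≅ 𝟙_ C)
    (a : X ⟶ G ⊗ 𝟙_ C) (e : X ⟶ G) (d : S ⟶ S') (x : S' ⟶ A) (ha : a ≫ (ρ_ G).hom = e)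
    (he : b.hom ≫ e = d ≫ b'.hom) :
    (b.hom ≫ a ≫ ((b'.inv ≫ x) ⊗ₘ (c.inv ≫ c.hom))) ≫ (ρ_ A).hom = d ≫ x := by
  obtain rfl : a = e ≫ (ρ_ G).inv := by rw [← ha]; simp
  rw [Iso.inv_hom_id, Category.assoc, Category.assoc, Category.assoc, tensorHom_id,
    rightUnitor_naturality, Iso.inv_hom_id_assoc, reassoc_of% he, Iso.hom_inv_id_assoc]

theorem box_nil_right {Γ : List C} {A : C} (x : MHom Γ A) :
    HEq (box x ((bracket []).hom : MHom [] (𝟙_ C)) ≫ (ρ_ A).hom) x := by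
  have h : box x ((bracket []).hom : MHom [] (𝟙_ C)) ≫ (ρ_ A).hom =
      eqToHom (congrArg tens (List.append_nil Γ)) ≫ x :=
    nil_right_step (bracket (Γ ++ [])) (bracket Γ) (bracket []) (foldAppend Γ []).hom _ _ x
      (foldAppend_nil_rightUnitor Γ) (bracket_eqToHom (List.append_nil Γ))
  rw [h]
  exact eqToHom_comp_heq' _ _

theorem cons_step {S X A G U T : C} (b : S ≅ A ⊗ G) (c : T ≅ A ⊗ 𝟙_ C) (d : U ≅ G) :
    b.hom ≫ (A ◁ (λ_ G).inv ≫ (α_ A (𝟙_ C) G).inv) ≫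
      ((c.inv ≫ c.hom ≫ (ρ_ A).hom) ⊗ₘ (d.inv ≫ d.hom)) = b.hom := by
  simp

/-- Exhibits brackets as satisfying the recursion that defines `foldUniv`. -/
theorem box_bracket (A : C) (Γ : List C) :
    box (mone A) ((bracket Γ).hom : MHom Γ (fold Γ)) = (bracket (A :: Γ)).hom :=
  cons_step (X := A) (bracket (A :: Γ)) (bracket [A]) (bracket Γ)

end Box

namespace TensorCat
variable (C : TensorCat.{u})

theorem ten_heq {Γ Δ : List C.carrier} {A B : C.carrier} (x : MHom Γ A) (y : MHom Δ B) :
    HEq (C.multi.ten x y) (box x y) := mcomp_pair_heq (C := C.carrier) x y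

theorem univ_heq_box (A B : C.carrier) :
    HEq (box (mone A) (mone B)) (C.multi.univ [A, B]) := box_mone A B

theorem univ_heq_nil : HEq ((bracket []).hom : MHom [] (𝟙_ C.carrier)) (C.multi.univ []) := by
  have h : ∀ (T : C.carrier) (h : (tens [] : C.carrier) = T), HEq (eqToHom h) (𝟙 (tens [] : C.carrier)) := by
    rintro _ rfl; rfl
  refine HEq.trans (heq_of_eq ?_) (h _ tens_nil)
  exact bracket_nil

/-- Morphisms as unary multimaps. -/
def emb {A B : C.carrier} (f : A ⟶ B) : C.multi.Hom [A] B := (unary A).hom ≫ f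

theorem comp_emb {Γ : List C.carrier} {A B : C.carrier} (f : A ⟶ B) (v : MHom Γ A) :
    C.multi.comp (C.emb f) (.single v) = v ≫ f := mcomp_unary (C := C.carrier) f v

/-- The criterion behind strictness of the comparison with the nucleus. A structural map `e` of the
nucleus is determined by its composite with a universal arrow, so it is the image of `k` as soon as
`v ≫ k`, computed in `C`, is that composite. -/
theorem emb_heq {Γ Γ' : List C.carrier} {R R' B B' : C.carrier} {k : R ⟶ B}
    {e : C.multi.Hom [R'] B'} {v : MHom Γ R} {v' : C.multi.Hom Γ' R'} {w : C.multi.Hom Γ' B'}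
    (hΓ : Γ = Γ') (hR : R = R') (hB : B = B') (hv : HEq v v')
    (hv' : C.multi.toMulticat.IsUniversal v') (he : C.multi.comp e (.single v') = w)
    (h : HEq (v ≫ k) w) : HEq (C.emb k) e := by
  refine RepFunctor.universal_heq (M := C.multi.toMulticat) hΓ hR hB hv hv' ?_
  rw [he, C.comp_emb]
  exact h

theorem foldOb_eq : ∀ Γ : List C.carrier, (fold Γ : C.carrier) = C.multi.foldOb Γ
  | [] => (tens_nil (C := C.carrier)).symm
  | A :: Γ => (congrArg (A ⊗ ·) (foldOb_eq Γ)).trans (tens_pair (C := C.carrier) A _).symm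

/-- The universal arrow of `Γ` is the identity of `tens Γ`, so its iterated version is the bracket
itself. The empty list relies on `bracket_nil`. -/
theorem bracket_heq_foldUniv : ∀ Γ : List C.carrier,
    HEq (bracket Γ).hom (C.multi.foldUniv Γ)
  | [] => C.univ_heq_nil
  | A :: Γ => (heq_of_eq (box_bracket A Γ).symm).trans
      ((box_congr rfl rfl rfl (C.foldOb_eq Γ) HEq.rfl (bracket_heq_foldUniv Γ)).trans
        (C.ten_heq (mone A) (C.multi.foldUniv Γ)).symm)

theorem ten₃_heq (X Y Z : C.carrier) :
    HEq (box (box (mone X) (mone Y)) (mone Z)) (C.multi.ten₃ X Y Z) :=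
  (box_congr rfl rfl (tens_pair X Y).symm rfl (C.univ_heq_box X Y) HEq.rfl).trans
    (C.ten_heq (C.multi.univ [X, Y]) (mone Z)).symm

theorem ten₃'_heq (X Y Z : C.carrier) :
    HEq (box (mone X) (box (mone Y) (mone Z))) (C.multi.ten₃' X Y Z) :=
  (box_congr rfl rfl rfl (tens_pair Y Z).symm HEq.rfl (C.univ_heq_box Y Z)).trans
    (C.ten_heq (mone X) (C.multi.univ [Y, Z])).symm

theorem tensor_eq {X X' Y Y' : C.carrier} (hX : X = X') (hY : Y = Y') :
    X ⊗ Y = tens [X', Y'] := by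
  subst hX hY; exact (tens_pair X Y).symm

theorem _root_.Multi.RepMulticat.foldUniv_congr (M : RepMulticat.{u}) {Γ Δ : List M.Ob}
    (h : Γ = Δ) : HEq (M.foldUniv Γ) (M.foldUniv Δ) := by
  subst h; rfl

/-- A monoidal category is the nucleus of its multicategory. -/
noncomputable def toNucleus : StrictFunctor C C.multi.nucleus where
  obj A := A
  map f := C.emb f
  map_id A := Category.comp_id _
  map_comp f g := ((C.comp_emb g _).trans (Category.assoc _ _ _)).symm
  obj_unit := (tens_nil (C := C.carrier)).symm
  obj_tensor A B := (tens_pair (C := C.carrier) A B).symm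
  obj_tens Γ := congrArg C.multi.T (List.map_id Γ).symm
  map_tensor {A A' B B'} f g :=
    C.emb_heq rfl (tens_pair A B).symm (tens_pair A' B').symm (C.univ_heq_box A B)
      (C.multi.univ_universal _) (C.multi.tensorHom_univ (C.emb f) (C.emb g))
      ((heq_of_eq (box_comp (mone A) (mone B) f g)).trans (C.ten_heq (C.emb f) (C.emb g)).symm)
  map_associator X Y Z :=
    C.emb_heq rfl (C.tensor_eq (tens_pair X Y).symm rfl) (C.tensor_eq rfl (tens_pair Y Z).symm)
      (C.ten₃_heq X Y Z) (C.multi.isUniversal_ten₃ X Y Z)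
      ((C.multi.isUniversal_ten₃ X Y Z).fac (C.multi.ten₃' X Y Z))
      ((box_assoc (mone X) (mone Y) (mone Z)).trans (C.ten₃'_heq X Y Z))
  map_leftUnitor A :=
    C.emb_heq (v := box ((bracket []).hom : MHom [] (𝟙_ C.carrier)) (mone A)) rfl
      (C.tensor_eq tens_nil.symm rfl) rfl
      ((box_congr rfl rfl tens_nil.symm rfl C.univ_heq_nil HEq.rfl).trans
        (C.ten_heq (C.multi.univ []) (mone A)).symm)
      (C.multi.isUniversal_leftInv A) ((C.multi.isUniversal_leftInv A).fac _)
      (heq_of_eq (box_nil_left (mone A)))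
  map_rightUnitor A :=
    C.emb_heq (v := box (mone A) ((bracket []).hom : MHom [] (𝟙_ C.carrier))) rfl
      (C.tensor_eq rfl tens_nil.symm) rfl
      ((box_congr rfl rfl rfl tens_nil.symm HEq.rfl C.univ_heq_nil).trans
        (C.ten_heq (mone A) (C.multi.univ [])).symm)
      (C.multi.isUniversal_rightInv A) ((C.multi.isUniversal_rightInv A).fac _)
      (box_nil_right (mone A))
  map_bracket Γ :=
    -- Composing with the universal arrow, an identity, leaves the bracket, which is the iterated
    -- universal arrow of the nucleus.
    C.emb_heq (v := 𝟙 (tens Γ)) (v' := C.multi.univ (Γ.map _root_.id)) (List.map_id Γ).symm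
      (congrArg tens (List.map_id Γ).symm)
      ((C.foldOb_eq Γ).trans (congrArg C.multi.foldOb (List.map_id Γ).symm))
      (C.multi.univ_heq (List.map_id Γ).symm) (C.multi.univ_universal _) (C.multi.ext_univ _)
      ((heq_of_eq (Category.id_comp _)).trans ((C.bracket_heq_foldUniv Γ).trans
        (C.multi.foldUniv_congr (List.map_id Γ).symm)))

end TensorCat

-- Invertible strict monoidal functors.

namespace StrictFunctor
variable {C D : TensorCat.{u}} (F : StrictFunctor C D)

/-- A functor inverse to a strict monoidal functor. -/
structure Inverse extends D.carrier ⥤ C.carrier where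
  comp_eq : F.toFunctor ⋙ toFunctor = 𝟭 _
  comp_eq' : toFunctor ⋙ F.toFunctor = 𝟭 _

namespace Inverse
variable {F} (G : F.Inverse)

theorem obj_obj (A : C.carrier) : G.obj (F.obj A) = A := Functor.congr_obj G.comp_eq A

theorem obj_obj' (A : D.carrier) : F.obj (G.obj A) = A := Functor.congr_obj G.comp_eq' A

theorem map_map {A B : C.carrier} (f : A ⟶ B) : HEq (G.map (F.map f)) f := by
  have := Functor.congr_hom G.comp_eq f
  simp only [Functor.comp_map, Functor.id_map] at this
  rw [this]; simp

theorem map_map' {A B : D.carrier} (f : A ⟶ B) : HEq (F.map (G.map f)) f := by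
  have := Functor.congr_hom G.comp_eq' f
  simp only [Functor.comp_map, Functor.id_map] at this
  rw [this]; simp

theorem obj_eq (G : F.Inverse) {A B : C.carrier} (h : F.obj A = F.obj B) : A = B := by
  rw [← G.obj_obj A, h, G.obj_obj]

/-- As for multicategories, strictness of the inverse is tested after applying `F`. -/
theorem heq_of_map_heq (G : F.Inverse) {A A' B B' : C.carrier} (hA : F.obj A = F.obj A')
    (hB : F.obj B = F.obj B') {f : A ⟶ B} {g : A' ⟶ B'} (h : HEq (F.map f) (F.map g)) :
    HEq f g :=
  (G.map_map f).symm.trans ((functor_map_heq G.toFunctor hA hB h).trans (G.map_map g))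

theorem obj_list (Γ : List D.carrier) : (Γ.map G.obj).map F.obj = Γ := by
  rw [List.map_map, show F.obj ∘ G.obj = _root_.id from funext G.obj_obj', List.map_id]

/-- The inverse of a strict monoidal functor is strict. -/
def functor : StrictFunctor D C where
  toFunctor := G.toFunctor
  obj_unit := G.obj_eq ((G.obj_obj' _).trans F.obj_unit.symm)
  obj_tensor A B := G.obj_eq ((G.obj_obj' _).trans
    (F.obj_tensor' (G.obj_obj' A) (G.obj_obj' B)).symm)
  obj_tens Γ := G.obj_eq ((G.obj_obj' _).trans ((F.obj_tens _).trans
    (congrArg tens (G.obj_list Γ))).symm)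
  map_tensor {A A' B B'} f g := G.heq_of_map_heq
    ((G.obj_obj' _).trans (F.obj_tensor' (G.obj_obj' A) (G.obj_obj' B)).symm)
    ((G.obj_obj' _).trans (F.obj_tensor' (G.obj_obj' A') (G.obj_obj' B')).symm)
    ((G.map_map' _).trans (F.map_tensorHom_heq (G.obj_obj' _) (G.obj_obj' _) (G.obj_obj' _)
      (G.obj_obj' _) (G.map_map' f) (G.map_map' g)).symm)
  map_associator X Y Z := G.heq_of_map_heq
    ((G.obj_obj' _).trans (F.obj_tensor' (F.obj_tensor' (G.obj_obj' X) (G.obj_obj' Y))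
      (G.obj_obj' Z)).symm)
    ((G.obj_obj' _).trans (F.obj_tensor' (G.obj_obj' X) (F.obj_tensor' (G.obj_obj' Y)
      (G.obj_obj' Z))).symm)
    ((G.map_map' _).trans
      (F.map_associator_heq (G.obj_obj' X) (G.obj_obj' Y) (G.obj_obj' Z)).symm)
  map_leftUnitor A := G.heq_of_map_heq
    ((G.obj_obj' _).trans (F.obj_tensor' F.obj_unit (G.obj_obj' A)).symm) rfl
    ((G.map_map' _).trans (F.map_leftUnitor_heq (G.obj_obj' A)).symm)
  map_rightUnitor A := G.heq_of_map_heq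
    ((G.obj_obj' _).trans (F.obj_tensor' (G.obj_obj' A) F.obj_unit).symm) rfl
    ((G.map_map' _).trans (F.map_rightUnitor_heq (G.obj_obj' A)).symm)
  map_bracket Γ := G.heq_of_map_heq
    ((G.obj_obj' _).trans ((F.obj_tens _).trans (congrArg tens (G.obj_list Γ))).symm)
    ((G.obj_obj' _).trans ((fold_map F _).trans (congrArg fold (G.obj_list Γ))).symm)
    ((G.map_map' _).trans ((F.map_bracket _).trans (bracket_hom_heq (G.obj_list Γ))).symm)

/-- An invertible strict monoidal functor is an isomorphism. -/
def iso : C ≅ D where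
  hom := F
  inv := G.functor
  hom_inv_id := ext' G.comp_eq
  inv_hom_id := ext' G.comp_eq'

end Inverse
end StrictFunctor

-- Bijectivity and naturality of the comparison with the nucleus.

namespace TensorCat

/-- Unary multimaps as morphisms. -/
def unemb (C : TensorCat.{u}) {A B : C.carrier} (f : C.multi.Hom [A] B) : A ⟶ B :=
  (unary A).inv ≫ f

theorem unemb_emb (C : TensorCat.{u}) {A B : C.carrier} (f : A ⟶ B) : C.unemb (C.emb f) = f :=
  Iso.inv_hom_id_assoc _ _

theorem emb_unemb (C : TensorCat.{u}) {A B : C.carrier} (f : C.multi.Hom [A] B) :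
    C.emb (C.unemb f) = f :=
  Iso.hom_inv_id_assoc _ _

theorem emb_injective (C : TensorCat.{u}) {A B : C.carrier} {f g : A ⟶ B}
    (h : C.emb f = C.emb g) : f = g := by
  rw [← C.unemb_emb f, h, C.unemb_emb]

noncomputable def toNucleusInverse (C : TensorCat.{u}) : C.toNucleus.Inverse where
  obj A := A
  map f := C.unemb f
  map_id A := C.emb_injective ((C.emb_unemb _).trans (C.toNucleus.map_id A).symm)
  map_comp f g := C.emb_injective ((C.emb_unemb _).trans (by
    refine Eq.trans ?_ (C.toNucleus.map_comp _ _).symm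
    exact congrArg₂ (· ≫ ·) (C.emb_unemb f).symm (C.emb_unemb g).symm))
  comp_eq := CategoryTheory.Functor.hext (fun _ => rfl) fun _ _ f => heq_of_eq (C.unemb_emb f)
  comp_eq' := CategoryTheory.Functor.hext (fun _ => rfl) fun _ _ f => heq_of_eq (C.emb_unemb f)

theorem _root_.Multi.StrictFunctor.mmap_emb {C D : TensorCat.{u}} (F : StrictFunctor C D)
    {A B : C.carrier} (f : A ⟶ B) : F.mmap (C.emb f) = D.emb (F.map f) :=
  eq_of_heq ((F.mmap_heq _).trans (F.map_comp_heq (F.obj_tens [A]) rfl rfl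
    ((F.mmap_heq _).symm.trans (heq_of_eq (F.mmap_mone A))) HEq.rfl))

theorem toNucleus_naturality {C D : TensorCat.{u}} (F : StrictFunctor C D) :
    F.comp D.toNucleus = C.toNucleus.comp (RepFunctor.nucleus F.multi) :=
  StrictFunctor.ext' (CategoryTheory.Functor.hext (fun _ => rfl) fun _ _ f => heq_of_eq (F.mmap_emb f).symm)

/-- Every monoidal category is naturally isomorphic to the nucleus of its multicategory. -/
noncomputable def nucleusIso : TensorCat.M ⋙ RepMulticat.N ≅ 𝟭 TensorCat.{u} :=
  (NatIso.ofComponents (fun C => C.toNucleusInverse.iso) fun F => toNucleus_naturality F).symm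

end TensorCat

/-- The nucleus is part of an adjoint equivalence. -/
noncomputable def RepMulticat.equivalence : RepMulticat.{u} ≌ TensorCat.{u} :=
  -- The constructor adjusts the unit so that the triangle identities hold, hence only the existence
  -- of the two natural isomorphisms matters. The comparison `kappaIso` itself need not be the unit.
  .mk RepMulticat.N TensorCat.M RepMulticat.kappaIso TensorCat.nucleusIso

end Multi

namespace Multi

/-! ## The nucleus of a free multicategory -/

section
variable {A B S : Type*} [Category A] [Category B] [Category S]

/-- The inverse of an equivalence is fully faithful, so a universal arrow remains universal after
transport. Any isomorphism `k` will do, which allows the explicit comparison to be used instead of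
the unit of `e`. -/
theorem bijective_comp_equivalence (e : A ≌ B) (U : A ⥤ S) {X : S} {o : A} (ι : X ⟶ U.obj o)
    (k : o ≅ e.inverse.obj (e.functor.obj o))
    (h : ∀ M, Function.Bijective fun f : o ⟶ M => ι ≫ U.map f) (Z : B) :
    Function.Bijective fun f : e.functor.obj o ⟶ Z =>
      (ι ≫ U.map k.hom) ≫ (e.inverse ⋙ U).map f := by
  have h₁ : Function.Bijective fun f : e.functor.obj o ⟶ Z => k.hom ≫ e.inverse.map f :=
    k.homFromEquiv.symm.bijective.comp (Functor.FullyFaithful.map_bijective (.ofFullyFaithful _) _ _)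
  have h₂ := (h _).comp h₁
  have h₃ : (fun f : e.functor.obj o ⟶ Z => (ι ≫ U.map k.hom) ≫ (e.inverse ⋙ U).map f) =
      (fun f => ι ≫ U.map f) ∘ fun f => k.hom ≫ e.inverse.map f := by
    funext f
    simp
  exact h₃ ▸ h₂
end

/-- Applied with the comparison functor as `k`, whose underlying map of signatures is `kappa`; the
composite of the inverse with `U` is `V` by definition. -/
theorem OSyn.nucleus_bijective (S : Sig.{u}) (C : TensorCat.{u}) :
    Function.Bijective fun f : RepMulticat.N.obj (OSyn S) ⟶ C =>
      (OSyn.incl S ≫ (OSyn S).kappa) ≫ TensorCat.V.map f :=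
  bijective_comp_equivalence RepMulticat.equivalence RepMulticat.U (OSyn.incl S)
    (RepMulticat.kappaIso.app (OSyn S)) (OSyn.bijective S) C

theorem OSyn.main :
    (∃ (F : Sig.{u} ⥤ RepMulticat.{u}) (adj : F ⊣ RepMulticat.U) (h : ∀ S, F.obj S = OSyn S),
        ∀ S, adj.unit.app S ≫ RepMulticat.U.map (eqToHom (h S)) = OSyn.incl S) ∧
      (∃ e : RepMulticat.{u} ≌ TensorCat.{u}, e.functor = RepMulticat.N ∧
        (∀ C, (e.inverse.obj C).data = C.tensorData) ∧
        e.inverse ⋙ RepMulticat.U = TensorCat.V) ∧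
      TensorCat.V.{u}.IsRightAdjoint ∧
      (∀ (L : Sig.{u} ⥤ TensorCat.{u}) (adj : L ⊣ TensorCat.V) (S : Sig.{u}),
        ∃! i : L.obj S ≅ RepMulticat.N.obj (OSyn S),
          adj.unit.app S ≫ TensorCat.V.map i.hom = OSyn.incl S ≫ (OSyn S).kappa) := by
  refine ⟨exists_adjunction _ _ OSyn.incl OSyn.bijective,
    ⟨RepMulticat.equivalence, rfl, fun C => rfl, TensorCat.M_U⟩, ?_,
    fun L adj S => existsUnique_iso _ adj _ (OSyn.nucleus_bijective S)⟩
  obtain ⟨F, adj, _⟩ := exists_adjunction TensorCat.V (fun S => RepMulticat.N.obj (OSyn S))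
    (fun S => OSyn.incl S ≫ (OSyn S).kappa) OSyn.nucleus_bijective
  exact ⟨F, ⟨adj⟩⟩

end Multi

-- Coherence for permutations of factors in a symmetric monoidal category.

namespace Multi
open MonoidalCategory NaryTensor

/-! ## Reordering an iterated tensor product -/

section Exch
variable {C : Type u} [Category.{u} C] [MonoidalCategory C] [SymmetricCategory C]

/-- Exchange of the first two factors of a tensor product. -/
def exch (A B X : C) : A ⊗ (B ⊗ X) ⟶ B ⊗ (A ⊗ X) :=
  (α_ A B X).inv ≫ (β_ A B).hom ▷ X ≫ (α_ B A X).hom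

theorem exch_exch (A B X : C) : exch A B X ≫ exch B A X = 𝟙 _ := by
  simp only [exch, Category.assoc, Iso.hom_inv_id_assoc]
  rw [← comp_whiskerRight_assoc, SymmetricCategory.symmetry]
  simp

theorem exch_naturality {A A' B B' X X' : C} (f : A ⟶ A') (g : B ⟶ B') (h : X ⟶ X') :
    (f ⊗ₘ (g ⊗ₘ h)) ≫ exch A' B' X' = exch A B X ≫ (g ⊗ₘ (f ⊗ₘ h)) := by
  simp only [exch, Category.assoc]
  rw [associator_inv_naturality_assoc, ← tensorHom_id, tensorHom_comp_tensorHom_assoc,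
    ← associator_naturality, ← tensorHom_id, tensorHom_comp_tensorHom_assoc,
    BraidedCategory.braiding_naturality]
  simp

theorem exch_whiskerLeft (A B : C) {X Y : C} (h : X ⟶ Y) :
    A ◁ B ◁ h ≫ exch A B Y = exch A B X ≫ B ◁ A ◁ h := by
  have := exch_naturality (𝟙 A) (𝟙 B) h
  simpa using this

theorem exch_whiskerRight (A : C) {B B' : C} (g : B ⟶ B') (X : C) :
    A ◁ g ▷ X ≫ exch A B' X = exch A B X ≫ g ▷ (A ⊗ X) := by
  have := exch_naturality (𝟙 A) g (𝟙 X)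
  simpa using this

/-- One hexagon: exchanging `A` with `B` and then with `D` is exchanging it with `B ⊗ D`. The
companion `exch_tensor_left` is the other hexagon. -/
theorem exch_tensor (A B D X : C) :
    exch A B (D ⊗ X) ≫ B ◁ exch A D X =
      A ◁ (α_ B D X).inv ≫ exch A (B ⊗ D) X ≫ (α_ B D (A ⊗ X)).hom := by
  simp only [exch, BraidedCategory.braiding_tensor_right_hom, comp_whiskerRight, Category.assoc,
    MonoidalCategory.whiskerLeft_comp]
  simp only [whiskerRight_tensor, whisker_assoc, Category.assoc]
  monoidal

theorem exch_tensor_left (A B D X : C) :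
    A ◁ exch B D X ≫ exch A D (B ⊗ X) =
      (α_ A B (D ⊗ X)).inv ≫ exch (A ⊗ B) D X ≫ D ◁ (α_ A B X).hom := by
  simp only [exch, BraidedCategory.braiding_tensor_left_hom, comp_whiskerRight, Category.assoc,
    MonoidalCategory.whiskerLeft_comp]
  simp only [whiskerRight_tensor, whisker_assoc, Category.assoc]
  monoidal

/-- By the hexagon, each side moves `A` past the block formed by `B` and `D` in one step. They
differ in whether `B` and `D` are exchanged before or after, which is naturality in the braiding of
`B` and `D`. -/
theorem exch_yang_baxter (A B D X : C) :
    A ◁ exch B D X ≫ exch A D (B ⊗ X) ≫ D ◁ exch A B X =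
      exch A B (D ⊗ X) ≫ B ◁ exch A D X ≫ exch B D (A ⊗ X) := by
  rw [exch_tensor, reassoc_of% exch_tensor]
  conv_lhs => rw [exch]
  conv_rhs => rw [exch.eq_1 B D (A ⊗ X)]
  simp only [MonoidalCategory.whiskerLeft_comp, Category.assoc, Iso.hom_inv_id_assoc]
  rw [← MonoidalCategory.whiskerLeft_comp_assoc A (α_ D B X).hom, Iso.hom_inv_id,
    MonoidalCategory.whiskerLeft_id, Category.id_comp, reassoc_of% exch_whiskerRight]

/-- Inductive step for exchanging two insertions that both pass a factor `D`: Yang–Baxter reorders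
the three exchanges, and the hypothesis deals with the remaining factors. -/
theorem exch_step {A B D X X₁ X₄ X₅ : C} {n : B ⊗ X₄ ⟶ X₅} {k : A ⊗ X₅ ⟶ X} {i : A ⊗ X₄ ⟶ X₁}
    {m : B ⊗ X₁ ⟶ X} (h : A ◁ n ≫ k = exch A B X₄ ≫ B ◁ i ≫ m) :
    A ◁ (exch B D X₄ ≫ D ◁ n) ≫ exch A D X₅ ≫ D ◁ k =
      exch A B (D ⊗ X₄) ≫ B ◁ (exch A D X₄ ≫ D ◁ i) ≫ exch B D X₁ ≫ D ◁ m := by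
  have h' := congrArg (D ◁ ·) h
  simp only [MonoidalCategory.whiskerLeft_comp] at h'
  simp only [MonoidalCategory.whiskerLeft_comp, Category.assoc]
  rw [reassoc_of% exch_whiskerLeft A D n, h', reassoc_of% exch_whiskerLeft B D i,
    reassoc_of% exch_yang_baxter A B D X₄]

theorem ins_step {A B X₁ X₂ X₃ X₄ X₅ X : C} {m₄ : X₃ ⟶ X₄} {o : B ⊗ X₄ ⟶ X₅} {k : A ⊗ X₅ ⟶ X}
    {i₂ : A ⊗ X₃ ⟶ X₂} {n : X₂ ⟶ X₁} {j : B ⊗ X₁ ⟶ X} {i₄ : A ⊗ X₄ ⟶ X₁}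
    (e : A ◁ m₄ ≫ i₄ = i₂ ≫ n) (e' : A ◁ o ≫ k = exch A B X₄ ≫ B ◁ i₄ ≫ j) :
    A ◁ (B ◁ m₄ ≫ o) ≫ k = (exch A B X₃ ≫ B ◁ i₂) ≫ B ◁ n ≫ j := by
  have h := congrArg (B ◁ ·) e
  simp only [MonoidalCategory.whiskerLeft_comp] at h
  rw [MonoidalCategory.whiskerLeft_comp, Category.assoc, e', Category.assoc, ← reassoc_of% h,
    reassoc_of% exch_whiskerLeft A B m₄]

theorem trans_step {A X₁ X₂ X₃ X₄ X : C} {i : A ⊗ X₁ ⟶ X₄} {m : X₄ ⟶ X} {k : X₁ ⟶ X₂}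
    {j : A ⊗ X₂ ⟶ X} {n : X₃ ⟶ X₁} (e : A ◁ k ≫ j = i ≫ m) :
    A ◁ (n ≫ k) ≫ j = (A ◁ n ≫ i) ≫ m := by
  rw [MonoidalCategory.whiskerLeft_comp, Category.assoc, e, Category.assoc]

theorem here_step {A B X₁ X₂ : C} (i : A ⊗ X₂ ⟶ X₁) :
    A ◁ 𝟙 (B ⊗ X₂) ≫ exch A B X₂ ≫ B ◁ i = exch A B X₂ ≫ B ◁ i ≫ 𝟙 (B ⊗ X₁) := by
  simp

theorem there_step {D B X X₁ : C} (m : B ⊗ X ⟶ X₁) :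
    D ◁ m ≫ 𝟙 (D ⊗ X₁) = exch D B X ≫ B ◁ 𝟙 (D ⊗ X) ≫ exch B D X ≫ D ◁ m := by
  rw [MonoidalCategory.whiskerLeft_id, Category.id_comp, reassoc_of% exch_exch, Category.comp_id]

end Exch

section Reorder
variable {C : Type u} [Category.{u} C] [MonoidalCategory C] [SymmetricCategory C] {X Y : Type*}

/-- `m` moves the first factor `A`, with label `a`, of `A ⊗ fold Γ₀` to its place in `Γ`; the factors
carry labels. -/
inductive Ins : (a : X) → (A : C) → (l₀ : List X) → (Γ₀ : List C) → (l : List X) → (Γ : List C) →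
    (A ⊗ fold Γ₀ ⟶ fold Γ) → Prop
  | here (a : X) (A : C) (l : List X) (Γ : List C) : Ins a A l Γ (a :: l) (A :: Γ) (𝟙 (A ⊗ fold Γ))
  | there {a : X} {A : C} {l₀ : List X} {Γ₀ : List C} {l : List X} {Γ : List C}
      {m : A ⊗ fold Γ₀ ⟶ fold Γ} (b : X) (B : C) (h : Ins a A l₀ Γ₀ l Γ m) :
      Ins a A (b :: l₀) (B :: Γ₀) (b :: l) (B :: Γ) (exch A B (fold Γ₀) ≫ B ◁ m)

/-- `m` reorders the labelled factors of an iterated tensor product. -/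
inductive Reorder : (l : List X) → (Γ : List C) → (l' : List X) → (Γ' : List C) →
    (fold Γ' ⟶ fold Γ) → Prop
  | nil : Reorder [] [] [] [] (𝟙 (𝟙_ C))
  | cons {a : X} {A : C} {l₀ : List X} {Γ₀ : List C} {l : List X} {Γ : List C} {l' : List X}
      {Γ' : List C} {m : A ⊗ fold Γ₀ ⟶ fold Γ} {n : fold Γ' ⟶ fold Γ₀}
      (i : Ins a A l₀ Γ₀ l Γ m) (h : Reorder l₀ Γ₀ l' Γ' n) :
      Reorder l Γ (a :: l') (A :: Γ') (A ◁ n ≫ m)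

theorem Ins.perm {a : X} {A : C} {l₀ l : List X} {Γ₀ Γ : List C} {m : A ⊗ fold Γ₀ ⟶ fold Γ}
    (h : Ins a A l₀ Γ₀ l Γ m) : l.Perm (a :: l₀) := by
  induction h with
  | here => exact .refl _
  | there b B h ih => exact (ih.cons b).trans (.swap _ _ _)

/-- Objects may repeat, so it is the labels that decide. If one derivation inserts at the head and
the other further on, the head label recurs in the tail, against distinctness. -/
theorem Ins.unique {a : X} {A A' : C} {l₀ l₀' l : List X} {Γ₀ Γ₀' Γ : List C}
    {m : A ⊗ fold Γ₀ ⟶ fold Γ} {m' : A' ⊗ fold Γ₀' ⟶ fold Γ} (h : Ins a A l₀ Γ₀ l Γ m)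
    (h' : Ins a A' l₀' Γ₀' l Γ m') (hl : l.Nodup) :
    A = A' ∧ l₀ = l₀' ∧ Γ₀ = Γ₀' ∧ HEq m m' := by
  induction h generalizing A' l₀' Γ₀' with
  | here l Γ =>
    cases h' with
    | here => exact ⟨rfl, rfl, rfl, HEq.rfl⟩
    | there _ _ h => exact absurd (h.perm.mem_iff.2 (List.mem_cons_self)) (List.nodup_cons.1 hl).1
  | there b B h ih =>
    cases h' with
    | here => exact absurd (h.perm.mem_iff.2 (List.mem_cons_self)) (List.nodup_cons.1 hl).1
    | there _ _ h' =>
      obtain ⟨rfl, rfl, rfl, hm⟩ := ih h' (List.nodup_cons.1 hl).2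
      obtain rfl := eq_of_heq hm
      exact ⟨rfl, rfl, rfl, HEq.rfl⟩

theorem Ins.nodup {a : X} {A : C} {l₀ l : List X} {Γ₀ Γ : List C} {m : A ⊗ fold Γ₀ ⟶ fold Γ}
    (h : Ins a A l₀ Γ₀ l Γ m) (hl : l.Nodup) : l₀.Nodup :=
  (List.nodup_cons.1 (h.perm.nodup_iff.1 hl)).2

/-- Reorderings of distinctly labelled factors are unique. -/
theorem Reorder.unique {l l' : List X} {Γ Γ' : List C} {m m' : fold Γ' ⟶ fold Γ}
    (h : Reorder l Γ l' Γ' m) (h' : Reorder l Γ l' Γ' m') (hl : l.Nodup) : m = m' := by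
  induction h with
  | nil => cases h'; rfl
  | cons i h ih =>
    cases h' with
    | cons i' h' =>
      obtain ⟨_, rfl, rfl, hm⟩ := i.unique i' hl
      obtain rfl := eq_of_heq hm
      rw [ih h' (i.nodup hl)]

theorem exists_ins {a : X} {A : C} : ∀ {l : List X} {Γ : List C}, l.length = Γ.length →
    (a, A) ∈ l.zip Γ → ∃ (l₀ : List X) (Γ₀ : List C) (m : A ⊗ fold Γ₀ ⟶ fold Γ),
      Ins a A l₀ Γ₀ l Γ m ∧ l₀.length = Γ₀.length ∧ (l.zip Γ).Perm ((a, A) :: l₀.zip Γ₀)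
  | [], _, _, h => by simp at h
  | b :: l, [], hl, _ => by simp at hl
  | b :: l, B :: Γ, hl, h => by
    rw [List.zip_cons_cons, List.mem_cons] at h
    rcases h with h | h
    · cases h
      exact ⟨l, Γ, _, .here _ _ _ _, by simpa using hl, .refl _⟩
    · obtain ⟨l₀, Γ₀, m, i, h₁, h₂⟩ := exists_ins (by simpa using hl) h
      exact ⟨b :: l₀, B :: Γ₀, _, .there b B i, by simpa using h₁,
        (h₂.cons _).trans (.swap _ _ _)⟩

/-- Insertion sort: the label wanted first is located in the source, taken out, and the remaining
factors are treated recursively. -/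
theorem exists_reorder : ∀ {l' l : List X} {Γ' Γ : List C}, l.length = Γ.length →
    l'.length = Γ'.length → (l.zip Γ).Perm (l'.zip Γ') → ∃ m, Reorder l Γ l' Γ' m
  | [], l, Γ', Γ, hl, hl', h => by
    obtain rfl := List.length_eq_zero_iff.1 hl'.symm
    have := h.length_eq
    rw [List.length_zip, ← hl] at this
    obtain rfl : l = [] := List.length_eq_zero_iff.1 (by simpa using this)
    obtain rfl := List.length_eq_zero_iff.1 hl.symm
    exact ⟨_, .nil⟩
  | a :: l', l, [], Γ, hl, hl', h => by simp at hl'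
  | a :: l', l, A :: Γ', Γ, hl, hl', h => by
    obtain ⟨l₀, Γ₀, m, i, h₁, h₂⟩ := exists_ins hl (h.mem_iff.2 (List.mem_cons_self))
    obtain ⟨n, hn⟩ := exists_reorder h₁ (by simpa using hl') (h₂.symm.trans h).cons_inv
    exact ⟨_, .cons i hn⟩

theorem Reorder.congr {l l' : List X} {Γ Γ' : List C} {m m' : fold Γ' ⟶ fold Γ}
    (h : Reorder l Γ l' Γ' m) (e : m = m') : Reorder l Γ l' Γ' m' := e ▸ h

theorem Reorder.refl : ∀ {l : List X} {Γ : List C}, l.length = Γ.length →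
    Reorder l Γ l Γ (𝟙 (fold Γ))
  | [], [], _ => .nil
  | a :: l, A :: Γ, h => by
    exact (Reorder.cons (.here a A l Γ) (Reorder.refl (by simpa using h))).congr
      ((Category.comp_id _).trans (MonoidalCategory.whiskerLeft_id _ _))
  | [], _ :: _, h => by simp at h
  | _ :: _, [], h => by simp at h

theorem Reorder.cons_cons {l l' : List X} {Γ Γ' : List C} {m : fold Γ' ⟶ fold Γ}
    (h : Reorder l Γ l' Γ' m) (a : X) (A : C) :
    Reorder (a :: l) (A :: Γ) (a :: l') (A :: Γ') (A ◁ m) :=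
  (Reorder.cons (.here a A l Γ) h).congr (Category.comp_id _)

theorem Ins.map (f : X → Y) {a : X} {A : C} {l₀ l : List X} {Γ₀ Γ : List C}
    {m : A ⊗ fold Γ₀ ⟶ fold Γ} (h : Ins a A l₀ Γ₀ l Γ m) :
    Ins (f a) A (l₀.map f) Γ₀ (l.map f) Γ m := by
  induction h with
  | here => exact .here _ _ _ _
  | there b B h ih => exact .there _ _ ih

theorem Reorder.map (f : X → Y) {l l' : List X} {Γ Γ' : List C} {m : fold Γ' ⟶ fold Γ}
    (h : Reorder l Γ l' Γ' m) : Reorder (l.map f) Γ (l'.map f) Γ' m := by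
  induction h with
  | nil => exact .nil
  | cons i h ih => exact .cons (i.map f) ih

/-- Two insertions can be exchanged. -/
theorem Ins.exchange {a b : X} {A B : C} {l l₁ l₂ : List X} {Γ Γ₁ Γ₂ : List C}
    {j : B ⊗ fold Γ₁ ⟶ fold Γ} {i : A ⊗ fold Γ₂ ⟶ fold Γ₁} (hj : Ins b B l₁ Γ₁ l Γ j)
    (hi : Ins a A l₂ Γ₂ l₁ Γ₁ i) :
    ∃ (l₃ : List X) (Γ₃ : List C) (k : A ⊗ fold Γ₃ ⟶ fold Γ) (n : B ⊗ fold Γ₂ ⟶ fold Γ₃),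
      Ins a A l₃ Γ₃ l Γ k ∧ Ins b B l₂ Γ₂ l₃ Γ₃ n ∧
        A ◁ n ≫ k = exch A B (fold Γ₂) ≫ B ◁ i ≫ j := by
  induction hj generalizing a A l₂ Γ₂ with
  | here l Γ =>
    exact ⟨_, _, _, _, .there b B hi, .here b B _ _, here_step i⟩
  | @there l₀ Γ₀ l Γ m c D hj ih =>
    cases hi with
    | here => exact ⟨_, _, _, _, .here _ _ _ _, hj, there_step m⟩
    | there _ _ hi =>
      obtain ⟨l₃, Γ₃, k, n, hk, hn, h⟩ := ih hi
      exact ⟨_, _, _, _, .there c D hk, .there c D hn, exch_step h⟩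

/-- An insertion can be moved past a reordering. -/
theorem Reorder.ins {a : X} {A : C} {l l' l₀' : List X} {Γ Γ' Γ₀' : List C} {m : fold Γ' ⟶ fold Γ}
    {i' : A ⊗ fold Γ₀' ⟶ fold Γ'} (h : Reorder l Γ l' Γ' m) (hi : Ins a A l₀' Γ₀' l' Γ' i') :
    ∃ (l₀ : List X) (Γ₀ : List C) (i : A ⊗ fold Γ₀ ⟶ fold Γ) (m₀ : fold Γ₀' ⟶ fold Γ₀),
      Ins a A l₀ Γ₀ l Γ i ∧ Reorder l₀ Γ₀ l₀' Γ₀' m₀ ∧ A ◁ m₀ ≫ i = i' ≫ m := by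
  induction h generalizing a A l₀' Γ₀' with
  | nil => cases hi
  | @cons b B l₁ Γ₁ l Γ l₂ Γ₂ j n hj h ih =>
    cases hi with
    | here => exact ⟨_, _, _, _, hj, h, (Category.id_comp _).symm⟩
    | there _ _ hi =>
      obtain ⟨l₄, Γ₄, i₄, m₄, hi₄, hm₄, e⟩ := ih hi
      obtain ⟨l₅, Γ₅, k, o, hk, ho, e'⟩ := hj.exchange hi₄
      exact ⟨_, _, _, _, hk, .cons ho hm₄, ins_step e e'⟩

/-- Induction on the second reordering: its first insertion is carried through the first reordering
by `Reorder.ins`, leaving a shorter pair to compose. -/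
theorem Reorder.trans {l l' l'' : List X} {Γ Γ' Γ'' : List C} {m : fold Γ' ⟶ fold Γ}
    {n : fold Γ'' ⟶ fold Γ'} (h : Reorder l Γ l' Γ' m) (h' : Reorder l' Γ' l'' Γ'' n) :
    Reorder l Γ l'' Γ'' (n ≫ m) := by
  induction h' generalizing l Γ with
  | nil => cases h; exact Reorder.nil.congr (Category.id_comp (𝟙 (𝟙_ C))).symm
  | cons i h' ih =>
    obtain ⟨l₀, Γ₀, j, k, hj, hk, e⟩ := h.ins i
    exact (Reorder.cons hj (ih hk)).congr (trans_step e)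

end Reorder

end Multi

namespace Multi
open MonoidalCategory NaryTensor

/-! ## Reordering blocks of factors -/

section Steps
variable {C : Type u} [Category.{u} C] [MonoidalCategory C] [SymmetricCategory C]

theorem exch_assoc (A B X D : C) : exch A B (X ⊗ D) ≫ B ◁ (α_ A X D).inv ≫ (α_ B (A ⊗ X) D).inv =
    A ◁ (α_ B X D).inv ≫ (α_ A (B ⊗ X) D).inv ≫ exch A B X ▷ D := by
  simp only [exch, comp_whiskerRight, whiskerRight_tensor, Category.assoc]
  monoidal

theorem exch_unit_right (A X : C) : A ◁ (λ_ X).inv ≫ exch A (𝟙_ C) X = (λ_ (A ⊗ X)).inv := by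
  simp only [exch, braiding_tensorUnit_right, comp_whiskerRight, Category.assoc]
  monoidal

theorem exch_unit_left (B X : C) : (λ_ (B ⊗ X)).inv ≫ exch (𝟙_ C) B X = B ◁ (λ_ X).inv := by
  simp only [exch, braiding_tensorUnit_left, comp_whiskerRight, Category.assoc]
  monoidal

theorem left_nil_step {X Y : C} (m : X ⟶ Y) : m ≫ (λ_ Y).inv = (λ_ X).inv ≫ (𝟙_ C) ◁ m := by
  simp

theorem left_cons_step {A D G G' X X' : C} {m : G' ⟶ G} {n : X' ⟶ X} {f : X ⟶ D ⊗ G}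
    {f' : X' ⟶ D ⊗ G'} (h : n ≫ f = f' ≫ D ◁ m) :
    A ◁ n ≫ A ◁ f ≫ (α_ A D G).inv = (A ◁ f' ≫ (α_ A D G').inv) ≫ (A ⊗ D) ◁ m := by
  rw [← MonoidalCategory.whiskerLeft_comp_assoc, h]
  simp

theorem right_here_step {A X D G : C} (f : X ⟶ G ⊗ D) :
    𝟙 (A ⊗ X) ≫ A ◁ f ≫ (α_ A G D).inv = A ◁ f ≫ (α_ A G D).inv ≫ 𝟙 (A ⊗ G) ▷ D := by
  simp

theorem right_there_step {A B D G G₀ X X₀ : C} {i : A ⊗ G₀ ⟶ G} {j : A ⊗ X₀ ⟶ X} {f : X ⟶ G ⊗ D}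
    {f₀ : X₀ ⟶ G₀ ⊗ D} (h : j ≫ f = A ◁ f₀ ≫ (α_ A G₀ D).inv ≫ i ▷ D) :
    (exch A B X₀ ≫ B ◁ j) ≫ B ◁ f ≫ (α_ B G D).inv =
      A ◁ (B ◁ f₀ ≫ (α_ B G₀ D).inv) ≫ (α_ A (B ⊗ G₀) D).inv ≫
        (exch A B G₀ ≫ B ◁ i) ▷ D := by
  rw [Category.assoc, ← MonoidalCategory.whiskerLeft_comp_assoc, h]
  simp only [MonoidalCategory.whiskerLeft_comp, comp_whiskerRight, Category.assoc]
  rw [← reassoc_of% exch_assoc A B G₀ D, ← reassoc_of% exch_whiskerLeft A B f₀]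
  simp

theorem right_cons_step {A D G G₀ G' X X₀ X' : C} {m : A ⊗ G₀ ⟶ G} {n : G' ⟶ G₀} {j : A ⊗ X₀ ⟶ X}
    {k : X' ⟶ X₀} {f : X ⟶ G ⊗ D} {f₀ : X₀ ⟶ G₀ ⊗ D} {f' : X' ⟶ G' ⊗ D}
    (h : j ≫ f = A ◁ f₀ ≫ (α_ A G₀ D).inv ≫ m ▷ D) (h' : k ≫ f₀ = f' ≫ n ▷ D) :
    (A ◁ k ≫ j) ≫ f = (A ◁ f' ≫ (α_ A G' D).inv) ≫ (A ◁ n ≫ m) ▷ D := by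
  rw [Category.assoc, h, ← MonoidalCategory.whiskerLeft_comp_assoc, h']
  simp

theorem past_cons_step {A B D G X X₀ : C} {i : A ⊗ X₀ ⟶ X} {f₀ : X₀ ⟶ D ⊗ G}
    {f : X ⟶ D ⊗ (A ⊗ G)} (h : i ≫ f = A ◁ f₀ ≫ exch A D G) :
    (exch A B X₀ ≫ B ◁ i) ≫ B ◁ f ≫ (α_ B D (A ⊗ G)).inv =
      A ◁ (B ◁ f₀ ≫ (α_ B D G).inv) ≫ exch A (B ⊗ D) G := by
  rw [Category.assoc, ← MonoidalCategory.whiskerLeft_comp_assoc, h]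
  simp only [MonoidalCategory.whiskerLeft_comp, Category.assoc]
  rw [← reassoc_of% exch_whiskerLeft A B f₀, reassoc_of% exch_tensor A B D G, Iso.hom_inv_id,
    Category.comp_id]

theorem block_nil_step {D G X : C} (f : X ⟶ D ⊗ G) :
    𝟙 X ≫ f ≫ D ◁ (λ_ G).inv = (λ_ X).inv ≫ (𝟙_ C) ◁ f ≫ exch (𝟙_ C) D G := by
  rw [← exch_unit_left]
  simp

theorem block_cons_step {A D G T X X₁ X₂ X₃ X₄ : C} {n : X₁ ⟶ X₂} {f : X₂ ⟶ D ⊗ X₃}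
    {g : X₃ ⟶ T ⊗ G} {f₁ : X₁ ⟶ T ⊗ X₄} {g₁ : X₄ ⟶ D ⊗ G} {i : A ⊗ X₂ ⟶ X} {f₂ : X ⟶ D ⊗ (A ⊗ X₃)}
    (h : n ≫ f ≫ D ◁ g = f₁ ≫ T ◁ g₁ ≫ exch T D G) (hi : i ≫ f₂ = A ◁ f ≫ exch A D X₃) :
    (A ◁ n ≫ i) ≫ f₂ ≫ D ◁ (A ◁ g ≫ (α_ A T G).inv) =
      (A ◁ f₁ ≫ (α_ A T X₄).inv) ≫ (A ⊗ T) ◁ g₁ ≫ exch (A ⊗ T) D G := by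
  have h' := congrArg (A ◁ ·) h
  simp only [MonoidalCategory.whiskerLeft_comp] at h'
  rw [Category.assoc, reassoc_of% hi]
  simp only [MonoidalCategory.whiskerLeft_comp, Category.assoc]
  rw [← reassoc_of% exch_whiskerLeft A D g, reassoc_of% h', reassoc_of% exch_tensor_left A T D G,
    ← MonoidalCategory.whiskerLeft_comp, Iso.hom_inv_id]
  simp

theorem args_there_step {A B D₁ D₂ G₀ F₀ F₁ G₁ X X₁ X₂ X₃ X₄ : C} {g : D₁ ⟶ A} {h : D₂ ⟶ B}
    {f₀ : G₀ ⟶ F₀} {f₁ : G₁ ⟶ F₁} {p : X ⟶ D₁ ⊗ X₁} {q : X₁ ⟶ D₂ ⊗ G₀} {i : A ⊗ F₀ ⟶ F₁}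
    {n₁ : X₂ ⟶ G₁} {r : X₂ ⟶ D₁ ⊗ G₀} {n₃ : X ⟶ X₃} {n₂ : X₃ ⟶ X₄} {s : X₃ ⟶ D₂ ⊗ X₂}
    {t : X₄ ⟶ D₂ ⊗ G₁} (e₁ : (r ≫ (g ⊗ₘ f₀)) ≫ i = n₁ ≫ f₁)
    (e₂ : n₂ ≫ t = s ≫ D₂ ◁ n₁) (e₃ : n₃ ≫ s ≫ D₂ ◁ r = p ≫ D₁ ◁ q ≫ exch D₁ D₂ G₀) :
    (p ≫ (g ⊗ₘ (q ≫ (h ⊗ₘ f₀)))) ≫ exch A B F₀ ≫ B ◁ i = (n₃ ≫ n₂) ≫ t ≫ (h ⊗ₘ f₁) := by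
  have h₁ : g ⊗ₘ (q ≫ (h ⊗ₘ f₀)) = D₁ ◁ q ≫ (g ⊗ₘ (h ⊗ₘ f₀)) := by
    rw [← id_tensorHom, tensorHom_comp_tensorHom, Category.id_comp]
  have h₂ : D₂ ◁ r ≫ (h ⊗ₘ (g ⊗ₘ f₀)) ≫ B ◁ i = D₂ ◁ n₁ ≫ (h ⊗ₘ f₁) := by
    rw [← id_tensorHom, ← id_tensorHom, ← id_tensorHom, tensorHom_comp_tensorHom,
      tensorHom_comp_tensorHom, tensorHom_comp_tensorHom, ← e₁]
    simp
  simp only [Category.assoc]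
  rw [h₁, Category.assoc, reassoc_of% exch_naturality g h f₀, ← reassoc_of% e₃, h₂,
    reassoc_of% e₂]

theorem args_cons_step {A D D' F F₀ F' G₀ G' X X₁ X' : C} {g : D ⟶ A} {g' : D' ⟶ A} {t : D' ⟶ D}
    {f₀ : G₀ ⟶ F₀} {f : X ⟶ F} {f' : G' ⟶ F'} {i : A ⊗ F₀ ⟶ F} {m : F' ⟶ F₀} {p : X₁ ⟶ D ⊗ G₀}
    {p' : X' ⟶ D' ⊗ G'} {n₀ : X₁ ⟶ X} {n₂ : G' ⟶ G₀} {n₃ : X' ⟶ X₁}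
    (e : (p ≫ (g ⊗ₘ f₀)) ≫ i = n₀ ≫ f) (e₁ : g' = t ≫ g) (e₂ : f' ≫ m = n₂ ≫ f₀)
    (e₃ : n₃ ≫ p = p' ≫ (t ⊗ₘ n₂)) :
    (p' ≫ (g' ⊗ₘ f')) ≫ A ◁ m ≫ i = (n₃ ≫ n₀) ≫ f := by
  have h : (g' ⊗ₘ f') ≫ A ◁ m = (t ⊗ₘ n₂) ≫ (g ⊗ₘ f₀) := by
    rw [← id_tensorHom, tensorHom_comp_tensorHom, tensorHom_comp_tensorHom, e₁, e₂,
      Category.comp_id]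
  simp only [Category.assoc] at e ⊢
  rw [reassoc_of% h, ← reassoc_of% e₃, e]

end Steps

section Blocks
variable {C : Type u} [Category.{u} C] [MonoidalCategory C] [SymmetricCategory C] {X Y : Type*}

theorem Reorder.append_left {l l' : List X} {Γ Γ' : List C} {m : fold Γ' ⟶ fold Γ}
    (h : Reorder l Γ l' Γ' m) : ∀ {w : List X} {Δ : List C}, w.length = Δ.length →
    ∃ n, Reorder (w ++ l) (Δ ++ Γ) (w ++ l') (Δ ++ Γ') n ∧
      n ≫ (foldAppend Δ Γ).hom = (foldAppend Δ Γ').hom ≫ fold Δ ◁ m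
  | [], [], _ => ⟨m, h, left_nil_step m⟩
  | b :: w, B :: Δ, hl => by
    obtain ⟨n, hn, e⟩ := h.append_left (w := w) (Δ := Δ) (by simpa using hl)
    exact ⟨_, hn.cons_cons b B, left_cons_step e⟩
  | [], _ :: _, h => by simp at h
  | _ :: _, [], h => by simp at h

theorem Ins.append_right {a : X} {A : C} {l₀ l : List X} {Γ₀ Γ : List C}
    {m : A ⊗ fold Γ₀ ⟶ fold Γ} (h : Ins a A l₀ Γ₀ l Γ m) (w : List X) (Δ : List C) :
    ∃ n, Ins a A (l₀ ++ w) (Γ₀ ++ Δ) (l ++ w) (Γ ++ Δ) n ∧ n ≫ (foldAppend Γ Δ).hom =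
      A ◁ (foldAppend Γ₀ Δ).hom ≫ (α_ A (fold Γ₀) (fold Δ)).inv ≫ m ▷ fold Δ := by
  induction h with
  | here l Γ => exact ⟨_, .here _ _ _ _, right_here_step _⟩
  | there b B h ih =>
    obtain ⟨n, hn, e⟩ := ih
    exact ⟨_, .there b B hn, right_there_step e⟩

theorem Reorder.append_right {l l' : List X} {Γ Γ' : List C} {m : fold Γ' ⟶ fold Γ}
    (h : Reorder l Γ l' Γ' m) {w : List X} {Δ : List C} (hl : w.length = Δ.length) :
    ∃ n, Reorder (l ++ w) (Γ ++ Δ) (l' ++ w) (Γ' ++ Δ) n ∧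
      n ≫ (foldAppend Γ Δ).hom = (foldAppend Γ' Δ).hom ≫ m ▷ fold Δ := by
  induction h with
  | nil => exact ⟨_, .refl hl, (Category.id_comp _).trans
      ((congrArg (_ ≫ ·) (id_whiskerRight (𝟙_ C) (fold Δ))).trans (Category.comp_id _)).symm⟩
  | cons i h ih =>
    obtain ⟨j, hj, e⟩ := i.append_right w Δ
    obtain ⟨n, hn, e'⟩ := ih
    exact ⟨_, .cons hj hn, right_cons_step e e'⟩

theorem Ins.length_eq {a : X} {A : C} {l₀ l : List X} {Γ₀ Γ : List C}
    {m : A ⊗ fold Γ₀ ⟶ fold Γ} (h : Ins a A l₀ Γ₀ l Γ m) (hl : l₀.length = Γ₀.length) :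
    l.length = Γ.length := by
  induction h with
  | here => simpa using hl
  | there b B h ih => simpa using ih (by simpa using hl)

theorem Reorder.length_eq {l l' : List X} {Γ Γ' : List C} {m : fold Γ' ⟶ fold Γ}
    (h : Reorder l Γ l' Γ' m) : l.length = Γ.length ∧ l'.length = Γ'.length := by
  induction h with
  | nil => exact ⟨rfl, rfl⟩
  | cons i h ih =>
    exact ⟨i.length_eq ih.1, by simpa using ih.2⟩

/-- Reordering two adjacent blocks independently is the tensor product of the two reorderings,
obtained by treating one block at a time. -/
theorem Reorder.append {l l' w w' : List X} {Γ Γ' Δ Δ' : List C} {m : fold Γ' ⟶ fold Γ}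
    {k : fold Δ' ⟶ fold Δ} (h : Reorder l Γ l' Γ' m) (h' : Reorder w Δ w' Δ' k) :
    ∃ n, Reorder (l ++ w) (Γ ++ Δ) (l' ++ w') (Γ' ++ Δ') n ∧
      n ≫ (foldAppend Γ Δ).hom = (foldAppend Γ' Δ').hom ≫ (m ⊗ₘ k) := by
  obtain ⟨n, hn, e⟩ := h.append_right h'.length_eq.1
  obtain ⟨n', hn', e'⟩ := h'.append_left h.length_eq.2
  refine ⟨_, hn.trans hn', ?_⟩
  rw [Category.assoc, e, reassoc_of% e', MonoidalCategory.tensorHom_def']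

/-- Moving one factor past a whole block is a single exchange with the tensor product of the block,
by iterating `exch_tensor`. -/
theorem exists_ins_past (a : X) (A : C) (l : List X) (Γ : List C) : ∀ {w : List X} {Δ : List C},
    w.length = Δ.length → ∃ i, Ins a A (w ++ l) (Δ ++ Γ) (w ++ a :: l) (Δ ++ A :: Γ) i ∧
      i ≫ (foldAppend Δ (A :: Γ)).hom = A ◁ (foldAppend Δ Γ).hom ≫ exch A (fold Δ) (fold Γ)
  | [], [], _ => ⟨_, .here _ _ _ _, (Category.id_comp _).trans (exch_unit_right A (fold Γ)).symm⟩
  | b :: w, B :: Δ, h => by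
    obtain ⟨i, hi, e⟩ := exists_ins_past a A l Γ (w := w) (Δ := Δ) (by simpa using h)
    exact ⟨_, .there b B hi, past_cons_step e⟩
  | [], _ :: _, h => by simp at h
  | _ :: _, [], h => by simp at h

/-- The factors of the block `Θ` are moved past `Δ` one at a time; `exch_tensor_left` collects these
moves into one exchange of the two tensor products. -/
theorem exists_block_swap {l w : List X} {Γ Δ : List C} (hl : l.length = Γ.length)
    (hw : w.length = Δ.length) : ∀ {v : List X} {Θ : List C}, v.length = Θ.length →
    ∃ n, Reorder (w ++ (v ++ l)) (Δ ++ (Θ ++ Γ)) (v ++ (w ++ l)) (Θ ++ (Δ ++ Γ)) n ∧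
      n ≫ (foldAppend Δ (Θ ++ Γ)).hom ≫ fold Δ ◁ (foldAppend Θ Γ).hom =
        (foldAppend Θ (Δ ++ Γ)).hom ≫ fold Θ ◁ (foldAppend Δ Γ).hom ≫
          exch (fold Θ) (fold Δ) (fold Γ)
  | [], [], _ => ⟨_, .refl (by simp [hl, hw]), block_nil_step _⟩
  | a :: v, A :: Θ, h => by
    obtain ⟨n, hn, e⟩ := exists_block_swap hl hw (v := v) (Θ := Θ) (by simpa using h)
    obtain ⟨i, hi, e'⟩ := exists_ins_past a A (v ++ l) (Θ ++ Γ) hw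
    exact ⟨_, .cons hi hn, block_cons_step e e'⟩
  | [], _ :: _, h => by simp at h
  | _ :: _, [], h => by simp at h

variable [NaryTensor C]

/-- The members of a list of multimaps carry labels satisfying `P`. -/
inductive Labelled (P : X → ∀ {Γ : List C} {A : C}, MHom Γ A → Prop) :
    {Γ As : List C} → List X → Args MHom Γ As → Prop
  | nil : Labelled P [] .nil
  | cons {a : X} {A : C} {Γ Δ Θ As : List C} {l : List X} {g : MHom Γ A} {gs : Args MHom Δ As}
      (h : Θ = Γ ++ Δ) (hg : P a g) (hgs : Labelled P l gs) : Labelled P (a :: l) (.cons g gs h)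

theorem labelled_of_get {P : X → ∀ {Γ : List C} {A : C}, MHom Γ A → Prop} {Γ As : List C}
    (gs : Args MHom Γ As) (l : Fin As.length → X) (h : ∀ i, P (l i) (gs.get i)) :
    Labelled P (List.ofFn l) gs := by
  induction gs with
  | nil => exact .nil
  | cons g gs e ih =>
    refine List.ofFn_succ (f := l) ▸ .cons e (h 0) (ih _ fun i => h i.succ)

theorem Labelled.length_eq {P : X → ∀ {Γ : List C} {A : C}, MHom Γ A → Prop} {W : X → List Y}
    (hW : ∀ (a : X) (Γ : List C) (A : C) (g : MHom Γ A), P a g → (W a).length = Γ.length)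
    {Γ As : List C} {l : List X} {gs : Args MHom Γ As} (h : Labelled P l gs) :
    (l.flatMap W).length = Γ.length := by
  induction h with
  | nil => rfl
  | cons h hg hgs ih => subst h; rw [List.flatMap_cons, List.length_append, ih, hW _ _ _ _ hg,
      List.length_append]

/-- Inserting a codomain in its place, lifted to multimaps: the member labelled `a` is brought to
the front, and its whole domain moves with it. The labels of the domain are the concatenated words
`W`. -/
theorem Ins.args {P : X → ∀ {Γ : List C} {A : C}, MHom Γ A → Prop} {W : X → List Y}
    (hW : ∀ (a : X) (Γ : List C) (A : C) (g : MHom Γ A), P a g → (W a).length = Γ.length)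
    {a : X} {A : C} {l₀ l : List X} {As₀ As : List C} {i : A ⊗ fold As₀ ⟶ fold As}
    (h : Ins a A l₀ As₀ l As i) {Γ : List C} {gs : Args MHom Γ As} (hgs : Labelled P l gs) :
    ∃ (Δ Γ₀ : List C) (g : MHom Δ A) (gs₀ : Args MHom Γ₀ As₀) (n : fold (Δ ++ Γ₀) ⟶ fold Γ),
      P a g ∧ Labelled P l₀ gs₀ ∧
      Reorder (l.flatMap W) Γ (W a ++ l₀.flatMap W) (Δ ++ Γ₀) n ∧
      foldArgs (.cons g gs₀ rfl) ≫ i = n ≫ foldArgs gs := by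
  induction h generalizing Γ with
  | here l As =>
    cases hgs with
    | cons h hg hgs =>
      subst h
      refine ⟨_, _, _, _, _, hg, hgs, .refl ?_, (Category.comp_id _).trans
        (Category.id_comp _).symm⟩
      rw [List.flatMap_cons, List.length_append, List.length_append, hgs.length_eq hW, hW _ _ _ _ hg]
  | there b B h ih =>
    cases hgs with
    | @cons _ _ Γb Γ₁ _ _ _ k gs h hg hgs =>
      subst h
      obtain ⟨Δ, Γ₀, g, gs₀, n₁, hg', hgs₀, hn₁, e₁⟩ := ih hgs
      obtain ⟨n₂, hn₂, e₂⟩ := hn₁.append_left (hW _ _ _ _ hg)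
      -- The member found in the tail has come to the front of the tail. Its domain `Δ` still has to
      -- pass the domain of the head.
      obtain ⟨n₃, hn₃, e₃⟩ := exists_block_swap (hgs₀.length_eq hW) (hW _ _ _ _ hg) (hW _ _ _ _ hg')
      refine ⟨Δ, Γb ++ Γ₀, g, .cons k gs₀ rfl, n₃ ≫ n₂, hg', .cons rfl hg hgs₀,
        hn₂.trans hn₃, ?_⟩
      rw [foldArgs_cons] at e₁
      rw [foldArgs_cons, foldArgs_cons, foldArgs_cons]
      exact args_there_step e₁ e₂ e₃

/-- Reordering a list of multimaps, each with its domain reordered, reorders the domain. -/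
theorem Reorder.args {P P' : X → ∀ {Γ : List C} {A : C}, MHom Γ A → Prop} {W W' : X → List Y}
    (hW : ∀ (a : X) (Γ : List C) (A : C) (g : MHom Γ A), P a g → (W a).length = Γ.length)
    (hP : ∀ (a : X) (Γ Γ' : List C) (A : C) (g : MHom Γ A) (g' : MHom Γ' A), P a g → P' a g' →
      ∃ t, Reorder (W a) Γ (W' a) Γ' t ∧ (bracket Γ').inv ≫ g' = t ≫ (bracket Γ).inv ≫ g)
    {l l' : List X} {As As' : List C} {m : fold As' ⟶ fold As} (h : Reorder l As l' As' m)
    {Γ Γ' : List C} {gs : Args MHom Γ As} {gs' : Args MHom Γ' As'} (hgs : Labelled P l gs)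
    (hgs' : Labelled P' l' gs') :
    ∃ n, Reorder (l.flatMap W) Γ (l'.flatMap W') Γ' n ∧ foldArgs gs' ≫ m = n ≫ foldArgs gs := by
  induction h generalizing Γ Γ' with
  | nil => cases hgs; cases hgs'; exact ⟨_, .nil, rfl⟩
  | cons i h ih =>
    cases hgs' with
    | cons e hg' hgs' =>
      subst e
      obtain ⟨Δ, Γ₀, g, gs₀, n₀, hg, hgs₀, hn₀, e⟩ := i.args hW hgs
      obtain ⟨t, ht, e₁⟩ := hP _ _ _ _ _ _ hg hg'
      obtain ⟨n₂, hn₂, e₂⟩ := ih hgs₀ hgs'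
      obtain ⟨n₃, hn₃, e₃⟩ := ht.append hn₂
      refine ⟨_, hn₀.trans hn₃, ?_⟩
      rw [foldArgs_cons] at e ⊢
      exact args_cons_step e e₁ e₂ e₃

end Blocks

end Multi

namespace Multi
open MonoidalCategory NaryTensor

/-! ## The symmetric multicategory of a symmetric monoidal category -/

/-- The blocks of positions, laid end to end, enumerate the concatenated domain. Statements about
positions are thereby turned into statements about lists of labels. -/
theorem Args.range_offset {O : Type u} {H : List O → O → Type u} {Γ As : List O}
    (gs : Args H Γ As) : ((List.finRange As.length).flatMap fun i =>
      (List.range (gs.dom i).length).map (gs.offset i + ·)) = List.range Γ.length := by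
  induction gs with
  | nil => rfl
  | @cons Γ Δ Θ A As g gs h ih =>
    subst h
    rw [List.length_append, List.range_add, ← ih]
    simp only [List.length_cons, List.finRange_succ, List.flatMap_cons, List.flatMap_map,
      List.map_flatMap, List.map_map]
    refine congrArg₂ (· ++ ·) ?_ ?_
    · change (List.range Γ.length).map (fun j => 0 + j) = _
      simp
    · refine List.flatMap_congr fun i _ => ?_
      refine congrArg (fun f => List.map f _) ?_
      funext j
      exact Nat.add_assoc _ _ _

theorem Args.offset_add_lt {O : Type u} {H : List O → O → Type u} {Γ As : List O}
    (gs : Args H Γ As) (i : Fin As.length) (j : Fin (gs.dom i).length) :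
    gs.offset i + j < Γ.length := by
  rw [← List.mem_range, ← gs.range_offset]
  exact List.mem_flatMap.2 ⟨i, List.mem_finRange i,
    List.mem_map.2 ⟨j, List.mem_range.2 j.2, rfl⟩⟩

section
variable {C : Type u} [Category.{u} C] [MonoidalCategory C] [SymmetricCategory C]

/-- The positions of the source of a permutation, in the order of the target. -/
def CtxPerm.labels {O : Type u} {Γ Γ' : List O} (p : CtxPerm Γ Γ') : List (Fin Γ.length) :=
  List.ofFn p.σ

/-- The positions are used as labels. The two lists of pairs (position, object) have no repetitions
and the same members because `p` preserves entries, so they are permutations of each other. -/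
theorem CtxPerm.exists_reorder {Γ Γ' : List C} (p : CtxPerm Γ Γ') :
    ∃ m, Reorder (List.finRange Γ.length) Γ p.labels Γ' m := by
  have hm : ∀ {n : ℕ} (Δ : List C) (f : Fin Δ.length → Fin n) (x : Fin n × C),
      x ∈ (List.ofFn f).zip Δ ↔ ∃ i, x = (f i, Δ.get i) := fun Δ f x => by
    rw [List.mem_iff_getElem]
    constructor
    · rintro ⟨i, hi, rfl⟩
      exact ⟨⟨i, by simpa using hi⟩, by simp⟩
    · rintro ⟨i, rfl⟩
      exact ⟨i, by simp, by simp⟩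
  have hn : ∀ {n : ℕ} (Δ : List C) (l : List (Fin n)), l.Nodup → l.length = Δ.length →
      (l.zip Δ).Nodup := fun Δ l h hl => by
    refine List.Nodup.of_map Prod.fst ?_
    rw [List.map_fst_zip hl.le]
    exact h
  refine Multi.exists_reorder (by simp) (by simp [labels]) ?_
  refine (List.perm_ext_iff_of_nodup (hn _ _ (List.nodup_finRange _) (by simp))
    (hn _ _ (List.nodup_ofFn_ofInjective p.σ.injective) (by simp))).2 fun x => ?_
  rw [hm Γ' p.σ, ← List.ofFn_id, hm]
  constructor
  · rintro ⟨i, rfl⟩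
    exact ⟨p.σ.symm i, by rw [p.get_eq]; simp⟩
  · rintro ⟨i, rfl⟩
    exact ⟨p.σ i, by rw [p.get_eq]; rfl⟩

/-- The isomorphism of iterated tensor products induced by a permutation. -/
noncomputable def CtxPerm.mor {Γ Γ' : List C} (p : CtxPerm Γ Γ') : fold Γ' ⟶ fold Γ :=
  p.exists_reorder.choose

theorem CtxPerm.reorder {Γ Γ' : List C} (p : CtxPerm Γ Γ') :
    Reorder (List.finRange Γ.length) Γ p.labels Γ' p.mor := p.exists_reorder.choose_spec

/-- Replaces the chosen morphism by any reordering labelled by natural-number positions; this is how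
the morphism of a permutation gets computed. -/
theorem CtxPerm.mor_eq {Γ Γ' : List C} (p : CtxPerm Γ Γ') {m : fold Γ' ⟶ fold Γ}
    (h : Reorder (List.range Γ.length) Γ (List.ofFn fun i => (p.σ i : ℕ)) Γ' m) : p.mor = m := by
  have h' := p.reorder.map Fin.val
  rw [List.map_coe_finRange_eq_range, labels, List.map_ofFn] at h'
  exact h'.unique h List.nodup_range

theorem CtxPerm.mor_refl (Γ : List C) : (CtxPerm.refl Γ).mor = 𝟙 (fold Γ) := by
  have h : (CtxPerm.refl Γ).labels = List.finRange Γ.length := List.ofFn_id _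
  exact (CtxPerm.refl Γ).reorder.unique (h ▸ .refl List.length_finRange) (List.nodup_finRange _)

/-- Relabelling the reordering of `q` along `p` makes its source labels the target labels of `p`.
The two then compose, and uniqueness identifies the result. -/
theorem CtxPerm.mor_trans {Γ Γ' Γ'' : List C} (p : CtxPerm Γ Γ') (q : CtxPerm Γ' Γ'') :
    (p.trans q).mor = q.mor ≫ p.mor := by
  have h := q.reorder.map p.σ
  have h₁ : (List.finRange Γ'.length).map p.σ = p.labels := (List.ofFn_eq_map).symm
  have h₂ : q.labels.map p.σ = (p.trans q).labels := List.map_ofFn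
  rw [h₁, h₂] at h
  exact (p.trans q).reorder.unique (p.reorder.trans h) (List.nodup_finRange _)

theorem CtxPerm.mor_cons {Γ Γ' : List C} (A : C) (p : CtxPerm Γ Γ') :
    (p.cons A).mor = A ◁ p.mor := by
  have h := (p.reorder.map Fin.succ).cons_cons 0 A
  have h₁ : (p.cons A).labels = 0 :: p.labels.map Fin.succ := by
    rw [labels, labels, List.map_ofFn]
    refine List.ofFn_succ.trans (congrArg₂ List.cons (by simp [cons]) ?_)
    refine congrArg List.ofFn (funext fun i => ?_)
    simp [cons]
  rw [← h₁, ← List.finRange_succ] at h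
  exact (p.cons A).reorder.unique h (List.nodup_finRange _)

theorem reorder_swap {X : Type*} (a b : X) (l : List X) (A B : C) {Γ : List C}
    (h : l.length = Γ.length) :
    Reorder (a :: b :: l) (A :: B :: Γ) (b :: a :: l) (B :: A :: Γ) (exch B A (fold Γ)) :=
  (Reorder.cons (.there a A (.here b B l Γ)) (.cons (.here a A l Γ) (.refl h))).congr (by
    have (X : C) : B ◁ (A ◁ 𝟙 X ≫ 𝟙 (A ⊗ X)) ≫ exch B A X ≫ A ◁ 𝟙 (B ⊗ X) = exch B A X := by
      simp
    exact this (fold Γ))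

/-- Ties the abstract action to the prescribed one, in which adjacent transpositions act by the
symmetry on two neighbouring factors. -/
theorem CtxPerm.mor_swap (Ψ : List C) (A B : C) : ∀ Λ : List C,
    (CtxPerm.swap Ψ A B Λ).mor = foldSwap Ψ A B Λ
  | [] => by
    have h := reorder_swap (0 : Fin (Ψ.length + 2)) 1 ((List.finRange Ψ.length).map
      fun i => i.succ.succ) A B (Γ := Ψ) (by simp)
    have h₁ : (CtxPerm.swap Ψ A B []).labels =
        1 :: 0 :: (List.finRange Ψ.length).map fun i => i.succ.succ := by
      rw [labels, ← List.ofFn_eq_map]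
      refine List.ofFn_succ.trans (congrArg₂ List.cons rfl (List.ofFn_succ.trans
        (congrArg₂ List.cons rfl (congrArg List.ofFn (funext fun i => ?_)))))
      exact Equiv.swap_apply_of_ne_of_ne (by simp [Fin.ext_iff]) (by simp [Fin.ext_iff])
    have h₂ : List.finRange (A :: B :: Ψ).length =
        0 :: 1 :: (List.finRange Ψ.length).map fun i => i.succ.succ := by
      simp only [List.length_cons, List.finRange_succ, List.map_cons, List.map_map]
      rfl
    refine (CtxPerm.swap Ψ A B []).reorder.unique ?_ (List.nodup_finRange _)
    rw [h₁]
    exact Eq.mpr (congrArg (Reorder · _ _ _ _) h₂) h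
  | X :: Λ => (mor_cons X _).trans (congrArg (X ◁ ·) (mor_swap Ψ A B Λ))

variable [NaryTensor C]

/-- Permutations act on multimaps by precomposition. -/
noncomputable def mact {Γ Γ' : List C} {B : C} (p : CtxPerm Γ Γ') (f : MHom Γ B) : MHom Γ' B :=
  (bracket Γ').hom ≫ p.mor ≫ (bracket Γ).inv ≫ f

theorem mact_refl {Γ : List C} {B : C} (f : MHom Γ B) : mact (.refl Γ) f = f := by
  rw [mact, CtxPerm.mor_refl]; simp

theorem mact_trans {Γ Γ' Γ'' : List C} {B : C} (p : CtxPerm Γ Γ') (q : CtxPerm Γ' Γ'')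
    (f : MHom Γ B) : mact (p.trans q) f = mact q (mact p f) := by
  rw [mact, CtxPerm.mor_trans]; simp [mact]

/-- Equivariance of composition. `Reorder.args` moves the block permutation across the tensor
product of the multimaps, and uniqueness of reorderings identifies the resulting morphism with the
one of `q`. -/
theorem mcomp_mact {As As' Γ Γ' : List C} {B : C} (f : MHom As B) (gs : Args MHom Γ As)
    (gs' : Args MHom Γ' As') (p : CtxPerm As As')
    (τ : ∀ i, CtxPerm (gs.dom (p.σ i)) (gs'.dom i)) (q : CtxPerm Γ Γ')
    (h : ∀ i, HEq (gs'.get i) (mact (τ i) (gs.get (p.σ i))))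
    (hq : ∀ i (j : Fin (gs'.dom i).length) (k : Fin Γ'.length), (k : ℕ) = gs'.offset i + j →
      (q.σ k : ℕ) = gs.offset (p.σ i) + (τ i).σ j) :
    mcomp (mact p f) gs' = mact q (mcomp f gs) := by
  -- Members of both lists are labelled by positions in `As`: label `a` belongs to the `a`-th member
  -- of `gs` and to the member of `gs'` at the position that `p` sends to `a`.
  let P : Fin As.length → ∀ {Γ : List C} {A : C}, MHom Γ A → Prop := fun a Γ A g =>
    gs.dom a = Γ ∧ As.get a = A ∧ HEq (gs.get a) g
  let P' : Fin As.length → ∀ {Γ : List C} {A : C}, MHom Γ A → Prop := fun a Γ A g =>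
    gs'.dom (p.σ.symm a) = Γ ∧ As'.get (p.σ.symm a) = A ∧ HEq (gs'.get (p.σ.symm a)) g
  -- The word `W a` lists the positions of block `a` in `Γ`; `V i` lists the positions in `Γ` from
  -- which the entries of block `i` of `Γ'` come.
  let W : Fin As.length → List ℕ := fun a =>
    (List.range (gs.dom a).length).map (gs.offset a + ·)
  let V : Fin As'.length → List ℕ := fun i =>
    List.ofFn fun j => gs.offset (p.σ i) + ((τ i).σ j : ℕ)
  -- `p.σ.symm (p.σ i)` is not definitionally `i`, and dependent types mention it. It is generalised
  -- and then substituted.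
  have hS : ∀ i {Γ A} {g : MHom Γ A}, P' (p.σ i) g →
      gs'.dom i = Γ ∧ As'.get i = A ∧ HEq (gs'.get i) g := fun i Γ A g hg => by
    have hk := p.σ.symm_apply_apply i
    simp only [P'] at hg
    generalize p.σ.symm (p.σ i) = k at hk hg
    subst hk
    exact hg
  have hS' : ∀ i, P' (p.σ i) (gs'.get i) := fun i => by
    have hk := p.σ.symm_apply_apply i
    simp only [P']
    generalize p.σ.symm (p.σ i) = k at hk ⊢
    subst hk
    exact ⟨rfl, rfl, HEq.rfl⟩
  obtain ⟨n, hn, e⟩ := p.reorder.args (P := P) (P' := P') (W := W)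
    (W' := fun a => V (p.σ.symm a)) (gs := gs) (gs' := gs')
    (by rintro a Γ A g ⟨rfl, _, _⟩; simp [W])
    (by
      rintro a Γ Γ' A g g' ⟨rfl, rfl, hg⟩ hg'
      obtain ⟨i, rfl⟩ := p.σ.surjective a
      obtain rfl := eq_of_heq hg
      obtain ⟨rfl, hA, hg'⟩ := hS i hg'
      have hg' : HEq (mact (τ i) (gs.get (p.σ i))) g' := (h i).symm.trans hg'
      obtain rfl := eq_of_heq hg'
      refine ⟨(τ i).mor, ?_, by simp [mact]⟩
      have ht := ((τ i).reorder.map Fin.val).map (gs.offset (p.σ i) + ·)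
      rw [List.map_coe_finRange_eq_range, CtxPerm.labels, List.map_ofFn, List.map_ofFn] at ht
      simp only [Equiv.symm_apply_apply]
      exact ht)
    (by
      rw [← List.ofFn_id]
      exact labelled_of_get gs _ fun i => ⟨rfl, rfl, HEq.rfl⟩)
    (labelled_of_get gs' p.σ hS')
  -- It remains to see that the concatenated words are the positions of `Γ` on one side and the
  -- values of `q` on the other.
  have hq' : q.mor = n := by
    refine q.mor_eq ?_
    convert hn using 1
    · exact gs.range_offset.symm
    -- `Q` extends `q` to all natural numbers. The value 0 is never used, as every position
    -- occurring is below the length of `Γ'`.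
    · let Q : ℕ → ℕ := fun k => if h : k < Γ'.length then q.σ ⟨k, h⟩ else 0
      have hQ : ∀ i, V i = ((List.range (gs'.dom i).length).map (gs'.offset i + ·)).map Q :=
        fun i => by
          rw [List.map_map, ← List.map_coe_finRange_eq_range, List.map_map, ← List.ofFn_eq_map]
          refine congrArg List.ofFn (funext fun j => ?_)
          have hj := gs'.offset_add_lt i j
          simp only [Q, Function.comp, dif_pos hj]
          exact (hq i j ⟨_, hj⟩ rfl).symm
      rw [CtxPerm.labels, List.ofFn_eq_map (f := p.σ), List.flatMap_map]
      simp only [Equiv.symm_apply_apply, hQ]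
      rw [← List.map_flatMap, gs'.range_offset, ← List.map_coe_finRange_eq_range, List.map_map,
        ← List.ofFn_eq_map]
      refine congrArg List.ofFn (funext fun j => ?_)
      simp [Q]
  rw [mcomp_eq, mact, mact, mcomp_eq, hq']
  simp only [Iso.inv_hom_id_assoc]
  rw [reassoc_of% e]

end

end Multi

namespace Multi
open MonoidalCategory NaryTensor

/-! ## The equivalence of symmetric representable multicategories and symmetric monoidal categories -/

/-- The symmetric representable multicategory of a symmetric monoidal category. -/
noncomputable def STensorCat.multi (C : STensorCat.{u}) : SRepMulticat.{u} where
  toRepMulticat := C.toTensorCat.multi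
  symmetry :=
    { act := fun p f => mact (C := C.carrier) p f
      act_refl := fun f => mact_refl (C := C.carrier) f
      act_trans := fun p q f => mact_trans (C := C.carrier) p q f
      comp_act := fun f gs gs' p τ q h hq => mcomp_mact (C := C.carrier) f gs gs' p τ q h hq }

/-- Only the adjacent transpositions have to be compared, and these are computed by
`CtxPerm.mor_swap`. -/
theorem STensorCat.multi_data (C : STensorCat.{u}) : C.multi.data = C.tensorData := by
  refine congrArg (SRepData.mk C.toTensorCat.tensorData) ?_
  funext Λ Ψ A B D f
  exact congrArg (fun m => (bracket _).hom ≫ m ≫ (bracket _).inv ≫ f)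
    (CtxPerm.mor_swap (C := C.carrier) Ψ A B Λ)

namespace SStrictFunctor
variable {C D : STensorCat.{u}} (F : SStrictFunctor C D)

theorem map_braiding_heq {X Y : C.carrier} {X' Y' : D.carrier} (hX : F.obj X = X')
    (hY : F.obj Y = Y') : HEq (F.map (β_ X Y).hom) (β_ X' Y').hom := by
  subst hX hY; exact F.map_braiding X Y

theorem map_exch {A B X : C.carrier} {A' B' X' : D.carrier} (hA : F.obj A = A')
    (hB : F.obj B = B') (hX : F.obj X = X') : HEq (F.map (exch A B X)) (exch A' B' X') :=
  F.map_comp_heq (F.obj_tensor' hA (F.obj_tensor' hB hX)) (F.obj_tensor' (F.obj_tensor' hA hB) hX)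
    (F.obj_tensor' hB (F.obj_tensor' hA hX)) (F.map_associator_inv_heq hA hB hX)
    (F.map_comp_heq (F.obj_tensor' (F.obj_tensor' hA hB) hX)
      (F.obj_tensor' (F.obj_tensor' hB hA) hX) (F.obj_tensor' hB (F.obj_tensor' hA hX))
      (F.map_whiskerRight_heq hX (F.obj_tensor' hA hB) (F.obj_tensor' hB hA)
        (F.map_braiding_heq hA hB)) (F.map_associator_heq hB hA hX))

theorem map_ins {X : Type*} {a : X} {A : C.carrier} {l₀ l : List X} {Γ₀ Γ : List C.carrier}
    {m : A ⊗ fold Γ₀ ⟶ fold Γ} (h : Ins a A l₀ Γ₀ l Γ m) :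
    ∃ m', Ins a (F.obj A) l₀ (Γ₀.map F.obj) l (Γ.map F.obj) m' ∧ HEq (F.map m) m' := by
  have hf := fold_map F.toStrictFunctor
  induction h with
  | here l Γ => exact ⟨_, .here _ _ _ _, F.map_id_heq (F.obj_tensor' rfl (hf Γ))⟩
  | @there l₀ Γ₀ l Γ m b B h ih =>
    obtain ⟨m', h', e⟩ := ih
    refine ⟨_, .there b _ h', ?_⟩
    exact F.map_comp_heq (F.obj_tensor' rfl (F.obj_tensor' rfl (hf _)))
      (F.obj_tensor' rfl (F.obj_tensor' rfl (hf _))) (F.obj_tensor' rfl (hf _))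
      (F.map_exch rfl rfl (hf _))
      (F.map_whiskerLeft_heq rfl (F.obj_tensor' rfl (hf _)) (hf _) e)

theorem map_reorder {X : Type*} {l l' : List X} {Γ Γ' : List C.carrier}
    {m : fold Γ' ⟶ fold Γ} (h : Reorder l Γ l' Γ' m) :
    ∃ m', Reorder l (Γ.map F.obj) l' (Γ'.map F.obj) m' ∧ HEq (F.map m) m' := by
  have hf := fold_map F.toStrictFunctor
  induction h with
  | nil => exact ⟨_, .nil, F.map_id_heq F.obj_unit⟩
  | cons i h ih =>
    obtain ⟨m', i', e⟩ := F.map_ins i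
    obtain ⟨n', h', e'⟩ := ih
    refine ⟨_, .cons i' h', ?_⟩
    exact F.map_comp_heq (F.obj_tensor' rfl (hf _)) (F.obj_tensor' rfl (hf _)) (hf _)
      (F.map_whiskerLeft_heq rfl (hf _) (hf _) e') e

/-- A strict symmetric functor takes insertions and exchanges to insertions and exchanges with the
same labels, so uniqueness of reorderings identifies the image. -/
theorem map_mor {Γ Γ' : List C.carrier} (p : CtxPerm Γ Γ') :
    HEq (F.map p.mor) (p.map F.obj).mor := by
  obtain ⟨m', h, e⟩ := F.map_reorder (p.reorder.map Fin.val)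
  refine e.trans (heq_of_eq (CtxPerm.mor_eq _ ?_).symm)
  rw [List.map_coe_finRange_eq_range, CtxPerm.labels, List.map_ofFn] at h
  convert h using 1
  · rw [List.length_map]
  · refine List.ext_getElem (by simp) fun i h₁ h₂ => ?_
    simp [CtxPerm.map]

theorem mmap_mact {Γ Γ' : List C.carrier} {B : C.carrier} (p : CtxPerm Γ Γ') (f : MHom Γ B) :
    F.mmap (mact p f) = mact (p.map F.obj) (F.mmap f) := by
  have hf := fold_map F.toStrictFunctor
  refine eq_of_heq ((F.mmap_heq _).trans ?_)
  exact F.map_comp_heq (F.obj_tens Γ') (hf Γ') rfl (F.map_bracket Γ')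
    (F.map_comp_heq (hf Γ') (hf Γ) rfl (F.map_mor p)
      (F.map_comp_heq (hf Γ) (F.obj_tens Γ) rfl (F.map_bracket_inv Γ) (F.mmap_heq f).symm))

/-- The functor of symmetric representable multicategories induced by a strict symmetric monoidal
functor. -/
noncomputable def multi : SRepFunctor C.multi D.multi where
  toRepFunctor := F.toStrictFunctor.multi
  map_act p f := F.mmap_mact p f

end SStrictFunctor

/-- The functor from symmetric monoidal categories to symmetric representable multicategories. -/
noncomputable def STensorCat.M : STensorCat.{u} ⥤ SRepMulticat.{u} where
  obj C := C.multi
  map F := SStrictFunctor.multi F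
  map_id C := SRepFunctor.toSig_injective (StrictFunctor.toSig_id C.toTensorCat)
  map_comp F G := SRepFunctor.toSig_injective
    (StrictFunctor.toSig_comp (SStrictFunctor.toStrictFunctor F) (SStrictFunctor.toStrictFunctor G))

theorem STensorCat.M_U : STensorCat.M.{u} ⋙ SRepMulticat.U = STensorCat.V := rfl

/-! ### Permutations and labels -/

/-- A permutation carries one labelling to another. -/
def CtxPerm.Tracks {O : Type u} {X : Type*} {Γ Γ' : List O} (p : CtxPerm Γ Γ') (l l' : List X) :
    Prop :=
  ∀ i : Fin Γ'.length, l'[(i : ℕ)]? = l[(p.σ i : ℕ)]?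

namespace CtxPerm
variable {O : Type u} {X : Type*} {Γ Γ' Γ'' : List O}

theorem Tracks.trans {p : CtxPerm Γ Γ'} {q : CtxPerm Γ' Γ''} {l l' l'' : List X}
    (h : p.Tracks l l') (h' : q.Tracks l' l'') : (p.trans q).Tracks l l'' :=
  fun i => (h' i).trans (h _)

theorem Tracks.cons {p : CtxPerm Γ Γ'} {l l' : List X} (h : p.Tracks l l') (a : X) (A : O) :
    (p.cons A).Tracks (a :: l) (a :: l') := fun i => by
  cases i using Fin.cases with
  | zero => simp [CtxPerm.cons]
  | succ i => simpa [CtxPerm.cons] using h i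

theorem tracks_swap (a b : X) (l : List X) (A B : O) (Γ : List O) :
    (CtxPerm.swap Γ A B []).Tracks (a :: b :: l) (b :: a :: l) := fun i =>
  match i with
  | ⟨0, _⟩ => by simp [CtxPerm.swap]
  | ⟨1, _⟩ => by simp [CtxPerm.swap]
  | ⟨i + 2, h⟩ => by
    have : (CtxPerm.swap Γ A B []).σ ⟨i + 2, h⟩ = ⟨i + 2, h⟩ :=
      Equiv.swap_apply_of_ne_of_ne (by simp) (by simp)
    rw [this]; rfl

theorem tracks_labels (p : CtxPerm Γ Γ') : p.Tracks (List.finRange Γ.length) p.labels := fun i => by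
  rw [labels, List.getElem?_ofFn]
  simp

/-- Distinct labels allow each position in the source to be recovered from its label. -/
theorem Tracks.unique {p q : CtxPerm Γ Γ'} {l l' : List X} (h : p.Tracks l l')
    (h' : q.Tracks l l') (hl : l.Nodup) (hn : Γ.length = l.length) : p = q :=
  ext' fun i => Fin.ext ((List.getElem?_inj (by rw [← hn]; exact (p.σ i).2) hl).1
    ((h i).symm.trans (h' i)))

end CtxPerm

-- The action of permutations, computed in the nucleus.

namespace SRepMulticat
open Multicat RepMulticat
variable (M : SRepMulticat.{u})

theorem ten_one_act {Δ Δ' : List M.Ob} {A B : M.Ob} (p : CtxPerm Δ Δ') (y : M.Hom Δ B) :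
    M.ten (M.one A) (M.act p y) = M.act (p.cons A) (M.ten (M.one A) y) := by
  have := M.act_pair (.refl [A]) p (p.cons A)
    (fun k j h => by
      match k, j, h with
      | ⟨_, _⟩, ⟨0, _⟩, rfl => rfl)
    (fun k j h => by
      obtain rfl : k = j.succ := Fin.ext (h.trans (Nat.add_comm _ _))
      simp [CtxPerm.cons, Nat.add_comm])
    (M.univ [A, B]) (M.one A) y
  rwa [show M.act (.refl [A]) (M.one A) = M.one A from M.symmetry.act_refl _] at this

theorem ten_swap {Δ : List M.Ob} {A B C : M.Ob} (w : M.Hom Δ C) :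
    M.ten (Γ := [A, B]) (M.act (M.swapPerm A B) (M.univ [B, A])) w =
      M.act (Γ := B :: A :: Δ) (Γ' := A :: B :: Δ) (.swap Δ B A [])
        (M.ten (Γ := [B, A]) (M.univ [B, A]) w) := by
  have := M.act_pair (M.swapPerm A B) (.refl Δ) (.swap Δ B A [])
    (fun k j h => by
      match k, j, h with
      | ⟨_, _⟩, ⟨0, _⟩, rfl => rfl
      | ⟨_, _⟩, ⟨1, _⟩, rfl => rfl)
    (fun k j h => by
      obtain rfl : k = j.succ.succ := Fin.ext (h.trans (Nat.add_comm _ _))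
      have : (CtxPerm.swap Δ B A []).σ j.succ.succ = j.succ.succ :=
        Equiv.swap_apply_of_ne_of_ne (by simp [Fin.ext_iff]) (by simp [Fin.ext_iff])
      rw [this]
      exact Nat.add_comm _ 2)
    (M.univ [M.T [B, A], C]) (M.univ [B, A]) w
  rwa [show M.act (.refl Δ) w = w from M.symmetry.act_refl _] at this

/-- The exchange in the nucleus is reassociate, braid, reassociate. On tensors, reassociation is
invisible and the braiding acts by the transposition. -/
theorem exch_ten {Δ : List M.Ob} {A B C : M.Ob} (w : M.Hom Δ C) :
    M.comp (exch (C := M.Nucleus) A B C) (.single (M.ten (M.one A) (M.ten (M.one B) w))) =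
      M.act (Γ := B :: A :: Δ) (Γ' := A :: B :: Δ) (.swap Δ B A [])
        (M.ten (Γ := [B]) (M.one B) (M.ten (Γ := [A]) (M.one A) w)) := by
  refine (M.comp_single _ _ _).trans ?_
  refine (congrArg (fun w => M.comp _ (.single w)) (M.assocInv_ten (M.one B) w)).trans ?_
  refine (M.comp_single _ _ _).trans ?_
  have h : M.comp (M.tensorHom (M.braid A B) (M.one C))
      (.single (M.ten (Γ := [A, B]) (M.ten (M.one A) (M.one B)) w)) =
      M.act (Γ := B :: A :: Δ) (Γ' := A :: B :: Δ) (.swap Δ B A [])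
        (M.ten (Γ := [B, A]) (M.ten (M.one B) (M.one A)) w) := by
    rw [M.tensorHom_comp_ten (M.braid A B) (M.one C) _ _ rfl (M.one_comp w), ten_one, braid_univ,
      ten_one]
    exact M.ten_swap w
  refine (congrArg (fun w => M.comp _ (.single w)) h).trans ?_
  refine (M.act_single _ _ _).trans (congrArg (M.act _) ?_)
  exact M.assocHom_ten (M.one B) (M.one A) w

/-- An insertion in the nucleus sends the universal multimap to a permuted universal multimap. The
permutation is known only through the labels it transports, which suffices once labels are distinct.
-/
theorem ins_foldUniv {X : Type*} {a : X} {A : M.Ob} {l₀ l : List X} {Γ₀ Γ : List M.Ob}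
    {m : (A ⊗ fold Γ₀ : M.Nucleus) ⟶ fold Γ} (h : Ins (C := M.Nucleus) a A l₀ Γ₀ l Γ m) :
    ∃ p : CtxPerm Γ (A :: Γ₀), p.Tracks l (a :: l₀) ∧
      M.comp m (.single (M.foldUniv (A :: Γ₀))) = M.act p (M.foldUniv Γ) := by
  induction h with
  | here l Γ => exact ⟨.refl _, fun _ => rfl, (M.one_comp _).trans (M.symmetry.act_refl _).symm⟩
  | @there l₀ Γ₀ l Γ m b B h ih =>
    obtain ⟨p, hp, e⟩ := ih
    refine ⟨(p.cons B).trans (.swap Γ₀ B A []),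
      (hp.cons b B).trans (CtxPerm.tracks_swap b a l₀ B A Γ₀), ?_⟩
    refine (M.comp_single _ _ _).trans ?_
    refine (congrArg (fun w => M.comp _ (.single w)) (M.exch_ten (M.foldUniv Γ₀))).trans ?_
    refine (M.act_single _ _ _).trans ?_
    refine (congrArg (M.act _) ((M.tensorHom_comp_ten (M.one B) m (M.one B) _ (M.one_comp _)
      e).trans (M.ten_one_act p (M.foldUniv Γ)))).trans ?_
    exact (M.symmetry.act_trans _ _ _).symm

theorem reorder_foldUniv {X : Type*} {l l' : List X} {Γ Γ' : List M.Ob}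
    {m : (fold Γ' : M.Nucleus) ⟶ fold Γ} (h : Reorder (C := M.Nucleus) l Γ l' Γ' m) :
    ∃ p : CtxPerm Γ Γ', p.Tracks l l' ∧
      M.comp m (.single (M.foldUniv Γ')) = M.act p (M.foldUniv Γ) := by
  induction h with
  | nil => exact ⟨.refl _, fun _ => rfl, (M.one_comp _).trans (M.symmetry.act_refl _).symm⟩
  | @cons a A l₀ Γ₀ l Γ l' Γ' m n i h ih =>
    obtain ⟨p, hp, e⟩ := M.ins_foldUniv i
    obtain ⟨q, hq, e'⟩ := ih
    refine ⟨p.trans (q.cons A), hp.trans (hq.cons a A), ?_⟩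
    refine (M.comp_single _ _ _).trans ?_
    refine (congrArg (fun w => M.comp _ (.single w)) ((M.tensorHom_comp_ten (M.one A) n (M.one A)
      _ (M.one_comp _) e').trans (M.ten_one_act q (M.foldUniv Γ₀)))).trans ?_
    refine (M.act_single _ _ _).trans ?_
    exact (congrArg (M.act _) e).trans (M.symmetry.act_trans _ _ _).symm

/-- The permutation supplied by `reorder_foldUniv` tracks the same distinct labels as `p`, hence
equals `p`. -/
theorem mor_foldUniv {Γ Γ' : List M.Ob} (p : CtxPerm Γ Γ') :
    M.comp (CtxPerm.mor (C := M.Nucleus) p) (.single (M.foldUniv Γ')) =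
      M.act p (M.foldUniv Γ) := by
  obtain ⟨q, hq, e⟩ := M.reorder_foldUniv (CtxPerm.reorder (C := M.Nucleus) p)
  obtain rfl := p.tracks_labels.unique hq (List.nodup_finRange _) (by simp)
  exact e

/-- Makes the comparison `t ↦ t^#` symmetric: restricted along `univ Γ'`, the right side becomes the
action on the iterated universal arrow, and the inverse bracket removes the iteration. -/
theorem ext_act {Γ Γ' : List M.Ob} {B : M.Ob} (p : CtxPerm Γ Γ') (f : M.Hom Γ B) :
    M.ext (M.act p f) = mact (C := M.Nucleus) p (M.ext f) :=
  (M.univ_universal Γ').hom_ext (by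
    rw [ext_univ]
    refine Eq.symm ((M.comp_single _ _ _).trans ?_)
    refine (congrArg (fun w => M.comp _ (.single w)) (M.ext_univ (M.foldUniv Γ'))).trans ?_
    refine (M.comp_single _ _ _).trans ?_
    refine (congrArg (fun w => M.comp _ (.single w)) (M.mor_foldUniv p)).trans ?_
    refine (M.act_single _ _ _).trans (congrArg (M.act p) ?_)
    refine (M.comp_single _ _ _).trans ?_
    refine (congrArg (fun w => M.comp _ (.single w)) ((M.isUniversal_foldUniv Γ).fac _)).trans ?_
    exact M.ext_univ f)

/-- The comparison of a symmetric representable multicategory with the one of its nucleus. -/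
noncomputable def kappaFunctor : SRepFunctor M M.nucleus.multi where
  toRepFunctor := M.toRepMulticat.kappaFunctor
  map_act p f := eq_of_heq ((M.toRepMulticat.kappaFunctor_heq _).trans
    ((heq_of_eq (M.ext_act p f)).trans
      (M.nucleus.multi.act_congr p _ (List.map_id _).symm (List.map_id _).symm rfl (fun _ => rfl)
        (M.toRepMulticat.kappaFunctor_heq f).symm)))

end SRepMulticat

namespace SRepFunctor
variable {M M' : SRepMulticat.{u}} (F : SRepFunctor M M') (G : F.toRepFunctor.Inverse)

/-- The inverse of a functor of symmetric representable multicategories. -/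
def inverse : SRepFunctor M' M where
  toRepFunctor := G.functor
  map_act p f := eq_of_heq (G.heq_of_map_heq rfl rfl ((G.map_map' _).trans
    (((heq_of_eq (F.map_act _ _)).trans (M'.act_congr _ _ (G.map_ob' _) (G.map_ob' _) (G.ob_ob _)
      (fun _ => rfl) (G.map_map' f))).symm)))

/-- An invertible functor is an isomorphism. -/
def iso : M ≅ M' where
  hom := F
  inv := F.inverse G
  hom_inv_id := toSig_injective (congrArg (fun K => RepMulticat.U.map K) G.iso.hom_inv_id)
  inv_hom_id := toSig_injective (congrArg (fun K => RepMulticat.U.map K) G.iso.inv_hom_id)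

end SRepFunctor

/-- The comparison is natural. -/
noncomputable def SRepMulticat.kappaIso : 𝟭 SRepMulticat.{u} ≅ SRepMulticat.N ⋙ STensorCat.M :=
  NatIso.ofComponents (fun M => M.kappaFunctor.iso M.toRepMulticat.kappaInverse) fun F =>
    SRepFunctor.toSig_injective (congrArg (fun K => RepMulticat.U.map K)
      (RepFunctor.kappa_naturality (SRepFunctor.toRepFunctor F)))

/-- With the identifications substituted, this says that the exchange of two factors in front of a
trailing unit is the braiding conjugated by right unitors. -/
theorem braiding_step {C : Type u} [Category.{u} C] [MonoidalCategory C] [SymmetricCategory C]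
    {T T' A B : C} {x : T ⟶ A ⊗ B} (hT : T = A ⊗ B) (hT' : T' = B ⊗ A) (hx : HEq x (𝟙 T))
    {b : T ⟶ A ⊗ (B ⊗ 𝟙_ C)} (hb : b = eqToHom hT ≫ A ◁ (ρ_ B).inv) {b' : B ⊗ (A ⊗ 𝟙_ C) ⟶ T'}
    (hb' : b' = B ◁ (ρ_ A).hom ≫ eqToHom hT'.symm) :
    HEq (x ≫ (β_ A B).hom) (b ≫ exch A B (𝟙_ C) ≫ b' ≫ 𝟙 T') := by
  subst hT hT' hb hb'
  obtain rfl := eq_of_heq hx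
  refine heq_of_eq ?_
  simp only [eqToHom_refl, Category.id_comp, Category.comp_id, exch, Category.assoc]
  rw [← rightUnitor_tensor_hom]
  rw [rightUnitor_naturality, ← rightUnitor_tensor_inv_assoc, Iso.inv_hom_id_assoc]

namespace STensorCat
variable (C : STensorCat.{u})

/-- A symmetric monoidal category is the nucleus of its multicategory. -/
noncomputable def toNucleus : SStrictFunctor C C.multi.nucleus where
  toStrictFunctor := C.toTensorCat.toNucleus
  map_braiding A B := by
    refine C.toTensorCat.emb_heq (w := mact (C.multi.swapPerm A B) (𝟙 (tens [B, A]))) rfl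
      (tens_pair A B).symm (tens_pair B A).symm
      (C.toTensorCat.univ_heq_box A B) (C.multi.univ_universal _) (C.multi.braid_univ A B) ?_
    -- On a two-element list the transposition defining the braiding of the nucleus is the adjacent
    -- one, whose morphism is known from `CtxPerm.mor_swap`.
    have h : mact (CtxPerm.swap [] B A []) (𝟙 (tens [B, A] : C.carrier)) =
        (bracket [A, B]).hom ≫ foldSwap [] B A [] ≫ (bracket [B, A]).inv ≫ 𝟙 _ := by
      rw [mact, CtxPerm.mor_swap]; rfl
    refine HEq.trans ?_ (heq_of_eq h.symm)
    exact braiding_step (tens_pair A B) (tens_pair B A) (box_mone A B) (bracket_pair A B)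
      (bracket_pair_inv B A)

end STensorCat

namespace SStrictFunctor
variable {C D : STensorCat.{u}} (F : SStrictFunctor C D) (G : F.toStrictFunctor.Inverse)

/-- The inverse of a strict symmetric monoidal functor. -/
def inverse : SStrictFunctor D C where
  toStrictFunctor := G.functor
  map_braiding A B := G.heq_of_map_heq
    ((G.obj_obj' _).trans (F.obj_tensor' (G.obj_obj' A) (G.obj_obj' B)).symm)
    ((G.obj_obj' _).trans (F.obj_tensor' (G.obj_obj' B) (G.obj_obj' A)).symm)
    ((G.map_map' _).trans (F.map_braiding_heq (G.obj_obj' A) (G.obj_obj' B)).symm)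

/-- An invertible strict symmetric monoidal functor is an isomorphism. -/
def iso : C ≅ D where
  hom := F
  inv := F.inverse G
  hom_inv_id := ext' G.comp_eq
  inv_hom_id := ext' G.comp_eq'

end SStrictFunctor

/-- Every symmetric monoidal category is naturally isomorphic to the nucleus of its multicategory. -/
noncomputable def STensorCat.nucleusIso : STensorCat.M ⋙ SRepMulticat.N ≅ 𝟭 STensorCat.{u} :=
  (NatIso.ofComponents (fun C => C.toNucleus.iso C.toTensorCat.toNucleusInverse) fun F =>
    SStrictFunctor.ext' (congrArg StrictFunctor.toFunctor
      (TensorCat.toNucleus_naturality (SStrictFunctor.toStrictFunctor F)))).symm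

/-- The nucleus is part of an adjoint equivalence. -/
noncomputable def SRepMulticat.equivalence : SRepMulticat.{u} ≌ STensorCat.{u} :=
  .mk SRepMulticat.N STensorCat.M SRepMulticat.kappaIso STensorCat.nucleusIso

end Multi

-- Labelled multimaps and the interpretation of the linear calculus.

namespace Multi

/-! ## Labelled lists of multimaps -/

namespace Args
variable {O : Type u} {H : List O → O → Type u} {X Y : Type*}

/-- The members of a list of multimaps carry labels from `l`, and their domains carry labels which
concatenate to `m`, such that all members satisfy `D`. -/
inductive Lab (D : X → List Y → (Γ : List O) → (A : O) → H Γ A → Prop) :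
    {Γ As : List O} → List X → List Y → Args H Γ As → Prop
  | nil : Lab D [] [] .nil
  | cons {a : X} {A : O} {Γ Δ Θ As : List O} {l : List X} {m m₁ m₂ : List Y} {g : H Γ A}
      {gs : Args H Δ As} (h : Θ = Γ ++ Δ) (hm : m = m₁ ++ m₂) (hg : D a m₁ Γ A g)
      (hgs : Lab D l m₂ gs) : Lab D (a :: l) m (.cons g gs h)

variable {D : X → List Y → (Γ : List O) → (A : O) → H Γ A → Prop}

theorem Lab.length_eq {Γ As : List O} {l : List X} {m : List Y} {gs : Args H Γ As}
    (h : Lab D l m gs) : l.length = As.length := by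
  induction h with
  | nil => rfl
  | cons h hm hg hgs ih => rw [List.length_cons, List.length_cons, ih]

theorem Lab.length_dom (hD : ∀ a m Γ A g, D a m Γ A g → m.length = Γ.length)
    {Γ As : List O} {l : List X} {m : List Y} {gs : Args H Γ As}
    (h : Lab D l m gs) : m.length = Γ.length := by
  induction h with
  | nil => rfl
  | cons h hm hg hgs ih => subst h hm; rw [List.length_append, List.length_append, ih, hD _ _ _ _ _ hg]

theorem Lab.single {Γ : List O} {A : O} {x : X} {m : List Y} {g : H Γ A} (h : D x m Γ A g) :
    Lab D [x] m (Args.single g) :=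
  .cons _ (List.append_nil m).symm h .nil

theorem Lab.of_cons {Γ Δ Θ As : List O} {A : O} {x : X} {l : List X} {m : List Y} {g : H Γ A}
    {gs : Args H Δ As} {e : Θ = Γ ++ Δ} (h : Lab D (x :: l) m (Args.cons g gs e)) :
    ∃ m₁ m₂, m = m₁ ++ m₂ ∧ D x m₁ Γ A g ∧ Lab D l m₂ gs := by
  cases h with
  | cons _ hm hg hgs => exact ⟨_, _, hm, hg, hgs⟩

theorem Lab.of_single {Γ : List O} {A : O} {x : X} {m : List Y} {g : H Γ A}
    (h : Lab D [x] m (Args.single g)) : D x m Γ A g := by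
  cases h with
  | cons _ hm hg hgs => cases hgs; rw [hm, List.append_nil]; exact hg

theorem Lab.app {Γ Δ As Bs : List O} {l l' : List X} {m m' : List Y} {a : Args H Γ As}
    {b : Args H Δ Bs} (ha : Lab D l m a) (hb : Lab D l' m' b) :
    Lab D (l ++ l') (m ++ m') (Args.app a b) := by
  induction ha with
  | nil => exact hb
  | cons h hm hg hgs ih => exact .cons _ (by rw [hm, List.append_assoc]) hg ih

/-- The words on the individual domains are part of the labelling, so cutting the list of members
also cuts the labels of the domain. -/
theorem Lab.of_app {Γ Δ As Bs : List O} {l l' : List X} {m : List Y} {a : Args H Γ As}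
    {b : Args H Δ Bs} (h : Lab D (l ++ l') m (Args.app a b)) (hl : l.length = As.length) :
    ∃ m₁ m₂, m = m₁ ++ m₂ ∧ Lab D l m₁ a ∧ Lab D l' m₂ b := by
  induction a generalizing l m with
  | nil =>
    obtain rfl := List.length_eq_zero_iff.1 hl
    exact ⟨[], m, rfl, .nil, h⟩
  | cons f fs e ih =>
    cases l with
    | nil => cases hl
    | cons x l =>
      obtain ⟨m₀, m₃, hm, hg, hgs⟩ := of_cons h
      obtain ⟨m₁, m₂, rfl, h₁, h₂⟩ := ih hgs (Nat.succ.inj hl)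
      exact ⟨_, m₂, hm.trans (List.append_assoc _ _ _).symm, .cons _ rfl hg h₁, h₂⟩

theorem Lab.map {X' Y' : Type*} {D' : X' → List Y' → (Γ : List O) → (A : O) → H Γ A → Prop}
    (φ : X → X') (ρ : Y → Y') (h : ∀ a m Γ A g, D a m Γ A g → D' (φ a) (m.map ρ) Γ A g)
    {Γ As : List O} {l : List X} {m : List Y} {gs : Args H Γ As} (hl : Lab D l m gs) :
    Lab D' (l.map φ) (m.map ρ) gs := by
  induction hl with
  | nil => exact .nil
  | cons e hm hg hgs ih => exact .cons e (by rw [hm, List.map_append]) (h _ _ _ _ _ hg) ih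

theorem Lab.ones {one : ∀ A, H [A] A} (φ : Y → X) : ∀ {As : List O} {m : List Y},
    (∀ y ∈ m, ∀ A, D (φ y) [y] [A] A (one A)) → m.length = As.length →
    Lab D (m.map φ) m (Args.ones one As)
  | [], [], _, _ => .nil
  | A :: As, y :: m, h, hm => .cons rfl rfl (h y List.mem_cons_self A)
      (Lab.ones φ (fun z hz => h z (List.mem_cons_of_mem y hz)) (Nat.succ.inj hm))

/-- Labellings compose: the domain labels of `gs` are the member labels of `hs`. Since each `D`
fixes the length of its word, the words cut `hs` in the same places as the domains do. -/
theorem Lab.bind {Z : Type*} {comp : ∀ {Γ As : List O} {B : O}, H As B → Args H Γ As → H Γ B}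
    {E : Y → List Z → (Γ : List O) → (A : O) → H Γ A → Prop}
    {F : X → List Z → (Γ : List O) → (A : O) → H Γ A → Prop}
    (hD : ∀ a m Γ A g, D a m Γ A g → m.length = Γ.length)
    (h : ∀ a m n Γ Θ A g (gs : Args H Θ Γ), D a m Γ A g → Lab E m n gs → F a n Θ A (comp g gs))
    {Θ Γ As : List O} {l : List X} {m : List Y} {n : List Z} {gs : Args H Γ As}
    {hs : Args H Θ Γ} (hg : Lab D l m gs) (hh : Lab E m n hs) : Lab F l n (gs.bind comp hs) := by
  induction hg generalizing Θ n with
  | nil => cases hh; exact .nil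
  | cons e hm hg hgs ih =>
    subst e hm
    obtain ⟨Θ₁, Θ₂, a, b, rfl, hh'⟩ := app_cases _ hs
    obtain rfl := eq_of_heq hh'
    obtain ⟨n₁, n₂, rfl, h₁, h₂⟩ := hh.of_app (hD _ _ _ _ _ hg)
    rw [bind_cons comp _ _ rfl _ a b rfl HEq.rfl]
    exact .cons rfl rfl (h _ _ _ _ _ _ _ _ hg h₁) (ih h₂)

theorem Lab.get (hD : ∀ a m Γ A g, D a m Γ A g → m.length = Γ.length)
    {Γ As : List O} {l : List X} {m : List Y} {gs : Args H Γ As} (h : Lab D l m gs) :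
    ∃ w : Fin As.length → List Y,
      (∀ i : Fin As.length, ∃ x, l[(i : ℕ)]? = some x ∧ D x (w i) _ _ (gs.get i)) ∧
      ∀ i (j : Fin (gs.dom i).length), m[gs.offset i + j]? = (w i)[(j : ℕ)]? := by
  induction h with
  | nil => exact ⟨fun i => i.elim0, fun i => i.elim0, fun i => i.elim0⟩
  | @cons a A Γ Δ Θ As l m m₁ m₂ g gs e hm hg hgs ih =>
    subst e hm
    obtain ⟨w, h₁, h₂⟩ := ih
    have hl := hD _ _ _ _ _ hg
    refine ⟨Fin.cons (α := fun _ => List Y) m₁ w, fun i => ?_, fun i j => ?_⟩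
    · match i with
      | ⟨0, _⟩ => exact ⟨a, rfl, hg⟩
      | ⟨i + 1, hi⟩ => exact h₁ ⟨i, Nat.lt_of_succ_lt_succ hi⟩
    · match i, j with
      | ⟨0, _⟩, j =>
        change (m₁ ++ m₂)[0 + (j : ℕ)]? = m₁[(j : ℕ)]?
        rw [Nat.zero_add, List.getElem?_append_left (by rw [hl]; exact j.2)]
      | ⟨i + 1, hi⟩, j =>
        refine Eq.trans ?_ (h₂ ⟨i, Nat.lt_of_succ_lt_succ hi⟩ j)
        change (m₁ ++ m₂)[Γ.length + _ + (j : ℕ)]? = _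
        rw [Nat.add_assoc, ← hl, List.getElem?_append_right (Nat.le_add_right _ _),
          Nat.add_sub_cancel_left]

/-- Assembles a labelled list from prescribed members and words; it is used to rearrange a list of
arguments. -/
theorem exists_lab (hD : ∀ a m Γ A g, D a m Γ A g → m.length = Γ.length) : ∀ {As : List O}
    (l : List X) (d : Fin As.length → List O)
    (w : Fin As.length → List Y) (g : ∀ i, H (d i) (As.get i)), l.length = As.length →
    (∀ (i : Fin As.length) x, l[(i : ℕ)]? = some x → D x (w i) _ _ (g i)) →
    ∃ (Θ : List O) (m : List Y) (gs : Args H Θ As), Lab D l m gs ∧ (∀ i, gs.dom i = d i) ∧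
      (∀ i, HEq (gs.get i) (g i)) ∧
      ∀ i (j : Fin (d i).length), m[gs.offset i + j]? = (w i)[(j : ℕ)]?
  | [], [], d, w, g, _, _ => ⟨[], [], .nil, .nil, fun i => i.elim0, fun i => i.elim0,
      fun i => i.elim0⟩
  | A :: As, x :: l, d, w, g, hl, h => by
    obtain ⟨Θ, m, gs, h₁, h₂, h₃, h₄⟩ := exists_lab hD l (fun i => d i.succ) (fun i => w i.succ)
      (fun i => g i.succ) (Nat.succ.inj hl) (fun i y hy => h i.succ y hy)
    have h₀ : D x (w 0) (d 0) A (g 0) := h 0 x rfl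
    have hl := hD _ _ _ _ _ h₀
    refine ⟨d 0 ++ Θ, w 0 ++ m, .cons (A := A) (g 0) gs rfl, .cons rfl rfl h₀ h₁, fun i => ?_,
      fun i => ?_, fun i j => ?_⟩
    · match i with
      | ⟨0, _⟩ => rfl
      | ⟨i + 1, hi⟩ => exact h₂ ⟨i, Nat.lt_of_succ_lt_succ hi⟩
    · match i with
      | ⟨0, _⟩ => exact HEq.rfl
      | ⟨i + 1, hi⟩ => exact h₃ ⟨i, Nat.lt_of_succ_lt_succ hi⟩
    · match i, j with
      | ⟨0, _⟩, j =>
        change (w 0 ++ m)[0 + (j : ℕ)]? = (w 0)[(j : ℕ)]?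
        rw [Nat.zero_add, List.getElem?_append_left (by rw [hl]; exact j.2)]
      | ⟨i + 1, hi⟩, j =>
        refine Eq.trans ?_ (h₄ ⟨i, Nat.lt_of_succ_lt_succ hi⟩ j)
        change (w 0 ++ m)[(d 0).length + _ + (j : ℕ)]? = _
        rw [Nat.add_assoc, ← hl, List.getElem?_append_right (Nat.le_add_right _ _),
          Nat.add_sub_cancel_left]

/-! ### Positions in the concatenated domain -/

theorem get_offset {Γ As : List O} (gs : Args H Γ As) (i : Fin As.length)
    (j : Fin (gs.dom i).length) : Γ[gs.offset i + j]? = (gs.dom i)[(j : ℕ)]? := by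
  induction gs with
  | nil => exact i.elim0
  | @cons Γ Δ Θ A As g gs h ih =>
    subst h
    match i, j with
    | ⟨0, _⟩, j =>
      change (Γ ++ Δ)[0 + (j : ℕ)]? = Γ[(j : ℕ)]?
      have : (j : ℕ) < Γ.length := j.2
      rw [Nat.zero_add, List.getElem?_append_left this]
    | ⟨i + 1, hi⟩, j =>
      refine Eq.trans ?_ (ih ⟨i, Nat.lt_of_succ_lt_succ hi⟩ j)
      change (Γ ++ Δ)[Γ.length + _ + (j : ℕ)]? = _
      rw [Nat.add_assoc, List.getElem?_append_right (Nat.le_add_right _ _),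
        Nat.add_sub_cancel_left]

/-- Surjectivity is `range_offset`. Injectivity follows by counting, since the lengths of the blocks
add up to the length of the domain. -/
theorem bijective_offset {Γ As : List O} (gs : Args H Γ As) : Function.Bijective
    fun x : (i : Fin As.length) × Fin (gs.dom i).length =>
      (⟨gs.offset x.1 + x.2, gs.offset_add_lt x.1 x.2⟩ : Fin Γ.length) := by
  refine (Fintype.bijective_iff_surjective_and_card _).2 ⟨fun k => ?_, ?_⟩
  · have hk := List.mem_range.2 k.2
    rw [← gs.range_offset, List.mem_flatMap] at hk
    obtain ⟨i, -, hi⟩ := hk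
    obtain ⟨j, hj, h⟩ := List.mem_map.1 hi
    exact ⟨⟨i, j, List.mem_range.1 hj⟩, Fin.ext h⟩
  · rw [Fintype.card_sigma, Fintype.card_fin]
    have h := congrArg List.length gs.range_offset
    rw [List.length_range, List.length_flatMap] at h
    rw [← h, ← List.ofFn_id, List.map_ofFn, List.sum_ofFn]
    simp

/-- The positions in the concatenated domain of a list of multimaps. -/
noncomputable def pos {Γ As : List O} (gs : Args H Γ As) :
    ((i : Fin As.length) × Fin (gs.dom i).length) ≃ Fin Γ.length :=
  Equiv.ofBijective _ gs.bijective_offset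

theorem exists_pos {Γ As : List O} (gs : Args H Γ As) (k : Fin Γ.length) :
    ∃ (i : Fin As.length) (j : Fin (gs.dom i).length), (k : ℕ) = gs.offset i + j :=
  let ⟨x, h⟩ := gs.pos.surjective k
  ⟨x.1, x.2, congrArg Fin.val h.symm⟩

/-- A position of a concatenated domain is a pair of a block and a position in it, so `p` on blocks
and `τ i` inside them assemble to a permutation. -/
theorem exists_blockPerm {As As' Γ Γ' : List O} (gs : Args H Γ As) (gs' : Args H Γ' As')
    (p : CtxPerm As As') (τ : ∀ i, CtxPerm (gs.dom (p.σ i)) (gs'.dom i)) :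
    ∃ q : CtxPerm Γ Γ', ∀ i (j : Fin (gs'.dom i).length) (k : Fin Γ'.length),
      (k : ℕ) = gs'.offset i + j → (q.σ k : ℕ) = gs.offset (p.σ i) + (τ i).σ j := by
  let e : Fin Γ'.length ≃ Fin Γ.length := gs'.pos.symm.trans
    ((Equiv.sigmaCongr (β₂ := fun i => Fin (gs.dom i).length) p.σ fun i => (τ i).σ).trans gs.pos)
  have he : ∀ i (j : Fin (gs'.dom i).length) (k : Fin Γ'.length),
      (k : ℕ) = gs'.offset i + j → (e k : ℕ) = gs.offset (p.σ i) + (τ i).σ j := by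
    intro i j k h
    have : gs'.pos.symm k = ⟨i, j⟩ := by
      rw [Equiv.symm_apply_eq]; exact Fin.ext h
    simp only [e, Equiv.trans_apply, this]
    rfl
  refine ⟨⟨e, fun k => ?_⟩, he⟩
  obtain ⟨i, j, h⟩ := gs'.exists_pos k
  have h₁ := gs'.get_offset i j
  have h₂ := gs.get_offset (p.σ i) ((τ i).σ j)
  rw [← h, List.getElem?_eq_getElem k.2, List.getElem?_eq_getElem j.2] at h₁
  rw [← he i j k h, List.getElem?_eq_getElem (e k).2,
    List.getElem?_eq_getElem ((τ i).σ j).2] at h₂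
  exact (Option.some.inj h₁).trans (((τ i).get_eq j).trans (Option.some.inj h₂).symm)

end Args

/-! ## Permutations of arguments -/

namespace CtxPerm
variable {O : Type u} {X : Type*} {Γ Γ' Γ'' : List O}

/-- The inverse permutation. -/
def symm (p : CtxPerm Γ Γ') : CtxPerm Γ' Γ :=
  ⟨p.σ.symm, fun i => by rw [p.get_eq, p.σ.apply_symm_apply]⟩

theorem Tracks.symm {p : CtxPerm Γ Γ'} {l l' : List X} (h : p.Tracks l l') :
    p.symm.Tracks l' l := fun i => by
  rw [h]; exact congrArg (fun j : Fin Γ.length => l[(j : ℕ)]?) (p.σ.apply_symm_apply i).symm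

theorem tracks_refl (l : List X) : (refl Γ).Tracks l l := fun _ => rfl

theorem Tracks.map {Y : Type*} {p : CtxPerm Γ Γ'} {l l' : List X} (h : p.Tracks l l')
    (f : X → Y) : p.Tracks (l.map f) (l'.map f) := fun i => by
  rw [List.getElem?_map, List.getElem?_map, h]

theorem length_eq (p : CtxPerm Γ Γ') : Γ'.length = Γ.length := Fin.equiv_iff_eq.1 ⟨p.σ⟩

/-- The identity as a permutation between equal lists. -/
def ofEq (h : Γ = Γ') : CtxPerm Γ Γ' := h ▸ refl Γ

theorem ofEq_val (h : Γ = Γ') (i : Fin Γ'.length) : ((ofEq h).σ i : ℕ) = i := by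
  subst h; rfl

end CtxPerm

namespace Multicat.Symmetry
variable {N : Multicat.{u}} (Y : N.Symmetry) {X Z : Type*}

theorem act_symm {Γ Γ' : List N.Ob} {B : N.Ob} (p : CtxPerm Γ Γ') (f : N.Hom Γ B) :
    Y.act p.symm (Y.act p f) = f := by
  rw [← Y.act_trans]
  refine Eq.trans ?_ (Y.act_refl f)
  congr 1
  exact CtxPerm.ext' fun i => p.σ.apply_symm_apply i

theorem act_ofEq {Γ Γ' : List N.Ob} {B : N.Ob} (h : Γ = Γ') (f : N.Hom Γ B) :
    HEq (Y.act (.ofEq h) f) f := by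
  subst h; exact heq_of_eq (Y.act_refl f)

/-- Permuting the arguments and acting on each of them. -/
theorem exists_comp_act {As As' Γ Γ' : List N.Ob} (gs : Args N.Hom Γ As)
    (gs' : Args N.Hom Γ' As') (p : CtxPerm As As') (w : Fin As.length → List X)
    (w' : Fin As'.length → List X) {m m' : List X}
    (hw : ∀ i (j : Fin (gs.dom i).length), m[gs.offset i + j]? = (w i)[(j : ℕ)]?)
    (hw' : ∀ i (j : Fin (gs'.dom i).length), m'[gs'.offset i + j]? = (w' i)[(j : ℕ)]?)
    (h : ∀ i, ∃ τ : CtxPerm (gs.dom (p.σ i)) (gs'.dom i), τ.Tracks (w (p.σ i)) (w' i) ∧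
      HEq (gs'.get i) (Y.act τ (gs.get (p.σ i)))) :
    ∃ q : CtxPerm Γ Γ', q.Tracks m m' ∧ ∀ {B : N.Ob} (f : N.Hom As B),
      N.comp (Y.act p f) gs' = Y.act q (N.comp f gs) := by
  choose τ h₁ h₂ using h
  obtain ⟨q, hq⟩ := Args.exists_blockPerm gs gs' p τ
  refine ⟨q, fun k => ?_, fun f => Y.comp_act f gs gs' p τ q h₂ hq⟩
  obtain ⟨i, j, hk⟩ := gs'.exists_pos k
  rw [hq i j k hk, hk, hw', hw, h₁]

/-- The labels decide which members correspond. If members with equal labels differ by permutations,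
these and `p` assemble to one permutation of the domain, to which equivariance of composition
applies. -/
theorem exists_comp_act_lab {D D' : X → List Z → (Γ : List N.Ob) → (A : N.Ob) → N.Hom Γ A → Prop}
    (hD : ∀ a m Γ A g, D a m Γ A g → m.length = Γ.length)
    (hD' : ∀ a m Γ A g, D' a m Γ A g → m.length = Γ.length)
    (h : ∀ x m m' Γ Γ' A g g', D x m Γ A g → D' x m' Γ' A g' →
      ∃ τ : CtxPerm Γ Γ', τ.Tracks m m' ∧ g' = Y.act τ g)
    {As As' Γ Γ' : List N.Ob} {p : CtxPerm As As'} {l l' : List X} (hp : p.Tracks l l')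
    {m m' : List Z} {gs : Args N.Hom Γ As} {gs' : Args N.Hom Γ' As'} (hg : gs.Lab D l m)
    (hg' : gs'.Lab D' l' m') :
    ∃ q : CtxPerm Γ Γ', q.Tracks m m' ∧ ∀ {B : N.Ob} (f : N.Hom As B),
      N.comp (Y.act p f) gs' = Y.act q (N.comp f gs) := by
  obtain ⟨w, h₁, h₂⟩ := hg.get hD
  obtain ⟨w', h₁', h₂'⟩ := hg'.get hD'
  refine Y.exists_comp_act gs gs' p w w' h₂ h₂' fun i => ?_
  obtain ⟨x, hx, hxg⟩ := h₁ (p.σ i)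
  obtain ⟨y, hy, hyg⟩ := h₁' i
  obtain rfl : x = y := Option.some.inj (hx.symm.trans ((hp i).symm.trans hy))
  have e := p.get_eq i
  -- The codomains at `p.σ i` and at `i` agree only propositionally; everything depending on them is
  -- generalised before they are identified.
  generalize gs.get (p.σ i) = g at hxg
  generalize gs'.get i = g' at hyg
  generalize As.get (p.σ i) = A at *
  generalize As'.get i = A' at *
  subst e
  obtain ⟨τ, hτ, rfl⟩ := h _ _ _ _ _ _ _ _ hxg hyg
  exact ⟨τ, hτ, HEq.rfl⟩

/-- Here only the permuted list is given. Its members are put back into the order of `As` unchanged,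
so the permutation inside each block is an identity up to casting. -/
theorem exists_permute {D : X → List Z → (Γ : List N.Ob) → (A : N.Ob) → N.Hom Γ A → Prop}
    (hD : ∀ a m Γ A g, D a m Γ A g → m.length = Γ.length)
    {As As' Γ' : List N.Ob} {p : CtxPerm As As'} {l l' : List X} (hp : p.Tracks l l')
    (hl : l.length = As.length) {m' : List Z} {gs' : Args N.Hom Γ' As'} (hg' : gs'.Lab D l' m') :
    ∃ (Γ : List N.Ob) (m : List Z) (gs : Args N.Hom Γ As) (q : CtxPerm Γ Γ'), gs.Lab D l m ∧
      q.Tracks m m' ∧ ∀ {B : N.Ob} (f : N.Hom As B),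
        N.comp (Y.act p f) gs' = Y.act q (N.comp f gs) := by
  obtain ⟨w', h₁', h₂'⟩ := hg'.get hD
  have e : ∀ k, As'.get (p.σ.symm k) = As.get k := fun k => by
    rw [p.get_eq, p.σ.apply_symm_apply]
  have hc : ∀ {Γ : List N.Ob} {A B : N.Ob} (h : A = B) (g : N.Hom Γ A) x m, D x m Γ A g →
      D x m Γ B (h ▸ g) := fun h g x m hx => by subst h; exact hx
  obtain ⟨Γ, m, gs, h₁, h₂, h₃, h₄⟩ := Args.exists_lab hD (As := As) l
    (fun k => gs'.dom (p.σ.symm k)) (fun k => w' (p.σ.symm k))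
    (fun k => e k ▸ gs'.get (p.σ.symm k)) hl fun k x hx => by
      obtain ⟨y, hy, hyg⟩ := h₁' (p.σ.symm k)
      rw [hp, p.σ.apply_symm_apply, hx] at hy
      obtain rfl := Option.some.inj hy
      exact hc _ _ _ _ hyg
  obtain ⟨q, h₅, h₆⟩ := Y.exists_comp_act gs gs' p (fun k => w' (p.σ.symm k)) w'
    (fun i j => h₄ i (j.cast (congrArg _ (h₂ i)))) h₂' fun i => by
    have hd : gs.dom (p.σ i) = gs'.dom i := (h₂ _).trans (by rw [p.σ.symm_apply_apply])
    refine ⟨.ofEq hd, fun j => ?_, ?_⟩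
    · rw [CtxPerm.ofEq_val, p.σ.symm_apply_apply]
    · refine HEq.trans ?_ (Y.act_ofEq hd _).symm
      refine HEq.trans ?_ (h₃ _).symm
      refine HEq.trans ?_ (eqRec_heq _ _).symm
      rw [p.σ.symm_apply_apply]
  exact ⟨Γ, m, gs, q, h₁, h₅, h₆⟩

end Multicat.Symmetry

end Multi

namespace Multi

/-! ## Permutations of contexts in blocks -/

namespace CtxPerm
variable {O : Type u} {X : Type*} {Γ Γ' Δ Δ' : List O}

theorem cons_zero (A : O) (p : CtxPerm Γ Γ') (h : 0 < (A :: Γ').length) :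
    (p.cons A).σ ⟨0, h⟩ = ⟨0, Nat.succ_pos _⟩ := by
  change (p.cons A).σ (0 : Fin (Γ'.length + 1)) = _
  simp [cons]

theorem cons_succ (A : O) (p : CtxPerm Γ Γ') (i : Fin Γ'.length) :
    (p.cons A).σ ⟨i + 1, Nat.succ_lt_succ i.2⟩ = ⟨p.σ i + 1, Nat.succ_lt_succ (p.σ i).2⟩ := by
  change (p.cons A).σ (Fin.succ i) = (Fin.succ (p.σ i) : Fin (Γ.length + 1))
  simp [cons]

/-- The permutation that moves an entry to the front. -/
def toFront (A : O) (Ψ : List O) : (Λ : List O) → CtxPerm (Λ ++ A :: Ψ) (A :: (Λ ++ Ψ))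
  | [] => refl (A :: Ψ)
  | B :: Λ => ((toFront A Ψ Λ).cons B).trans (swap (Λ ++ Ψ) B A [])

theorem tracks_toFront (A : O) (Ψ : List O) (x : X) (m : List X) : ∀ {Λ : List O} {l : List X},
    l.length = Λ.length → (toFront A Ψ Λ).Tracks (l ++ x :: m) (x :: (l ++ m))
  | [], [], _ => tracks_refl _
  | B :: Λ, y :: l, h =>
    ((tracks_toFront A Ψ x m (Nat.succ.inj h)).cons y B).trans (tracks_swap y x (l ++ m) B A _)

/-- The block sum of two permutations, described by its values on positions, because `Fin (Γ ++
Δ).length` does not split definitionally. -/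
theorem exists_append (p : CtxPerm Γ Γ') (q : CtxPerm Δ Δ') :
    ∃ r : CtxPerm (Γ ++ Δ) (Γ' ++ Δ'),
      (∀ (k : Fin (Γ' ++ Δ').length) (j : Fin Γ'.length), (k : ℕ) = j → (r.σ k : ℕ) = p.σ j) ∧
      ∀ (k : Fin (Γ' ++ Δ').length) (j : Fin Δ'.length), (k : ℕ) = Γ'.length + j →
        (r.σ k : ℕ) = Γ.length + q.σ j := by
  let e : Fin (Γ' ++ Δ').length ≃ Fin (Γ ++ Δ).length :=
    (finCongr List.length_append).trans (finSumFinEquiv.symm.trans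
      ((Equiv.sumCongr p.σ q.σ).trans (finSumFinEquiv.trans (finCongr List.length_append.symm))))
  have h₁ : ∀ (k : Fin (Γ' ++ Δ').length) (j : Fin Γ'.length), (k : ℕ) = j →
      (e k : ℕ) = p.σ j := fun k j h => by
    have : finCongr List.length_append k = Fin.castAdd Δ'.length j := Fin.ext h
    simp only [e, Equiv.trans_apply, this, finSumFinEquiv_symm_apply_castAdd]
    rfl
  have h₂ : ∀ (k : Fin (Γ' ++ Δ').length) (j : Fin Δ'.length), (k : ℕ) = Γ'.length + j →
      (e k : ℕ) = Γ.length + q.σ j := fun k j h => by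
    have : finCongr List.length_append k = Fin.natAdd Γ'.length j := Fin.ext h
    simp only [e, Equiv.trans_apply, this, finSumFinEquiv_symm_apply_natAdd]
    rfl
  refine ⟨⟨e, fun k => ?_⟩, h₁, h₂⟩
  rw [List.get_eq_getElem, List.get_eq_getElem]
  rcases Nat.lt_or_ge k Γ'.length with hk | hk
  · have := h₁ k ⟨k, hk⟩ rfl
    simp only [this]
    rw [List.getElem_append_left hk, List.getElem_append_left (p.σ ⟨k, hk⟩).2]
    exact p.get_eq ⟨k, hk⟩
  · have hk' : k - Γ'.length < Δ'.length := by
      have := k.2.trans_eq List.length_append; omega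
    have := h₂ k ⟨k - Γ'.length, hk'⟩ (by simp only; omega)
    simp only [this]
    rw [List.getElem_append_right hk, List.getElem_append_right (Nat.le_add_right _ _)]
    simp only [Nat.add_sub_cancel_left]
    exact q.get_eq ⟨k - Γ'.length, hk'⟩

theorem tracks_append {p : CtxPerm Γ Γ'} {q : CtxPerm Δ Δ'} {r : CtxPerm (Γ ++ Δ) (Γ' ++ Δ')}
    (h₁ : ∀ (k : Fin (Γ' ++ Δ').length) (j : Fin Γ'.length), (k : ℕ) = j → (r.σ k : ℕ) = p.σ j)
    (h₂ : ∀ (k : Fin (Γ' ++ Δ').length) (j : Fin Δ'.length), (k : ℕ) = Γ'.length + j →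
      (r.σ k : ℕ) = Γ.length + q.σ j)
    {l l' m m' : List X} (hp : p.Tracks l l') (hq : q.Tracks m m') (hl : l.length = Γ.length)
    (hl' : l'.length = Γ'.length) : r.Tracks (l ++ m) (l' ++ m') := fun k => by
  rcases Nat.lt_or_ge k Γ'.length with hk | hk
  · rw [h₁ k ⟨k, hk⟩ rfl, List.getElem?_append_left (by omega),
      List.getElem?_append_left (by rw [hl]; exact (p.σ _).2)]
    exact hp ⟨k, hk⟩
  · have hk' : k - Γ'.length < Δ'.length := by
      have := k.2.trans_eq List.length_append; omega
    rw [h₂ k ⟨k - Γ'.length, hk'⟩ (by simp only; omega), List.getElem?_append_right (by omega),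
      List.getElem?_append_right (by omega), hl, hl', Nat.add_sub_cancel_left]
    exact hq ⟨k - Γ'.length, hk'⟩

/-- A permutation which fixes the labels of the first entries is a permutation of the others. -/
theorem exists_of_tracks_range {p : CtxPerm (Γ ++ Δ) (Γ ++ Δ')} {l l' : List ℕ}
    (hp : p.Tracks (List.range Γ.length ++ l.map (· + Γ.length))
      (List.range Γ.length ++ l'.map (· + Γ.length)))
    (hl : l.length = Δ.length) (hl' : l'.length = Δ'.length) :
    ∃ q : CtxPerm Δ Δ', q.Tracks l l' ∧
      (∀ (k : Fin (Γ ++ Δ').length) (j : Fin Γ.length), (k : ℕ) = j →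
        (p.σ k : ℕ) = (refl Γ).σ j) ∧
      ∀ (k : Fin (Γ ++ Δ').length) (j : Fin Δ'.length), (k : ℕ) = Γ.length + j →
        (p.σ k : ℕ) = Γ.length + q.σ j := by
  have hlt : ∀ (m : List ℕ) i, i < Γ.length →
      (List.range Γ.length ++ m.map (· + Γ.length))[i]? = some i := fun m i hi => by
    rw [List.getElem?_append_left (by simpa using hi), List.getElem?_range hi]
  have hge : ∀ (m : List ℕ) i, (List.range Γ.length ++ m.map (· + Γ.length))[Γ.length + i]? =
      m[i]?.map (· + Γ.length) := fun m i => by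
    rw [List.getElem?_append_right (by simp), List.length_range, Nat.add_sub_cancel_left,
      List.getElem?_map]
  have hlen := p.length_eq
  rw [List.length_append, List.length_append] at hlen
  -- The labels of the other entries are shifted by the length of `Γ`. A label below that length
  -- therefore occurs only at the position it names.
  have h₁ : ∀ k : Fin (Γ ++ Δ').length, (k : ℕ) < Γ.length → (p.σ k : ℕ) = k := fun k hk => by
    have h := hp k
    rw [hlt _ _ hk] at h
    rcases Nat.lt_or_ge (p.σ k) Γ.length with hs | hs
    · rw [hlt _ _ hs] at h
      exact (Option.some.inj h).symm
    · obtain ⟨i, hi⟩ := Nat.exists_eq_add_of_le hs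
      rw [hi, hge] at h
      cases hi : l[i]? with
      | none => rw [hi] at h; cases h
      | some a => rw [hi] at h; have : _ = a + Γ.length := Option.some.inj h; omega
  have h₂ : ∀ k : Fin (Γ ++ Δ').length, Γ.length ≤ (k : ℕ) → Γ.length ≤ (p.σ k : ℕ) :=
    fun k hk => by
    have h := hp k
    obtain ⟨i, hi⟩ := Nat.exists_eq_add_of_le hk
    by_contra hs
    rw [hlt _ _ (Nat.lt_of_not_le hs), hi, hge] at h
    cases hi : l'[i]? with
    | none => rw [hi] at h; cases h
    | some a => rw [hi] at h; have : a + Γ.length = p.σ k := Option.some.inj h; omega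
  have hb : ∀ j : Fin Δ'.length, Γ.length + j < (Γ ++ Δ').length := fun j => by
    rw [List.length_append]; omega
  let s : Fin Δ'.length → Fin Δ.length := fun j => ⟨p.σ ⟨Γ.length + j, hb j⟩ - Γ.length, by
    have h₃ := (p.σ ⟨Γ.length + j, hb j⟩).2.trans_eq List.length_append
    have h₄ := h₂ ⟨Γ.length + j, hb j⟩ (Nat.le_add_right _ _)
    omega⟩
  have hs : ∀ j : Fin Δ'.length, (p.σ ⟨Γ.length + j, hb j⟩ : ℕ) = Γ.length + s j := fun j =>
    (Nat.add_sub_cancel' (h₂ ⟨Γ.length + j, hb j⟩ (Nat.le_add_right _ _))).symm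
  have hinj : Function.Injective s := fun i j h => by
    have := p.σ.injective (Fin.ext ((hs i).trans ((congrArg (Γ.length + ·)
      (congrArg Fin.val h)).trans (hs j).symm)))
    rw [Fin.mk.injEq] at this
    exact Fin.ext (Nat.add_left_cancel this)
  -- Injectivity comes from `p`; the cardinalities agree because `p` equates the lengths of the two
  -- full contexts and `Γ` is common to both.
  let e : Fin Δ'.length ≃ Fin Δ.length := Equiv.ofBijective s
    ((Fintype.bijective_iff_injective_and_card s).2 ⟨hinj, by simp; omega⟩)
  refine ⟨⟨e, fun j => ?_⟩, fun j => ?_, fun k j h => ?_, fun k j h => ?_⟩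
  · have h := p.get_eq ⟨Γ.length + j, hb j⟩
    rw [List.get_eq_getElem, List.get_eq_getElem] at h
    simp only [hs] at h
    rw [List.getElem_append_right (Nat.le_add_right _ _),
      List.getElem_append_right (Nat.le_add_right _ _)] at h
    simp only [Nat.add_sub_cancel_left] at h
    exact h
  · have h := hp ⟨Γ.length + j, hb j⟩
    rw [hs, hge, hge] at h
    exact Option.map_injective (fun _ _ h => Nat.add_right_cancel h) h
  · exact (h₁ k (h ▸ j.2)).trans h
  · obtain rfl : k = ⟨Γ.length + j, hb j⟩ := Fin.ext h
    exact hs j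

end CtxPerm

namespace Args
variable {O : Type u} {H : List O → O → Type u} (one : ∀ A, H [A] A)

theorem dom_ones : ∀ (As : List O) (i : Fin As.length), (ones one As).dom i = [As.get i]
  | _ :: _, ⟨0, _⟩ => rfl
  | _ :: As, ⟨i + 1, h⟩ => dom_ones As ⟨i, Nat.lt_of_succ_lt_succ h⟩

theorem get_ones : ∀ (As : List O) (i : Fin As.length),
    HEq ((ones one As).get i) (one (As.get i))
  | _ :: _, ⟨0, _⟩ => HEq.rfl
  | _ :: As, ⟨i + 1, h⟩ => get_ones As ⟨i, Nat.lt_of_succ_lt_succ h⟩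

theorem offset_ones : ∀ (As : List O) (i : Fin As.length), (ones one As).offset i = i
  | _ :: _, ⟨0, _⟩ => rfl
  | _ :: As, ⟨i + 1, h⟩ => by
    refine (congrArg ([_].length + ·) (offset_ones As ⟨i, Nat.lt_of_succ_lt_succ h⟩)).trans ?_
    exact Nat.add_comm 1 i

end Args

-- Multimaps up to label-preserving permutation.

namespace Multicat.Symmetry
variable {N : Multicat.{u}} (Y : N.Symmetry) {X Z : Type*}

theorem comp_act_of_exists {As As' Γ Γ' : List N.Ob} {B : N.Ob} (f : N.Hom As B)
    (gs : Args N.Hom Γ As) (gs' : Args N.Hom Γ' As') (p : CtxPerm As As') (q : CtxPerm Γ Γ')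
    (h : ∀ i, ∃ τ : CtxPerm (gs.dom (p.σ i)) (gs'.dom i),
      HEq (gs'.get i) (Y.act τ (gs.get (p.σ i))) ∧
      ∀ (j : Fin (gs'.dom i).length) (k : Fin Γ'.length), (k : ℕ) = gs'.offset i + j →
        (q.σ k : ℕ) = gs.offset (p.σ i) + τ.σ j) :
    N.comp (Y.act p f) gs' = Y.act q (N.comp f gs) := by
  choose τ h₁ h₂ using h
  exact Y.comp_act f gs gs' p τ q h₁ h₂

/-- Equivariance for substitution into the first argument alone: the permutation of the result is
`τ` on the substituted block and `p` on the remaining entries. -/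
theorem comp_act_cons {Δ Δ' Ψ Ψ' : List N.Ob} {A B : N.Ob} (p : CtxPerm Ψ Ψ') (τ : CtxPerm Δ Δ')
    (q : CtxPerm (Δ ++ Ψ) (Δ' ++ Ψ'))
    (h₁ : ∀ (k : Fin (Δ' ++ Ψ').length) (j : Fin Δ'.length), (k : ℕ) = j → (q.σ k : ℕ) = τ.σ j)
    (h₂ : ∀ (k : Fin (Δ' ++ Ψ').length) (j : Fin Ψ'.length), (k : ℕ) = Δ'.length + j →
      (q.σ k : ℕ) = Δ.length + p.σ j)
    (e : N.Hom (A :: Ψ) B) (g : N.Hom Δ A) :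
    N.comp (Y.act (p.cons A) e) (.cons (Y.act τ g) (.ones N.one Ψ') rfl) =
      Y.act q (N.comp e (.cons g (.ones N.one Ψ) rfl)) := by
  refine Y.comp_act_of_exists e _ _ _ q fun i => ?_
  match i with
  | ⟨0, h⟩ =>
    rw [CtxPerm.cons_zero]
    exact ⟨τ, HEq.rfl, fun j k hk => (h₁ k j (hk.trans (Nat.zero_add _))).trans
      (Nat.zero_add _).symm⟩
  | ⟨i + 1, h⟩ =>
    have hi : i < Ψ'.length := Nat.lt_of_succ_lt_succ h
    rw [CtxPerm.cons_succ A p ⟨i, hi⟩]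
    change ∃ τ : CtxPerm ((Args.ones N.one Ψ).dom (p.σ ⟨i, hi⟩))
        ((Args.ones N.one Ψ').dom ⟨i, hi⟩),
      HEq ((Args.ones N.one Ψ').get ⟨i, hi⟩)
        (Y.act τ ((Args.ones N.one Ψ).get (p.σ ⟨i, hi⟩))) ∧
      ∀ (j : Fin ((Args.ones N.one Ψ').dom ⟨i, hi⟩).length) (k : Fin (Δ' ++ Ψ').length),
        (k : ℕ) = Δ'.length + (Args.ones N.one Ψ').offset ⟨i, hi⟩ + j →
        (q.σ k : ℕ) = Δ.length + (Args.ones N.one Ψ).offset (p.σ ⟨i, hi⟩) + τ.σ j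
    have hd : (Args.ones N.one Ψ).dom (p.σ ⟨i, hi⟩) = (Args.ones N.one Ψ').dom ⟨i, hi⟩ := by
      rw [Args.dom_ones, Args.dom_ones, p.get_eq]
    refine ⟨.ofEq hd, ?_, fun j k hk => ?_⟩
    · refine (Args.get_ones N.one Ψ' _).trans (HEq.trans ?_ (Y.act_ofEq hd _).symm)
      rw [p.get_eq]
      exact (Args.get_ones N.one Ψ _).symm
    -- The domain of an identity has one entry, so the offset is already the position.
    · have hj : (j : ℕ) = 0 := by
        have := j.2.trans_eq (congrArg List.length (Args.dom_ones N.one Ψ' ⟨i, hi⟩))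
        exact Nat.lt_one_iff.1 this
      rw [CtxPerm.ofEq_val, hj, Args.offset_ones]
      rw [hj, Args.offset_ones] at hk
      exact h₂ k ⟨i, hi⟩ hk

/-- A labelled multimap is obtained from another one by a permutation which preserves labels. -/
def Moves {Γ Γ' : List N.Ob} {B : N.Ob} (m : List X) (f : N.Hom Γ B) (m' : List X)
    (f' : N.Hom Γ' B) : Prop :=
  m.length = Γ.length ∧ m'.length = Γ'.length ∧
    ∃ p : CtxPerm Γ Γ', p.Tracks m m' ∧ f' = Y.act p f

section Moves
variable {Y} {Γ Γ' Γ'' : List N.Ob} {B : N.Ob} {f : N.Hom Γ B} {f' : N.Hom Γ' B}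
  {f'' : N.Hom Γ'' B} {m m' m'' : List X}

theorem Moves.refl (h : m.length = Γ.length) : Y.Moves m f m f :=
  ⟨h, h, .refl Γ, CtxPerm.tracks_refl m, (Y.act_refl f).symm⟩

theorem Moves.symm (h : Y.Moves m f m' f') : Y.Moves m' f' m f := by
  obtain ⟨h₁, h₂, p, hp, rfl⟩ := h
  exact ⟨h₂, h₁, p.symm, hp.symm, (Y.act_symm p f).symm⟩

theorem Moves.trans (h : Y.Moves m f m' f') (h' : Y.Moves m' f' m'' f'') :
    Y.Moves m f m'' f'' := by
  obtain ⟨h₁, -, p, hp, rfl⟩ := h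
  obtain ⟨-, h₂, q, hq, rfl⟩ := h'
  exact ⟨h₁, h₂, p.trans q, hp.trans hq, (Y.act_trans p q f).symm⟩

theorem Moves.map (h : Y.Moves m f m' f') (ρ : X → Z) :
    Y.Moves (m.map ρ) f (m'.map ρ) f' := by
  obtain ⟨h₁, h₂, p, hp, rfl⟩ := h
  exact ⟨by simpa using h₁, by simpa using h₂, p, hp.map ρ, rfl⟩

/-- With distinct labels the only label-preserving permutation is the identity. This is what turns
the relational semantics into a function. -/
theorem Moves.eq_of_nodup {f' : N.Hom Γ B} (h : Y.Moves m f m f') (hm : m.Nodup) : f' = f := by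
  obtain ⟨h₁, -, p, hp, rfl⟩ := h
  rw [hp.unique (CtxPerm.tracks_refl m) hm h₁.symm, Y.act_refl]

/-- Composition respects moves, both in the outer multimap and in correspondingly labelled
arguments. -/
theorem Moves.comp {D D' : X → List Z → (Γ : List N.Ob) → (A : N.Ob) → N.Hom Γ A → Prop}
    (hD : ∀ a m Γ A g, D a m Γ A g → m.length = Γ.length)
    (hD' : ∀ a m Γ A g, D' a m Γ A g → m.length = Γ.length)
    (h : ∀ x m m' Γ Γ' A g g', D x m Γ A g → D' x m' Γ' A g' → Y.Moves m g m' g')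
    {As As' Γ Γ' : List N.Ob} {l l' : List X} {f : N.Hom As B} {f' : N.Hom As' B}
    (hf : Y.Moves l f l' f') {m m' : List Z} {gs : Args N.Hom Γ As} {gs' : Args N.Hom Γ' As'}
    (hg : gs.Lab D l m) (hg' : gs'.Lab D' l' m') :
    Y.Moves m (N.comp f gs) m' (N.comp f' gs') := by
  obtain ⟨h₁, -, p, hp, rfl⟩ := hf
  obtain ⟨q, hq, e⟩ := Y.exists_comp_act_lab hD hD'
    (fun x m m' Γ Γ' A g g' hx hx' => (h x m m' Γ Γ' A g g' hx hx').2.2) hp hg hg'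
  exact ⟨hg.length_dom hD, hg'.length_dom hD', q, hq, e f⟩

/-- Arguments given for the moved multimap are rearranged into arguments for the original one.
Substitution can thus be pushed below the permutation hidden in a denotation. -/
theorem Moves.exists_comp {D : X → List Z → (Γ : List N.Ob) → (A : N.Ob) → N.Hom Γ A → Prop}
    (hD : ∀ a m Γ A g, D a m Γ A g → m.length = Γ.length)
    {As As' Γ' : List N.Ob} {l l' : List X} {f : N.Hom As B} {f' : N.Hom As' B}
    (hf : Y.Moves l f l' f') {m' : List Z} {gs' : Args N.Hom Γ' As'} (hg' : gs'.Lab D l' m') :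
    ∃ (Γ : List N.Ob) (m : List Z) (gs : Args N.Hom Γ As), gs.Lab D l m ∧
      Y.Moves m (N.comp f gs) m' (N.comp f' gs') := by
  obtain ⟨h₁, -, p, hp, rfl⟩ := hf
  obtain ⟨Γ, m, gs, q, hg, hq, e⟩ := Y.exists_permute hD hp h₁ hg'
  exact ⟨Γ, m, gs, hg, hg.length_dom hD, hg'.length_dom hD, q, hq, e f⟩

end Moves

/-- Moving an argument to the front. -/
theorem moves_toFront {Λ Δ Ψ : List N.Ob} {A B : N.Ob} {l m n : List X} (hl : l.length = Λ.length)
    (hm : m.length = Δ.length) (hn : n.length = Ψ.length) (e : N.Hom (Λ ++ ([A] ++ Ψ)) B)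
    (g : N.Hom Δ A) :
    Y.Moves (l ++ (m ++ n)) (N.comp e (.app (.ones N.one Λ) (.app (.single g) (.ones N.one Ψ))))
      (m ++ (l ++ n)) (N.comp (Y.act (CtxPerm.toFront A Ψ Λ) e)
        (.cons g (.ones N.one (Λ ++ Ψ)) rfl)) := by
  -- The label `none` marks the argument to be moved, and `some x` marks an identity carrying the
  -- label `x`.
  let D : Option X → List X → (Γ : List N.Ob) → (A : N.Ob) → N.Hom Γ A → Prop :=
    fun x k Γ C h => match x with
      | none => k = m ∧ Γ = Δ ∧ ∃ hC : C = A, HEq h g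
      | some x => k = [x] ∧ Γ = [C] ∧ HEq h (N.one C)
  have hD : ∀ a m Γ A g, D a m Γ A g → m.length = Γ.length := by
    rintro (_ | x) k Γ C h ⟨rfl, rfl, -⟩
    · exact hm
    · rfl
  have h₁ : ∀ (Λ : List N.Ob) (l : List X), l.length = Λ.length →
      (Args.ones N.one Λ).Lab D (l.map some) l := fun Λ l hl =>
    .ones some (fun x _ C => ⟨rfl, rfl, HEq.rfl⟩) hl
  have h₂ : (Args.single g).Lab D [none] m := .single ⟨rfl, rfl, rfl, HEq.rfl⟩
  refine Moves.comp (D := D) (D' := D) hD hD ?_ (l := l.map some ++ none :: n.map some)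
    (l' := none :: (l.map some ++ n.map some)) ?_ ((h₁ Λ l hl).app (h₂.app (h₁ Ψ n hn))) ?_
  · rintro (_ | x) k k' Γ Γ' C h h' ⟨rfl, e₁, hh⟩ ⟨rfl, e₂, hh'⟩
    · subst e₁ e₂
      obtain ⟨-, hh⟩ := hh
      obtain ⟨-, hh'⟩ := hh'
      obtain rfl := eq_of_heq (hh.trans hh'.symm)
      exact .refl hm
    · subst e₁ e₂
      obtain rfl := eq_of_heq (hh.trans hh'.symm)
      exact .refl rfl
  · exact ⟨by simp [hl, hn], by simp [hl, hn], CtxPerm.toFront A Ψ Λ,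
      CtxPerm.tracks_toFront A Ψ none _ (by simpa using hl), rfl⟩
  · rw [← List.map_append]
    exact .cons rfl rfl ⟨rfl, rfl, rfl, HEq.rfl⟩ (h₁ (Λ ++ Ψ) (l ++ n) (by simp [hl, hn]))

end Multicat.Symmetry

end Multi

namespace Multi

/-! ## Restriction of symmetries -/

namespace Args
variable {O O' : Type u} {H : List O → O → Type u} {H' : List O' → O' → Type u} (o : O → O')
  (φ : ∀ {Γ A}, H Γ A → H' (Γ.map o) (o A))

theorem dom_map {Γ As : List O} (gs : Args H Γ As) (i : Fin (As.map o).length) :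
    (gs.map o φ).dom i = (gs.dom (i.cast (List.length_map _))).map o := by
  induction gs with
  | nil => exact i.elim0
  | cons f fs h ih =>
    match i with
    | ⟨0, _⟩ => rfl
    | ⟨i + 1, hi⟩ => exact ih ⟨i, Nat.lt_of_succ_lt_succ hi⟩

theorem get_map {Γ As : List O} (gs : Args H Γ As) (i : Fin (As.map o).length) :
    HEq ((gs.map o φ).get i) (φ (gs.get (i.cast (List.length_map _)))) := by
  induction gs with
  | nil => exact i.elim0
  | cons f fs h ih =>
    match i with
    | ⟨0, _⟩ => exact HEq.rfl
    | ⟨i + 1, hi⟩ => exact ih ⟨i, Nat.lt_of_succ_lt_succ hi⟩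

theorem offset_map {Γ As : List O} (gs : Args H Γ As) (i : Fin (As.map o).length) :
    (gs.map o φ).offset i = gs.offset (i.cast (List.length_map _)) := by
  induction gs with
  | nil => exact i.elim0
  | cons f fs h ih =>
    match i with
    | ⟨0, _⟩ => rfl
    | ⟨i + 1, hi⟩ =>
      exact congrArg₂ (· + ·) (List.length_map _) (ih ⟨i, Nat.lt_of_succ_lt_succ hi⟩)

end Args

theorem Multicat.Symmetry.act_congr {N : Multicat.{u}} (Y : N.Symmetry)
    {Γ₁ Γ₂ Δ₁ Δ₂ : List N.Ob} {B B' : N.Ob}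
    (p : CtxPerm Γ₁ Δ₁) (q : CtxPerm Γ₂ Δ₂) (hΓ : Γ₁ = Γ₂) (hΔ : Δ₁ = Δ₂) (hB : B = B')
    (hσ : ∀ i, (p.σ i : ℕ) = q.σ (i.cast (congrArg _ hΔ)))
    {f : N.Hom Γ₁ B} {g : N.Hom Γ₂ B'} (h : HEq f g) : HEq (Y.act p f) (Y.act q g) := by
  subst hΓ hΔ hB; obtain rfl := eq_of_heq h
  obtain rfl : p = q := CtxPerm.ext' fun i => Fin.ext (hσ i)
  rfl

/-- The symmetric structure on a restricted multicategory. -/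
def Multicat.Symmetry.pullback {M : Multicat.{u}} (Y : M.Symmetry) {O : Type u} (o : O → M.Ob) :
    (M.pullback o).Symmetry where
  act p f := Y.act (p.map o) f
  act_refl f := (eq_of_heq (Y.act_congr _ _ rfl rfl rfl (fun _ => rfl) HEq.rfl)).trans
    (Y.act_refl f)
  act_trans p q f := (eq_of_heq (Y.act_congr _ _ rfl rfl rfl (fun _ => rfl) HEq.rfl)).trans
    (Y.act_trans (p.map o) (q.map o) f)
  comp_act {As As' Γ Γ' B} f gs gs' p τ q h hq := by
    have hA : ∀ i, o (As'.get i) = o (As.get (p.σ i)) := fun i => congrArg o (p.get_eq i)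
    have c : ∀ (As : List O) (i : Fin (As.map o).length),
        o (As.get (i.cast (List.length_map _))) = (As.map o).get i := fun As i => by simp
    refine Calculus.comp_act_aux Y f (gs.map o fun f => f) (gs'.map o fun f => f) (p.map o)
      (q.map o) _ (Args.dom_map o _ gs) _ (Args.dom_map o _ gs')
      (fun i => cast (congrArg (M.Hom _) (c As i)) (gs.get (i.cast (List.length_map _))))
      (fun i => (Args.get_map (H' := M.Hom) o _ gs i).trans (cast_heq _ _).symm)
      (fun i => cast (congrArg (M.Hom _) (c As' i)) (gs'.get (i.cast (List.length_map _))))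
      (fun i => (Args.get_map (H' := M.Hom) o _ gs' i).trans (cast_heq _ _).symm)
      (fun i => (τ (i.cast (List.length_map _))).map o) (fun i => ?_) fun i j k hk => ?_
    · refine (cast_heq _ _).trans ((h (i.cast (List.length_map _))).trans ?_)
      exact Y.act_congr _ _ rfl rfl (c As ((p.map o).σ i)) (fun _ => rfl) (cast_heq _ _).symm
    · rw [Args.offset_map] at hk ⊢
      exact hq (i.cast (List.length_map _)) (j.cast (List.length_map _)) (k.cast (List.length_map _)) hk

theorem CtxPerm.tracks_swap_append {O : Type u} {X : Type*} (a b : X) (m : List X) (A B : O)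
    (Ψ : List O) : ∀ {Λ : List O} {l : List X}, l.length = Λ.length →
      (CtxPerm.swap Ψ A B Λ).Tracks (l ++ a :: b :: m) (l ++ b :: a :: m)
  | [], [], _ => tracks_swap a b m A B Ψ
  | C :: _, x :: _, h => (tracks_swap_append a b m A B Ψ (Nat.succ.inj h)).cons x C

/-! ## Labelled multimaps denoted by linear terms -/

section Denotation
open Multicat
variable {N : Multicat.{u}} (Y : N.Symmetry)

/-- The multimap is an identity, labelled by `i`. -/
inductive IsVar (i : ℕ) : List ℕ → (Γ : List N.Ob) → (B : N.Ob) → N.Hom Γ B → Prop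
  | mk (B : N.Ob) : IsVar i [i] [B] B (N.one B)

/-- The multimap is, up to permutation, `op` composed with multimaps satisfying `D`. -/
inductive IsApp {n : ℕ} (D : Fin n → List ℕ → (Γ : List N.Ob) → (B : N.Ob) → N.Hom Γ B → Prop)
    {As : List N.Ob} {B : N.Ob} (op : N.Hom As B) :
    List ℕ → (Γ : List N.Ob) → (B : N.Ob) → N.Hom Γ B → Prop
  | mk {Θ Γ : List N.Ob} {m l : List ℕ} {gs : Args N.Hom Θ As} {f : N.Hom Γ B}
      (hg : gs.Lab D (List.finRange n) m) (h : Y.Moves m (N.comp op gs) l f) : IsApp D op l Γ B f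

/-- The multimap is, up to permutation, obtained from `g` by decomposing it along `v`. -/
inductive IsLet (Ds Dt : List ℕ → (Γ : List N.Ob) → (B : N.Ob) → N.Hom Γ B → Prop)
    {As : List N.Ob} {R : N.Ob} (v : N.Hom As R) :
    List ℕ → (Γ : List N.Ob) → (B : N.Ob) → N.Hom Γ B → Prop
  | mk {Γ Δ Ψ : List N.Ob} {B : N.Ob} {l lΔ lΨ : List ℕ} {f : N.Hom Γ B} (g : N.Hom Δ R)
      (e : N.Hom (R :: Ψ) B) (hs : Ds lΔ Δ R g)
      (ht : Dt (List.range As.length ++ lΨ.map (· + As.length)) (As ++ Ψ) B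
        (N.comp e (.cons v (.ones N.one Ψ) rfl)))
      (h : Y.Moves (lΔ ++ lΨ) (N.comp e (.cons g (.ones N.one Ψ) rfl)) l f) :
      IsLet Ds Dt v l Γ B f

variable {Y}

theorem IsVar.moves {i : ℕ} {l l' : List ℕ} {Γ Γ' : List N.Ob} {B : N.Ob} {f : N.Hom Γ B}
    {f' : N.Hom Γ' B} (h : IsVar i l Γ B f) (h' : Y.Moves l f l' f') : IsVar i l' Γ' B f' := by
  cases h
  obtain ⟨-, h₂, p, hp, rfl⟩ := h'
  obtain ⟨A, rfl⟩ := List.length_eq_one_iff.1 p.length_eq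
  obtain ⟨x, rfl⟩ := List.length_eq_one_iff.1 h₂
  obtain rfl : A = B := (p.get_eq (0 : Fin 1)).trans (by
    rw [show p.σ (0 : Fin 1) = (0 : Fin 1) from Subsingleton.elim (α := Fin 1) _ _]; rfl)
  obtain rfl : p = .refl _ := CtxPerm.ext' fun i => Subsingleton.elim (α := Fin 1) _ _
  obtain rfl : x = i := Option.some.inj (hp 0)
  rw [Y.act_refl]
  exact .mk _

theorem IsVar.length {i : ℕ} {l : List ℕ} {Γ : List N.Ob} {B : N.Ob} {f : N.Hom Γ B}
    (h : IsVar i l Γ B f) : l.length = Γ.length := by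
  cases h; rfl

theorem IsVar.map (ρ : ℕ → ℕ) {i : ℕ} {l : List ℕ} {Γ : List N.Ob} {B : N.Ob} {f : N.Hom Γ B}
    (h : IsVar i l Γ B f) : IsVar (ρ i) (l.map ρ) Γ B f := by
  cases h; exact .mk B

theorem IsVar.subst {E : ℕ → List ℕ → (Γ : List N.Ob) → (B : N.Ob) → N.Hom Γ B → Prop}
    {i : ℕ} {l m : List ℕ} {Γ Θ : List N.Ob} {B : N.Ob} {f : N.Hom Γ B}
    {gs : Args N.Hom Θ Γ} (h : IsVar i l Γ B f) (hg : gs.Lab E l m) :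
    E i m Θ B (N.comp f gs) := by
  cases h
  obtain ⟨g, rfl⟩ := Args.exists_single gs
  rw [N.one_comp]
  exact hg.of_single

theorem IsVar.unique {i : ℕ} {l l' : List ℕ} {Γ Γ' : List N.Ob} {B : N.Ob} {f : N.Hom Γ B}
    {f' : N.Hom Γ' B} (h : IsVar i l Γ B f) (h' : IsVar i l' Γ' B f') : Y.Moves l f l' f' := by
  cases h; cases h'; exact .refl rfl

section
variable {n : ℕ} {D D' : Fin n → List ℕ → (Γ : List N.Ob) → (B : N.Ob) → N.Hom Γ B → Prop}
  {As : List N.Ob} {A : N.Ob} {op : N.Hom As A} {l l' : List ℕ} {Γ Γ' : List N.Ob} {B : N.Ob}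
  {f : N.Hom Γ B} {f' : N.Hom Γ' B}

theorem IsApp.length (h : IsApp Y D op l Γ B f) : l.length = Γ.length := by
  cases h with
  | mk _ h => exact h.2.1

theorem IsApp.moves (h : IsApp Y D op l Γ B f) (h' : Y.Moves l f l' f') :
    IsApp Y D op l' Γ' B f' := by
  cases h with
  | mk hg h => exact .mk hg (h.trans h')

theorem IsApp.map (ρ : ℕ → ℕ) (hD : ∀ a m Γ B g, D a m Γ B g → D' a (m.map ρ) Γ B g)
    (h : IsApp Y D op l Γ B f) : IsApp Y D' op (l.map ρ) Γ B f := by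
  cases h with
  | mk hg h => exact .mk (by simpa using hg.map (D' := D') _root_.id ρ hD) (h.map ρ)

/-- The arguments are first pulled back through the permutation in the denotation; then
associativity composes them with the arguments of `op`. -/
theorem IsApp.subst {E : ℕ → List ℕ → (Γ : List N.Ob) → (B : N.Ob) → N.Hom Γ B → Prop}
    (hD : ∀ a m Γ B g, D a m Γ B g → m.length = Γ.length)
    (hE : ∀ a m Γ B g, E a m Γ B g → m.length = Γ.length)
    (hD' : ∀ a m k Γ Θ B g (gs : Args N.Hom Θ Γ), D a m Γ B g → gs.Lab E m k →
      D' a k Θ B (N.comp g gs))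
    (h : IsApp Y D op l Γ B f) {Θ : List N.Ob} {m : List ℕ} {gs : Args N.Hom Θ Γ}
    (hg : gs.Lab E l m) : IsApp Y D' op m Θ B (N.comp f gs) := by
  cases h with
  | mk hs h =>
    obtain ⟨Θ', m', gs', h₁, h₂⟩ := h.exists_comp hE hg
    rw [N.assoc] at h₂
    exact .mk (hs.bind hD hD' h₁) h₂

/-- Arguments at the same index differ by moves, so the two composites do as well. -/
theorem IsApp.unique (hD : ∀ a m Γ B g, D a m Γ B g → m.length = Γ.length)
    (ih : ∀ a m m' Γ Γ' B g g', D a m Γ B g → D a m' Γ' B g' → Y.Moves m g m' g')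
    (h : IsApp Y D op l Γ B f) (h' : IsApp Y D op l' Γ' B f') : Y.Moves l f l' f' := by
  cases h with
  | mk hg h =>
    cases h' with
    | mk hg' h' =>
      exact h.symm.trans ((Symmetry.Moves.comp hD hD ih (.refl hg.length_eq) hg hg').trans h')

end

section
variable {Ds Ds' Dt Dt' : List ℕ → (Γ : List N.Ob) → (B : N.Ob) → N.Hom Γ B → Prop}
  {As : List N.Ob} {R : N.Ob} {v : N.Hom As R} {l l' : List ℕ} {Γ Γ' : List N.Ob} {B : N.Ob}
  {f : N.Hom Γ B} {f' : N.Hom Γ' B}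

theorem IsLet.length (h : IsLet Y Ds Dt v l Γ B f) : l.length = Γ.length := by
  cases h with
  | mk _ _ _ _ h => exact h.2.1

theorem IsLet.moves (h : IsLet Y Ds Dt v l Γ B f) (h' : Y.Moves l f l' f') :
    IsLet Y Ds Dt v l' Γ' B f' := by
  cases h with
  | mk g e hs ht h => exact .mk g e hs ht (h.trans h')

theorem IsLet.map (ρ : ℕ → ℕ) (hs : ∀ m Γ B g, Ds m Γ B g → Ds' (m.map ρ) Γ B g)
    (ht : ∀ m Γ B g, Dt m Γ B g → Dt' (m.map (LTm.lift As.length ρ)) Γ B g)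
    (h : IsLet Y Ds Dt v l Γ B f) : IsLet Y Ds' Dt' v (l.map ρ) Γ B f := by
  cases h with
  | @mk _ Δ Ψ _ _ lΔ lΨ _ g e hg he h =>
    refine .mk (lΨ := lΨ.map ρ) g e (hs _ _ _ _ hg) ?_ (by simpa using h.map ρ)
    have e₁ : (List.range As.length).map (LTm.lift As.length ρ) = List.range As.length :=
      (List.map_congr_left fun i hi => if_pos (List.mem_range.1 hi)).trans (List.map_id _)
    have e₂ : (lΨ.map (· + As.length)).map (LTm.lift As.length ρ) =
        (lΨ.map ρ).map (· + As.length) := by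
      rw [List.map_map, List.map_map]
      exact List.map_congr_left fun i _ => by simp [LTm.lift]
    have := ht _ _ _ _ he
    rwa [List.map_append, e₁, e₂] at this

/-- The pulled-back arguments split into those for the decomposed multimap and those for the
remaining context. Bound variables receive identities, and the other labels are shifted past them.
-/
theorem IsLet.subst {E E' : ℕ → List ℕ → (Γ : List N.Ob) → (B : N.Ob) → N.Hom Γ B → Prop}
    (hDs : ∀ m Γ B g, Ds m Γ B g → m.length = Γ.length)
    (hE : ∀ a m Γ B g, E a m Γ B g → m.length = Γ.length)
    (hs : ∀ m k Γ Θ B g (gs : Args N.Hom Θ Γ), Ds m Γ B g → gs.Lab E m k →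
      Ds' k Θ B (N.comp g gs))
    (ht : ∀ m k Γ Θ B g (gs : Args N.Hom Θ Γ), Dt m Γ B g → gs.Lab E' m k →
      Dt' k Θ B (N.comp g gs))
    (hone : ∀ i < As.length, ∀ A, E' i [i] [A] A (N.one A))
    (hE' : ∀ i m Γ B g, E i m Γ B g → E' (i + As.length) (m.map (· + As.length)) Γ B g)
    (h : IsLet Y Ds Dt v l Γ B f) {Θ : List N.Ob} {m : List ℕ} {gs : Args N.Hom Θ Γ}
    (hg : gs.Lab E l m) : IsLet Y Ds' Dt' v m Θ B (N.comp f gs) := by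
  cases h with
  | @mk _ Δ Ψ _ _ lΔ lΨ _ g e hd he h =>
    obtain ⟨Θ', m', gs', h₁, h₂⟩ := h.exists_comp hE hg
    obtain ⟨Θ₁, Θ₂, a, b, rfl, hh⟩ := Args.app_cases Δ gs'
    obtain rfl := eq_of_heq hh
    obtain ⟨m₁, m₂, rfl, ha, hb⟩ := h₁.of_app (hDs _ _ _ _ hd)
    -- The arguments `a` go into the decomposed multimap, and `b` into the remaining context.
    have key : ∀ {Δ Θ : List N.Ob} (g : N.Hom Δ R) (a : Args N.Hom Θ Δ),
        N.comp (N.comp e (.cons g (.ones N.one Ψ) rfl)) (.app a b) =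
          N.comp e (.cons (N.comp g a) b rfl) := fun g a => by
      rw [N.assoc, Args.bind_cons N.comp g _ rfl _ a b rfl HEq.rfl, ones_bind]
    have key' : ∀ {Δ : List N.Ob} (g : N.Hom Δ R),
        N.comp (N.comp e (.cons (N.one R) b rfl)) (.cons g (.ones N.one Θ₂) rfl) =
          N.comp e (.cons g b rfl) := fun g => by
      rw [N.assoc, Args.bind_cons N.comp _ _ rfl (.cons g (.ones N.one Θ₂) rfl) (.single g)
        (.ones N.one Θ₂) rfl HEq.rfl, bind_ones, N.one_comp]
    rw [key] at h₂
    -- The arguments `b` are absorbed into the new factorisation, leaving its first slot free for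
    -- the decomposed multimap.
    refine .mk (Ψ := Θ₂) (lΨ := m₂) (N.comp g a) (N.comp e (.cons (N.one R) b rfl)) (hs _ _ _ _ _ _ _ hd ha) ?_
      (by rw [key']; exact h₂)
    rw [key']
    have h₃ := Args.Lab.ones (D := E') (one := N.one) (As := As) _root_.id
      (fun i hi A => hone i (List.mem_range.1 hi) A) List.length_range
    rw [List.map_id] at h₃
    have := ht _ _ _ _ _ _ _ he (h₃.app (hb.map (· + As.length) (· + As.length) hE'))
    rwa [key, N.comp_one] at this

/-- The bodies differ by a permutation `q` which fixes the bound labels and hence comes from a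
permutation `r` of the remaining context. Strength of `v` lifts this relation from the bodies to
their factorisations `e` and `e'`, and block sums then relate the two composites. -/
theorem IsLet.unique (hv : N.IsStrong v) (hDs : ∀ m Γ B g, Ds m Γ B g → m.length = Γ.length)
    (hs : ∀ m m' Γ Γ' B g g', Ds m Γ B g → Ds m' Γ' B g' → Y.Moves m g m' g')
    (ht : ∀ m m' Γ Γ' B g g', Dt m Γ B g → Dt m' Γ' B g' → Y.Moves m g m' g')
    (h : IsLet Y Ds Dt v l Γ B f) (h' : IsLet Y Ds Dt v l' Γ' B f') : Y.Moves l f l' f' := by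
  cases h with
  | @mk _ Δ Ψ _ _ lΔ lΨ _ g e hd he h =>
  cases h' with
  | @mk _ Δ' Ψ' _ _ lΔ' lΨ' _ g' e' hd' he' h' =>
    refine h.symm.trans (Symmetry.Moves.trans ?_ h')
    have hl := hDs _ _ _ _ hd
    have hl' := hDs _ _ _ _ hd'
    have hm : lΨ.length = Ψ.length := by
      have := h.1; rw [List.length_append, List.length_append] at this; omega
    have hm' : lΨ'.length = Ψ'.length := by
      have := h'.1; rw [List.length_append, List.length_append] at this; omega
    obtain ⟨-, -, p, hp, rfl⟩ := hs _ _ _ _ _ _ _ hd hd'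
    obtain ⟨-, -, q, hq, hqe⟩ := ht _ _ _ _ _ _ _ he he'
    -- Bound labels are below the number of bound variables and free ones are not, so `q` splits
    -- even if the free labels repeat.
    obtain ⟨r, hr, h₁, h₂⟩ := CtxPerm.exists_of_tracks_range hq hm hm'
    have e₁ := Y.comp_act_cons r (.refl As) q h₁ h₂ e v
    rw [Y.act_refl, ← hqe] at e₁
    -- `e'` and the permuted `e` have the same restriction along `v`, so they coincide.
    obtain rfl := (hv [] Ψ' B _).unique e₁ rfl
    obtain ⟨k, h₃, h₄⟩ := CtxPerm.exists_append p r
    exact ⟨h.1, h'.1, k, CtxPerm.tracks_append h₃ h₄ hp hr hl hl',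
      Y.comp_act_cons r p k h₃ h₄ e g⟩

/-- `IsLet` keeps the decomposed argument in first position. A `let` in the middle of a context is
brought to that form by moving the slot to the front, once with `g` and once with `v` in it. -/
theorem IsLet.intro (hDt : ∀ {m m' : List ℕ} {Γ Γ' : List N.Ob} {B : N.Ob} {g : N.Hom Γ B}
      {g' : N.Hom Γ' B}, Dt m Γ B g → Y.Moves m g m' g' → Dt m' Γ' B g')
    (hDs : ∀ m Γ B g, Ds m Γ B g → m.length = Γ.length)
    {Λ Δ Ψ : List N.Ob} {lΛ lΔ lΨ : List ℕ} (hΛ : lΛ.length = Λ.length)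
    (hΨ : lΨ.length = Ψ.length) {g : N.Hom Δ R} (e : N.Hom (Λ ++ ([R] ++ Ψ)) B)
    (hs : Ds lΔ Δ R g)
    (ht : Dt (lΛ.map (· + As.length) ++ (List.range As.length ++ lΨ.map (· + As.length)))
      (Λ ++ (As ++ Ψ)) B
      (N.comp e (.app (.ones N.one Λ) (.app (.single v) (.ones N.one Ψ))))) :
    IsLet Y Ds Dt v (lΛ ++ (lΔ ++ lΨ)) (Λ ++ (Δ ++ Ψ)) B
      (N.comp e (.app (.ones N.one Λ) (.app (.single g) (.ones N.one Ψ)))) := by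
  refine .mk (lΨ := lΛ ++ lΨ) g (Y.act (CtxPerm.toFront R Ψ Λ) e) hs ?_
    (Y.moves_toFront hΛ (hDs _ _ _ _ hs) hΨ e g).symm
  rw [List.map_append]
  exact hDt ht (Y.moves_toFront (by simpa using hΛ) List.length_range (by simpa using hΨ) e v)

end
end Denotation

end Multi

namespace Multi

/-! ## Interpretation of the linear calculus -/

section LinearInterp
open Multicat LTm
variable {S : Sig.{u}} {M : SRepMulticat.{u}} (φ : S ⟶ RepMulticat.U.obj M.toRepMulticat)

/-- The multicategory in which types and terms are interpreted. -/
abbrev Sig.Fun.multi : Multicat.{u} := M.toMulticat.pullback (Sig.Fun.ty φ)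

/-- Its symmetric structure. -/
def Sig.Fun.symm : (Sig.Fun.multi φ).Symmetry := M.symmetry.pullback (Sig.Fun.ty φ)

namespace LTm

/-- A multimap with a labelled domain is denoted by a term whose variables are the labels. -/
def Den : LTm S → List ℕ → (Γ : List (Ty S.Ob)) → (B : Ty S.Ob) → (Sig.Fun.multi φ).Hom Γ B → Prop
  | .var i => IsVar (N := Sig.Fun.multi φ) i
  | .con c ts => IsApp (N := Sig.Fun.multi φ) (Sig.Fun.symm φ) (fun i => Den (ts i))
      (Sig.Fun.con φ c)
  | .tens As ts => IsApp (N := Sig.Fun.multi φ) (Sig.Fun.symm φ) (fun i => Den (ts i))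
      (Sig.Fun.tens φ As)
  | .letT As s t => IsLet (N := Sig.Fun.multi φ) (Sig.Fun.symm φ) (Den s) (Den t)
      (Sig.Fun.tens φ As)

variable {φ}

theorem Den.length : ∀ (t : LTm S) (l : List ℕ) (Γ : List (Ty S.Ob)) (B : Ty S.Ob)
    (f : (Sig.Fun.multi φ).Hom Γ B), Den φ t l Γ B f → l.length = Γ.length
  | .var _, _, _, _, _, h => IsVar.length h
  | .con _ _, _, _, _, _, h => IsApp.length h
  | .tens _ _, _, _, _, _, h => IsApp.length h
  | .letT _ _ _, _, _, _, _, h => IsLet.length h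

theorem Den.moves : ∀ {t : LTm S} {l l' : List ℕ} {Γ Γ' : List (Ty S.Ob)} {B : Ty S.Ob}
    {f : (Sig.Fun.multi φ).Hom Γ B} {f' : (Sig.Fun.multi φ).Hom Γ' B}, Den φ t l Γ B f →
    (Sig.Fun.symm φ).Moves l f l' f' → Den φ t l' Γ' B f'
  | .var _, _, _, _, _, _, _, _, h, h' => IsVar.moves h h'
  | .con _ _, _, _, _, _, _, _, _, h, h' => IsApp.moves h h'
  | .tens _ _, _, _, _, _, _, _, _, h, h' => IsApp.moves h h'
  | .letT _ _ _, _, _, _, _, _, _, _, h, h' => IsLet.moves h h'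

theorem Den.rename (t : LTm S) : ∀ (ρ : ℕ → ℕ) (l : List ℕ) (Γ : List (Ty S.Ob)) (B : Ty S.Ob)
    (f : (Sig.Fun.multi φ).Hom Γ B), Den φ t l Γ B f → Den φ (t.rename ρ) (l.map ρ) Γ B f := by
  induction t with
  | var i => exact fun ρ l Γ B f h => IsVar.map ρ h
  | con c ts ih => exact fun ρ l Γ B f h => IsApp.map ρ (fun a => ih a ρ) h
  | tens As ts ih => exact fun ρ l Γ B f h => IsApp.map ρ (fun a => ih a ρ) h
  | letT As s t ihs iht => exact fun ρ l Γ B f h => IsLet.map ρ (ihs ρ) (iht (lift As.length ρ)) h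

/-- Semantic substitution lemma. Under binders the labelled arguments are extended by identities and
shifted, matching `lifts`. -/
theorem Den.subst (t : LTm S) : ∀ (σ : ℕ → LTm S) (l m : List ℕ) (Γ Θ : List (Ty S.Ob))
    (B : Ty S.Ob) (f : (Sig.Fun.multi φ).Hom Γ B) (gs : Args (Sig.Fun.multi φ).Hom Θ Γ),
    Den φ t l Γ B f → gs.Lab (fun i => Den φ (σ i)) l m →
    Den φ (t.subst σ) m Θ B ((Sig.Fun.multi φ).comp f gs) := by
  induction t with
  | var i => exact fun σ l m Γ Θ B f gs h hg => IsVar.subst (E := fun i => Den φ (σ i)) h hg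
  | con c ts ih => 
    exact fun σ l m Γ Θ B f gs h hg => IsApp.subst (fun a => Den.length (ts a))
      (fun i => Den.length (σ i)) (fun a => ih a σ) h hg
  | tens As ts ih =>
    exact fun σ l m Γ Θ B f gs h hg => IsApp.subst (fun a => Den.length (ts a))
      (fun i => Den.length (σ i)) (fun a => ih a σ) h hg
  | letT As s t ihs iht =>
    intro σ l m Γ Θ B f gs h hg
    refine IsLet.subst (E := fun i => Den φ (σ i)) (E' := fun i => Den φ (lifts As.length σ i))
      (Den.length s) (fun i => Den.length (σ i)) (ihs σ)
      (iht (lifts As.length σ)) (fun i hi A => ?_) (fun i m Γ B g hg => ?_) h hg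
    · rw [lifts, if_pos hi]; exact IsVar.mk (N := Sig.Fun.multi φ) A
    · rw [lifts, if_neg (by omega), Nat.add_sub_cancel]
      exact Den.rename _ _ _ _ _ _ hg

/-- The induction is on the raw term and needs no typing derivation: contexts and multimaps vary
freely, and the `let` case is where universality in context is used. -/
theorem Den.unique (t : LTm S) : ∀ (l l' : List ℕ) (Γ Γ' : List (Ty S.Ob)) (B : Ty S.Ob)
    (f : (Sig.Fun.multi φ).Hom Γ B) (f' : (Sig.Fun.multi φ).Hom Γ' B), Den φ t l Γ B f →
    Den φ t l' Γ' B f' → (Sig.Fun.symm φ).Moves l f l' f' := by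
  induction t with
  | var i => exact fun l l' Γ Γ' B f f' h h' => IsVar.unique h h'
  | con c ts ih => 
    exact fun l l' Γ Γ' B f f' h h' => IsApp.unique (fun a => Den.length (ts a)) ih h h'
  | tens As ts ih =>
    exact fun l l' Γ Γ' B f f' h h' => IsApp.unique (fun a => Den.length (ts a)) ih h h'
  | letT As s t ihs iht =>
    exact fun l l' Γ Γ' B f f' h h' => IsLet.unique (Sig.Fun.tens_strong φ As)
      (Den.length s) ihs iht h h'

/-- Collects denotations of the arguments of a constant or tuple into one list, whose domain labels
are the names in the concatenated context. -/
theorem exists_lab_flatten {N : Multicat.{u}} {X : Type*} {L : Type*} (τ : L → N.Ob)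
    (D : X → List ℕ → (Γ : List N.Ob) → (B : N.Ob) → N.Hom Γ B → Prop) : ∀ {As : List L}
    (x : Fin As.length → X) (Δ : Fin As.length → List (ℕ × N.Ob)),
    (∀ i, ∃ f, D (x i) ((Δ i).map Prod.fst) ((Δ i).map Prod.snd) (τ (As.get i)) f) →
    ∃ gs : Args N.Hom ((List.ofFn Δ).flatten.map Prod.snd) (As.map τ),
      gs.Lab D (List.ofFn x) ((List.ofFn Δ).flatten.map Prod.fst)
  | [], _, _, _ => ⟨.nil, .nil⟩
  | A :: As, x, Δ, h => by
    obtain ⟨f, hf⟩ := h 0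
    obtain ⟨gs, hg⟩ := exists_lab_flatten τ D (fun i => x i.succ) (fun i => Δ i.succ)
      fun i => h i.succ
    rw [List.ofFn_succ, List.ofFn_succ]
    exact ⟨.cons (A := τ A) f gs (by rw [List.flatten_cons, List.map_append]),
      .cons _ (by rw [List.flatten_cons, List.map_append]) hf hg⟩

theorem Ctx.map_rename (ρ : ℕ → ℕ) (Γ : Ctx S) :
    (Γ.rename ρ).map Prod.fst = (Γ.map Prod.fst).map ρ ∧
      (Γ.rename ρ).map Prod.snd = Γ.map Prod.snd := by
  simp [Ctx.rename, Function.comp_def]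

theorem map_names (k : ℕ) (As : List (Ty S.Ob)) :
    (names k As).map Prod.fst = List.range' k As.length ∧ (names k As).map Prod.snd = As := by
  induction As generalizing k with
  | nil => exact ⟨rfl, rfl⟩
  | cons A As ih =>
    rw [names, List.map_cons, List.map_cons, (ih _).1, (ih _).2]
    exact ⟨rfl, rfl⟩

/-- Every typed term denotes a multimap. -/
theorem Typed.exists_den {Γ : Ctx S} {t : LTm S} {B : Ty S.Ob} (ht : Typed Γ t B) :
    ∃ f, Den φ t (Γ.map Prod.fst) (Γ.map Prod.snd) B f := by
  induction ht with
  | var n A => exact ⟨_, IsVar.mk (N := Sig.Fun.multi φ) A⟩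
  | con c ts Δ _ ih =>
    obtain ⟨gs, hg⟩ := exists_lab_flatten (N := Sig.Fun.multi φ) Ty.base
      (fun i => Den φ (ts i)) _root_.id Δ ih
    rw [List.ofFn_id] at hg
    exact ⟨_, .mk hg (.refl (hg.length_dom fun a => Den.length (ts a)))⟩
  | tens As ts Δ _ ih =>
    have := exists_lab_flatten (N := Sig.Fun.multi φ) _root_.id
      (fun i => Den φ (ts i)) _root_.id Δ ih
    rw [List.ofFn_id, List.map_id] at this
    obtain ⟨gs, hg⟩ := this
    exact ⟨_, .mk hg (.refl (hg.length_dom fun a => Den.length (ts a)))⟩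
  | @letT As B s t Λ Δ Ψ _ _ ihs iht =>
    rw [List.map_append, List.map_append, List.map_append, List.map_append,
      (Ctx.map_rename _ Λ).1, (Ctx.map_rename _ Λ).2, (Ctx.map_rename _ Ψ).1,
      (Ctx.map_rename _ Ψ).2, (map_names 0 As).1, (map_names 0 As).2,
      ← List.range_eq_range'] at iht
    obtain ⟨g, hg⟩ := ihs
    obtain ⟨f, hf⟩ := iht
    -- The denotation of the body factors along the universal arrow of `As` in context, which
    -- supplies the multimap into which `g` is substituted.
    obtain ⟨e, rfl, -⟩ := Sig.Fun.tens_strong φ As (Λ.map Prod.snd) (Ψ.map Prod.snd) B f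
    rw [List.map_append, List.map_append, List.map_append, List.map_append]
    exact ⟨_, IsLet.intro Den.moves (Den.length s) (by simp) (by simp) e hg hf⟩
  | exch Λ Ψ x y _ ih =>
    rw [List.map_append, List.map_append, List.map_cons, List.map_cons, List.map_cons,
      List.map_cons] at ih ⊢
    obtain ⟨f, hf⟩ := ih
    -- Exchange keeps the term and permutes objects and labels simultaneously, so the same term
    -- denotes the permuted multimap.
    exact ⟨_, hf.moves ⟨by simp, by simp, _,
      CtxPerm.tracks_swap_append x.1 y.1 _ x.2 y.2 _ (by simp), rfl⟩⟩

end LTm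

-- The interpretation as a function on linear terms.

namespace LTerm

theorem exists_den {Γ : List (Ty S.Ob)} {B : Ty S.Ob} (t : LTerm S Γ B) :
    ∃ f, Den φ t.1 (List.range Γ.length) Γ B f := by
  have := t.2.exists_den (φ := φ)
  rwa [(map_names 0 Γ).1, (map_names 0 Γ).2, ← List.range_eq_range'] at this

/-- The interpretation of linear terms. -/
noncomputable def interp {Γ : List (Ty S.Ob)} {B : Ty S.Ob} (t : LTerm S Γ B) :
    (Sig.Fun.multi φ).Hom Γ B := (t.exists_den (φ := φ)).choose

theorem den_interp {Γ : List (Ty S.Ob)} {B : Ty S.Ob} (t : LTerm S Γ B) :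
    Den φ t.1 (List.range Γ.length) Γ B (interp φ t) := (t.exists_den (φ := φ)).choose_spec

variable {φ}

/-- The labels `0, 1, …` are distinct, so any denotation with them is the interpretation. Each law
below is proved by producing one. -/
theorem interp_eq {Γ : List (Ty S.Ob)} {B : Ty S.Ob} (t : LTerm S Γ B)
    {f : (Sig.Fun.multi φ).Hom Γ B} (h : Den φ t.1 (List.range Γ.length) Γ B f) :
    interp φ t = f :=
  (Den.unique t.1 _ _ _ _ _ _ _ h (den_interp φ t)).eq_of_nodup List.nodup_range

/-- The shifts built into `sub` give consecutive blocks of labels, so the interpreted arguments are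
labelled as `Den.subst` requires. -/
theorem lab_sub {Γ As : List (Ty S.Ob)} (ts : Args (LTerm S) Γ As) :
    (ts.mapHom (H' := (Sig.Fun.multi φ).Hom) (interp φ)).Lab (fun i => Den φ (sub ts i))
      (List.range As.length) (List.range Γ.length) := by
  induction ts with
  | nil => exact .nil
  | @cons Γ Δ Θ A As t ts h ih =>
    subst h
    rw [List.length_cons, List.range_succ_eq_map, List.length_append, List.range_add]
    refine .cons _ rfl (den_interp φ t) ?_
    have : (fun j => Γ.length + j) = (· + Γ.length) := funext fun j => Nat.add_comm _ _
    rw [this]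
    exact ih.map Nat.succ (· + Γ.length) fun i m Γ' B g hg => Den.rename _ _ _ _ _ _ hg

theorem interp_comp {Γ As : List (Ty S.Ob)} {B : Ty S.Ob} (t : LTerm S As B)
    (ts : Args (LTerm S) Γ As) :
    interp φ (comp t ts) = (Sig.Fun.multi φ).comp (interp φ t) (ts.mapHom (interp φ)) :=
  interp_eq _ (Den.subst _ _ _ _ _ _ _ _ _ (den_interp φ t) (lab_sub ts))

theorem interp_var (A : Ty S.Ob) : interp φ (var A) = (Sig.Fun.multi φ).one A :=
  interp_eq _ (IsVar.mk (N := Sig.Fun.multi φ) A)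

theorem lab_vars {n : ℕ} {As : List (Ty S.Ob)} (h : As.length = n) :
    (Args.ones (Sig.Fun.multi φ).one As).Lab (fun i : Fin n => Den φ (.var i))
      (List.finRange n) (List.range As.length) := by
  subst h
  have := (Args.Lab.ones (D := fun (i : Fin As.length) (m : List (Fin As.length)) =>
      Den φ (.var i) (m.map Fin.val)) (one := (Sig.Fun.multi φ).one) (As := As)
    (m := List.finRange As.length) _root_.id
    (fun i _ A => IsVar.mk (N := Sig.Fun.multi φ) A) (by simp)).map
    (D' := fun (i : Fin As.length) => Den φ (.var i)) _root_.id Fin.val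
    fun _ _ _ _ _ h => h
  rwa [List.map_id, List.map_id, List.map_coe_finRange_eq_range] at this

theorem interp_tens (As : List (Ty S.Ob)) : interp φ (tens As) = Sig.Fun.tens φ As :=
  interp_eq _ (.mk (lab_vars rfl) (by
    rw [(Sig.Fun.multi φ).comp_one]; exact .refl List.length_range))

theorem interp_con {As : List S.Ob} {B : S.Ob} (c : S.con As B) :
    interp φ (con c) = Sig.Fun.con φ c :=
  interp_eq _ (.mk (lab_vars (by simp)) (by
    rw [(Sig.Fun.multi φ).comp_one]; exact .refl List.length_range))

theorem interp_act {Γ Γ' : List (Ty S.Ob)} {B : Ty S.Ob} (p : CtxPerm Γ Γ') (t : LTerm S Γ B) :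
    interp φ (act p t) = (Sig.Fun.symm φ).act p (interp φ t) := by
  refine interp_eq _ ((Den.rename _ (permIdx p) _ _ _ _ (den_interp φ t)).moves
    ⟨by simp, by simp, p, fun i => ?_, rfl⟩)
  rw [List.getElem?_range i.2, List.getElem?_map, List.getElem?_range (p.σ i).2]
  exact congrArg some (permIdx_symm p i).symm

/-- The shift of `s` and the renaming `place` of the body label the parts of the context exactly as
`IsLet.intro` expects. -/
theorem interp_letT {Δ : List (Ty S.Ob)} {B : Ty S.Ob} (Λ Ψ As : List (Ty S.Ob))
    (s : LTerm S Δ (.tens As)) (t : LTerm S (Λ ++ (As ++ Ψ)) B)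
    (e : (Sig.Fun.multi φ).Hom (Λ ++ ([.tens As] ++ Ψ)) B)
    (he : (Sig.Fun.multi φ).comp e (.app (.ones (Sig.Fun.multi φ).one Λ)
      (.app (.single (Sig.Fun.tens φ As)) (.ones (Sig.Fun.multi φ).one Ψ))) = interp φ t) :
    interp φ (letT Λ Ψ As s t) = (Sig.Fun.multi φ).comp e
      (.app (.ones (Sig.Fun.multi φ).one Λ) (.app (.single (interp φ s))
        (.ones (Sig.Fun.multi φ).one Ψ))) := by
  have hs := Den.rename _ (· + Λ.length) _ _ _ _ (den_interp φ s)
  have ht := Den.rename _ (place Λ.length As.length Δ.length) _ _ _ _ (den_interp φ t)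
  rw [← he] at ht
  -- `place` makes the middle variables the bound labels, shifts those of `Λ` past them, and gives
  -- those of `Ψ` their final positions behind `Δ` before that shift.
  have e₁ : (List.range (Λ ++ (As ++ Ψ)).length).map (place Λ.length As.length Δ.length) =
      (List.range Λ.length).map (· + As.length) ++ (List.range As.length ++
        ((List.range Ψ.length).map (fun i => Λ.length + (Δ.length + i))).map (· + As.length)) := by
    simp only [List.length_append, List.range_add, List.map_append, List.map_map]
    refine congrArg₂ (· ++ ·) (List.map_congr_left fun i hi => ?_) (congrArg₂ (· ++ ·)
      ((List.map_congr_left fun i hi => ?_).trans (List.map_id _))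
      (List.map_congr_left fun i hi => ?_))
    · simp [place, List.mem_range.1 hi]
    · simp [place, List.mem_range.1 hi]
    · have h₁ : ¬ Λ.length + (As.length + i) < Λ.length := by omega
      have h₂ : ¬ Λ.length + (As.length + i) < Λ.length + As.length := by omega
      simp only [Function.comp_apply, place, h₁, h₂, if_false]
      omega
  have e₂ : List.range (Λ ++ (Δ ++ Ψ)).length = List.range Λ.length ++
      ((List.range Δ.length).map (· + Λ.length) ++
        (List.range Ψ.length).map (fun i => Λ.length + (Δ.length + i))) := by
    simp only [List.length_append, List.range_add, List.map_append, List.map_map]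
    refine congrArg (_ ++ ·) (congrArg₂ (· ++ ·) (List.map_congr_left fun i hi => ?_) rfl)
    exact Nat.add_comm _ _
  refine interp_eq _ ?_
  rw [e₂]
  rw [e₁] at ht
  exact IsLet.intro Den.moves (Den.length _) (by simp) (by simp) e hs ht

end LTerm

/-- The interpretation of the linear calculus. -/
noncomputable def LCalc.model : (LCalc S).Model M.toRepMulticat where
  ob := Sig.Fun.ty φ
  ob_T := Ty.interp_tens _ _
  map t := LTerm.interp φ t
  map_one := LTerm.interp_var
  map_comp := LTerm.interp_comp
  map_tens As := (heq_of_eq (LTerm.interp_tens As)).trans (Sig.Fun.tens_heq φ As)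
  map_letT Λ Ψ As s t e he := by
    refine LTerm.interp_letT Λ Ψ As s t e (Eq.trans ?_ he)
    exact congrArg (fun x => (Sig.Fun.multi φ).comp e (.app (.ones (Sig.Fun.multi φ).one Λ)
      (.app (.single x) (.ones (Sig.Fun.multi φ).one Ψ)))) (LTerm.interp_tens As).symm
  map_exch Y hY _ _ _ p t t' h := by
    obtain rfl : LExch S = Y := Option.some.inj hY
    exact (LTerm.interp_act p t).trans ((congrArg _ h).trans (LTerm.interp_act p t').symm)

/-- The functor of symmetric multicategories given by the interpretation. -/
noncomputable def LSyn.desc : SRepFunctor (LSyn S) M where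
  toRepFunctor := (LCalc.model φ).toRepFunctor
  map_act p f := by
    induction f using Quotient.inductionOn with
    | h t => exact LTerm.interp_act p t

end LinearInterp

end Multi

namespace Multi

/-! ## Freeness of the linear calculus -/

theorem SRepFunctor.agree_act {N M : SRepMulticat.{u}} {F G : SRepFunctor N M} (h : F.ob = G.ob)
    {Γ Γ' : List N.Ob} {B : N.Ob} (p : CtxPerm Γ Γ') {f : N.Hom Γ B}
    (hf : RepFunctor.Agree F.toRepFunctor G.toRepFunctor f) :
    RepFunctor.Agree F.toRepFunctor G.toRepFunctor (N.symmetry.act p f) := by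
  rw [RepFunctor.Agree, F.map_act, G.map_act]
  have hl : ∀ Γ : List N.Ob, Γ.map F.ob = Γ.map G.ob := fun Γ => by rw [h]
  exact M.symmetry.act_congr (p.map F.ob) (p.map G.ob) (hl _) (hl _) (congrFun h B)
    (fun _ => rfl) hf

namespace LTm
variable {S : Sig.{u}} {P : ∀ {Γ : List (Ty S.Ob)} {B : Ty S.Ob}, LTerm S Γ B → Prop}

/-- The name of the `i`-th variable of a context. -/
def nameOf (Γ : Ctx S) (i : ℕ) : ℕ := (Γ.map Prod.fst).getD i 0

theorem nameOf_lt {Γ Δ : Ctx S} {i : ℕ} (h : i < Γ.length) :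
    nameOf (Γ ++ Δ) i = nameOf Γ i := by
  rw [nameOf, List.map_append, List.getD_append _ _ _ _ (by simpa using h)]; rfl

theorem nameOf_ge (Γ Δ : Ctx S) (i : ℕ) : nameOf (Γ ++ Δ) (Γ.length + i) = nameOf Δ i := by
  rw [nameOf, List.map_append, List.getD_append_right _ _ _ _ (by simp)]
  simp [nameOf]

theorem nameOf_names {As : List (Ty S.Ob)} {i : ℕ} (h : i < As.length) :
    nameOf (names 0 As) i = i := by
  rw [nameOf, (map_names 0 As).1, List.getD_eq_getElem _ _ (by simpa using h)]
  simp

theorem nameOf_rename (ρ : ℕ → ℕ) {Γ : Ctx S} {i : ℕ} (h : i < Γ.length) :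
    nameOf (Γ.rename ρ) i = ρ (nameOf Γ i) := by
  rw [nameOf, nameOf, (Ctx.map_rename ρ Γ).1, List.getD_eq_getElem _ _ (by simpa using h),
    List.getD_eq_getElem _ _ (by simpa using h), List.getElem_map]

/-- Arguments with arbitrary variable names are replaced by terms in consecutively numbered
contexts. Renaming the positions in the concatenated context by its names recovers the originals. -/
theorem exists_args_of_flatten {L : Type*} (τ : L → Ty S.Ob) : ∀ {As : List L}
    (ts : Fin As.length → LTm S) (Δ : Fin As.length → Ctx S),
    (∀ i, ∃ u : LTerm S ((Δ i).map Prod.snd) (τ (As.get i)),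
      P u ∧ u.tm.rename (nameOf (Δ i)) = ts i) →
    ∃ us : Args (LTerm S) ((List.ofFn Δ).flatten.map Prod.snd) (As.map τ),
      us.All (fun u => P u) ∧
        ∀ i : Fin As.length, (LTerm.sub us i).rename (nameOf (List.ofFn Δ).flatten) = ts i
  | [], _, _, _ => ⟨.nil, trivial, fun i => i.elim0⟩
  | A :: As, ts, Δ, h => by
    obtain ⟨u, hu, h₀⟩ := h 0
    obtain ⟨us, hus, h₁⟩ := exists_args_of_flatten τ (fun i => ts i.succ) (fun i => Δ i.succ)
      fun i => h i.succ
    rw [List.ofFn_succ, List.flatten_cons]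
    refine ⟨.cons (A := τ A) u us List.map_append, ⟨hu, hus⟩, fun i => ?_⟩
    match i with
    | ⟨0, _⟩ => exact (u.rename_congr fun i hi => nameOf_lt (by simpa using hi)).trans h₀
    | ⟨i + 1, hi⟩ =>
      refine Eq.trans ?_ (h₁ ⟨i, Nat.lt_of_succ_lt_succ hi⟩)
      change ((LTerm.sub us i).shift _).rename _ = _
      rw [shift, rename_rename]
      refine congrArg (fun ρ => rename ρ _) (funext fun j => ?_)
      rw [List.length_map, Nat.add_comm j, nameOf_ge]

/-- Every typed term arises from the term formers by renaming of variables. -/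
theorem Typed.exists_term (hvar : ∀ A, P (LTerm.var A))
    (hcon : ∀ {Γ : List (Ty S.Ob)} {As : List S.Ob} {B : S.Ob} (c : S.con As B)
      (us : Args (LTerm S) Γ (As.map .base)), us.All (fun u => P u) →
      P (LTerm.comp (LTerm.con c) us))
    (htens : ∀ {Γ : List (Ty S.Ob)} (As : List (Ty S.Ob)) (us : Args (LTerm S) Γ As),
      us.All (fun u => P u) → P (LTerm.comp (LTerm.tens As) us))
    (hlet : ∀ {Δ : List (Ty S.Ob)} {B : Ty S.Ob} (Λ Ψ As : List (Ty S.Ob))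
      (s : LTerm S Δ (.tens As)) (t : LTerm S (Λ ++ (As ++ Ψ)) B), P s → P t →
      P (LTerm.letT Λ Ψ As s t))
    (hact : ∀ {Γ Γ' : List (Ty S.Ob)} {B : Ty S.Ob} (p : CtxPerm Γ Γ') (t : LTerm S Γ B), P t →
      P (LTerm.act p t))
    {Γ : Ctx S} {t : LTm S} {B : Ty S.Ob} (ht : Typed Γ t B) :
    ∃ u : LTerm S (Γ.map Prod.snd) B, P u ∧ u.tm.rename (nameOf Γ) = t := by
  induction ht with
  | var n A => exact ⟨_, hvar A, rfl⟩
  | con c ts Δ _ ih =>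
    obtain ⟨us, hu, h⟩ := exists_args_of_flatten Ty.base ts Δ ih
    exact ⟨_, hcon c us hu, congrArg (LTm.con c) (funext h)⟩
  | tens As ts Δ _ ih =>
    have := exists_args_of_flatten _root_.id ts Δ ih
    rw [List.map_id] at this
    obtain ⟨us, hu, h⟩ := this
    exact ⟨_, htens As us hu, congrArg (LTm.tens As) (funext h)⟩
  | @letT As B s t Λ Δ Ψ _ _ ihs iht =>
    obtain ⟨v, hv, rfl⟩ := ihs
    rw [List.map_append, List.map_append, (Ctx.map_rename _ Λ).2, (Ctx.map_rename _ Ψ).2,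
      (map_names 0 As).2] at iht
    obtain ⟨w, hw, rfl⟩ := iht
    rw [List.map_append, List.map_append]
    refine ⟨_, hlet _ _ As v w hv hw, congrArg₂ (LTm.letT As) ?_ ?_⟩
    · rw [shift, rename_rename]
      refine v.rename_congr fun i hi => ?_
      rw [List.length_map] at hi
      rw [List.length_map, Nat.add_comm, nameOf_ge, nameOf_lt hi]
    · rw [rename_rename]
      refine w.rename_congr fun i hi => ?_
      simp only [List.length_append, List.length_map] at hi ⊢
      have hΛ : (Ctx.rename (· + As.length) Λ).length = Λ.length := List.length_map _
      have hA : (names (S := S) 0 As).length = As.length := by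
        rw [← List.length_map (f := Prod.fst), (map_names 0 As).1, List.length_range']
      rcases Nat.lt_or_ge i Λ.length with h | h
      · rw [LTerm.place, if_pos h, lift, if_neg (by omega), Nat.add_sub_cancel, nameOf_lt h,
          nameOf_lt (by omega), nameOf_rename _ h]
      · obtain ⟨i, rfl⟩ := Nat.exists_eq_add_of_le h
        rw [← hΛ, nameOf_ge, hΛ]
        rcases Nat.lt_or_ge i As.length with h' | h'
        · rw [LTerm.place, if_neg (by omega), if_pos (by omega), Nat.add_sub_cancel_left, lift, if_pos h',
            nameOf_lt (by omega), nameOf_names h']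
        · obtain ⟨i, rfl⟩ := Nat.exists_eq_add_of_le h'
          rw [← hA, nameOf_ge, hA, nameOf_rename _ (by omega), LTerm.place, if_neg (by omega),
            if_neg (by omega), lift, if_neg (by omega),
            show Λ.length + (As.length + i) + Δ.length - As.length =
              Λ.length + (Δ.length + i) by omega, nameOf_ge, nameOf_ge]
  | exch Λ Ψ x y _ ih =>
    obtain ⟨v, hv, rfl⟩ := ih
    -- The exchanged term is realised by the action of the transposition. Because the transposition
    -- also transports the names, the raw term recovered is unchanged.
    have hp : ∃ p : CtxPerm ((Λ ++ x :: y :: Ψ).map Prod.snd) ((Λ ++ y :: x :: Ψ).map Prod.snd),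
        p.Tracks ((Λ ++ x :: y :: Ψ).map Prod.fst) ((Λ ++ y :: x :: Ψ).map Prod.fst) := by
      rw [List.map_append, List.map_append, List.map_append, List.map_append, List.map_cons,
        List.map_cons, List.map_cons, List.map_cons, List.map_cons, List.map_cons, List.map_cons,
        List.map_cons]
      exact ⟨_, CtxPerm.tracks_swap_append x.1 y.1 _ x.2 y.2 _ (by simp)⟩
    obtain ⟨p, hp⟩ := hp
    refine ⟨_, hact p v hv, ?_⟩
    change (v.tm.rename (LTerm.permIdx p)).rename _ = _
    rw [rename_rename]
    refine v.rename_congr fun i hi => ?_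
    obtain ⟨j, hj⟩ := p.σ.surjective ⟨i, hi⟩
    obtain rfl : (p.σ j : ℕ) = i := congrArg Fin.val hj
    rw [LTerm.permIdx_symm, nameOf, nameOf, List.getD_eq_getElem?_getD,
      List.getD_eq_getElem?_getD, hp j]

end LTm

namespace LSyn
open RepFunctor Calculus

theorem incl_desc {S : Sig.{u}} {M : SRepMulticat.{u}} (φ : S ⟶ SRepMulticat.U.obj M) :
    LSyn.incl S ≫ SRepMulticat.U.map (LSyn.desc φ) = φ := by
  refine Sig.Fun.ext' rfl fun {Γ B} c => ?_
  refine (Args.castDom_heq _ _).trans ?_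
  exact (heq_of_eq (LTerm.interp_con (φ := φ) c)).trans (Args.castDom_heq _ _)

/-- As in the ordered case, but the induction goes through `LTm.Typed.exists_term`, which adds
closure under the action of permutations; this is where preservation of the symmetric action enters.
-/
theorem incl_hom_ext {S : Sig.{u}} {M : SRepMulticat.{u}} {F G : SRepFunctor (LSyn S) M}
    (h : LSyn.incl S ≫ SRepMulticat.U.map F = LSyn.incl S ≫ SRepMulticat.U.map G) : F = G := by
  have hb : ∀ a, F.ob (.base a) = G.ob (.base a) := fun a => congrFun (congrArg Sig.Fun.ob h) a
  have hob : F.ob = G.ob := Ty.hom_ext M.T F.ob G.ob hb F.ob_T G.ob_T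
  have hcon : ∀ {As : List S.Ob} {B : S.Ob} (c : S.con As B),
      Agree F.toRepFunctor G.toRepFunctor (SynHom.mk (K := LCalc S) (LTerm.con c)) :=
    fun {As B} c => by
    have h₁ : HEq (Sig.Fun.map (LSyn.incl S ≫ SRepMulticat.U.map F) c)
      (Sig.Fun.map (LSyn.incl S ≫ SRepMulticat.U.map G) c) := by rw [h]
    exact (Args.castDom_heq _ _).symm.trans (h₁.trans (Args.castDom_heq _ _))
  have hmap : ∀ {Γ As : List (Ty S.Ob)} (us : Args (LTerm S) Γ As),
      us.All (fun u => Agree F.toRepFunctor G.toRepFunctor (SynHom.mk (K := LCalc S) u)) →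
      (us.mapHom (SynHom.mk (K := LCalc S))).All
        fun f => Agree F.toRepFunctor G.toRepFunctor f := fun us hu => by
    induction us with
    | nil => trivial
    | cons u us e ih => exact ⟨hu.1, ih hu.2⟩
  have key : ∀ {Γ : List (Ty S.Ob)} {B : Ty S.Ob} (t : LTerm S Γ B),
      Agree F.toRepFunctor G.toRepFunctor (SynHom.mk (K := LCalc S) t) := fun {Γ B} t => by
    have := t.2.exists_term
      (P := fun u => Agree F.toRepFunctor G.toRepFunctor (SynHom.mk (K := LCalc S) u))
      (fun A => agree_one hob (N := (LCalc S).syn) A)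
      (fun c us hu => agree_comp_mk (K := LCalc S) hob _ us (hcon c) (hmap us hu))
      (fun As us hu => agree_comp_mk (K := LCalc S) hob _ us
        (agree_univ hob (N := (LCalc S).syn) As) (hmap us hu))
      (fun Λ Ψ As s t hs ht => agree_letT (K := LCalc S) hob s t hs ht)
      (fun p t ht => SRepFunctor.agree_act hob p ht)
    rw [(LTm.map_names 0 Γ).2] at this
    obtain ⟨u, hu, hut⟩ := this
    -- In the context `0, 1, …` the name of each position is the position itself, so the renaming
    -- relating `u` to `t` is trivial.
    obtain rfl : u = t := LTerm.ext (Eq.trans (Eq.trans (LTm.rename_id u.tm).symm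
      (u.rename_congr fun i hi => (LTm.nameOf_names hi).symm)) hut)
    exact hu
  refine SRepFunctor.toSig_injective (Sig.Fun.ext' hob fun {Γ B} q => ?_)
  induction q using Quotient.inductionOn with
  | h t => exact key t

/-- The syntactic symmetric multicategory is free on its signature. -/
theorem bijective (S : Sig.{u}) (M : SRepMulticat.{u}) : Function.Bijective
    fun F : LSyn S ⟶ M => LSyn.incl S ≫ SRepMulticat.U.map F :=
  ⟨fun _ _ h => incl_hom_ext h, fun φ => ⟨_, incl_desc φ⟩⟩

theorem nucleus_bijective (S : Sig.{u}) (C : STensorCat.{u}) :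
    Function.Bijective fun f : SRepMulticat.N.obj (LSyn S) ⟶ C =>
      (LSyn.incl S ≫ (LSyn S).kappa) ≫ STensorCat.V.map f :=
  bijective_comp_equivalence SRepMulticat.equivalence SRepMulticat.U (LSyn.incl S)
    (SRepMulticat.kappaIso.app (LSyn S)) (LSyn.bijective S) C

theorem main :
    (∃ (F : Sig.{u} ⥤ SRepMulticat.{u}) (adj : F ⊣ SRepMulticat.U) (h : ∀ S, F.obj S = LSyn S),
        ∀ S, adj.unit.app S ≫ SRepMulticat.U.map (eqToHom (h S)) = LSyn.incl S) ∧
      (∃ e : SRepMulticat.{u} ≌ STensorCat.{u}, e.functor = SRepMulticat.N ∧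
        (∀ C, (e.inverse.obj C).data = C.tensorData) ∧
        e.inverse ⋙ SRepMulticat.U = STensorCat.V) ∧
      STensorCat.V.{u}.IsRightAdjoint ∧
      (∀ (L : Sig.{u} ⥤ STensorCat.{u}) (adj : L ⊣ STensorCat.V) (S : Sig.{u}),
        ∃! i : L.obj S ≅ SRepMulticat.N.obj (LSyn S),
          adj.unit.app S ≫ STensorCat.V.map i.hom = LSyn.incl S ≫ (LSyn S).kappa) := by
  refine ⟨exists_adjunction _ _ LSyn.incl LSyn.bijective,
    ⟨SRepMulticat.equivalence, rfl, fun C => C.multi_data, STensorCat.M_U⟩, ?_,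
    fun L adj S => existsUnique_iso _ adj _ (LSyn.nucleus_bijective S)⟩
  obtain ⟨F, adj, _⟩ := exists_adjunction STensorCat.V (fun S => SRepMulticat.N.obj (LSyn S))
    (fun S => LSyn.incl S ≫ (LSyn S).kappa) LSyn.nucleus_bijective
  exact ⟨F, ⟨adj⟩⟩

end LSyn

end Multi

theorem mainTheorem10 :
    ((∃ (F : Multi.Sig.{u} ⥤ Multi.RepMulticat.{u}) (adj : F ⊣ Multi.RepMulticat.U)
          (h : ∀ S, F.obj S = Multi.OSyn S),
        ∀ S, adj.unit.app S ≫ Multi.RepMulticat.U.map (eqToHom (h S)) = Multi.OSyn.incl S) ∧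
      (∃ e : Multi.RepMulticat.{u} ≌ Multi.TensorCat.{u},
        e.functor = Multi.RepMulticat.N ∧
        (∀ C, (e.inverse.obj C).data = C.tensorData) ∧
        e.inverse ⋙ Multi.RepMulticat.U = Multi.TensorCat.V) ∧
      Multi.TensorCat.V.{u}.IsRightAdjoint ∧
      (∀ (L : Multi.Sig.{u} ⥤ Multi.TensorCat.{u}) (adj : L ⊣ Multi.TensorCat.V)
          (S : Multi.Sig.{u}),
        ∃! i : L.obj S ≅ Multi.RepMulticat.N.obj (Multi.OSyn S),
          adj.unit.app S ≫ Multi.TensorCat.V.map i.hom =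
            Multi.OSyn.incl S ≫ (Multi.OSyn S).kappa)) ∧
    ((∃ (F : Multi.Sig.{u} ⥤ Multi.SRepMulticat.{u}) (adj : F ⊣ Multi.SRepMulticat.U)
          (h : ∀ S, F.obj S = Multi.LSyn S),
        ∀ S, adj.unit.app S ≫ Multi.SRepMulticat.U.map (eqToHom (h S)) = Multi.LSyn.incl S) ∧
      (∃ e : Multi.SRepMulticat.{u} ≌ Multi.STensorCat.{u},
        e.functor = Multi.SRepMulticat.N ∧
        (∀ C, (e.inverse.obj C).data = C.tensorData) ∧
        e.inverse ⋙ Multi.SRepMulticat.U = Multi.STensorCat.V) ∧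
      Multi.STensorCat.V.{u}.IsRightAdjoint ∧
      (∀ (L : Multi.Sig.{u} ⥤ Multi.STensorCat.{u}) (adj : L ⊣ Multi.STensorCat.V)
          (S : Multi.Sig.{u}),
        ∃! i : L.obj S ≅ Multi.SRepMulticat.N.obj (Multi.LSyn S),
          adj.unit.app S ≫ Multi.STensorCat.V.map i.hom =
            Multi.LSyn.incl S ≫ (Multi.LSyn S).kappa)) := by
  exact ⟨Multi.OSyn.main, Multi.LSyn.main⟩
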